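/- Work over $\mathbb C$ and fix $\nu\in\mathbb C$. For $N\in\{1,2,3,\dots\}\cup\{\infty\}$ let $\mathbb C^N$ have basis $(e_i)_{1\le i\le N}$ (countable if $N=\infty$), let $\mathfrak{gl}_N$ be the Lie algebra of $N\times N$ matrices with finitely many non-zero entries, with matrix units $E_{ij}$, let $U_N=\mathrm{span}(e_2,e_3,\dots)$, $\mathfrak{gl}(U_N)=\mathrm{span}\{E_{ij}: i,j\ge 2\}$, $\mathfrak u_N^+=\mathrm{span}\{E_{1j}: j\ge2\}$, $\mathfrak u_N^-=\mathrm{span}\{E_{i1}: i\ge 2\}\cong U_N$, and for $n\le N$ let $\mathfrak{gl}_n^\perp=\mathrm{span}\{E_{ij}: n< i,j\le N\}\subset\mathfrak{gl}_N$. A module over $\mathfrak{gl}_N$ (or over $\mathfrak{gl}(U_N)$) is called polynomial if it is a direct summand of a finite direct sum of tensor powers of the tautological module $\mathbb C^N$ (resp. $U_N$). Let $O^{\mathfrak p_N}_{\nu,\mathbb C^N}$ be the full subcategory of the category of $\mathfrak{gl}_N$-modules whose objects $M$ satisfy: (i) restricted to $\mathfrak{gl}(U_N)$, $M$ is a (possibly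 infinite) direct sum of polynomial modules; (ii) $M$ has degree $\nu$: for each Young diagram $\lambda$, $E_{11}$ acts by $\nu-|\lambda|$ on every $\mathfrak{gl}(U_N)$-submodule of $M$ isomorphic to the Schur functor $S^\lambda U_N$; (iii) $M$ is finitely generated over $\mathrm{Sym}(U_N)\cong\mathcal U(\mathfrak u_N^-)$, i.e. there are a polynomial $\mathfrak{gl}(U_N)$-module $E$ and a surjective, $\mathfrak{gl}(U_N)$-equivariant and $\mathrm{Sym}(U_N)$-linear map $\mathrm{Sym}(U_N)\otimes E\to M$; (iv) for each $v\in M$ there is $m\ge0$ such that all products of $m$ elements of $\mathfrak u_N^+$ annihilate $v$. Let $\hat\pi_N: O^{\mathfrak p_N}_{\nu,\mathbb C^N}\to\widehat O^{\mathfrak p_N}_{\nu,\mathbb C^N}$ be the Serre quotient by the polynomial $\mathfrak{gl}_N$-modules, that is, the localization at the morphisms with polynomial kernel and cokernel. For $n\ge1$ let $\mathfrak{Res}_{n,n+1}: O^{\mathfrak p_{n+1}}_{\nu,\mathbb C^{n+1}}\to O^{\mathfrak p_n}_{\nu,\mathbb C^n}$ and $\Gamma_n: O^{\mathfrak p_\infty}_{\nu,\mathbb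 C^\infty}\to O^{\mathfrak p_n}_{\nu,\mathbb C^n}$ be the functors $(\cdot)^{\mathfrak{gl}_n^\perp}$ of invariants, and $\widehat{\mathfrak{Res}}_{n,n+1}$, $\widehat\Gamma_n$ the functors induced on the Serre quotients, so that $\widehat\Gamma_n\circ\hat\pi_\infty=\hat\pi_n\circ\Gamma_n$ and similarly for $\widehat{\mathfrak{Res}}_{n,n+1}$. The inverse limit $\varprojlim_{n\ge1}\widehat O^{\mathfrak p_n}_{\nu,\mathbb C^n}$ has as objects the families $((X_n)_{n\ge1},(\phi_n)_{n\ge1})$ with $X_n\in\widehat O^{\mathfrak p_n}_{\nu,\mathbb C^n}$ and isomorphisms $\phi_n:\widehat{\mathfrak{Res}}_{n,n+1}(X_{n+1})\to X_n$, and as morphisms the families of morphisms compatible with the $\phi_n$. The restricted inverse limit $\varprojlim_{n\ge1,\ \mathrm{restr}}\widehat O^{\mathfrak p_n}_{\nu,\mathbb C^n}$ is its full subcategory on the objects for which the sequence of lengths of the $X_n$ is finite and constant for large $n$. Proposition. The functors $\mathfrak{Res}_{n,n+1}$, $\Gamma_n$, $\widehat{\mathfrak{Res}}_{n,n+1}$,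 $\widehat\Gamma_n$ are well defined; for $M\in O^{\mathfrak p_\infty}_{\nu,\mathbb C^\infty}$ the natural inclusion $\Gamma_n(M)\subseteq\mathfrak{Res}_{n,n+1}(\Gamma_{n+1}(M))$ is an equality, which gives natural isomorphisms $\widehat{\mathfrak{Res}}_{n,n+1}\circ\widehat\Gamma_{n+1}\cong\widehat\Gamma_n$; and the functor $X\mapsto(\widehat\Gamma_n(X))_{n\ge1}$, with these isomorphisms, takes values in the restricted inverse limit and is an equivalence of categories $$\widehat\Gamma_{\lim}:\ \widehat O^{\mathfrak p_\infty}_{\nu,\mathbb C^\infty}\ \longrightarrow\ \varprojlim_{n\ge1,\ \mathrm{restr}}\widehat O^{\mathfrak p_n}_{\nu,\mathbb C^n}.$$ -/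

import Mathlib

open CategoryTheory
open scoped TensorProduct DirectSum

universe u v w

attribute [local instance 100] LieRing.ofAssociativeRing

noncomputable section

namespace ParabolicO

/-! ### Lie algebras of finitely supported matrices -/

/-- `ℂ^∞`, with basis `e_0, e_1, e_2, …` (indices start at `0`, so `e_0` is the distinguished
vector and `ℂ^N` is spanned by the `e_i` with `i < N`). -/
abbrev CInf : Type := ℕ →₀ ℂ

/-- The matrix unit `E i j : e_j ↦ e_i`, as an endomorphism of `ℂ^∞`. -/
def matUnit (i j : ℕ) : Module.End ℂ CInf :=
  Finsupp.lsingle i ∘ₗ Finsupp.lapply j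

theorem matUnit_mul (i j k l : ℕ) :
    matUnit i j * matUnit k l = if j = k then matUnit i l else 0 := by
  ext a b
  by_cases h : j = k <;> by_cases h' : l = a <;>
    simp [matUnit, Finsupp.single_apply, h, h']

/-- The space of matrices with finitely many non-zero entries, all of them in positions `(i, j)`
with `R i j`. -/
def matSpan (R : ℕ → ℕ → Prop) : Submodule ℂ (Module.End ℂ CInf) :=
  Submodule.span ℂ {A | ∃ i j, R i j ∧ A = matUnit i j}

theorem matSpan_mul_mem {R R' : ℕ → ℕ → Prop} {P : Submodule ℂ (Module.End ℂ CInf)}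
    (h : ∀ i j k l, R i j → R' k l → matUnit i j * matUnit k l ∈ P)
    {x y : Module.End ℂ CInf} (hx : x ∈ matSpan R) (hy : y ∈ matSpan R') : x * y ∈ P := by
  unfold matSpan at hx hy
  induction hx using Submodule.span_induction with
  | zero => rw [zero_mul]; exact P.zero_mem
  | add a b _ _ ha hb => rw [add_mul]; exact P.add_mem ha hb
  | smul c a _ ha => rw [smul_mul_assoc]; exact P.smul_mem c ha
  | mem a ha =>
    obtain ⟨i, j, h1, rfl⟩ := ha
    induction hy using Submodule.span_induction with
    | zero => rw [mul_zero]; exact P.zero_mem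
    | add a b _ _ ha hb => rw [mul_add]; exact P.add_mem ha hb
    | smul c a _ ha => rw [mul_smul_comm]; exact P.smul_mem c ha
    | mem b hb =>
      obtain ⟨k, l, h2, rfl⟩ := hb
      exact h _ _ _ _ h1 h2

/-- The space `matSpan R` as a Lie algebra, for a transitive relation `R`. -/
def matAlg (R : ℕ → ℕ → Prop) (hR : ∀ i j k, R i j → R j k → R i k) :
    LieSubalgebra ℂ (Module.End ℂ CInf) where
  toSubmodule := matSpan R
  lie_mem' := by
    intro x y hx hy
    have key : ∀ i j k l, R i j → R k l → matUnit i j * matUnit k l ∈ matSpan R := by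
      intro i j k l h1 h2
      rw [matUnit_mul]
      split_ifs with h
      · subst h
        exact Submodule.subset_span ⟨i, l, hR _ _ _ h1 h2, rfl⟩
      · exact Submodule.zero_mem _
    exact Submodule.sub_mem _ (matSpan_mul_mem key hx hy) (matSpan_mul_mem key hy hx)

theorem matAlg_mono {R R' : ℕ → ℕ → Prop} (hR : ∀ i j k, R i j → R j k → R i k)
    (hR' : ∀ i j k, R' i j → R' j k → R' i k) (h : ∀ i j, R i j → R' i j) :
    matAlg R hR ≤ matAlg R' hR' := by
  intro x hx
  exact Submodule.span_mono (by rintro _ ⟨i, j, hij, rfl⟩; exact ⟨i, j, h i j hij, rfl⟩) hx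

/-- `𝔤𝔩(ℂ^S)` for a set `S` of indices: matrices with finitely many non-zero entries,
supported in `S × S`. -/
def glOn (S : Set ℕ) : LieSubalgebra ℂ (Module.End ℂ CInf) :=
  matAlg (fun i j => i ∈ S ∧ j ∈ S) (fun _ _ _ h h' => ⟨h.1, h'.2⟩)

theorem glOn_mono {S T : Set ℕ} (h : S ⊆ T) : glOn S ≤ glOn T :=
  matAlg_mono _ _ (fun _ _ hij => ⟨h hij.1, h hij.2⟩)

theorem commute_of_disjoint {S T : Set ℕ} (h : Disjoint S T) {x y : Module.End ℂ CInf}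
    (hx : x ∈ glOn S) (hy : y ∈ glOn T) : x * y - y * x = 0 := by
  have h1 : x * y ∈ (⊥ : Submodule ℂ (Module.End ℂ CInf)) := by
    refine matSpan_mul_mem (fun i j k l h1 h2 => ?_) hx hy
    rw [matUnit_mul, if_neg]
    · exact Submodule.zero_mem _
    · rintro rfl; exact Set.disjoint_left.mp h h1.2 h2.1
  have h2 : y * x ∈ (⊥ : Submodule ℂ (Module.End ℂ CInf)) := by
    refine matSpan_mul_mem (fun i j k l h1 h2 => ?_) hy hx
    rw [matUnit_mul, if_neg]
    · exact Submodule.zero_mem _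
    · rintro rfl; exact Set.disjoint_left.mp h h2.1 h1.2
  rw [(Submodule.mem_bot ℂ).mp h1, (Submodule.mem_bot ℂ).mp h2]
  exact sub_self (0 : Module.End ℂ CInf)

/-- Indices of the basis of `ℂ^N`, for `N ∈ ℕ ∪ {∞}`. -/
def idx (N : ℕ∞) : Set ℕ := {i | (i : ℕ∞) < N}

/-- Indices of the basis of `U_N`, the span of all basis vectors of `ℂ^N` but the first. -/
def idxU (N : ℕ∞) : Set ℕ := {i | 0 < i ∧ (i : ℕ∞) < N}

/-- Indices of the basis of `ℂ^N` that do not belong to `ℂ^n`. -/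
def idxPerp (n N : ℕ∞) : Set ℕ := {i | n ≤ (i : ℕ∞) ∧ (i : ℕ∞) < N}

/-- `𝔤𝔩_N`, for `N ∈ ℕ ∪ {∞}`. -/
abbrev gl (N : ℕ∞) : LieSubalgebra ℂ (Module.End ℂ CInf) := glOn (idx N)

/-- `𝔤𝔩(U_N) ⊆ 𝔤𝔩_N`. -/
abbrev glU (N : ℕ∞) : LieSubalgebra ℂ (Module.End ℂ CInf) := glOn (idxU N)

/-- `𝔤𝔩_n^⊥ ⊆ 𝔤𝔩_N`. -/
abbrev glPerp (n N : ℕ∞) : LieSubalgebra ℂ (Module.End ℂ CInf) := glOn (idxPerp n N)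

/-- `𝔲⁺ ⊆ 𝔤𝔩_N`, the span of the `E 0 j` with `0 < j < N`. -/
def uPlus (N : ℕ∞) : LieSubalgebra ℂ (Module.End ℂ CInf) :=
  matAlg (fun i j => i = 0 ∧ j ∈ idxU N)
    (fun _ _ _ h h' => absurd h'.1 (Nat.pos_iff_ne_zero.mp h.2.1))

/-- `𝔲⁻ ⊆ 𝔤𝔩_N`, the span of the `E i 0` with `0 < i < N`. -/
def uMinus (N : ℕ∞) : LieSubalgebra ℂ (Module.End ℂ CInf) :=
  matAlg (fun i j => i ∈ idxU N ∧ j = 0)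
    (fun _ _ _ h h' => absurd h.2 (Nat.pos_iff_ne_zero.mp h'.1.1))

theorem zero_mem_idx {N : ℕ∞} {i : ℕ} (hi : i ∈ idxU N) : 0 ∈ idx N :=
  lt_of_le_of_lt (by simp) hi.2

theorem glU_le (N : ℕ∞) : glU N ≤ gl N := glOn_mono (fun _ h => h.2)

theorem glPerp_le (n N : ℕ∞) : glPerp n N ≤ gl N := glOn_mono (fun _ h => h.2)

theorem glPerp_anti {n n' : ℕ∞} (h : n ≤ n') (N : ℕ∞) : glPerp n' N ≤ glPerp n N :=
  glOn_mono (fun _ hi => ⟨h.trans hi.1, hi.2⟩)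

theorem glPerp_mono (n : ℕ∞) {N N' : ℕ∞} (h : N ≤ N') : glPerp n N ≤ glPerp n N' :=
  glOn_mono (fun _ hi => ⟨hi.1, lt_of_lt_of_le hi.2 h⟩)

theorem gl_le {n N : ℕ∞} (h : n ≤ N) : gl n ≤ gl N :=
  glOn_mono (fun _ hi => lt_of_lt_of_le hi h)

theorem uPlus_le (N : ℕ∞) : uPlus N ≤ gl N := by
  refine matAlg_mono _ _ ?_
  rintro i j ⟨rfl, hj⟩
  exact ⟨zero_mem_idx hj, hj.2⟩

theorem uMinus_le (N : ℕ∞) : uMinus N ≤ gl N := by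
  refine matAlg_mono _ _ ?_
  rintro i j ⟨hi, rfl⟩
  exact ⟨hi.2, zero_mem_idx hi⟩

/-! ### Categories of Lie algebra modules -/

/-- A module over the complex Lie algebra `L`. -/
structure LieRep (L : Type w) [LieRing L] [LieAlgebra ℂ L] where
  V : Type u
  [addCommGroup : AddCommGroup V]
  [module : Module ℂ V]
  [lieRingModule : LieRingModule L V]
  [lieModule : LieModule ℂ L V]

attribute [instance] LieRep.addCommGroup LieRep.module LieRep.lieRingModule LieRep.lieModule

section LieRep

variable {L : Type w} [LieRing L] [LieAlgebra ℂ L]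

instance : Category (LieRep.{u} L) where
  Hom M N := M.V →ₗ⁅ℂ,L⁆ N.V
  id M := LieModuleHom.id
  comp f g := LieModuleHom.comp g f

/-- The equivariant linear map underlying a morphism. -/
def LieRep.toLie {M N : LieRep.{u} L} (f : M ⟶ N) : M.V →ₗ⁅ℂ,L⁆ N.V := f

/-- A submodule, as a module in its own right. -/
abbrev LieRep.ofSub (M : LieRep.{u} L) (K : LieSubmodule ℂ L M.V) : LieRep.{u} L where
  V := K

/-- A quotient module. -/
abbrev LieRep.ofQuot (M : LieRep.{u} L) (K : LieSubmodule ℂ L M.V) : LieRep.{u} L where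
  V := M.V ⧸ K

/-- Restriction of a module along a homomorphism of Lie algebras. -/
def LieRep.res {L' : Type w} [LieRing L'] [LieAlgebra ℂ L'] (a : L' →ₗ⁅ℂ⁆ L)
    (M : LieRep.{u} L) : LieRep.{u} L' :=
  letI := LieRingModule.compLieHom M.V a
  haveI := LieModule.compLieHom M.V a
  { V := M.V }

/-- The underlying spaces of a module and of its restriction are the same. -/
def LieRep.resEquiv {L' : Type w} [LieRing L'] [LieAlgebra ℂ L'] (a : L' →ₗ⁅ℂ⁆ L)
    (M : LieRep.{u} L) : (M.res a).V ≃ₗ[ℂ] M.V :=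
  LinearEquiv.refl ℂ M.V

theorem LieRep.resEquiv_lie {L' : Type w} [LieRing L'] [LieAlgebra ℂ L'] (a : L' →ₗ⁅ℂ⁆ L)
    (M : LieRep.{u} L) (x : L') (m : (M.res a).V) :
    M.resEquiv a ⁅x, m⁆ = ⁅a x, M.resEquiv a m⁆ := rfl

/-- For commuting homomorphisms `a : A → L`, `b : B → L`, the subspace of `B`-invariants of an
`L`-module, as an `A`-submodule. -/
def LieRep.invSub {A B : Type w} [LieRing A] [LieAlgebra ℂ A] [LieRing B] [LieAlgebra ℂ B]
    (a : A →ₗ⁅ℂ⁆ L) (b : B →ₗ⁅ℂ⁆ L) (hab : ∀ x y, ⁅a x, b y⁆ = 0) (M : LieRep.{u} L) :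
    LieSubmodule ℂ A (M.res a).V where
  carrier := {m | ∀ y : B, ⁅b y, M.resEquiv a m⁆ = 0}
  add_mem' := by
    intro m m' hm hm' y
    rw [map_add, lie_add, hm y, hm' y, add_zero]
  zero_mem' := fun y => by rw [map_zero, lie_zero]
  smul_mem' := by
    intro c m hm y
    rw [map_smul, lie_smul, hm y, smul_zero]
  lie_mem := by
    intro x m hm y
    have h0 : ⁅b y, a x⁆ = 0 := by rw [← lie_skew, hab, neg_zero]
    rw [LieRep.resEquiv_lie, leibniz_lie, h0, zero_lie, hm y, lie_zero, add_zero]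

/-- The functor of `B`-invariants, from `L`-modules to `A`-modules. -/
def LieRep.inv {A B : Type w} [LieRing A] [LieAlgebra ℂ A] [LieRing B] [LieAlgebra ℂ B]
    (a : A →ₗ⁅ℂ⁆ L) (b : B →ₗ⁅ℂ⁆ L) (hab : ∀ x y, ⁅a x, b y⁆ = 0) :
    LieRep.{u} L ⥤ LieRep.{u} A where
  obj M := (M.res a).ofSub (M.invSub a b hab)
  map {M N} f :=
    { toFun := fun (m : M.invSub a b hab) =>
        (⟨(N.resEquiv a).symm (LieRep.toLie f (M.resEquiv a m.1)), fun y => by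
          rw [LinearEquiv.apply_symm_apply, ← LieModuleHom.map_lie, m.2 y,
            _root_.map_zero]⟩ : N.invSub a b hab)
      map_add' := fun (m m' : M.invSub a b hab) =>
        Subtype.ext ((LieRep.toLie f).toLinearMap.map_add (M.resEquiv a m.1) (M.resEquiv a m'.1))
      map_smul' := fun c (m : M.invSub a b hab) =>
        Subtype.ext ((LieRep.toLie f).toLinearMap.map_smul c (M.resEquiv a m.1))
      map_lie' := fun {x} {m : M.invSub a b hab} =>
        Subtype.ext (LieModuleHom.map_lie (LieRep.toLie f) (a x) (M.resEquiv a m.1)) }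
  map_id _ := rfl
  map_comp _ _ := rfl

end LieRep

/-! ### Polynomial modules -/

/-- The tautological module `ℂ^S` over `𝔤𝔩(ℂ^S)`, as a subspace of `ℂ^∞`. -/
def tautSub (S : Set ℕ) : LieSubmodule ℂ (glOn S) CInf where
  toSubmodule := Finsupp.supported ℂ ℂ S
  lie_mem := by
    rintro ⟨x, hx⟩ m -
    change x m ∈ Finsupp.supported ℂ ℂ S
    change x ∈ Submodule.span ℂ {A | ∃ i j, (i ∈ S ∧ j ∈ S) ∧ A = matUnit i j} at hx
    induction hx using Submodule.span_induction with
    | zero => exact Submodule.zero_mem _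
    | add a b _ _ ha hb => exact Submodule.add_mem _ ha hb
    | smul c a _ ha => exact Submodule.smul_mem _ c ha
    | mem a ha =>
      obtain ⟨i, j, h, rfl⟩ := ha
      exact Finsupp.single_mem_supported ℂ _ h.1

/-- The tensor power `(ℂ^S)^{⊗ k}` as a `𝔤𝔩(ℂ^S)`-module. -/
def tensPow (S : Set ℕ) : ℕ → LieRep.{0} (glOn S)
  | 0 => { V := TrivialLieModule ℂ (glOn S) ℂ }
  | k + 1 => { V := (tautSub S) ⊗[ℂ] (tensPow S k).V }

/-- Polynomial modules: direct summands of finite direct sums of tensor powers of the tautological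
module. -/
def IsPoly {S : Set ℕ} (M : LieRep.{u} (glOn S)) : Prop :=
  ∃ (r : ℕ) (d : Fin r → ℕ) (i : M.V →ₗ⁅ℂ, glOn S⁆ ⨁ j, (tensPow S (d j)).V)
    (p : (⨁ j, (tensPow S (d j)).V) →ₗ⁅ℂ, glOn S⁆ M.V), ∀ m, p (i m) = m

/-- Modules that are (possibly infinite) direct sums of polynomial modules. -/
def IsIndPoly {S : Set ℕ} (M : LieRep.{u} (glOn S)) : Prop :=
  ∃ s : Set (LieSubmodule ℂ (glOn S) M.V),
    sSupIndep s ∧ sSup s = ⊤ ∧ ∀ K ∈ s, IsPoly (M.ofSub K)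

/-! ### The parabolic category `O` -/

/-- The restriction of a `𝔤𝔩_N`-module to `𝔤𝔩(U_N)`. -/
abbrev resU {N : ℕ∞} (M : LieRep.{u} (gl N)) : LieRep.{u} (glU N) :=
  M.res (LieSubalgebra.inclusion (glU_le N))

/-- `M` is of degree `ν`: the element `E 0 0` acts by `ν - k` on the degree `k` part of the
`𝔤𝔩(U_N)`-module `M`. The latter is the sum of all submodules `S^λ U_N` of `M` with `|λ| = k`;
these are the simple constituents of `U_N^{⊗ k}`, so that it is also the sum of the images of all
equivariant maps from `U_N^{⊗ k}` to `M`. -/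
def HasDegree (ν : ℂ) {N : ℕ∞} (M : LieRep.{u} (gl N)) : Prop :=
  ∀ (k : ℕ) (f : (tensPow (idxU N) k).V →ₗ⁅ℂ, glU N⁆ (resU M).V) (t : (tensPow (idxU N) k).V)
    (x : gl N), (x : Module.End ℂ CInf) = matUnit 0 0 →
      ⁅x, M.resEquiv _ (f t)⁆ = (ν - k) • M.resEquiv _ (f t)

/-- `M` is finitely generated over `Sym(U_N) = 𝒰(𝔲⁻)`: it is a quotient of `Sym(U_N) ⊗ E` for
a polynomial `𝔤𝔩(U_N)`-module `E`. Equivariant `Sym(U_N)`-linear maps `Sym(U_N) ⊗ E → M` are the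
same as equivariant maps `φ : E → M`, and the image of the former is the `𝔲⁻`-submodule generated
by the image of the latter. -/
def IsFG {N : ℕ∞} (M : LieRep.{u} (gl N)) : Prop :=
  ∃ (E : LieRep.{u} (glU N)) (φ : E.V →ₗ⁅ℂ, glU N⁆ (resU M).V), IsPoly E ∧
    LieSubmodule.lieSpan ℂ (uMinus N) (Set.range fun e =>
      (M.resEquiv (LieSubalgebra.inclusion (uMinus_le N))).symm (M.resEquiv _ (φ e))) = ⊤

/-- `M` is locally nilpotent over `𝒰(𝔲⁺)`: each vector is killed by all products of `m` elements
of `𝔲⁺`, for some `m`. -/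
def IsLocNilp {N : ℕ∞} (M : LieRep.{u} (gl N)) : Prop :=
  ∀ v : M.V, ∃ m : ℕ, ∀ l : List (uPlus N), l.length = m →
    l.foldr (fun x t => ⁅LieSubalgebra.inclusion (uPlus_le N) x, t⁆) v = 0

/-- The objects of the category `O^{𝔭_N}_{ν, ℂ^N}`, for `1 ≤ N ≤ ∞`. -/
def parO (ν : ℂ) (N : ℕ∞) : ObjectProperty (LieRep.{u} (gl N)) :=
  fun M => IsIndPoly (resU M) ∧ HasDegree ν M ∧ IsFG M ∧ IsLocNilp M

/-- The category `O^{𝔭_N}_{ν, ℂ^N}`. -/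
abbrev OCat (ν : ℂ) (N : ℕ∞) := (parO.{u} ν N).FullSubcategory

/-- The morphisms of `O^{𝔭_N}_{ν, ℂ^N}` with polynomial kernel and polynomial cokernel. -/
def isoModPoly (ν : ℂ) (N : ℕ∞) : MorphismProperty (OCat.{u} ν N) := fun M M' f =>
  IsPoly (M.obj.ofSub (LieRep.toLie f.hom).ker) ∧
    IsPoly (M'.obj.ofQuot (LieRep.toLie f.hom).range)

/-- The Serre quotient of `O^{𝔭_N}_{ν, ℂ^N}` by the polynomial modules: the localization at the
morphisms with polynomial kernel and cokernel. -/
abbrev OHat (ν : ℂ) (N : ℕ∞) := (isoModPoly.{u} ν N).Localization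

/-- The quotient functor `π̂_N`. -/
abbrev piHat (ν : ℂ) (N : ℕ∞) : OCat.{u} ν N ⥤ OHat.{u} ν N := (isoModPoly ν N).Q

/-! ### Invariants under `𝔤𝔩_n^⊥` -/

theorem disjoint_idxPerp (n N : ℕ∞) : Disjoint (idx n) (idxPerp n N) :=
  Set.disjoint_left.mpr fun _ hi hj => absurd hj.1 (not_le.mpr hi)

theorem gl_comm_glPerp {n N : ℕ∞} (h : n ≤ N) (x : gl n) (y : glPerp n N) :
    ⁅LieSubalgebra.inclusion (gl_le h) x, LieSubalgebra.inclusion (glPerp_le n N) y⁆ = 0 := by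
  apply Subtype.ext
  rw [LieSubalgebra.coe_bracket]
  exact commute_of_disjoint (disjoint_idxPerp n N) x.2 y.2

/-- The functor `(·)^{𝔤𝔩_n^⊥}` from `𝔤𝔩_N`-modules to `𝔤𝔩_n`-modules, for `n ≤ N ≤ ∞`. It gives
`Res_{n, n+1}` for `N = n + 1` and `Γ_n` for `N = ∞`. -/
def glInv {n N : ℕ∞} (h : n ≤ N) : LieRep.{u} (gl N) ⥤ LieRep.{u} (gl n) :=
  LieRep.inv (LieSubalgebra.inclusion (gl_le h)) (LieSubalgebra.inclusion (glPerp_le n N))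
    (gl_comm_glPerp h)

/-- The functor `(·)^{𝔤𝔩_n^⊥}` takes objects of `O^{𝔭_N}_{ν, ℂ^N}` to objects of
`O^{𝔭_n}_{ν, ℂ^n}`. -/
def InvMapsO (ν : ℂ) {n N : ℕ∞} (h : n ≤ N) : Prop :=
  ∀ M : LieRep.{u} (gl N), parO ν N M → parO ν n ((glInv h).obj M)

/-- The functor `(·)^{𝔤𝔩_n^⊥} : O^{𝔭_N}_{ν, ℂ^N} ⥤ O^{𝔭_n}_{ν, ℂ^n}`. -/
def invO {ν : ℂ} {n N : ℕ∞} (h : n ≤ N) (hO : InvMapsO.{u} ν h) : OCat.{u} ν N ⥤ OCat.{u} ν n :=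
  ObjectProperty.lift _ ((parO ν N).ι ⋙ glInv h) (fun M => hO M.obj M.property)

/-- The functor `π̂_n ∘ (·)^{𝔤𝔩_n^⊥}` factors through the Serre quotient. -/
def InvDescends {ν : ℂ} {n N : ℕ∞} (h : n ≤ N) (hO : InvMapsO.{u} ν h) : Prop :=
  (isoModPoly.{u} ν N).IsInvertedBy (invO h hO ⋙ piHat ν n)

/-- The functor induced by `(·)^{𝔤𝔩_n^⊥}` on the Serre quotients. -/
def invHat {ν : ℂ} {n N : ℕ∞} (h : n ≤ N) (hO : InvMapsO.{u} ν h) (hW : InvDescends h hO) :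
    OHat.{u} ν N ⥤ OHat.{u} ν n :=
  Localization.Construction.lift _ hW

theorem piHat_comp_invHat {ν : ℂ} {n N : ℕ∞} (h : n ≤ N) (hO : InvMapsO.{u} ν h)
    (hW : InvDescends h hO) : piHat ν N ⋙ invHat h hO hW = invO h hO ⋙ piHat ν n :=
  Localization.Construction.fac _ hW

/-! ### Inverse limits and restricted inverse limits of categories -/

/-- An object of the inverse limit of a system of categories `F i : C (i + 1) ⥤ C i`. -/
structure InvLim {C : ℕ → Type u} [∀ i, Category.{v} (C i)] (F : ∀ i, C (i + 1) ⥤ C i) where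
  obj : ∀ i, C i
  iso : ∀ i, (F i).obj (obj (i + 1)) ≅ obj i

namespace InvLim

variable {C : ℕ → Type u} [∀ i, Category.{v} (C i)] {F : ∀ i, C (i + 1) ⥤ C i}

/-- A morphism in the inverse limit. -/
@[ext]
structure Hom (X Y : InvLim F) where
  app : ∀ i, X.obj i ⟶ Y.obj i
  comm : ∀ i, (F i).map (app (i + 1)) ≫ (Y.iso i).hom = (X.iso i).hom ≫ app i

instance : Category (InvLim F) where
  Hom X Y := Hom X Y
  id X := { app := fun i => 𝟙 _, comm := fun i => by simp }
  comp f g :=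
    { app := fun i => f.app i ≫ g.app i
      comm := fun i => by
        rw [Functor.map_comp, Category.assoc, g.comm, ← Category.assoc, f.comm, Category.assoc] }
  id_comp f := by apply Hom.ext; funext i; exact Category.id_comp _
  comp_id f := by apply Hom.ext; funext i; exact Category.comp_id _
  assoc f g h := by apply Hom.ext; funext i; exact Category.assoc _ _ _

/-- The functor to the inverse limit induced by functors `G i : D ⥤ C i` and isomorphisms
`F i ∘ G (i + 1) ≅ G i`. -/
def lift {D : Type*} [Category D] (G : ∀ i, D ⥤ C i) (α : ∀ i, G (i + 1) ⋙ F i ≅ G i) :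
    D ⥤ InvLim F where
  obj X := { obj := fun i => (G i).obj X, iso := fun i => (α i).app X }
  map f := { app := fun i => (G i).map f, comm := fun i => (α i).hom.naturality f }
  map_id X := by apply Hom.ext; funext i; exact (G i).map_id X
  map_comp f g := by apply Hom.ext; funext i; exact (G i).map_comp f g

end InvLim

/-- The length of an object: the supremum of the lengths of strictly increasing chains of
subobjects. -/
def objLength {C : Type u} [Category.{v} C] (X : C) : ℕ∞ := Order.height (⊤ : Subobject X)

/-- The objects of the restricted inverse limit: the sequence of lengths of the components is
eventually constant (and finite). -/
def restrProp {C : ℕ → Type u} [∀ i, Category.{v} (C i)] (F : ∀ i, C (i + 1) ⥤ C i) :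
    ObjectProperty (InvLim F) :=
  fun X => ∃ l n₀ : ℕ, ∀ i, n₀ ≤ i → objLength (X.obj i) = l

/-- The restricted inverse limit, a full subcategory of the inverse limit. -/
abbrev RestrInvLim {C : ℕ → Type u} [∀ i, Category.{v} (C i)] (F : ∀ i, C (i + 1) ⥤ C i) :=
  (restrProp F).FullSubcategory

/-! ### The system of Serre quotients and the functor to its limit -/

/-- The integer `i + 1` as an element of `ℕ ∪ {∞}`; the systems below are indexed by `i ≥ 0`, the
`i`-th term being attached to `𝔤𝔩_{i+1}`. -/
abbrev nn (i : ℕ) : ℕ∞ := ((i + 1 : ℕ) : ℕ∞)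

theorem nn_le_succ (i : ℕ) : nn i ≤ nn (i + 1) := by exact_mod_cast Nat.le_succ _

theorem nn_le_top (i : ℕ) : nn i ≤ ⊤ := le_top

/-- The inclusion of `M^{𝔤𝔩_n^⊥}` into the `𝔤𝔩_n^⊥`-invariants of `M^{𝔤𝔩_{n'}^⊥}`, for a
`𝔤𝔩_N`-module `M` and `n ≤ n' ≤ N`, as a natural transformation. -/
def invIncl {n n' N : ℕ∞} (h : n ≤ n') (h' : n' ≤ N) :
    (glInv.{u} (h.trans h')) ⟶ glInv.{u} h' ⋙ glInv.{u} h where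
  app M :=
    { toFun := fun (m : M.invSub _ _ (gl_comm_glPerp (h.trans h'))) =>
        (⟨(((glInv h').obj M).resEquiv _).symm
            (⟨(M.resEquiv _).symm (M.resEquiv _ m.1), fun y =>
              m.2 (LieSubalgebra.inclusion (glPerp_anti h N) y)⟩ :
              M.invSub _ _ (gl_comm_glPerp h')),
          fun y => Subtype.ext
            (m.2 (LieSubalgebra.inclusion (glPerp_mono n h') y))⟩ :
          ((glInv h').obj M).invSub _ _ (gl_comm_glPerp h))
      map_add' := fun _ _ => rfl
      map_smul' := fun _ _ => rfl
      map_lie' := rfl }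
  naturality _ _ _ := rfl

/-- On `O^{𝔭_∞}_{ν, ℂ^∞}`, the inclusion of `Γ_n` into `Res_{n, n+1} ∘ Γ_{n+1}` is an
isomorphism. -/
def InvCompatible (ν : ℂ) (i : ℕ) : Prop :=
  ∀ M : LieRep.{u} (gl ⊤), parO ν ⊤ M → IsIso ((invIncl (nn_le_succ i) (nn_le_top (i + 1))).app M)

section Gamma

variable {ν : ℂ}
  (hRes : ∀ i, InvMapsO.{u} ν (nn_le_succ i)) (hΓ : ∀ i, InvMapsO.{u} ν (nn_le_top i))
  (hResW : ∀ i, InvDescends (nn_le_succ i) (hRes i))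
  (hΓW : ∀ i, InvDescends (nn_le_top i) (hΓ i))
  (hcomp : ∀ i, InvCompatible.{u} ν i)

/-- The functor induced by `Res_{n, n+1}` on the Serre quotients, with `n = i + 1`. -/
def ResHat (i : ℕ) : OHat.{u} ν (nn (i + 1)) ⥤ OHat.{u} ν (nn i) :=
  invHat (nn_le_succ i) (hRes i) (hResW i)

/-- The functor induced by `Γ_n` on the Serre quotients, with `n = i + 1`. -/
def GammaHat (i : ℕ) : OHat.{u} ν ⊤ ⥤ OHat.{u} ν (nn i) :=
  invHat (nn_le_top i) (hΓ i) (hΓW i)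

/-- The natural isomorphism `Res_{n, n+1} ∘ Γ_{n+1} ≅ Γ_n`, with `n = i + 1`: the inverse of the
inclusion `invIncl`. -/
def resGammaIso (i : ℕ) : invO (nn_le_top (i + 1)) (hΓ (i + 1)) ⋙ invO (nn_le_succ i) (hRes i) ≅
    invO (nn_le_top i) (hΓ i) :=
  (NatIso.ofComponents (F := invO (nn_le_top i) (hΓ i))
    (G := invO (nn_le_top (i + 1)) (hΓ (i + 1)) ⋙ invO (nn_le_succ i) (hRes i))
    (fun M => ObjectProperty.isoMk _
      (@asIso _ _ _ _ ((invIncl (nn_le_succ i) (nn_le_top (i + 1))).app M.obj)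
        (hcomp i M.obj M.property)))
    (fun _ => rfl)).symm

theorem piHat_comp_GammaHat_comp_ResHat (i : ℕ) :
    piHat ν ⊤ ⋙ GammaHat hΓ hΓW (i + 1) ⋙ ResHat hRes hResW i =
      (invO (nn_le_top (i + 1)) (hΓ (i + 1)) ⋙ invO (nn_le_succ i) (hRes i)) ⋙
        piHat ν (nn i) := by
  have h1 := piHat_comp_invHat (nn_le_top (i + 1)) (hΓ (i + 1)) (hΓW (i + 1))
  have h2 := piHat_comp_invHat (nn_le_succ i) (hRes i) (hResW i)
  calc piHat ν ⊤ ⋙ GammaHat hΓ hΓW (i + 1) ⋙ ResHat hRes hResW i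
      = (piHat ν ⊤ ⋙ GammaHat hΓ hΓW (i + 1)) ⋙ ResHat hRes hResW i := rfl
    _ = (invO (nn_le_top (i + 1)) (hΓ (i + 1)) ⋙ piHat ν (nn (i + 1))) ⋙
          ResHat hRes hResW i := congrArg (· ⋙ ResHat hRes hResW i) h1
    _ = invO (nn_le_top (i + 1)) (hΓ (i + 1)) ⋙ piHat ν (nn (i + 1)) ⋙
          ResHat hRes hResW i := rfl
    _ = _ := congrArg (invO (nn_le_top (i + 1)) (hΓ (i + 1)) ⋙ ·) h2

/-- The natural isomorphism between the functors induced by `Res_{n, n+1} ∘ Γ_{n+1}` and by `Γ_n`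
on the Serre quotients: the unique one that restricts to `resGammaIso`. -/
def resGammaHatIso (i : ℕ) :
    GammaHat hΓ hΓW (i + 1) ⋙ ResHat hRes hResW i ≅ GammaHat hΓ hΓW i :=
  letI : Localization.Lifting (piHat.{u} ν ⊤) (isoModPoly ν ⊤)
      ((invO (nn_le_top (i + 1)) (hΓ (i + 1)) ⋙ invO (nn_le_succ i) (hRes i)) ⋙
        piHat ν (nn i))
      (GammaHat hΓ hΓW (i + 1) ⋙ ResHat hRes hResW i) :=
    ⟨eqToIso (piHat_comp_GammaHat_comp_ResHat hRes hΓ hResW hΓW i)⟩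
  letI : Localization.Lifting (piHat.{u} ν ⊤) (isoModPoly ν ⊤)
      (invO (nn_le_top i) (hΓ i) ⋙ piHat ν (nn i)) (GammaHat hΓ hΓW i) :=
    ⟨eqToIso (piHat_comp_invHat (nn_le_top i) (hΓ i) (hΓW i))⟩
  Localization.liftNatIso (piHat ν ⊤) (isoModPoly ν ⊤)
    ((invO (nn_le_top (i + 1)) (hΓ (i + 1)) ⋙ invO (nn_le_succ i) (hRes i)) ⋙ piHat ν (nn i))
    (invO (nn_le_top i) (hΓ i) ⋙ piHat ν (nn i)) _ _
    (Functor.isoWhiskerRight (resGammaIso hRes hΓ hcomp i) (piHat ν (nn i)))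

/-- The inverse limit of the Serre quotients. -/
abbrev OHatInvLim := InvLim (C := fun i => OHat.{u} ν (nn i)) (ResHat hRes hResW)

/-- The functor to the inverse limit induced by the functors `GammaHat`. -/
def GammaHatInvLim : OHat.{u} ν ⊤ ⥤ OHatInvLim hRes hResW :=
  InvLim.lift (C := fun i => OHat.{u} ν (nn i)) (GammaHat hΓ hΓW)
    (resGammaHatIso hRes hΓ hResW hΓW hcomp)

/-- The functor `GammaHatInvLim` takes its values in the restricted inverse limit. -/
def GammaHatLandsInRestr : Prop :=
  ∀ X, restrProp (C := fun i => OHat.{u} ν (nn i)) (ResHat hRes hResW)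
    ((GammaHatInvLim hRes hΓ hResW hΓW hcomp).obj X)

/-- The restricted inverse limit of the Serre quotients. -/
abbrev OHatRestrLim := RestrInvLim (C := fun i => OHat.{u} ν (nn i)) (ResHat hRes hResW)

/-- The functor to the restricted inverse limit induced by the functors `GammaHat`. -/
def GammaHatLim (hlen : GammaHatLandsInRestr hRes hΓ hResW hΓW hcomp) :
    OHat.{u} ν ⊤ ⥤ OHatRestrLim hRes hResW :=
  ObjectProperty.lift _ (GammaHatInvLim hRes hΓ hResW hΓW hcomp) hlen

end Gamma

end ParabolicO

end

noncomputable section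

namespace ParabolicO

/-! ### Vector spaces with an action of matrix units -/

/-! Everything is expressed through the operators `e i j` of the matrix units. A tensor power of the
tautological module carries a positive definite Hermitian form for which `e i j` and `e j i` are
adjoint, so sums of images of tensor powers are semisimple. Polynomial modules are then the finite
sums of such images, and their weights have natural numbers as entries. Hence a vector of weight
zero at an index `j` is killed by all `e i j`, and the invariants of 𝔤𝔩_n^⊥ are the vectors of
weight zero outside the first `n` indices. Taking invariants is a weight projection; it is exact,
and the submodule generated by a module of invariants has no further invariants (`pr_zero_gen`).

The finiteness input is `IsO.exists_bound`: a submodule of an object of O is determined by its part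
of bounded degree. Filter the module by the degree `d` of generators over 𝒰(𝔲⁻). Modulo the earlier
steps, the operator ∑ `e i 0` `e 0 i` acts on products of `m` operators `e i 0` applied to words of
length `d` as m(ν - d - m + 1) minus a sum of m·d permutations. For large `m` it is injective by
diagonal dominance, so the high degree part of a submodule is obtained from its part of lower
degree. Consequently objects of O have finite length and submodules stay in O. Moreover a vector of
degree at most `K` is generated by vectors whose weights only involve `K` chosen indices, so the
submodules of a fixed object are detected by their 𝔤𝔩_n^⊥-invariants for all large `n`
(`IsO.exists_detects`). A homomorphism between the invariants of detected modules extends uniquely,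
because the submodule generated by its graph is again a graph (`exists_extension`).

In the Serre quotient, polynomial modules are replaced by their iterated extensions (`PF`), a class
that is closed under extensions by construction. By finite length, each object has a least submodule
with quotient in this class, and that submodule has a largest submodule in the class. The resulting
subquotient is local: it has no non-zero quotient or submodule in the class. The Serre quotient is
equivalent to the full subcategory of local modules (`isEquivalence_locIncl_piHat`), and lengths in
it are computed by chains of submodules whose steps are not in the class (`le_objLength_piHat_iff`).
On a fixed local module, taking invariants preserves locality, length and homomorphisms as soon as
`n` is large. Since a morphism of the inverse limit is determined by its components at large
indices, this gives full faithfulness and values in the restricted limit.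

For essential surjectivity, represent the components by local modules. Once the lengths are
constant, the invariants of each representative have the same length as the representative, and this
forces them to be local and to generate it (`IsLocal.inv_of_length`). The isomorphisms in the Serre
quotients therefore come from isomorphisms of modules, and the representatives form an increasing
sequence in which each is the invariants of the next and generates it. The union of the sequence is
an object of O over 𝔤𝔩_∞ (`exists_limit`) whose invariants are the given modules for large `n`,
hence, by compatibility, for all `n`. -/

/-- A family of operators `e i j` on `V`, thought of as the action of the matrix units. -/
abbrev Ops (V : Type*) [AddCommGroup V] [Module ℂ V] := ℕ → ℕ → Module.End ℂ V

section Ops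

variable {V V' V'' : Type*} [AddCommGroup V] [Module ℂ V] [AddCommGroup V'] [Module ℂ V']
  [AddCommGroup V''] [Module ℂ V'']

/-- The operators `e i j`, `i, j ∈ S`, satisfy the commutation relations of matrix units. -/
def IsSys (S : Set ℕ) (e : Ops V) : Prop :=
  ∀ i ∈ S, ∀ j ∈ S, ∀ k ∈ S, ∀ l ∈ S, ∀ v, e i j (e k l v) =
    e k l (e i j v) + (if j = k then e i l v else 0) - (if l = i then e k j v else 0)

/-- The subspace `W` is stable under the `e i j` with `i, j ∈ S`. -/
def Stable (S : Set ℕ) (e : Ops V) (W : Submodule ℂ V) : Prop :=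
  ∀ i ∈ S, ∀ j ∈ S, ∀ v ∈ W, e i j v ∈ W

/-- The linear map `f` commutes with the `e i j` with `i, j ∈ S`. -/
def Commutes (S : Set ℕ) (e : Ops V) (e' : Ops V') (f : V →ₗ[ℂ] V') : Prop :=
  ∀ i ∈ S, ∀ j ∈ S, ∀ v, f (e i j v) = e' i j (f v)

theorem IsSys.mono {S T : Set ℕ} {e : Ops V} (h : IsSys S e) (hT : T ⊆ S) : IsSys T e :=
  fun i hi j hj k hk l hl => h i (hT hi) j (hT hj) k (hT hk) l (hT hl)

theorem Stable.mono {S T : Set ℕ} {e : Ops V} {W : Submodule ℂ V} (h : Stable S e W)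
    (hT : T ⊆ S) : Stable T e W :=
  fun i hi j hj => h i (hT hi) j (hT hj)

theorem Commutes.mono {S T : Set ℕ} {e : Ops V} {e' : Ops V'} {f : V →ₗ[ℂ] V'}
    (h : Commutes S e e' f) (hT : T ⊆ S) : Commutes T e e' f :=
  fun i hi j hj => h i (hT hi) j (hT hj)

theorem Commutes.comp {S : Set ℕ} {e : Ops V} {e' : Ops V'} {e'' : Ops V''}
    {g : V' →ₗ[ℂ] V''} {f : V →ₗ[ℂ] V'} (hg : Commutes S e' e'' g) (hf : Commutes S e e' f) :
    Commutes S e e'' (g ∘ₗ f) := fun i hi j hj v => by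
  rw [LinearMap.comp_apply, LinearMap.comp_apply, hf i hi j hj, hg i hi j hj]

theorem Commutes.id {S : Set ℕ} (e : Ops V) : Commutes S e e LinearMap.id :=
  fun _ _ _ _ _ => rfl

theorem Commutes.stable_range {S : Set ℕ} {e : Ops V} {e' : Ops V'} {f : V →ₗ[ℂ] V'}
    (hf : Commutes S e e' f) : Stable S e' (LinearMap.range f) := by
  rintro i hi j hj _ ⟨v, rfl⟩
  exact ⟨e i j v, hf i hi j hj v⟩

theorem Commutes.stable_map {S : Set ℕ} {e : Ops V} {e' : Ops V'} {f : V →ₗ[ℂ] V'}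
    (hf : Commutes S e e' f) {W : Submodule ℂ V} (hW : Stable S e W) :
    Stable S e' (W.map f) := by
  rintro i hi j hj _ ⟨v, hv, rfl⟩
  exact ⟨e i j v, hW i hi j hj v hv, hf i hi j hj v⟩

theorem Commutes.stable_comap {S : Set ℕ} {e : Ops V} {e' : Ops V'} {f : V →ₗ[ℂ] V'}
    (hf : Commutes S e e' f) {W : Submodule ℂ V'} (hW : Stable S e' W) :
    Stable S e (W.comap f) := by
  intro i hi j hj v hv
  rw [Submodule.mem_comap, hf i hi j hj]
  exact hW i hi j hj _ hv

theorem Commutes.stable_ker {S : Set ℕ} {e : Ops V} {e' : Ops V'} {f : V →ₗ[ℂ] V'}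
    (hf : Commutes S e e' f) : Stable S e (LinearMap.ker f) := by
  intro i hi j hj v hv
  rw [LinearMap.mem_ker] at hv ⊢
  rw [hf i hi j hj, hv, map_zero]

theorem Stable.inf {S : Set ℕ} {e : Ops V} {W W' : Submodule ℂ V} (h : Stable S e W)
    (h' : Stable S e W') : Stable S e (W ⊓ W') :=
  fun i hi j hj v hv => ⟨h i hi j hj v hv.1, h' i hi j hj v hv.2⟩

theorem stable_sSup {S : Set ℕ} {e : Ops V} {s : Set (Submodule ℂ V)}
    (h : ∀ W ∈ s, Stable S e W) : Stable S e (sSup s) := by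
  intro i hi j hj v hv
  have : sSup s ≤ (sSup s).comap (e i j) := by
    refine sSup_le fun W hW w hw => ?_
    exact (le_sSup hW : W ≤ sSup s) (h W hW i hi j hj w hw)
  exact this hv

theorem stable_sInf {S : Set ℕ} {e : Ops V} {s : Set (Submodule ℂ V)}
    (h : ∀ W ∈ s, Stable S e W) : Stable S e (sInf s) := by
  intro i hi j hj v hv
  rw [Submodule.mem_sInf] at hv ⊢
  exact fun W hW => h W hW i hi j hj v (hv W hW)

theorem Stable.bot (S : Set ℕ) (e : Ops V) : Stable S e ⊥ := by
  intro i _ j _ v hv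
  rw [Submodule.mem_bot] at hv ⊢
  rw [hv, map_zero]

theorem Stable.top (S : Set ℕ) (e : Ops V) : Stable S e ⊤ := fun _ _ _ _ _ _ => trivial

theorem stable_span {S : Set ℕ} {e : Ops V} {X : Set V}
    (h : ∀ i ∈ S, ∀ j ∈ S, ∀ x ∈ X, e i j x ∈ Submodule.span ℂ X) :
    Stable S e (Submodule.span ℂ X) := by
  intro i hi j hj v hv
  have : Submodule.span ℂ X ≤ (Submodule.span ℂ X).comap (e i j) :=
    Submodule.span_le.mpr fun x hx => h i hi j hj x hx
  exact this hv

/-- The stable subspace generated by `X`. -/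
def gen (S : Set ℕ) (e : Ops V) (X : Set V) : Submodule ℂ V :=
  sInf {W | Stable S e W ∧ X ⊆ W}

theorem gen_stable (S : Set ℕ) (e : Ops V) (X : Set V) : Stable S e (gen S e X) :=
  stable_sInf fun _ h => h.1

theorem subset_gen (S : Set ℕ) (e : Ops V) (X : Set V) : X ⊆ gen S e X :=
  fun _ hx => Submodule.mem_sInf.mpr fun _ hW => hW.2 hx

theorem gen_le {S : Set ℕ} {e : Ops V} {X : Set V} {W : Submodule ℂ V} (hW : Stable S e W)
    (h : X ⊆ W) : gen S e X ≤ W := sInf_le ⟨hW, h⟩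

end Ops

/-! ### The matrix units acting on a module -/

theorem matUnit_mem {S : Set ℕ} {i j : ℕ} (hi : i ∈ S) (hj : j ∈ S) : matUnit i j ∈ glOn S :=
  Submodule.subset_span ⟨i, j, ⟨hi, hj⟩, rfl⟩

open Classical in
/-- The action of the matrix units, extended by zero. -/
def LieRep.e {S : Set ℕ} (M : LieRep.{u} (glOn S)) : Ops M.V := fun i j =>
  if h : i ∈ S ∧ j ∈ S then
    LieModule.toEnd ℂ (glOn S) M.V ⟨matUnit i j, matUnit_mem h.1 h.2⟩ else 0

theorem LieRep.e_eq {S : Set ℕ} (M : LieRep.{u} (glOn S)) {i j : ℕ} (hi : i ∈ S) (hj : j ∈ S)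
    (m : M.V) : M.e i j m = ⁅(⟨matUnit i j, matUnit_mem hi hj⟩ : glOn S), m⁆ := by
  unfold LieRep.e
  rw [dif_pos ⟨hi, hj⟩]
  rfl

theorem LieRep.lie_eq {S : Set ℕ} (M : LieRep.{u} (glOn S)) {i j : ℕ} (hi : i ∈ S) (hj : j ∈ S)
    (x : glOn S) (hx : (x : Module.End ℂ CInf) = matUnit i j) (m : M.V) :
    ⁅x, m⁆ = M.e i j m := by
  rw [M.e_eq hi hj]
  congr 1
  exact Subtype.ext hx

theorem LieRep.isSys {S : Set ℕ} (M : LieRep.{u} (glOn S)) : IsSys S M.e := by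
  intro i hi j hj k hk l hl v
  rw [M.e_eq hi hj, M.e_eq hk hl, leibniz_lie, add_comm, M.e_eq hi hj, M.e_eq hk hl, add_sub_assoc]
  congr 1
  have : ⁅(⟨matUnit i j, matUnit_mem hi hj⟩ : glOn S), (⟨matUnit k l, matUnit_mem hk hl⟩ : glOn S)⁆
      = (if j = k then (⟨matUnit i l, matUnit_mem hi hl⟩ : glOn S) else 0) -
        (if l = i then (⟨matUnit k j, matUnit_mem hk hj⟩ : glOn S) else 0) := by
    apply Subtype.ext
    rw [LieSubalgebra.coe_bracket, Ring.lie_def]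
    change matUnit i j * matUnit k l - matUnit k l * matUnit i j = _
    rw [matUnit_mul, matUnit_mul]
    split_ifs <;> rfl
  rw [this, sub_lie]
  congr 1
  · split_ifs
    · rw [M.e_eq hi hl]
    · rw [zero_lie]
  · split_ifs
    · rw [M.e_eq hk hj]
    · rw [zero_lie]

/-- Reduces statements that are linear in the acting matrix to matrix units, which is why stability
and equivariance need only be tested on the `e i j`. -/
theorem glOn_induction {S : Set ℕ} {p : glOn S → Prop}
    (unit : ∀ i (hi : i ∈ S) j (hj : j ∈ S), p ⟨matUnit i j, matUnit_mem hi hj⟩)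
    (zero : p 0) (add : ∀ x y, p x → p y → p (x + y)) (smul : ∀ (c : ℂ) x, p x → p (c • x))
    (x : glOn S) : p x := by
  obtain ⟨x, hx⟩ := x
  change x ∈ Submodule.span ℂ {A | ∃ i j, (i ∈ S ∧ j ∈ S) ∧ A = matUnit i j} at hx
  induction hx using Submodule.span_induction with
  | zero => exact zero
  | add a b ha hb iha ihb => exact add ⟨a, ha⟩ ⟨b, hb⟩ iha ihb
  | smul c a ha iha => exact smul c ⟨a, ha⟩ iha
  | mem a ha =>
    obtain ⟨i, j, h, rfl⟩ := ha
    exact unit i h.1 j h.2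

section

variable {S : Set ℕ} {M N : LieRep.{u} (glOn S)} {M' : LieRep.{v} (glOn S)}

theorem LieRep.commutes (f : M.V →ₗ⁅ℂ, glOn S⁆ M'.V) :
    Commutes S M.e M'.e (f : M.V →ₗ[ℂ] M'.V) := by
  intro i hi j hj v
  rw [M.e_eq hi hj, M'.e_eq hi hj]
  exact f.map_lie _ _

/-- A linear map commuting with matrix units is a morphism of modules. -/
def LieRep.homOfCommutes (f : M.V →ₗ[ℂ] M'.V) (hf : Commutes S M.e M'.e f) :
    M.V →ₗ⁅ℂ, glOn S⁆ M'.V where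
  toLinearMap := f
  map_lie' := by
    intro x m
    change f ⁅x, m⁆ = ⁅x, f m⁆
    induction x using glOn_induction generalizing m with
    | unit i hi j hj =>
      have := hf i hi j hj m
      rwa [M.e_eq hi hj, M'.e_eq hi hj] at this
    | zero => rw [zero_lie, zero_lie, map_zero]
    | add x y hx hy => rw [add_lie, add_lie, map_add, hx, hy]
    | smul c x hx => rw [smul_lie, smul_lie, map_smul, hx]

/-- A stable subspace is a submodule. -/
def LieRep.subOfStable (W : Submodule ℂ M.V) (hW : Stable S M.e W) :
    LieSubmodule ℂ (glOn S) M.V where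
  toSubmodule := W
  lie_mem := by
    intro x m hm
    change m ∈ W at hm
    change ⁅x, m⁆ ∈ W
    induction x using glOn_induction with
    | unit i hi j hj =>
      rw [← M.e_eq hi hj]
      exact hW i hi j hj m hm
    | zero => rw [zero_lie]; exact W.zero_mem
    | add x y hx hy => rw [add_lie]; exact W.add_mem hx hy
    | smul c x hx => rw [smul_lie]; exact W.smul_mem c hx

theorem LieRep.stable (K : LieSubmodule ℂ (glOn S) M.V) : Stable S M.e K.toSubmodule := by
  intro i hi j hj m hm
  rw [M.e_eq hi hj]
  exact K.lie_mem hm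

theorem LieRep.ofSub_e (K : LieSubmodule ℂ (glOn S) M.V) (i j : ℕ) (m : K) :
    (((M.ofSub K).e i j m : K) : M.V) = M.e i j m := by
  by_cases h : i ∈ S ∧ j ∈ S
  · rw [(M.ofSub K).e_eq h.1 h.2, M.e_eq h.1 h.2]
    rfl
  · unfold LieRep.e
    rw [dif_neg h, dif_neg h]
    rfl

theorem LieRep.ofQuot_e (K : LieSubmodule ℂ (glOn S) M.V) (i j : ℕ) (m : M.V) :
    (M.ofQuot K).e i j (LieSubmodule.Quotient.mk m) =
      (LieSubmodule.Quotient.mk (M.e i j m) : M.V ⧸ K) := by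
  by_cases h : i ∈ S ∧ j ∈ S
  · rw [(M.ofQuot K).e_eq h.1 h.2, M.e_eq h.1 h.2]
    rfl
  · unfold LieRep.e
    rw [dif_neg h, dif_neg h]
    rfl

theorem LieRep.res_e {T : Set ℕ} (hT : T ⊆ S) (i j : ℕ) (hi : i ∈ T) (hj : j ∈ T)
    (m : (M.res (LieSubalgebra.inclusion (glOn_mono hT))).V) :
    M.resEquiv _ ((M.res (LieSubalgebra.inclusion (glOn_mono hT))).e i j m) =
      M.e i j (M.resEquiv _ m) := by
  rw [LieRep.e_eq _ hi hj, LieRep.resEquiv_lie, M.e_eq (hT hi) (hT hj)]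
  rfl

end

/-! ### The basis of words of a tensor power -/

/-- The standard basis of the tautological module. -/
def tautBasis (S : Set ℕ) : Module.Basis S ℂ (tautSub S) :=
  Module.Basis.ofRepr (Finsupp.supportedEquivFinsupp S)

theorem coe_tautBasis {S : Set ℕ} (s : S) :
    ((tautBasis S s : tautSub S) : CInf) = Finsupp.single (s : ℕ) 1 := by
  change ((Finsupp.supportedEquivFinsupp (M := ℂ) (R := ℂ) S).symm (Finsupp.single s 1) : CInf) = _
  rw [Finsupp.supportedEquivFinsupp_symm_single]

theorem lie_tautBasis {S : Set ℕ} {i j : ℕ} (hi : i ∈ S) (hj : j ∈ S) (s : S) :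
    ⁅(⟨matUnit i j, matUnit_mem hi hj⟩ : glOn S), tautBasis S s⁆ =
      if (s : ℕ) = j then tautBasis S ⟨i, hi⟩ else 0 := by
  apply Subtype.ext
  change matUnit i j ((tautBasis S s : tautSub S) : CInf) = _
  rw [coe_tautBasis]
  split_ifs with h
  · rw [coe_tautBasis]
    simp [matUnit, h]
  · simp [matUnit, h]

/-- The basis of words of the tensor power. -/
def tensBasis (S : Set ℕ) : (k : ℕ) → Module.Basis (Fin k → S) ℂ (tensPow S k).V
  | 0 => (Module.Basis.singleton (Fin 0 → S) ℂ).map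
      ((TrivialLieModule.equiv ℂ (glOn S) ℂ).symm)
  | k + 1 => ((tautBasis S).tensorProduct (tensBasis S k)).reindex
      (Fin.consEquiv fun _ => (S : Type))

theorem tensBasis_succ {S : Set ℕ} {k : ℕ} (w : Fin (k + 1) → S) :
    tensBasis S (k + 1) w = tautBasis S (w 0) ⊗ₜ[ℂ] tensBasis S k (Fin.tail w) := by
  change ((tautBasis S).tensorProduct (tensBasis S k)).reindex
      (Fin.consEquiv fun _ => (S : Type)) w = _
  rw [Module.Basis.reindex_apply, Module.Basis.tensorProduct_apply']
  rfl

/-- The Leibniz rule: `e i j` turns the letters `j` of a word into `i`, one at a time. -/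
theorem tensPow_e_basis {S : Set ℕ} {i j : ℕ} (hi : i ∈ S) (hj : j ∈ S) (k : ℕ)
    (w : Fin k → S) : (tensPow S k).e i j (tensBasis S k w) =
      ∑ b, if (w b : ℕ) = j then tensBasis S k (Function.update w b ⟨i, hi⟩) else 0 := by
  induction k with
  | zero =>
    rw [LieRep.e_eq _ hi hj, Finset.univ_eq_empty, Finset.sum_empty]
    rfl
  | succ k ih =>
    rw [LieRep.e_eq _ hi hj, tensBasis_succ]
    have h1 : ⁅(⟨matUnit i j, matUnit_mem hi hj⟩ : glOn S),
        tautBasis S (w 0) ⊗ₜ[ℂ] tensBasis S k (Fin.tail w)⁆ =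
        ⁅(⟨matUnit i j, matUnit_mem hi hj⟩ : glOn S), tautBasis S (w 0)⁆ ⊗ₜ[ℂ]
          tensBasis S k (Fin.tail w) + tautBasis S (w 0) ⊗ₜ[ℂ]
        ⁅(⟨matUnit i j, matUnit_mem hi hj⟩ : glOn S), tensBasis S k (Fin.tail w)⁆ :=
      TensorProduct.LieModule.lie_tmul_right _ _ _
    refine h1.trans ?_
    rw [← (tensPow S k).e_eq hi hj, ih, lie_tautBasis hi hj, Fin.sum_univ_succ]
    congr 1
    · split_ifs with h
      · rw [tensBasis_succ, Function.update_self]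
        congr 2
      · exact TensorProduct.zero_tmul _ _
    · rw [TensorProduct.tmul_sum]
      refine Finset.sum_congr rfl fun b _ => ?_
      change (tautBasis S (w 0) ⊗ₜ[ℂ] if (w b.succ : ℕ) = j then _ else _) = _
      split_ifs with h
      · rw [tensBasis_succ]
        congr 1
        rw [Fin.tail_update_succ]
      · exact TensorProduct.tmul_zero _ _

/-! ### Weights -/

section Weights

variable {V V' : Type*} [AddCommGroup V] [Module ℂ V] [AddCommGroup V'] [Module ℂ V']

open Classical in
/-- The operator `e i i` for `i ∈ S`, and zero otherwise. -/
def diagOp (S : Set ℕ) (e : Ops V) (i : ℕ) : Module.End ℂ V := if i ∈ S then e i i else 0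

/-- The weight space of weight `α`, with respect to the `e i i` with `i ∈ S`. It is zero unless `α`
is supported in `S`. -/
def wt (S : Set ℕ) (e : Ops V) (α : ℕ →₀ ℕ) : Submodule ℂ V :=
  ⨅ i, LinearMap.ker (diagOp S e i - (α i : ℂ) • (1 : Module.End ℂ V))

variable {S : Set ℕ} {e : Ops V} {e' : Ops V'}

/-- The clause about indices outside `S` comes from `diagOp` vanishing there. Without it, weights
differing only outside `S` would share a weight space and independence would fail. -/
theorem mem_wt {α : ℕ →₀ ℕ} {v : V} :
    v ∈ wt S e α ↔ (∀ i ∈ S, e i i v = (α i : ℂ) • v) ∧ ∀ i ∉ S, α i ≠ 0 → v = 0 := by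
  unfold wt
  simp only [Submodule.mem_iInf, LinearMap.mem_ker, LinearMap.sub_apply, LinearMap.smul_apply,
    Module.End.one_apply, sub_eq_zero]
  constructor
  · intro h
    refine ⟨fun i hi => ?_, fun i hi h0 => ?_⟩
    · have := h i
      rwa [diagOp, if_pos hi] at this
    · have := h i
      rw [diagOp, if_neg hi, LinearMap.zero_apply, eq_comm, smul_eq_zero] at this
      exact this.resolve_left (by exact_mod_cast h0)
  · rintro ⟨h1, h2⟩ i
    by_cases hi : i ∈ S
    · rw [diagOp, if_pos hi, h1 i hi]
    · rw [diagOp, if_neg hi, LinearMap.zero_apply]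
      by_cases h0 : α i = 0
      · rw [h0, Nat.cast_zero, zero_smul]
      · rw [h2 i hi h0, smul_zero]

theorem wt_apply {α : ℕ →₀ ℕ} {v : V} (h : v ∈ wt S e α) {i : ℕ} (hi : i ∈ S) :
    e i i v = (α i : ℂ) • v := (mem_wt.mp h).1 i hi

theorem wt_eq_zero {α : ℕ →₀ ℕ} {v : V} (h : v ∈ wt S e α) {i : ℕ} (hi : i ∉ S)
    (h0 : α i ≠ 0) : v = 0 := (mem_wt.mp h).2 i hi h0

theorem diagOp_of_mem_wt {α : ℕ →₀ ℕ} {v : V} (h : v ∈ wt S e α) (i : ℕ) :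
    diagOp S e i v = (α i : ℂ) • v := by
  by_cases hi : i ∈ S
  · rw [diagOp, if_pos hi, wt_apply h hi]
  · rw [diagOp, if_neg hi, LinearMap.zero_apply]
    by_cases h0 : α i = 0
    · rw [h0, Nat.cast_zero, zero_smul]
    · rw [wt_eq_zero h hi h0, smul_zero]

/-- The subspace `W` is stable under the diagonal matrix units. -/
def DiagStable (S : Set ℕ) (e : Ops V) (W : Submodule ℂ V) : Prop :=
  ∀ i ∈ S, ∀ v ∈ W, e i i v ∈ W

theorem Stable.diag {W : Submodule ℂ V} (h : Stable S e W) : DiagStable S e W :=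
  fun i hi => h i hi i hi

theorem DiagStable.bot : DiagStable S e ⊥ := (Stable.bot S e).diag

/-- Elimination of one weight at a time: if `α` and `β` differ at `i`, then `diagOp S e i - β i`
kills the component of weight `β` and multiplies that of weight `α` by a non-zero scalar. No
commutation of the diagonal operators is needed. -/
theorem wt_components {W : Submodule ℂ V} (hW : DiagStable S e W) (s : Finset (ℕ →₀ ℕ)) :
    ∀ (x : (ℕ →₀ ℕ) → V) (_ : ∀ α ∈ s, x α ∈ wt S e α) (_ : ∑ α ∈ s, x α ∈ W),
    ∀ α ∈ s, x α ∈ W := by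
  classical
  have hD : ∀ i, ∀ v ∈ W, diagOp S e i v ∈ W := by
    intro i v hv
    by_cases hi : i ∈ S
    · rw [diagOp, if_pos hi]; exact hW i hi v hv
    · rw [diagOp, if_neg hi]; exact W.zero_mem
  induction s using Finset.induction_on with
  | empty => intro x _ _ α hα; simp at hα
  | insert β s hβ ih =>
    intro x hx h
    have key : ∀ α ∈ s, x α ∈ W := by
      intro α hα
      obtain ⟨i, hi⟩ : ∃ i, α i ≠ β i := by
        by_contra! hc
        exact hβ ((Finsupp.ext hc : α = β) ▸ hα)
      have h1 := ih (fun γ => ((γ i : ℂ) - β i) • x γ)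
        (fun γ hγ => (wt S e γ).smul_mem _ (hx γ (Finset.mem_insert_of_mem hγ))) ?_ α hα
      · exact (W.smul_mem_iff (sub_ne_zero.mpr (by exact_mod_cast hi))).mp h1
      · have h2 := W.sub_mem (hD i _ h) (W.smul_mem (β i : ℂ) h)
        rw [Finset.sum_insert hβ, map_add, smul_add, map_sum, Finset.smul_sum,
          diagOp_of_mem_wt (hx β (Finset.mem_insert_self _ _)), add_sub_add_left_eq_sub,
          ← Finset.sum_sub_distrib] at h2
        convert h2 using 1
        refine Finset.sum_congr rfl fun γ hγ => ?_
        rw [diagOp_of_mem_wt (hx γ (Finset.mem_insert_of_mem hγ)), sub_smul]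
    intro α hα
    rcases Finset.mem_insert.mp hα with rfl | hα
    · rw [Finset.sum_insert hβ] at h
      exact (Submodule.add_mem_iff_left _ (W.sum_mem key)).mp h
    · exact key α hα

theorem iSupIndep_wt (S : Set ℕ) (e : Ops V) : iSupIndep (wt S e) := by
  classical
  intro α
  rw [Submodule.disjoint_def]
  intro x hx hx'
  rw [iSup_subtype', Submodule.mem_iSup_iff_exists_finsupp] at hx'
  obtain ⟨f, hf, hsum⟩ := hx'
  -- A vector common to the `α`-space and the sum of the others gives a vanishing sum of weight
  -- vectors, with `-x` in weight `α`; its components then lie in `⊥`.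
  let y : (ℕ →₀ ℕ) → V := fun β => if h : β ≠ α then f ⟨β, h⟩ else -x
  have hy : ∀ β, y β ∈ wt S e β := by
    intro β
    by_cases h : β ≠ α
    · simp only [y, dif_pos h]; exact hf ⟨β, h⟩
    · simp only [y, dif_neg h]
      rw [not_not.mp h]
      exact (wt S e α).neg_mem hx
  have hα : α ∉ f.support.map (Function.Embedding.subtype fun β => β ≠ α) := by
    simp
  have h := wt_components (S := S) (e := e) DiagStable.bot
    (insert α (f.support.map (Function.Embedding.subtype fun β => β ≠ α))) y (fun β _ => hy β)
    (by
      rw [Finset.sum_insert hα, Finset.sum_map, Submodule.mem_bot]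
      simp only [y, ne_eq, not_true_eq_false, dite_false]
      rw [neg_add_eq_zero, ← hsum]
      refine Finset.sum_congr rfl fun β _ => ?_
      have hb := β.2
      simp [hb])
    α (Finset.mem_insert_self _ _)
  rw [Submodule.mem_bot] at h
  simpa [y] using h

/-- `V` is spanned by weight vectors. -/
def IsWeight (S : Set ℕ) (e : Ops V) : Prop := ⨆ α, wt S e α = ⊤

theorem isCompl_wt (h : IsWeight S e) (A : Set (ℕ →₀ ℕ)) :
    IsCompl (⨆ α ∈ A, wt S e α) (⨆ α ∈ Aᶜ, wt S e α) := by
  constructor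
  · exact (iSupIndep_wt S e).disjoint_biSup_biSup disjoint_compl_right
  · rw [codisjoint_iff, eq_top_iff, ← h]
    refine iSup_le fun α => ?_
    by_cases hα : α ∈ A
    · exact le_sup_of_le_left (le_biSup (wt S e) hα)
    · exact le_sup_of_le_right (le_biSup (wt S e) (show α ∈ Aᶜ from hα))

open Classical in
/-- The projection to the sum of the weight spaces with weight in `A`. -/
def pr (S : Set ℕ) (e : Ops V) (A : Set (ℕ →₀ ℕ)) : Module.End ℂ V :=
  if h : IsWeight S e then Submodule.projection _ _ (isCompl_wt h A) else 0

theorem pr_of_mem (h : IsWeight S e) {A : Set (ℕ →₀ ℕ)} {α : ℕ →₀ ℕ} (hα : α ∈ A) {v : V}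
    (hv : v ∈ wt S e α) : pr S e A v = v := by
  rw [pr, dif_pos h]
  exact Submodule.projection_apply_of_mem_left _ ((le_biSup (wt S e) hα : _) hv)

theorem pr_of_notMem (h : IsWeight S e) {A : Set (ℕ →₀ ℕ)} {α : ℕ →₀ ℕ} (hα : α ∉ A) {v : V}
    (hv : v ∈ wt S e α) : pr S e A v = 0 := by
  rw [pr, dif_pos h]
  exact Submodule.projection_apply_of_mem_right _
    ((le_biSup (wt S e) (show α ∈ Aᶜ from hα) : _) hv)

theorem exists_sum_wt (h : IsWeight S e) (v : V) :
    ∃ (s : Finset (ℕ →₀ ℕ)) (x : (ℕ →₀ ℕ) → V), (∀ α, x α ∈ wt S e α) ∧ v = ∑ α ∈ s, x α := by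
  have hv : v ∈ ⨆ α, wt S e α := by rw [show ⨆ α, wt S e α = ⊤ from h]; trivial
  rw [Submodule.mem_iSup_iff_exists_finsupp] at hv
  obtain ⟨f, hf, hsum⟩ := hv
  exact ⟨f.support, f, hf, hsum.symm⟩

theorem pr_mem (h : IsWeight S e) (A : Set (ℕ →₀ ℕ)) {W : Submodule ℂ V} (hW : DiagStable S e W)
    {v : V} (hv : v ∈ W) : pr S e A v ∈ W := by
  classical
  obtain ⟨s, x, hx, rfl⟩ := exists_sum_wt h v
  have hc := wt_components hW s x (fun α _ => hx α) hv
  rw [map_sum]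
  refine W.sum_mem fun α hα => ?_
  by_cases hA : α ∈ A
  · rw [pr_of_mem h hA (hx α)]; exact hc α hα
  · rw [pr_of_notMem h hA (hx α)]; exact W.zero_mem

/-- To prove an inclusion of a subspace stable under the diagonal matrix units, it is enough to
consider weight vectors. -/
theorem le_of_wt (h : IsWeight S e) {W : Submodule ℂ V} (hW : DiagStable S e W)
    {W' : Submodule ℂ V} (hle : ∀ α, ∀ v ∈ wt S e α, v ∈ W → v ∈ W') : W ≤ W' := by
  intro v hv
  obtain ⟨s, x, hx, rfl⟩ := exists_sum_wt h v
  have hc := wt_components hW s x (fun α _ => hx α) hv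
  exact W'.sum_mem fun α hα => hle α _ (hx α) (hc α hα)

theorem Commutes.map_wt {f : V →ₗ[ℂ] V'} (hf : Commutes S e e' f) {α : ℕ →₀ ℕ} {v : V}
    (hv : v ∈ wt S e α) : f v ∈ wt S e' α := by
  rw [mem_wt] at hv ⊢
  refine ⟨fun i hi => ?_, fun i hi h0 => ?_⟩
  · rw [← hf i hi i hi, hv.1 i hi, map_smul]
  · rw [hv.2 i hi h0, map_zero]

theorem Commutes.mem_wt_of_injective {f : V →ₗ[ℂ] V'} (hf : Commutes S e e' f)
    (hi : Function.Injective f) {α : ℕ →₀ ℕ} {v : V} (hv : f v ∈ wt S e' α) : v ∈ wt S e α := by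
  rw [mem_wt] at hv ⊢
  refine ⟨fun i h => hi ?_, fun i h h0 => hi ?_⟩
  · rw [hf i h i h, hv.1 i h, map_smul]
  · rw [hv.2 i h h0, map_zero]

theorem IsWeight.of_surjective (h : IsWeight S e) {f : V →ₗ[ℂ] V'} (hf : Commutes S e e' f)
    (hs : Function.Surjective f) : IsWeight S e' := by
  unfold IsWeight
  rw [eq_top_iff]
  rintro v -
  obtain ⟨v, rfl⟩ := hs v
  obtain ⟨s, x, hx, rfl⟩ := exists_sum_wt h v
  rw [map_sum]
  exact Submodule.sum_mem _ fun α _ => Submodule.mem_iSup_of_mem α (hf.map_wt (hx α))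

/-- The range of `f` is stable, so it contains the weight components of each of its elements, and
these can be pulled back one by one. -/
theorem IsWeight.of_injective (h : IsWeight S e') {f : V →ₗ[ℂ] V'} (hf : Commutes S e e' f)
    (hi : Function.Injective f) : IsWeight S e := by
  unfold IsWeight
  rw [eq_top_iff]
  rintro v -
  obtain ⟨s, x, hx, hv⟩ := exists_sum_wt h (f v)
  have hc := wt_components (W := LinearMap.range f) hf.stable_range.diag s x (fun α _ => hx α)
    (hv ▸ LinearMap.mem_range_self f v)
  choose! y hy using hc
  have : v = ∑ α ∈ s, y α := by
    apply hi
    rw [hv, map_sum]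
    exact Finset.sum_congr rfl fun α hα => (hy α hα).symm
  rw [this]
  exact Submodule.sum_mem _ fun α hα => Submodule.mem_iSup_of_mem α
    (hf.mem_wt_of_injective hi (by rw [hy α hα]; exact hx α))

theorem Commutes.pr {f : V →ₗ[ℂ] V'} (hf : Commutes S e e' f) (h : IsWeight S e)
    (h' : IsWeight S e') (A : Set (ℕ →₀ ℕ)) (v : V) : f (pr S e A v) = ParabolicO.pr S e' A (f v) := by
  obtain ⟨s, x, hx, rfl⟩ := exists_sum_wt h v
  simp only [map_sum]
  refine Finset.sum_congr rfl fun α _ => ?_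
  by_cases hA : α ∈ A
  · rw [pr_of_mem h hA (hx α), pr_of_mem h' hA (hf.map_wt (hx α))]
  · rw [pr_of_notMem h hA (hx α), pr_of_notMem h' hA (hf.map_wt (hx α)), map_zero]

/-- A weight vector in the span of a set of weight vectors is in the span of those of the same
weight. -/
theorem mem_span_wt {ι : Type*} (h : IsWeight S e) {g : ι → V} {γ : ι → (ℕ →₀ ℕ)}
    (hg : ∀ i, g i ∈ wt S e (γ i)) {W : Submodule ℂ V} (hW : DiagStable S e W)
    {α : ℕ →₀ ℕ} {v : V} (hv : v ∈ wt S e α) (hvs : v ∈ W ⊔ Submodule.span ℂ (Set.range g)) :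
    v ∈ W ⊔ Submodule.span ℂ (g '' {i | γ i = α}) := by
  obtain ⟨a, ha, b, hb, rfl⟩ := Submodule.mem_sup.mp hvs
  rw [← pr_of_mem h (Set.mem_singleton α) hv, map_add]
  refine Submodule.add_mem_sup (pr_mem h _ hW ha) ?_
  have : Submodule.span ℂ (Set.range g) ≤
      (Submodule.span ℂ (g '' {i | γ i = α})).comap (ParabolicO.pr S e {α}) := by
    refine Submodule.span_le.mpr ?_
    rintro _ ⟨i, rfl⟩
    by_cases hi : γ i = α
    · change ParabolicO.pr S e {α} (g i) ∈ Submodule.span ℂ (g '' {i | γ i = α})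
      rw [pr_of_mem h (A := {α}) hi (hg i)]
      exact Submodule.subset_span ⟨i, hi, rfl⟩
    · change ParabolicO.pr S e {α} (g i) ∈ Submodule.span ℂ (g '' {i | γ i = α})
      rw [pr_of_notMem h (A := {α}) hi (hg i)]
      exact Submodule.zero_mem _
  exact this hb

/-- An eigenvector of `e i i` for an eigenvalue that is not a natural number is zero. -/
theorem eq_zero_of_eigen (h : IsWeight S e) {i : ℕ} (hi : i ∈ S) {c : ℂ}
    (hc : ∀ n : ℕ, (n : ℂ) ≠ c) {v : V} (hv : e i i v = c • v) : v = 0 := by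
  obtain ⟨s, x, hx, rfl⟩ := exists_sum_wt h v
  have h1 : ∑ α ∈ s, ((α i : ℂ) - c) • x α ∈ (⊥ : Submodule ℂ V) := by
    rw [Submodule.mem_bot]
    simp only [sub_smul]
    rw [Finset.sum_sub_distrib, ← Finset.smul_sum, ← hv, map_sum, sub_eq_zero]
    exact Finset.sum_congr rfl fun α _ => (wt_apply (hx α) hi).symm
  have h2 := wt_components DiagStable.bot s (fun α => ((α i : ℂ) - c) • x α)
    (fun α _ => (wt S e α).smul_mem _ (hx α)) h1
  refine Finset.sum_eq_zero fun α hα => ?_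
  have := h2 α hα
  rw [Submodule.mem_bot, smul_eq_zero, sub_eq_zero] at this
  exact this.resolve_left (hc _)

/-- The total degree of a weight. -/
def deg (α : ℕ →₀ ℕ) : ℕ := α.sum fun _ a => a

theorem deg_add (α β : ℕ →₀ ℕ) : deg (α + β) = deg α + deg β :=
  Finsupp.sum_add_index' (fun _ => rfl) (fun _ _ _ => rfl)

theorem deg_single (i a : ℕ) : deg (Finsupp.single i a) = a := Finsupp.sum_single_index rfl

/-- The matrix unit `e i j` shifts weights. -/
theorem map_wt (hs : IsSys S e) {i j : ℕ} (hi : i ∈ S) (hj : j ∈ S) {α β : ℕ →₀ ℕ}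
    (hαβ : α + Finsupp.single i 1 = β + Finsupp.single j 1) {v : V} (hv : v ∈ wt S e α) :
    e i j v ∈ wt S e β := by
  rw [mem_wt]
  have hk : ∀ k, (α k : ℂ) + (if i = k then 1 else 0) = β k + (if j = k then 1 else 0) := by
    intro k
    have := DFunLike.congr_fun hαβ k
    simp only [Finsupp.add_apply, Finsupp.single_apply] at this
    exact_mod_cast this
  refine ⟨fun k hkS => ?_, fun k hkS h0 => ?_⟩
  · rw [hs k hkS k hkS i hi j hj, wt_apply hv hkS, map_smul]
    have h1 := hk k
    have h2 : (β k : ℂ) = α k + (if i = k then 1 else 0) - (if j = k then 1 else 0) := by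
      rw [h1]; ring
    rw [h2, sub_smul, add_smul]
    congr 1
    · congr 1
      by_cases h : i = k
      · subst h; rw [if_pos rfl, if_pos rfl, one_smul]
      · rw [if_neg h, if_neg (Ne.symm h), zero_smul]
    · by_cases h : j = k
      · subst h; rw [if_pos rfl, if_pos rfl, one_smul]
      · rw [if_neg h, if_neg h, zero_smul]
  · have hik : i ≠ k := fun h => hkS (h ▸ hi)
    have hjk : j ≠ k := fun h => hkS (h ▸ hj)
    have := hk k
    rw [if_neg hik, if_neg hjk, add_zero, add_zero] at this
    have h1 : α k = β k := by exact_mod_cast this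
    rw [wt_eq_zero hv hkS (h1 ▸ h0), map_zero]

/-- A vector killed by `e j j` is killed by `e i j`, `i ≠ j`. -/
theorem map_eq_zero_of_diag {C : Set ℕ} (hs : IsSys S e) (h : IsWeight C e) {i j : ℕ} (hi : i ∈ S)
    (hj : j ∈ S) (hjC : j ∈ C) (hij : i ≠ j) {v : V} (h0 : e j j v = 0) : e i j v = 0 := by
  -- The commutation relation makes `e i j v` an eigenvector of `e j j` with eigenvalue `-1`, which
  -- is not a natural number.
  apply eq_zero_of_eigen h hjC (c := -1)
  · intro n hn
    have : ((n + 1 : ℕ) : ℂ) = 0 := by push_cast; rw [hn]; ring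
    exact absurd (Nat.cast_eq_zero.mp this) (Nat.succ_ne_zero n)
  · rw [hs j hj j hj i hi j hj, h0, map_zero, if_neg (Ne.symm hij), if_pos rfl, neg_one_smul]
    abel

theorem mem_wt_zero {v : V} : v ∈ wt S e 0 ↔ ∀ i ∈ S, e i i v = 0 := by
  rw [mem_wt]
  simp

theorem pr_zero_mem (h : IsWeight S e) (v : V) : pr S e {0} v ∈ wt S e 0 := by
  obtain ⟨s, x, hx, rfl⟩ := exists_sum_wt h v
  rw [map_sum]
  refine Submodule.sum_mem _ fun α _ => ?_
  by_cases hA : α ∈ ({0} : Set (ℕ →₀ ℕ))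
  · rw [pr_of_mem h hA (hx α)]
    exact (Set.mem_singleton_iff.mp hA) ▸ hx α
  · rw [pr_of_notMem h hA (hx α)]
    exact Submodule.zero_mem _

theorem pr_diag (h : IsWeight S e) (A : Set (ℕ →₀ ℕ)) {i : ℕ} (hi : i ∈ S) (v : V) :
    pr S e A (e i i v) = e i i (pr S e A v) := by
  obtain ⟨s, x, hx, rfl⟩ := exists_sum_wt h v
  simp only [map_sum]
  refine Finset.sum_congr rfl fun α _ => ?_
  by_cases hA : α ∈ A
  · rw [wt_apply (hx α) hi, map_smul, pr_of_mem h hA (hx α), wt_apply (hx α) hi]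
  · rw [wt_apply (hx α) hi, map_smul, pr_of_notMem h hA (hx α), map_zero, smul_zero]

open Classical in
theorem wt_le_of_subset {C : Set ℕ} (hC : C ⊆ S) (α : ℕ →₀ ℕ) :
    wt S e α ≤ wt C e (α.filter (· ∈ C)) := by
  intro v hv
  rw [mem_wt]
  refine ⟨fun i hi => ?_, fun i hi h0 => ?_⟩
  · rw [wt_apply hv (hC hi), Finsupp.filter_apply_pos _ _ hi]
  · rw [Finsupp.filter_apply_neg _ _ hi] at h0
    exact absurd rfl h0

theorem IsWeight.mono (h : IsWeight S e) {C : Set ℕ} (hC : C ⊆ S) : IsWeight C e := by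
  classical
  unfold IsWeight
  rw [eq_top_iff, ← show ⨆ α, wt S e α = ⊤ from h]
  exact iSup_le fun α => (wt_le_of_subset hC α).trans (le_iSup (wt C e) _)

end Weights

/-! ### Weights and semisimplicity of tensor powers -/

/-- The weight of a word. -/
def wordWt {S : Set ℕ} {k : ℕ} (w : Fin k → S) : ℕ →₀ ℕ :=
  ∑ b, Finsupp.single (w b : ℕ) 1

theorem wordWt_apply {S : Set ℕ} {k : ℕ} (w : Fin k → S) (i : ℕ) :
    wordWt w i = ∑ b, if (w b : ℕ) = i then 1 else 0 := by
  rw [wordWt, Finsupp.finsetSum_apply]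
  exact Finset.sum_congr rfl fun b _ => Finsupp.single_apply

theorem deg_wordWt {S : Set ℕ} {k : ℕ} (w : Fin k → S) : deg (wordWt w) = k := by
  have h : ∀ s : Finset (Fin k), deg (∑ b ∈ s, Finsupp.single (w b : ℕ) 1) = s.card := by
    intro s
    classical
    induction s using Finset.induction_on with
    | empty => rfl
    | insert b s hb ih =>
      rw [Finset.sum_insert hb, deg_add, deg_single, ih, Finset.card_insert_of_notMem hb, add_comm]
  rw [wordWt, h, Finset.card_univ, Fintype.card_fin]

theorem tensBasis_mem_wt {S : Set ℕ} {k : ℕ} (w : Fin k → S) :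
    tensBasis S k w ∈ wt S (tensPow S k).e (wordWt w) := by
  rw [mem_wt]
  refine ⟨fun i hi => ?_, fun i hi h0 => ?_⟩
  · rw [tensPow_e_basis hi hi, wordWt_apply, Nat.cast_sum, Finset.sum_smul]
    refine Finset.sum_congr rfl fun b _ => ?_
    split_ifs with h
    · rw [show (⟨i, hi⟩ : S) = w b from Subtype.ext h.symm, Function.update_eq_self, Nat.cast_one,
        one_smul]
    · rw [Nat.cast_zero, zero_smul]
  · exfalso
    rw [wordWt_apply] at h0
    obtain ⟨b, _, hb⟩ := Finset.exists_ne_zero_of_sum_ne_zero h0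
    have : (w b : ℕ) = i := by by_contra hc; exact hb (if_neg hc)
    exact hi (this ▸ (w b).2)

theorem isWeight_tensPow (S : Set ℕ) (k : ℕ) : IsWeight S (tensPow S k).e := by
  unfold IsWeight
  rw [eq_top_iff, ← (tensBasis S k).span_eq, Submodule.span_le]
  rintro _ ⟨w, rfl⟩
  exact Submodule.mem_iSup_of_mem _ (tensBasis_mem_wt w)

/-- In the basis of words the matrix of `e i j` is the transpose of that of `e j i`; this is the
source of the adjunction `hermForm_e`. -/
theorem tensPow_repr_e {S : Set ℕ} {i j : ℕ} (hi : i ∈ S) (hj : j ∈ S) (k : ℕ)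
    (y : (tensPow S k).V) (w : Fin k → S) :
    (tensBasis S k).repr ((tensPow S k).e i j y) w =
      ∑ b, if (w b : ℕ) = i then (tensBasis S k).repr y (Function.update w b ⟨j, hj⟩) else 0 := by
  classical
  have : (tensBasis S k).coord w ∘ₗ (tensPow S k).e i j =
      ∑ b, if (w b : ℕ) = i then (tensBasis S k).coord (Function.update w b ⟨j, hj⟩) else 0 := by
    refine (tensBasis S k).ext fun u => ?_
    rw [LinearMap.comp_apply, tensPow_e_basis hi hj, map_sum, LinearMap.sum_apply]
    refine Finset.sum_congr rfl fun b _ => ?_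
    have hiff : (u b : ℕ) = j ∧ Function.update u b ⟨i, hi⟩ = w ↔
        (w b : ℕ) = i ∧ u = Function.update w b ⟨j, hj⟩ := by
      constructor
      · rintro ⟨h, rfl⟩
        refine ⟨by rw [Function.update_self], ?_⟩
        rw [Function.update_idem, show (⟨j, hj⟩ : S) = u b from Subtype.ext h.symm,
          Function.update_eq_self]
      · rintro ⟨h, rfl⟩
        refine ⟨by rw [Function.update_self], ?_⟩
        rw [Function.update_idem, show (⟨i, hi⟩ : S) = w b from Subtype.ext h.symm,
          Function.update_eq_self]
    have h1 : (tensBasis S k).coord w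
        (if (u b : ℕ) = j then tensBasis S k (Function.update u b ⟨i, hi⟩) else 0) =
        if (u b : ℕ) = j ∧ Function.update u b ⟨i, hi⟩ = w then 1 else 0 := by
      by_cases h : (u b : ℕ) = j
      · rw [if_pos h, Module.Basis.coord_apply, Module.Basis.repr_self, Finsupp.single_apply]
        simp only [h, true_and]
      · rw [if_neg h, map_zero, if_neg (fun h' => h h'.1)]
    have h2 : (if (w b : ℕ) = i then (tensBasis S k).coord (Function.update w b ⟨j, hj⟩) else 0)
        (tensBasis S k u) = if (w b : ℕ) = i ∧ u = Function.update w b ⟨j, hj⟩ then 1 else 0 := by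
      by_cases h : (w b : ℕ) = i
      · rw [if_pos h, Module.Basis.coord_apply, Module.Basis.repr_self, Finsupp.single_apply]
        simp only [h, true_and]
      · rw [if_neg h, LinearMap.zero_apply, if_neg (fun h' => h h'.1)]
    rw [h1, h2]
    simp only [hiff]
  have h := LinearMap.congr_fun this y
  rw [LinearMap.comp_apply, LinearMap.sum_apply, Module.Basis.coord_apply] at h
  rw [h]
  refine Finset.sum_congr rfl fun b _ => ?_
  split_ifs <;> rfl

/-- The linear form `x ↦ ∑ x_w * conj y_w` on a tensor power. -/
def hermForm (S : Set ℕ) (k : ℕ) (y : (tensPow S k).V) : (tensPow S k).V →ₗ[ℂ] ℂ :=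
  (tensBasis S k).constr ℂ fun w => starRingEnd ℂ ((tensBasis S k).repr y w)

theorem hermForm_basis {S : Set ℕ} {k : ℕ} (y : (tensPow S k).V) (w : Fin k → S) :
    hermForm S k y (tensBasis S k w) = starRingEnd ℂ ((tensBasis S k).repr y w) :=
  (tensBasis S k).constr_basis ℂ _ w

/-- The operators `e i j` and `e j i` are adjoint, so orthogonal complements of stable subspaces are
stable. This is the algebraic form of the unitary trick. -/
theorem hermForm_e {S : Set ℕ} {i j : ℕ} (hi : i ∈ S) (hj : j ∈ S) (k : ℕ)
    (x y : (tensPow S k).V) : hermForm S k ((tensPow S k).e i j y) x =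
      hermForm S k y ((tensPow S k).e j i x) := by
  have : hermForm S k ((tensPow S k).e i j y) = hermForm S k y ∘ₗ (tensPow S k).e j i := by
    refine (tensBasis S k).ext fun w => ?_
    rw [hermForm_basis, LinearMap.comp_apply, tensPow_e_basis hj hi, tensPow_repr_e hi hj, map_sum,
      map_sum]
    refine Finset.sum_congr rfl fun b _ => ?_
    split_ifs
    · rw [hermForm_basis]
    · rw [map_zero, map_zero]
  rw [this, LinearMap.comp_apply]

theorem hermForm_self {S : Set ℕ} {k : ℕ} {x : (tensPow S k).V} (h : hermForm S k x x = 0) :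
    x = 0 := by
  rw [hermForm, Module.Basis.constr_apply, Finsupp.sum] at h
  simp only [smul_eq_mul, Complex.mul_conj] at h
  rw [← Complex.ofReal_sum] at h
  have h' := Complex.ofReal_eq_zero.mp h
  rw [Finset.sum_eq_zero_iff_of_nonneg fun _ _ => Complex.normSq_nonneg _] at h'
  apply (tensBasis S k).repr.injective
  rw [map_zero]
  ext w
  by_cases hw : w ∈ ((tensBasis S k).repr x).support
  · exact Complex.normSq_eq_zero.mp (h' w hw)
  · exact Finsupp.notMem_support_iff.mp hw

/-- The orthogonal complement of a subspace of a tensor power. -/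
def hermPerp {S : Set ℕ} {k : ℕ} (W : Submodule ℂ (tensPow S k).V) :
    Submodule ℂ (tensPow S k).V where
  carrier := {y | ∀ x ∈ W, hermForm S k y x = 0}
  zero_mem' := by
    intro x _
    have : hermForm S k 0 = 0 := (tensBasis S k).ext fun w => by
      rw [hermForm_basis]; simp
    rw [this, LinearMap.zero_apply]
  add_mem' := by
    intro y y' hy hy' x hx
    have : hermForm S k (y + y') = hermForm S k y + hermForm S k y' :=
      (tensBasis S k).ext fun w => by
        rw [LinearMap.add_apply, hermForm_basis, hermForm_basis, hermForm_basis]; simp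
    rw [this, LinearMap.add_apply, hy x hx, hy' x hx, add_zero]
  smul_mem' := by
    intro c y hy x hx
    have : hermForm S k (c • y) = starRingEnd ℂ c • hermForm S k y :=
      (tensBasis S k).ext fun w => by
        rw [LinearMap.smul_apply, hermForm_basis, hermForm_basis]; simp
    rw [this, LinearMap.smul_apply, hy x hx, smul_zero]

theorem stable_hermPerp {S : Set ℕ} {k : ℕ} {W : Submodule ℂ (tensPow S k).V}
    (hW : Stable S (tensPow S k).e W) : Stable S (tensPow S k).e (hermPerp W) := by
  intro i hi j hj y hy x hx
  rw [hermForm_e hi hj]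
  exact hy _ (hW j hj i hi x hx)

theorem pr_tensBasis {S : Set ℕ} {k : ℕ} (A : Set (ℕ →₀ ℕ)) [DecidablePred (· ∈ A)]
    (w : Fin k → S) : pr S (tensPow S k).e A (tensBasis S k w) =
      if wordWt w ∈ A then tensBasis S k w else 0 := by
  split_ifs with h
  · exact pr_of_mem (isWeight_tensPow S k) h (tensBasis_mem_wt w)
  · exact pr_of_notMem (isWeight_tensPow S k) h (tensBasis_mem_wt w)

/-- For infinite `S` a tensor power is only a pre-Hilbert space, in which orthogonal complements may
be too small. A stable subspace is however graded by weights, and only finitely many words have a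
given weight, so the decomposition of a vector can be found in a finite-dimensional sum of weight
spaces. -/
theorem isCompl_hermPerp {S : Set ℕ} {k : ℕ} {W : Submodule ℂ (tensPow S k).V}
    (hW : Stable S (tensPow S k).e W) : IsCompl W (hermPerp W) := by
  classical
  constructor
  · rw [Submodule.disjoint_def]
    exact fun x hx hx' => hermForm_self (hx' x hx)
  rw [codisjoint_iff, eq_top_iff]
  rintro x -
  -- the finite set of words supporting `x`, saturated with respect to weights
  let A : Set (ℕ →₀ ℕ) := wordWt '' (((tensBasis S k).repr x).support : Set (Fin k → S))
  have hfin : {w : Fin k → S | wordWt w ∈ A}.Finite := by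
    have hF : {w : Fin k → S | ∀ b, (w b : ℕ) ∈
        ((tensBasis S k).repr x).support.biUnion fun u => (wordWt u).support}.Finite := by
      exact (Set.Finite.pi' (t := fun _ : Fin k => (Subtype.val ⁻¹'
        ((((tensBasis S k).repr x).support.biUnion fun u => (wordWt u).support : Finset ℕ) :
          Set ℕ) : Set S)) fun _ => Set.Finite.preimage Subtype.val_injective.injOn
            (Finset.finite_toSet _)).subset fun w hw b => hw b
    refine hF.subset ?_
    rintro w ⟨u, hu, huw⟩ b
    rw [Finset.mem_biUnion]
    refine ⟨u, hu, ?_⟩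
    rw [huw, Finsupp.mem_support_iff, wordWt_apply]
    exact (Finset.sum_pos' (fun _ _ => Nat.zero_le _)
      ⟨b, Finset.mem_univ _, by rw [if_pos rfl]; exact Nat.one_pos⟩).ne'
  let I := {w : Fin k → S | wordWt w ∈ A}
  have : Fintype I := hfin.fintype
  -- The span of the words with weight in `A`, as a finite-dimensional Hilbert space, where
  -- orthogonal projections exist.
  let ι : EuclideanSpace ℂ I →ₗ[ℂ] (tensPow S k).V :=
    (Fintype.linearCombination ℂ fun w : I => tensBasis S k w) ∘ₗ
      (WithLp.linearEquiv 2 ℂ (I → ℂ)).toLinearMap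
  have hι : ∀ h : EuclideanSpace ℂ I, ι h = ∑ w : I, h w • tensBasis S k w := fun h => rfl
  clear_value ι
  have hrepr : ∀ (h : EuclideanSpace ℂ I) (w : I), (tensBasis S k).repr (ι h) w = h w := by
    intro h w
    rw [hι, map_sum, Finsupp.finsetSum_apply, Finset.sum_eq_single w]
    · rw [map_smul, Module.Basis.repr_self, Finsupp.smul_single, Finsupp.single_eq_same,
        smul_eq_mul, mul_one]
    · intro b _ hb
      rw [map_smul, Module.Basis.repr_self, Finsupp.smul_single,
        Finsupp.single_eq_of_ne (fun h => hb (Subtype.ext h.symm))]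
    · intro hn; exact absurd (Finset.mem_univ _) hn
  have hx : ι (WithLp.toLp 2 fun w : I => (tensBasis S k).repr x w) = x := by
    rw [hι]
    conv_rhs => rw [← (tensBasis S k).linearCombination_repr x, Finsupp.linearCombination_apply,
      Finsupp.sum]
    change ∑ w : I, (tensBasis S k).repr x (w : Fin k → S) • tensBasis S k (w : Fin k → S) = _
    rw [← Finset.sum_subset (Finset.subset_univ
      ((((tensBasis S k).repr x).support.subtype (· ∈ I) : Finset I)))]
    · exact Finset.sum_subtype_of_mem (fun w => (tensBasis S k).repr x w • tensBasis S k w)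
        fun w hw => ⟨w, hw, rfl⟩
    · intro w _ hw
      rw [Finset.mem_subtype, Finsupp.notMem_support_iff] at hw
      rw [hw, zero_smul]
  have hpr : ∀ z : (tensPow S k).V, ∃ h : EuclideanSpace ℂ I,
      pr S (tensPow S k).e A z = ι h ∧ ∀ w : I, h w = (tensBasis S k).repr z w := by
    intro z
    refine ⟨WithLp.toLp 2 fun w : I => (tensBasis S k).repr z w, ?_, fun _ => rfl⟩
    have : pr S (tensPow S k).e A = ι ∘ₗ (WithLp.linearEquiv 2 ℂ (I → ℂ)).symm.toLinearMap ∘ₗ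
        (LinearMap.pi fun w : I => (tensBasis S k).coord (w : Fin k → S)) := by
      refine (tensBasis S k).ext fun u => ?_
      rw [pr_tensBasis, LinearMap.comp_apply, hι]
      change _ = ∑ w : I, (tensBasis S k).repr (tensBasis S k u) w • tensBasis S k w
      simp only [Module.Basis.repr_self, Finsupp.single_apply]
      split_ifs with h
      · rw [Finset.sum_eq_single ⟨u, h⟩]
        · rw [if_pos rfl, one_smul]
        · intro b _ hb
          rw [if_neg (fun h => hb (Subtype.ext h.symm)), zero_smul]
        · intro hn; exact absurd (Finset.mem_univ _) hn
      · rw [Finset.sum_eq_zero]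
        intro w _
        rw [if_neg (fun h' => h (by rw [h']; exact w.2)), zero_smul]
    rw [this]
    rfl
  have hherm : ∀ (h : EuclideanSpace ℂ I) (z : (tensPow S k).V),
      hermForm S k (ι h) z = hermForm S k (ι h) (pr S (tensPow S k).e A z) := by
    intro h z
    have : hermForm S k (ι h) = hermForm S k (ι h) ∘ₗ pr S (tensPow S k).e A := by
      refine (tensBasis S k).ext fun u => ?_
      rw [LinearMap.comp_apply, pr_tensBasis]
      split_ifs with hu
      · rfl
      · rw [map_zero, hermForm_basis, hι, map_sum, Finsupp.finsetSum_apply, Finset.sum_eq_zero,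
          map_zero]
        intro w _
        rw [map_smul, Module.Basis.repr_self, Finsupp.smul_single,
          Finsupp.single_eq_of_ne (fun h => hu (by rw [h]; exact w.2))]
    exact LinearMap.congr_fun this z
  obtain ⟨p, hp, q, hq, hpq⟩ := Submodule.exists_add_mem_mem_orthogonal (K := W.comap ι)
    (WithLp.toLp 2 fun w : I => (tensBasis S k).repr x w)
  rw [← hx, hpq, map_add]
  refine Submodule.add_mem_sup hp ?_
  intro z hz
  -- The pairing with `ι q` only sees the component of `z` with weights in `A`, and this component
  -- is still in `W` because `W` is graded.
  rw [hherm]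
  obtain ⟨h, hh, hh'⟩ := hpr z
  have hmem : h ∈ W.comap ι := by
    rw [Submodule.mem_comap, ← hh]
    exact pr_mem (isWeight_tensPow S k) A hW.diag hz
  have := (Submodule.mem_orthogonal _ _).mp hq h hmem
  rw [hh]
  conv_lhs => rw [hι h, map_sum]
  rw [← inner_conj_symm, PiLp.inner_apply, map_eq_zero] at this
  rw [← this]
  refine Finset.sum_congr rfl fun w _ => ?_
  rw [map_smul, hermForm_basis, hrepr]
  rfl

/-! ### Sums of images of tensor powers -/

section WordAlgebra

variable {V V' : Type*} [AddCommGroup V] [Module ℂ V] [AddCommGroup V'] [Module ℂ V']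

/-- The space `V` as a module over the free algebra on the matrix units `e i j`, `i, j ∈ S`. -/
def EMod (_S : Set ℕ) (_e : Ops V) : Type _ := V

instance (S : Set ℕ) (e : Ops V) : AddCommGroup (EMod S e) := inferInstanceAs (AddCommGroup V)

instance (S : Set ℕ) (e : Ops V) : Module ℂ (EMod S e) := inferInstanceAs (Module ℂ V)

/-- The action of the free algebra on `V`. -/
def wordHom (S : Set ℕ) (e : Ops V) : FreeAlgebra ℂ (S × S) →ₐ[ℂ] Module.End ℂ V :=
  FreeAlgebra.lift ℂ fun p => e p.1 p.2

/-- Over the free algebra, submodules are the stable subspaces and homomorphisms are the maps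
commuting with the matrix units, without any relation between the operators. The general theory of
semisimple modules becomes available in this way. -/
instance (S : Set ℕ) (e : Ops V) : Module (FreeAlgebra ℂ (S × S)) (EMod S e) :=
  Module.compHom V (wordHom S e).toRingHom

variable {S : Set ℕ} {e : Ops V} {e' : Ops V'}

theorem wordHom_mem {W : Submodule ℂ V} (hW : Stable S e W) (r : FreeAlgebra ℂ (S × S)) :
    ∀ v ∈ W, wordHom S e r v ∈ W := by
  induction r using FreeAlgebra.induction with
  | grade0 c => intro v hv; rw [AlgHom.commutes]; exact W.smul_mem c hv
  | grade1 p =>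
    intro v hv
    rw [wordHom, FreeAlgebra.lift_ι_apply]
    exact hW _ p.1.2 _ p.2.2 v hv
  | mul a b ha hb => intro v hv; rw [map_mul]; exact ha _ (hb _ hv)
  | add a b ha hb => intro v hv; rw [map_add]; exact W.add_mem (ha _ hv) (hb _ hv)

theorem Commutes.wordHom {f : V →ₗ[ℂ] V'} (hf : Commutes S e e' f) (r : FreeAlgebra ℂ (S × S)) :
    ∀ v, f (wordHom S e r v) = ParabolicO.wordHom S e' r (f v) := by
  induction r using FreeAlgebra.induction with
  | grade0 c =>
    intro v
    rw [AlgHom.commutes, AlgHom.commutes, Module.algebraMap_end_apply,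
      Module.algebraMap_end_apply, map_smul]
  | grade1 p =>
    intro v
    rw [ParabolicO.wordHom, FreeAlgebra.lift_ι_apply, ParabolicO.wordHom,
      FreeAlgebra.lift_ι_apply]
    exact hf _ p.1.2 _ p.2.2 v
  | mul a b ha hb =>
    intro v
    rw [map_mul, map_mul, Module.End.mul_apply, Module.End.mul_apply, ← hb, ← ha]
  | add a b ha hb =>
    intro v
    rw [map_add, map_add, LinearMap.add_apply, LinearMap.add_apply, map_add, ha, hb]

/-- A stable subspace as a submodule over the free algebra. -/
def Stable.toEMod {W : Submodule ℂ V} (hW : Stable S e W) :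
    Submodule (FreeAlgebra ℂ (S × S)) (EMod S e) where
  carrier := {v : EMod S e | (show V from v) ∈ W}
  add_mem' := fun ha hb => W.add_mem ha hb
  zero_mem' := W.zero_mem
  smul_mem' := fun r v hv => wordHom_mem hW r v hv

theorem EMod.smul_algebraMap (c : ℂ) (v : EMod S e) :
    algebraMap ℂ (FreeAlgebra ℂ (S × S)) c • v = c • v := by
  change wordHom S e (algebraMap _ _ c) (show V from v) = c • (show V from v)
  rw [AlgHom.commutes, Module.algebraMap_end_apply]

theorem EMod.smul_ι (a b : S) (v : V) :
    FreeAlgebra.ι ℂ (a, b) • (show EMod S e from v) = (show EMod S e from e a b v) := by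
  change wordHom S e (FreeAlgebra.ι ℂ (a, b)) v = e a b v
  rw [wordHom, FreeAlgebra.lift_ι_apply]

/-- A submodule over the free algebra as a subspace. -/
def ofEMod (p : Submodule (FreeAlgebra ℂ (S × S)) (EMod S e)) : Submodule ℂ V where
  carrier := {v : V | (show EMod S e from v) ∈ p}
  add_mem' := fun ha hb => p.add_mem ha hb
  zero_mem' := p.zero_mem
  smul_mem' := fun c v hv =>
    EMod.smul_algebraMap (S := S) (e := e) c v ▸ p.smul_mem (algebraMap ℂ _ c) hv

theorem stable_ofEMod (p : Submodule (FreeAlgebra ℂ (S × S)) (EMod S e)) :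
    Stable S e (ofEMod p) := by
  intro i hi j hj v hv
  have h := EMod.smul_ι (e := e) ⟨i, hi⟩ ⟨j, hj⟩ v
  change (show EMod S e from e i j v) ∈ p
  rw [← h]
  exact p.smul_mem _ hv

/-- A linear map commuting with matrix units as a homomorphism of modules. -/
def Commutes.toEMod {f : V →ₗ[ℂ] V'} (hf : Commutes S e e' f) :
    EMod S e →ₗ[FreeAlgebra ℂ (S × S)] EMod S e' where
  toFun := f
  map_add' := f.map_add
  map_smul' := fun r v => hf.wordHom r v

/-- A homomorphism of modules over the free algebra as a linear map. -/
def ofEModHom (g : EMod S e →ₗ[FreeAlgebra ℂ (S × S)] EMod S e') : V →ₗ[ℂ] V' where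
  toFun := g
  map_add' := g.map_add
  map_smul' := fun c v => by
    have h := g.map_smul (algebraMap ℂ _ c) (show EMod S e from v)
    rw [EMod.smul_algebraMap, EMod.smul_algebraMap] at h
    exact h

theorem commutes_ofEModHom (g : EMod S e →ₗ[FreeAlgebra ℂ (S × S)] EMod S e') :
    Commutes S e e' (ofEModHom g) := by
  intro i hi j hj v
  have h := g.map_smul (FreeAlgebra.ι ℂ (⟨i, hi⟩, ⟨j, hj⟩)) (show EMod S e from v)
  rw [EMod.smul_ι] at h
  exact h.trans (EMod.smul_ι (e := e') ⟨i, hi⟩ ⟨j, hj⟩ (g v))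

/-- The vectors in the images of equivariant maps from tensor powers. -/
def polyVecs (S : Set ℕ) (e : Ops V) : Set V :=
  {v | ∃ (k : ℕ) (f : (tensPow S k).V →ₗ[ℂ] V) (x : (tensPow S k).V),
    Commutes S (tensPow S k).e e f ∧ f x = v}

/-- `V` is a sum of images of tensor powers. -/
def IndP (S : Set ℕ) (e : Ops V) : Prop := Submodule.span ℂ (polyVecs S e) = ⊤

/-- `V` is a finite sum of images of tensor powers. -/
def FinP (S : Set ℕ) (e : Ops V) : Prop :=
  ∃ (r : ℕ) (d : Fin r → ℕ) (f : ∀ j, (tensPow S (d j)).V →ₗ[ℂ] V),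
    (∀ j, Commutes S (tensPow S (d j)).e e (f j)) ∧ ⨆ j, LinearMap.range (f j) = ⊤

theorem FinP.indP (h : FinP S e) : IndP S e := by
  obtain ⟨r, d, f, hf, htop⟩ := h
  unfold IndP
  rw [eq_top_iff, ← htop]
  refine iSup_le fun j => ?_
  rintro _ ⟨x, rfl⟩
  exact Submodule.subset_span ⟨d j, f j, x, hf j, rfl⟩

theorem isSemisimple_tensPow (S : Set ℕ) (k : ℕ) :
    IsSemisimpleModule (FreeAlgebra ℂ (S × S)) (EMod S (tensPow S k).e) where
  exists_isCompl p := by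
    have h := isCompl_hermPerp (stable_ofEMod p)
    refine ⟨(stable_hermPerp (stable_ofEMod p)).toEMod, ?_, ?_⟩
    · rw [Submodule.disjoint_def]
      exact fun x hx hx' => Submodule.disjoint_def.mp h.1 x hx hx'
    · rw [codisjoint_iff, eq_top_iff]
      rintro v -
      have hv : (show (tensPow S k).V from v) ∈ ofEMod p ⊔ hermPerp (ofEMod p) := by
        rw [codisjoint_iff.mp h.2]; trivial
      obtain ⟨a, ha, b, hb, hab⟩ := Submodule.mem_sup.mp hv
      exact Submodule.mem_sup.mpr ⟨a, ha, b, hb, hab⟩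

/-- Images of semisimple modules and sums of semisimple submodules are semisimple. -/
theorem IndP.isSemisimple (h : IndP S e) :
    IsSemisimpleModule (FreeAlgebra ℂ (S × S)) (EMod S e) := by
  let ι := Σ k, {f : (tensPow S k).V →ₗ[ℂ] V // Commutes S (tensPow S k).e e f}
  refine isSemisimpleModule_of_isSemisimpleModule_submodule'
    (p := fun i : ι => LinearMap.range i.2.2.toEMod) (fun i => ?_) ?_
  · have := isSemisimple_tensPow S i.1
    exact IsSemisimpleModule.range _
  · rw [eq_top_iff]
    rintro v -
    have hv : (show V from v) ∈ Submodule.span ℂ (polyVecs S e) := by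
      rw [show Submodule.span ℂ (polyVecs S e) = ⊤ from h]; trivial
    have hle : Submodule.span ℂ (polyVecs S e) ≤
        ofEMod (⨆ i : ι, LinearMap.range i.2.2.toEMod) := by
      refine Submodule.span_le.mpr ?_
      rintro _ ⟨k, f, x, hf, rfl⟩
      exact (le_iSup (fun i : ι => LinearMap.range i.2.2.toEMod) ⟨k, f, hf⟩) ⟨x, rfl⟩
    exact hle hv

/-- Equivariant injections into sums of images of tensor powers split. -/
theorem IndP.exists_retraction (h : IndP S e') {i : V →ₗ[ℂ] V'} (hi : Commutes S e e' i)
    (hinj : Function.Injective i) :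
    ∃ p : V' →ₗ[ℂ] V, Commutes S e' e p ∧ ∀ v, p (i v) = v := by
  have := h.isSemisimple
  have hinj' : Function.Injective hi.toEMod := hinj
  obtain ⟨p, hp⟩ := IsSemisimpleModule.extension_property hi.toEMod hinj'
    (LinearMap.id : EMod S e →ₗ[FreeAlgebra ℂ (S × S)] EMod S e)
  exact ⟨ofEModHom p, commutes_ofEModHom p, fun v => LinearMap.congr_fun hp v⟩

/-- Equivariant surjections from sums of images of tensor powers split. -/
theorem IndP.exists_section (h : IndP S e) {q : V →ₗ[ℂ] V'} (hq : Commutes S e e' q)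
    (hsurj : Function.Surjective q) :
    ∃ s : V' →ₗ[ℂ] V, Commutes S e' e s ∧ ∀ v, q (s v) = v := by
  have := h.isSemisimple
  have hsurj' : Function.Surjective hq.toEMod := hsurj
  obtain ⟨s, hs⟩ := IsSemisimpleModule.lifting_property hq.toEMod hsurj'
    (LinearMap.id : EMod S e' →ₗ[FreeAlgebra ℂ (S × S)] EMod S e')
  exact ⟨ofEModHom s, commutes_ofEModHom s, fun v => LinearMap.congr_fun hs v⟩

theorem IndP.of_surjective (h : IndP S e) {q : V →ₗ[ℂ] V'} (hq : Commutes S e e' q)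
    (hsurj : Function.Surjective q) : IndP S e' := by
  unfold IndP
  rw [eq_top_iff, ← LinearMap.range_eq_top.mpr hsurj, ← Submodule.map_top,
    ← show Submodule.span ℂ (polyVecs S e) = ⊤ from h, Submodule.map_span]
  refine Submodule.span_mono ?_
  rintro _ ⟨_, ⟨k, f, x, hf, rfl⟩, rfl⟩
  exact ⟨k, q ∘ₗ f, x, hq.comp hf, rfl⟩

/-- By semisimplicity a submodule is also a quotient, so closure under submodules follows from
closure under quotients. -/
theorem IndP.of_injective (h : IndP S e') {i : V →ₗ[ℂ] V'} (hi : Commutes S e e' i)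
    (hinj : Function.Injective i) : IndP S e := by
  obtain ⟨p, hp, hpi⟩ := h.exists_retraction hi hinj
  exact h.of_surjective hp fun v => ⟨i v, hpi v⟩

theorem FinP.of_surjective (h : FinP S e) {q : V →ₗ[ℂ] V'} (hq : Commutes S e e' q)
    (hsurj : Function.Surjective q) : FinP S e' := by
  obtain ⟨r, d, f, hf, htop⟩ := h
  refine ⟨r, d, fun j => q ∘ₗ f j, fun j => hq.comp (hf j), ?_⟩
  simp only [LinearMap.range_comp]
  rw [← Submodule.map_iSup, htop, Submodule.map_top, LinearMap.range_eq_top.mpr hsurj]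

theorem FinP.of_injective (h : FinP S e') {i : V →ₗ[ℂ] V'} (hi : Commutes S e e' i)
    (hinj : Function.Injective i) : FinP S e := by
  obtain ⟨p, hp, hpi⟩ := h.indP.exists_retraction hi hinj
  exact h.of_surjective hp fun v => ⟨i v, hpi v⟩

theorem IndP.isWeight (h : IndP S e) : IsWeight S e := by
  unfold IsWeight
  rw [eq_top_iff, ← show Submodule.span ℂ (polyVecs S e) = ⊤ from h, Submodule.span_le]
  rintro _ ⟨k, f, x, hf, rfl⟩
  obtain ⟨s, y, hy, rfl⟩ := exists_sum_wt (isWeight_tensPow S k) x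
  rw [map_sum]
  exact Submodule.sum_mem _ fun α _ => Submodule.mem_iSup_of_mem α (hf.map_wt (hy α))

end WordAlgebra

/-! ### Polynomial modules as sums of images of tensor powers -/

section Poly

variable {S : Set ℕ}

/-- A finite direct sum of modules. -/
abbrev sumRep {r : ℕ} (D : Fin r → LieRep.{0} (glOn S)) : LieRep.{0} (glOn S) where
  V := ⨁ j, (D j).V

theorem sumRep_commutes {r : ℕ} (D : Fin r → LieRep.{0} (glOn S)) (j : Fin r) :
    Commutes S (D j).e (sumRep D).e (DirectSum.lof ℂ (Fin r) (fun j => (D j).V) j) :=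
  LieRep.commutes (M' := sumRep D)
    (DirectSum.lieModuleOf ℂ (Fin r) (glOn S) (fun j => (D j).V) j)

theorem sumRep_iSup_range {r : ℕ} (D : Fin r → LieRep.{0} (glOn S)) :
    ⨆ j, LinearMap.range (M₂ := (sumRep D).V)
      (DirectSum.lof ℂ (Fin r) (fun j => (D j).V) j) = ⊤ := by
  rw [eq_top_iff]
  rintro x -
  change ⨁ j, (D j).V at x
  induction x using DirectSum.induction_on with
  | zero => exact Submodule.zero_mem _
  | of j x => exact Submodule.mem_iSup_of_mem j ⟨x, rfl⟩
  | add x y hx hy => exact Submodule.add_mem _ hx hy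

theorem sumRep_desc {r : ℕ} (D : Fin r → LieRep.{0} (glOn S)) {M : LieRep.{u} (glOn S)}
    (f : ∀ j, (D j).V →ₗ[ℂ] M.V) (hf : ∀ j, Commutes S (D j).e M.e (f j)) :
    ∃ q : (sumRep D).V →ₗ[ℂ] M.V, Commutes S (sumRep D).e M.e q ∧
      ∀ j x, q (DirectSum.lof ℂ (Fin r) (fun j => (D j).V) j x) = f j x := by
  let q : (sumRep D).V →ₗ[ℂ] M.V := DirectSum.toModule ℂ (Fin r) M.V f
  have hqof : ∀ j x, q (DirectSum.lof ℂ (Fin r) (fun j => (D j).V) j x) = f j x :=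
    fun j x => DirectSum.toModule_lof (M := fun j => (D j).V) (φ := f) ℂ j x
  refine ⟨q, ?_, hqof⟩
  intro i hi j hj v
  have hv : v ∈ ⨆ j, LinearMap.range (M₂ := (sumRep D).V)
      (DirectSum.lof ℂ (Fin r) (fun j => (D j).V) j) := by
    rw [sumRep_iSup_range]; trivial
  induction hv using Submodule.iSup_induction' with
  | zero => simp only [map_zero]
  | mem a x hx =>
    obtain ⟨x, rfl⟩ := hx
    rw [← sumRep_commutes D a i hi j hj x, hqof, hf a i hi j hj, hqof]
  | add x y _ _ hx hy => rw [map_add, map_add, map_add, map_add, hx, hy]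

theorem finP_sumTensPow {r : ℕ} (d : Fin r → ℕ) :
    FinP S (sumRep fun j => tensPow S (d j)).e :=
  ⟨r, d, fun j => DirectSum.lof ℂ (Fin r) (fun j => (tensPow S (d j)).V) j,
    sumRep_commutes fun j => tensPow S (d j), sumRep_iSup_range fun j => tensPow S (d j)⟩

theorem isPoly_iff_sumRep (M : LieRep.{u} (glOn S)) : IsPoly M ↔
    ∃ (r : ℕ) (d : Fin r → ℕ) (i : M.V →ₗ⁅ℂ, glOn S⁆ (sumRep fun j => tensPow S (d j)).V)
      (p : (sumRep fun j => tensPow S (d j)).V →ₗ⁅ℂ, glOn S⁆ M.V), ∀ m, p (i m) = m := Iff.rfl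

/-- A finite sum of images is a quotient of a finite direct sum of tensor powers, and semisimplicity
splits the quotient map, so that quotients are direct summands. -/
theorem isPoly_iff (M : LieRep.{u} (glOn S)) : IsPoly M ↔ FinP S M.e := by
  rw [isPoly_iff_sumRep]
  constructor
  · rintro ⟨r, d, i, p, h⟩
    exact (finP_sumTensPow d).of_surjective (LieRep.commutes p) fun m => ⟨i m, h m⟩
  · rintro ⟨r, d, f, hf, htop⟩
    obtain ⟨q, hq, hqof⟩ := sumRep_desc (fun j => tensPow S (d j)) f hf
    have hsurj : Function.Surjective q := by
      rw [← LinearMap.range_eq_top, eq_top_iff, ← htop]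
      refine iSup_le fun j => ?_
      rintro _ ⟨x, rfl⟩
      exact ⟨_, hqof j x⟩
    obtain ⟨s, hs, hqs⟩ := (finP_sumTensPow d).indP.exists_section hq hsurj
    exact ⟨r, d, LieRep.homOfCommutes s hs, LieRep.homOfCommutes q hq, hqs⟩

theorem ofSub_commutes {M : LieRep.{u} (glOn S)} (K : LieSubmodule ℂ (glOn S) M.V) :
    Commutes S (M.ofSub K).e M.e K.toSubmodule.subtype :=
  fun i _ j _ m => LieRep.ofSub_e K i j m

theorem ofQuot_commutes {M : LieRep.{u} (glOn S)} (K : LieSubmodule ℂ (glOn S) M.V) :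
    Commutes S M.e (M.ofQuot K).e (LieSubmodule.Quotient.mk' K : M.V →ₗ⁅ℂ, glOn S⁆ M.V ⧸ K) :=
  fun i _ j _ m => (LieRep.ofQuot_e K i j m).symm

/-- The direct sum decomposition is recovered from semisimplicity: the module is a direct sum of
simple submodules, and each simple submodule is a quotient of a single tensor power, hence
polynomial. -/
theorem isIndPoly_iff (M : LieRep.{u} (glOn S)) : IsIndPoly M ↔ IndP S M.e := by
  constructor
  · rintro ⟨s, -, htop, hs⟩
    have hst : Stable S M.e (Submodule.span ℂ (polyVecs S M.e)) := by
      refine stable_span ?_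
      rintro i hi j hj _ ⟨k, f, x, hf, rfl⟩
      exact Submodule.subset_span ⟨k, f, (tensPow S k).e i j x, hf, hf i hi j hj x⟩
    have hle : sSup s ≤ LieRep.subOfStable _ hst := by
      refine sSup_le fun K hK m hm => ?_
      have h := ((isPoly_iff _).mp (hs K hK)).indP
      have h1 : (⟨m, hm⟩ : K) ∈ Submodule.span ℂ (polyVecs S (M.ofSub K).e) := by
        rw [show Submodule.span ℂ (polyVecs S (M.ofSub K).e) = ⊤ from h]; trivial
      have h2 := Submodule.mem_map_of_mem (f := K.toSubmodule.subtype) h1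
      rw [Submodule.map_span] at h2
      refine Submodule.span_mono ?_ h2
      rintro _ ⟨_, ⟨k, f, x, hf, rfl⟩, rfl⟩
      exact ⟨k, K.toSubmodule.subtype ∘ₗ f, x, (ofSub_commutes K).comp hf, rfl⟩
    rw [htop] at hle
    unfold IndP
    rw [eq_top_iff]
    exact fun m _ => hle (LieSubmodule.mem_top m)
  · intro h
    have hss := h.isSemisimple
    obtain ⟨s, hind, htop, hsimp⟩ := IsSemisimpleModule.exists_sSupIndep_sSup_simples_eq_top
      (FreeAlgebra ℂ (S × S)) (EMod S M.e)
    let φ : Submodule (FreeAlgebra ℂ (S × S)) (EMod S M.e) ≃o LieSubmodule ℂ (glOn S) M.V :=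
      { toFun := fun p => LieRep.subOfStable (ofEMod p) (stable_ofEMod p)
        invFun := fun K => (LieRep.stable K).toEMod
        left_inv := fun p => rfl
        right_inv := fun K => rfl
        map_rel_iff' := Iff.rfl }
    refine ⟨φ '' s, ?_, ?_, ?_⟩
    · rintro _ ⟨p, hp, rfl⟩
      have h1 := (hind hp).map_orderIso φ
      rw [φ.map_sSup] at h1
      rwa [← Set.image_singleton, ← Set.image_sdiff φ.injective, sSup_image]
    · rw [sSup_image, ← φ.map_sSup, htop, map_top]
    · rintro _ ⟨p, hp, rfl⟩
      rw [isPoly_iff]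
      have hps : IsSimpleModule (FreeAlgebra ℂ (S × S)) p := hsimp p hp
      obtain ⟨π, hπ⟩ := IsSemisimpleModule.extension_property p.subtype p.subtype_injective
        LinearMap.id
      have := IsSimpleModule.nontrivial (FreeAlgebra ℂ (S × S)) p
      obtain ⟨m, hm⟩ : ∃ m : p, m ≠ 0 := exists_ne 0
      -- The images of tensor powers span the module, so the projection `π` onto the simple
      -- submodule cannot vanish on all of them; by simplicity a non-zero composite is surjective.
      have : ∃ (k : ℕ) (f : (tensPow S k).V →ₗ[ℂ] M.V) (hf : Commutes S (tensPow S k).e M.e f),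
          π ∘ₗ hf.toEMod ≠ 0 := by
        by_contra! hc
        have hle : Submodule.span ℂ (polyVecs S M.e) ≤ ofEMod (LinearMap.ker π) := by
          refine Submodule.span_le.mpr ?_
          rintro _ ⟨k, f, x, hf, rfl⟩
          exact LinearMap.congr_fun (hc k f hf) x
        rw [show Submodule.span ℂ (polyVecs S M.e) = ⊤ from h] at hle
        have h1 : π m = 0 := hle (Submodule.mem_top (x := (show M.V from (m : EMod S M.e))))
        exact hm ((LinearMap.congr_fun hπ m).symm.trans h1)
      obtain ⟨k, f, hf, hne⟩ := this
      have hsurj := LinearMap.surjective_of_ne_zero hne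
      let e0 : EMod S (M.ofSub (φ p)).e →ₗ[FreeAlgebra ℂ (S × S)] EMod S M.e :=
        (ofSub_commutes (φ p)).toEMod
      let g : (tensPow S k).V →ₗ[ℂ] (M.ofSub (φ p)).V :=
        LinearMap.codRestrict (ofEMod p) (ofEModHom (p.subtype ∘ₗ π ∘ₗ hf.toEMod))
          fun x => (π (f x)).2
      have hg : Commutes S (tensPow S k).e (M.ofSub (φ p)).e g := by
        intro i hi j hj x
        apply Subtype.ext
        refine Eq.trans ?_ (LieRep.ofSub_e (φ p) i j (g x)).symm
        exact commutes_ofEModHom (p.subtype ∘ₗ π ∘ₗ hf.toEMod) i hi j hj x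
      refine ⟨1, fun _ => k, fun _ => g, fun _ => hg, ?_⟩
      rw [ciSup_const, LinearMap.range_eq_top]
      intro m
      obtain ⟨x, hx⟩ := hsurj m
      exact ⟨x, Subtype.ext (congrArg Subtype.val hx)⟩

end Poly

/-! ### Vectors of weight zero for part of the indices -/

section Lifting

variable {V V' : Type*} [AddCommGroup V] [Module ℂ V] [AddCommGroup V'] [Module ℂ V']
  {S C T : Set ℕ} {e : Ops V} {e' : Ops V'}

/-- Weight zero at `j` already forces `e i j v = 0`, since a non-zero value would have weight `-1`
at `j`. In particular, weight zero for the indices in `C` means invariance under the matrix units of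
`C`. -/
theorem map_zero_wt (hs : IsSys S e) (h : IsWeight C e) (hC : C ⊆ S) {i j : ℕ} (hi : i ∈ S)
    (hj : j ∈ C) {v : V} (hv : v ∈ wt C e 0) : e i j v = 0 := by
  rw [mem_wt_zero] at hv
  by_cases hij : i = j
  · subst hij; exact hv i hj
  · exact map_eq_zero_of_diag hs h hi (hC hj) hj hij (hv j hj)

theorem stable_zero_wt (hs : IsSys S e) (hC : C ⊆ S) : Stable (S \ C) e (wt C e 0) := by
  intro i hi j hj v hv
  rw [mem_wt_zero] at hv ⊢
  intro k hk
  rw [hs k (hC hk) k (hC hk) i hi.1 j hj.1, hv k hk, map_zero, if_neg, if_neg]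
  · simp
  · rintro rfl; exact hj.2 hk
  · rintro rfl; exact hi.2 hk

/-- All weights of `e i j v` are at least one at `i`, so the image has no component of weight zero.
-/
theorem pr_zero_map (hs : IsSys S e) (h : IsWeight C e) (hC : C ⊆ S) {i j : ℕ} (hi : i ∈ C)
    (hj : j ∈ S) (hij : i ≠ j) (v : V) : pr C e {0} (e i j v) = 0 := by
  obtain ⟨s, x, hx, rfl⟩ := exists_sum_wt h v
  simp only [map_sum]
  refine Finset.sum_eq_zero fun α _ => ?_
  have h1 : e i i (e i j (x α)) = ((α i : ℂ) + 1) • e i j (x α) := by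
    rw [hs i (hC hi) i (hC hi) i (hC hi) j hj, wt_apply (hx α) hi, map_smul, if_pos rfl,
      if_neg (Ne.symm hij), sub_zero, add_smul, one_smul]
  have h2 := pr_diag h {0} hi (e i j (x α))
  rw [h1, mem_wt_zero.mp (pr_zero_mem h _) i hi, map_smul, smul_eq_zero] at h2
  exact h2.resolve_left (Nat.cast_add_one_ne_zero _)

/-- The submodule generated by a space `Y` of vectors of weight zero for the indices in `C`, that is
stable under the matrix units with indices not in `C`, has no other vectors of weight zero. -/
theorem pr_zero_gen (hs : IsSys S e) (h : IsWeight C e) (hC : C ⊆ S) {Y : Submodule ℂ V}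
    (hY : Stable (S \ C) e Y) (hY0 : Y ≤ wt C e 0) {v : V} (hv : v ∈ gen S e Y) :
    pr C e {0} v ∈ Y := by
  -- A Poincaré–Birkhoff–Witt argument: `X` is obtained from `Y` with only the units `e i j`, `i ∈
  -- C`, `j ∉ C`. The other units preserve `Y` or kill it, and they can be commuted past these, so
  -- `X` is the whole generated submodule.
  let X : Submodule ℂ V := sInf {W | Y ≤ W ∧ ∀ i ∈ C, ∀ j ∈ S \ C, ∀ w ∈ W, e i j w ∈ W}
  have hX : ∀ i ∈ C, ∀ j ∈ S \ C, ∀ w ∈ X, e i j w ∈ X := by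
    intro i hi j hj w hw
    exact Submodule.mem_sInf.mpr fun W hW => hW.2 i hi j hj w (Submodule.mem_sInf.mp hw W hW)
  have hYX : Y ≤ X := le_sInf fun W hW => hW.1
  have hXle : ∀ W : Submodule ℂ V, Y ≤ W → (∀ i ∈ C, ∀ j ∈ S \ C, ∀ w ∈ W, e i j w ∈ W) → X ≤ W :=
    fun W h1 h2 => sInf_le ⟨h1, h2⟩
  -- Induction principle: a family of units preserves `X` if it maps `Y` into `X` and passes through
  -- one generating operator. It is applied to the units inside the complement of `C`, then inside
  -- `C`, then from `C` to the complement, whose commutators involve the first two families.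
  have step : ∀ A B : Set ℕ, (∀ k ∈ A, ∀ l ∈ B, ∀ y ∈ Y, e k l y ∈ X) →
      (∀ k ∈ A, ∀ l ∈ B, ∀ i ∈ C, ∀ j ∈ S \ C, ∀ w ∈ X, e k l w ∈ X → e k l (e i j w) ∈ X) →
      ∀ k ∈ A, ∀ l ∈ B, ∀ w ∈ X, e k l w ∈ X := by
    intro A B h1 h2 k hk l hl w hw
    have : X ≤ X ⊓ X.comap (e k l) := by
      refine hXle _ (le_inf hYX fun y hy => h1 k hk l hl y hy) ?_
      rintro i hi j hj w ⟨hw, hw'⟩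
      exact ⟨hX i hi j hj w hw, h2 k hk l hl i hi j hj w hw hw'⟩
    exact (this hw).2
  have hTT : ∀ k ∈ S \ C, ∀ l ∈ S \ C, ∀ w ∈ X, e k l w ∈ X := by
    refine step _ _ (fun k hk l hl y hy => hYX (hY k hk l hl y hy)) ?_
    intro k hk l hl i hi j hj w hw hw'
    rw [hs k hk.1 l hl.1 i (hC hi) j hj.1, if_neg (by rintro rfl; exact hl.2 hi), add_zero]
    refine X.sub_mem (hX i hi j hj _ hw') ?_
    split_ifs
    · exact hX i hi l hl w hw
    · exact X.zero_mem
  have hCC : ∀ k ∈ C, ∀ l ∈ C, ∀ w ∈ X, e k l w ∈ X := by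
    refine step _ _ (fun k hk l hl y hy => ?_) ?_
    · rw [map_zero_wt hs h hC (hC hk) hl (hY0 hy)]; exact X.zero_mem
    intro k hk l hl i hi j hj w hw hw'
    rw [hs k (hC hk) l (hC hl) i (hC hi) j hj.1,
      if_neg (fun hjk : j = k => hj.2 (hjk ▸ hk)), sub_zero]
    refine X.add_mem (hX i hi j hj _ hw') ?_
    split_ifs
    · exact hX k hk j hj w hw
    · exact X.zero_mem
  have hTC : ∀ k ∈ S \ C, ∀ l ∈ C, ∀ w ∈ X, e k l w ∈ X := by
    refine step _ _ (fun k hk l hl y hy => ?_) ?_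
    · rw [map_zero_wt hs h hC hk.1 hl (hY0 hy)]; exact X.zero_mem
    intro k hk l hl i hi j hj w hw hw'
    rw [hs k hk.1 l (hC hl) i (hC hi) j hj.1]
    refine X.sub_mem (X.add_mem (hX i hi j hj _ hw') ?_) ?_
    · split_ifs
      · exact hTT k hk j hj w hw
      · exact X.zero_mem
    · split_ifs
      · exact hCC i hi l hl w hw
      · exact X.zero_mem
  have hXS : Stable S e X := by
    intro k hk l hl w hw
    by_cases hkC : k ∈ C <;> by_cases hlC : l ∈ C
    · exact hCC k hkC l hlC w hw
    · exact hX k hkC l ⟨hl, hlC⟩ w hw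
    · exact hTC k ⟨hk, hkC⟩ l hlC w hw
    · exact hTT k ⟨hk, hkC⟩ l ⟨hl, hlC⟩ w hw
  -- Whatever is produced by a generating operator has positive weight on `C`, so only `Y` itself
  -- contributes to weight zero.
  have hXp : X ≤ Y.comap (pr C e {0}) := by
    refine hXle _ (fun y hy => ?_) fun i hi j hj w _ => ?_
    · rw [Submodule.mem_comap, pr_of_mem h (Set.mem_singleton _) (hY0 hy)]
      exact hy
    · rw [Submodule.mem_comap, pr_zero_map hs h hC hi hj.1 (by rintro rfl; exact hj.2 hi)]
      exact Y.zero_mem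
  exact hXp (gen_le hXS hYX hv)

/-- The diagonal action on a product. -/
def prodOps (e : Ops V) (e' : Ops V') : Ops (V × V') := fun i j => (e i j).prodMap (e' i j)

theorem IsSys.prod (hs : IsSys S e) (hs' : IsSys S e') : IsSys S (prodOps e e') := by
  intro i hi j hj k hk l hl v
  apply Prod.ext
  · have := hs i hi j hj k hk l hl v.1
    change e i j (e k l v.1) = _
    rw [this]
    split_ifs <;> rfl
  · have := hs' i hi j hj k hk l hl v.2
    change e' i j (e' k l v.2) = _
    rw [this]
    split_ifs <;> rfl

theorem commutes_inl (S : Set ℕ) (e : Ops V) (e' : Ops V') :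
    Commutes S e (prodOps e e') (LinearMap.inl ℂ V V') := by
  intro i _ j _ v
  exact Prod.ext rfl (map_zero (e' i j)).symm

theorem commutes_inr (S : Set ℕ) (e : Ops V) (e' : Ops V') :
    Commutes S e' (prodOps e e') (LinearMap.inr ℂ V V') := by
  intro i _ j _ v
  exact Prod.ext (map_zero (e i j)).symm rfl

theorem commutes_fst (S : Set ℕ) (e : Ops V) (e' : Ops V') :
    Commutes S (prodOps e e') e (LinearMap.fst ℂ V V') := fun _ _ _ _ _ => rfl

theorem commutes_snd (S : Set ℕ) (e : Ops V) (e' : Ops V') :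
    Commutes S (prodOps e e') e' (LinearMap.snd ℂ V V') := fun _ _ _ _ _ => rfl

theorem IsWeight.prod (h : IsWeight S e) (h' : IsWeight S e') : IsWeight S (prodOps e e') := by
  unfold IsWeight
  rw [eq_top_iff, ← LinearMap.sup_range_inl_inr]
  refine sup_le ?_ ?_
  · rintro _ ⟨v, rfl⟩
    obtain ⟨s, x, hx, rfl⟩ := exists_sum_wt h v
    rw [map_sum]
    exact Submodule.sum_mem _ fun α _ =>
      Submodule.mem_iSup_of_mem α ((commutes_inl S e e').map_wt (hx α))
  · rintro _ ⟨v, rfl⟩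
    obtain ⟨s, x, hx, rfl⟩ := exists_sum_wt h' v
    rw [map_sum]
    exact Submodule.sum_mem _ fun α _ =>
      Submodule.mem_iSup_of_mem α ((commutes_inr S e e').map_wt (hx α))

/-- Equivariant maps between the spaces of vectors of weight zero extend. -/
theorem exists_extension (hs : IsSys S e) (hs' : IsSys S e') (h : IsWeight C e)
    (h' : IsWeight C e') (hC : C ⊆ S)
    (hgen : ∀ W, Stable S e W → wt C e 0 ≤ W → W = ⊤)
    (g : wt C e 0 →ₗ[ℂ] V')
    (hcog : ∀ W, Stable S e' W → W ≤ gen S e' (Set.range g) → W ⊓ wt C e' 0 = ⊥ → W = ⊥) (hg0 : ∀ v, g v ∈ wt C e' 0)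
    (hg : ∀ i ∈ S \ C, ∀ j ∈ S \ C, ∀ v w : wt C e 0, (w : V) = e i j v → g w = e' i j (g v)) :
    ∃ f : V →ₗ[ℂ] V', Commutes S e e' f ∧ ∀ v : wt C e 0, f v = g v := by
  -- The graph of `g`. The submodule `W` of `V × V'` that it generates has no weight zero vectors
  -- outside the graph, and it will be the graph of the extension.
  let Y : Submodule ℂ (V × V') := LinearMap.range ((wt C e 0).subtype.prod g)
  have hY : Stable (S \ C) (prodOps e e') Y := by
    rintro i hi j hj _ ⟨v, rfl⟩
    exact ⟨⟨e i j v, stable_zero_wt hs hC i hi j hj v v.2⟩,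
      Prod.ext rfl (hg i hi j hj v _ rfl)⟩
  have hY0 : Y ≤ wt C (prodOps e e') 0 := by
    rintro _ ⟨v, rfl⟩
    rw [mem_wt_zero]
    exact fun i hi => Prod.ext (mem_wt_zero.mp v.2 i hi) (mem_wt_zero.mp (hg0 v) i hi)
  let W := gen S (prodOps e e') (Y : Set (V × V'))
  have hW : Stable S (prodOps e e') W := gen_stable _ _ _
  have hW0 : ∀ v ∈ W, v ∈ wt C (prodOps e e') 0 → v ∈ Y := by
    intro v hv hv0
    have := pr_zero_gen (hs.prod hs') (h.prod h') hC hY hY0 hv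
    rwa [pr_of_mem (h.prod h') (Set.mem_singleton _) hv0] at this
  -- Single-valuedness: the part of `W` over `0` is a stable subspace without non-zero vectors of
  -- weight zero. It lies in the submodule generated by the image of `g`, so `hcog` is only needed
  -- inside that submodule.
  have hker : ∀ v', ((0 : V), v') ∈ W → v' = 0 := by
    have : W.comap (LinearMap.inr ℂ V V') = ⊥ := by
      refine hcog _ ((commutes_inr S e e').stable_comap hW) (fun v' hv' => ?_) ?_
      · refine gen_le ((commutes_snd S e e').stable_comap (gen_stable S e' (Set.range g))) ?_ hv'
        rintro _ ⟨v, rfl⟩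
        exact subset_gen _ _ _ ⟨v, rfl⟩
      rw [eq_bot_iff]
      rintro v' ⟨hv', hv0⟩
      obtain ⟨v, hv⟩ := hW0 _ hv' ((commutes_inr C e e').map_wt hv0)
      have h1 : (v : V) = 0 := congrArg Prod.fst hv
      have h2 : g v = v' := congrArg Prod.snd hv
      rw [Submodule.mem_bot, ← h2, show v = 0 from Subtype.ext h1, map_zero]
    intro v' hv'
    have h1 : v' ∈ W.comap (LinearMap.inr ℂ V V') := hv'
    rwa [this] at h1
  have hsurj : W.map (LinearMap.fst ℂ V V') = ⊤ := by
    refine hgen _ ((commutes_fst S e e').stable_map hW) fun v hv => ?_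
    exact ⟨(v, g ⟨v, hv⟩), subset_gen _ _ _ ⟨⟨v, hv⟩, rfl⟩, rfl⟩
  have hbij : Function.Bijective ((LinearMap.fst ℂ V V') ∘ₗ W.subtype) := by
    constructor
    · rw [← LinearMap.ker_eq_bot, LinearMap.ker_eq_bot']
      rintro ⟨⟨v, v'⟩, hv⟩ h0
      change v = 0 at h0
      subst h0
      exact Subtype.ext (Prod.ext rfl (hker v' hv))
    · intro v
      obtain ⟨p, hp, hpv⟩ := (hsurj ▸ Submodule.mem_top : v ∈ W.map (LinearMap.fst ℂ V V'))
      exact ⟨⟨p, hp⟩, hpv⟩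
  let E := LinearEquiv.ofBijective _ hbij
  let f : V →ₗ[ℂ] V' := (LinearMap.snd ℂ V V') ∘ₗ W.subtype ∘ₗ E.symm.toLinearMap
  have hf : ∀ v, (v, f v) ∈ W := by
    intro v
    have h1 : ((E.symm v : W) : V × V').1 = v := E.apply_symm_apply v
    have h2 : ((E.symm v : W) : V × V') = (v, f v) := Prod.ext h1 rfl
    rw [← h2]
    exact (E.symm v).2
  have huniq : ∀ v v', (v, v') ∈ W → f v = v' := by
    intro v v' hv
    have := W.sub_mem (hf v) hv
    rw [Prod.mk_sub_mk, sub_self] at this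
    exact sub_eq_zero.mp (hker _ this)
  refine ⟨f, fun i hi j hj v => huniq _ _ (hW i hi j hj _ (hf v)), fun v => huniq _ _ ?_⟩
  exact subset_gen _ _ _ ⟨v, rfl⟩

theorem card_support_le_deg (α : ℕ →₀ ℕ) : α.support.card ≤ deg α := by
  rw [deg, Finsupp.sum, Finset.card_eq_sum_ones]
  exact Finset.sum_le_sum fun i hi => Nat.one_le_iff_ne_zero.mpr (Finsupp.mem_support_iff.mp hi)

/-- A weight vector of degree at most the number of indices in `T` is generated by vectors with
weight supported in `T`. -/
theorem mem_of_deg_le (hs : IsSys S e) (h : IsWeight S e) (hT : T ⊆ S) {W X : Submodule ℂ V}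
    (hW : Stable S e W) (hX : Stable S e X) {D : ℕ} (hD : (D : ℕ∞) ≤ T.encard)
    (hWX : ∀ α, deg α = D → ∀ v ∈ wt S e α, v ∈ W → v ∈ wt (S \ T) e 0 → v ∈ X) :
    ∀ (n : ℕ) (α : ℕ →₀ ℕ), (∀ t : Finset ℕ, (∀ i ∈ t, i ∉ T) → ∑ i ∈ t, α i ≤ n) →
      deg α = D → ∀ v ∈ wt S e α, v ∈ W → v ∈ X := by
  -- Induction on the total weight outside `T`, measured on finite sets of indices because `T` may
  -- have an infinite complement.
  intro n
  induction n with
  | zero =>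
    intro α hα hd v hv hvW
    refine hWX α hd v hv hvW ?_
    rw [mem_wt_zero]
    intro i hi
    have := hα {i} (by simpa using hi.2)
    rw [Finset.sum_singleton, Nat.le_zero] at this
    rw [wt_apply hv hi.1, this, Nat.cast_zero, zero_smul]
  | succ n ih =>
    intro α hα hd v hv hvW
    by_cases hsupp : ∀ i, i ∉ T → α i = 0
    · refine hWX α hd v hv hvW ?_
      rw [mem_wt_zero]
      intro i hi
      rw [wt_apply hv hi.1, hsupp i hi.2, Nat.cast_zero, zero_smul]
    push Not at hsupp
    obtain ⟨i, hiT, hi0⟩ := hsupp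
    by_cases hiS : i ∈ S
    swap
    · rw [wt_eq_zero hv hiS hi0]; exact X.zero_mem
    -- Pigeonhole: if all indices of `T` occurred in `α`, then together with `i ∉ T` the support
    -- would have more than `D` elements.
    obtain ⟨j, hjT, hj0⟩ : ∃ j ∈ T, α j = 0 := by
      by_contra! hc
      have hsub : T ⊆ (α.support.erase i : Finset ℕ) := by
        intro j hj
        rw [Finset.mem_coe, Finset.mem_erase, Finsupp.mem_support_iff]
        exact ⟨by rintro rfl; exact hiT hj, hc j hj⟩
      have h1 := Set.encard_le_encard hsub
      rw [Set.encard_coe_eq_coe_finsetCard] at h1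
      have h2 : (α.support.erase i).card < α.support.card :=
        Finset.card_erase_lt_of_mem (Finsupp.mem_support_iff.mpr hi0)
      have h3 := card_support_le_deg α
      have h4 := hD.trans h1
      have h5 : D ≤ (α.support.erase i).card := by exact_mod_cast h4
      omega
    have hij : i ≠ j := by rintro rfl; exact hiT hjT
    have hjS := hT hjT
    let β : ℕ →₀ ℕ := α - Finsupp.single i 1 + Finsupp.single j 1
    have hle : Finsupp.single i 1 ≤ α := by
      rw [Finsupp.single_le_iff]; exact Nat.one_le_iff_ne_zero.mpr hi0
    have hβ : α + Finsupp.single j 1 = β + Finsupp.single i 1 := by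
      simp only [β]
      rw [add_right_comm, tsub_add_cancel_of_le hle]
    have hdβ : deg β = deg α := by
      have := congrArg deg hβ
      rw [deg_add, deg_add, deg_single, deg_single] at this
      omega
    have hmem : e j i v ∈ X := by
      refine ih β ?_ (hdβ ▸ hd) _ (map_wt hs hjS hiS hβ hv) (hW j hjS i hiS v hvW)
      intro t ht
      have h1 := hα (insert i t) (by
        intro k hk
        rcases Finset.mem_insert.mp hk with rfl | hk
        · exact hiT
        · exact ht k hk)
      have h2 : ∑ k ∈ insert i t, β k + 1 ≤ ∑ k ∈ insert i t, α k := by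
        have h3 : ∀ k ∈ insert i t, β k + Finsupp.single i 1 k = α k := by
          intro k hk
          have := DFunLike.congr_fun hβ k
          rw [Finsupp.add_apply, Finsupp.add_apply] at this
          rw [← this, Finsupp.single_eq_of_ne, add_zero]
          rintro rfl
          rcases Finset.mem_insert.mp hk with h | hk
          · exact hij h.symm
          · exact ht _ hk hjT
        rw [← Finset.sum_congr rfl h3, Finset.sum_add_distrib]
        refine Nat.add_le_add_left ?_ _
        have := Finset.single_le_sum (f := fun k => Finsupp.single i 1 k)
          (fun _ _ => Nat.zero_le _) (Finset.mem_insert_self i t)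
        simpa using this
      have h3 : ∑ k ∈ t, β k ≤ ∑ k ∈ insert i t, β k :=
        Finset.sum_le_sum_of_subset (Finset.subset_insert i t)
      omega
    -- The move from `i` to `j` can be undone: as `j` does not occur in the weight of `v`, the
    -- relation gives `e i j (e j i v) = α i • v`, and `α i ≠ 0`.
    have h1 := hX i hiS j hjS _ hmem
    have hjj : e j j v = 0 := by rw [wt_apply hv hjS, hj0, Nat.cast_zero, zero_smul]
    rw [hs i hiS j hjS j hjS i hiS, map_eq_zero_of_diag hs h hiS hjS hjS hij hjj, map_zero,
      if_pos rfl, if_pos rfl, hjj, sub_zero, zero_add, wt_apply hv hiS] at h1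
    exact (X.smul_mem_iff (by exact_mod_cast hi0)).mp h1

theorem mem_of_deg_le_encard (hs : IsSys S e) (h : IsWeight S e) (hT : T ⊆ S)
    {W X : Submodule ℂ V} (hW : Stable S e W) (hX : Stable S e X)
    {α : ℕ →₀ ℕ} (hα : (deg α : ℕ∞) ≤ T.encard)
    (hWX : ∀ β, deg β = deg α → ∀ v ∈ wt S e β, v ∈ W → v ∈ wt (S \ T) e 0 → v ∈ X)
    {v : V} (hv : v ∈ wt S e α) (hvW : v ∈ W) : v ∈ X := by
  refine mem_of_deg_le hs h hT hW hX hα hWX (deg α) α (fun t _ => ?_) rfl v hv hvW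
  rw [deg, Finsupp.sum, ← Finset.sum_filter_ne_zero]
  exact Finset.sum_le_sum_of_subset fun i hi =>
    Finsupp.mem_support_iff.mpr (Finset.mem_filter.mp hi).2

end Lifting

/-! ### Weights for part of the indices -/

section PartialWeights

variable {V V' : Type*} [AddCommGroup V] [Module ℂ V] [AddCommGroup V'] [Module ℂ V']
  {S C T : Set ℕ} {e : Ops V} {e' : Ops V'}

theorem map_partial_wt (hs : IsSys S e) (hC : C ⊆ S) {i j : ℕ} (hi : i ∈ S) (hj : j ∈ S)
    {α β : ℕ →₀ ℕ} (hC1 : ∀ k ∈ C, α k + (if i = k then 1 else 0) = β k + (if j = k then 1 else 0))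
    (hC2 : ∀ k ∉ C, α k = β k) {v : V} (hv : v ∈ wt C e α) : e i j v ∈ wt C e β := by
  rw [mem_wt]
  refine ⟨fun k hk => ?_, fun k hk h0 => ?_⟩
  · have h1 : (α k : ℂ) + (if i = k then 1 else 0) = β k + (if j = k then 1 else 0) := by
      exact_mod_cast hC1 k hk
    have h2 : (β k : ℂ) = α k + (if i = k then 1 else 0) - (if j = k then 1 else 0) := by
      rw [h1]; ring
    rw [hs k (hC hk) k (hC hk) i hi j hj, wt_apply hv hk, map_smul, h2, sub_smul, add_smul]
    congr 1
    · congr 1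
      by_cases h : i = k
      · subst h; rw [if_pos rfl, if_pos rfl, one_smul]
      · rw [if_neg h, if_neg (Ne.symm h), zero_smul]
    · by_cases h : j = k
      · subst h; rw [if_pos rfl, if_pos rfl, one_smul]
      · rw [if_neg h, if_neg h, zero_smul]
  · rw [wt_eq_zero hv hk (hC2 k hk ▸ h0), map_zero]

theorem map_wt_raise (hs : IsSys S e) (hC : C ⊆ S) {i j : ℕ} (hi : i ∈ C) (hj : j ∈ S \ C)
    {α : ℕ →₀ ℕ} {v : V} (hv : v ∈ wt C e α) : e i j v ∈ wt C e (α + Finsupp.single i 1) := by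
  refine map_partial_wt hs hC (hC hi) hj.1 (fun k hk => ?_) (fun k hk => ?_) hv
  · rw [Finsupp.add_apply, Finsupp.single_apply, if_neg (c := j = k), add_zero]
    rintro rfl; exact hj.2 hk
  · rw [Finsupp.add_apply, Finsupp.single_apply, if_neg, add_zero]
    rintro rfl; exact hk hi

theorem map_wt_lower (hs : IsSys S e) (hC : C ⊆ S) {i j : ℕ} (hi : i ∈ S \ C) (hj : j ∈ C)
    {α : ℕ →₀ ℕ} {v : V} (hv : v ∈ wt C e (α + Finsupp.single j 1)) : e i j v ∈ wt C e α := by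
  refine map_partial_wt hs hC hi.1 (hC hj) (fun k hk => ?_) (fun k hk => ?_) hv
  · rw [Finsupp.add_apply, Finsupp.single_apply, if_neg (c := i = k), add_zero]
    rintro rfl; exact hi.2 hk
  · rw [Finsupp.add_apply, Finsupp.single_apply, if_neg, add_zero]
    rintro rfl; exact hk hj

theorem map_wt_same (hs : IsSys S e) (hC : C ⊆ S) {i j : ℕ} (hi : i ∈ S \ C) (hj : j ∈ S \ C)
    {α : ℕ →₀ ℕ} {v : V} (hv : v ∈ wt C e α) : e i j v ∈ wt C e α := by
  refine map_partial_wt hs hC hi.1 hj.1 (fun k hk => ?_) (fun _ _ => rfl) hv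
  rw [if_neg, if_neg]
  · rintro rfl; exact hj.2 hk
  · rintro rfl; exact hi.2 hk

theorem pr_map_same (hs : IsSys S e) (h : IsWeight C e) (hC : C ⊆ S) {i j : ℕ} (hi : i ∈ S \ C)
    (hj : j ∈ S \ C) (A : Set (ℕ →₀ ℕ)) (v : V) : pr C e A (e i j v) = e i j (pr C e A v) := by
  obtain ⟨s, x, hx, rfl⟩ := exists_sum_wt h v
  simp only [map_sum]
  refine Finset.sum_congr rfl fun α _ => ?_
  by_cases hA : α ∈ A
  · rw [pr_of_mem h hA (hx α), pr_of_mem h hA (map_wt_same hs hC hi hj (hx α))]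
  · rw [pr_of_notMem h hA (hx α), pr_of_notMem h hA (map_wt_same hs hC hi hj (hx α)), map_zero]

theorem pr_singleton_mem (h : IsWeight S e) (α : ℕ →₀ ℕ) (v : V) : pr S e {α} v ∈ wt S e α := by
  obtain ⟨s, x, hx, rfl⟩ := exists_sum_wt h v
  rw [map_sum]
  refine Submodule.sum_mem _ fun β _ => ?_
  by_cases hA : β ∈ ({α} : Set (ℕ →₀ ℕ))
  · rw [pr_of_mem h hA (hx β)]
    exact (Set.mem_singleton_iff.mp hA) ▸ hx β
  · rw [pr_of_notMem h hA (hx β)]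
    exact Submodule.zero_mem _

/-- Weight vectors lift along equivariant surjections. -/
theorem exists_wt_lift (h : IsWeight S e) (h' : IsWeight S e') {q : V →ₗ[ℂ] V'}
    (hq : Commutes S e e' q) (hsurj : Function.Surjective q) {α : ℕ →₀ ℕ} {v' : V'}
    (hv' : v' ∈ wt S e' α) : ∃ v ∈ wt S e α, q v = v' := by
  obtain ⟨v, rfl⟩ := hsurj v'
  exact ⟨pr S e {α} v, pr_singleton_mem h α v,
    by rw [hq.pr h h', pr_of_mem h' (Set.mem_singleton α) hv']⟩

/-! Vectors of weight zero outside `T`, as a module over the matrix units with indices in `T`. -/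

theorem map_wt_inv (hT : T ⊆ S) {ι : V' →ₗ[ℂ] V} (hι : Commutes T e' e ι)
    (hr : LinearMap.range ι ≤ wt (S \ T) e 0) {α : ℕ →₀ ℕ} {v : V'} (hv : v ∈ wt T e' α) :
    ι v ∈ wt S e α := by
  rw [mem_wt]
  have h0 : ∀ i ∉ T, α i ≠ 0 → v = 0 := fun i hi h => wt_eq_zero hv hi h
  refine ⟨fun i hi => ?_, fun i hi h => ?_⟩
  · by_cases hiT : i ∈ T
    · exact wt_apply (hι.map_wt hv) hiT
    · rw [mem_wt_zero.mp (hr ⟨v, rfl⟩) i ⟨hi, hiT⟩]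
      by_cases h : α i = 0
      · rw [h, Nat.cast_zero, zero_smul]
      · rw [h0 i hiT h, map_zero, smul_zero]
  · rw [h0 i (fun h' => hi (hT h')) h, map_zero]

theorem mem_wt_of_inv {ι : V' →ₗ[ℂ] V} (hT : T ⊆ S) (hι : Commutes T e' e ι)
    (hinj : Function.Injective ι) (hr : LinearMap.range ι ≤ wt (S \ T) e 0) {α : ℕ →₀ ℕ} {v : V'}
    (hv : ι v ∈ wt S e α) : v ∈ wt T e' α := by
  refine hι.mem_wt_of_injective hinj ?_
  rw [mem_wt]
  refine ⟨fun i hi => wt_apply hv (hT hi), fun i hi h => ?_⟩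
  by_cases hiS : i ∈ S
  · have h1 := wt_apply hv hiS
    rw [mem_wt_zero.mp (hr ⟨v, rfl⟩) i ⟨hiS, hi⟩, eq_comm, smul_eq_zero] at h1
    exact h1.resolve_left (by exact_mod_cast h)
  · exact wt_eq_zero hv hiS h

/-- The inclusion of tensor powers for an inclusion of index sets. -/
def tensIncl (hT : T ⊆ S) (k : ℕ) : (tensPow T k).V →ₗ[ℂ] (tensPow S k).V :=
  (tensBasis T k).constr ℂ fun w => tensBasis S k fun b => Set.inclusion hT (w b)

theorem tensIncl_basis (hT : T ⊆ S) (k : ℕ) (w : Fin k → T) :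
    tensIncl hT k (tensBasis T k w) = tensBasis S k fun b => Set.inclusion hT (w b) :=
  (tensBasis T k).constr_basis ℂ _ w

theorem tensIncl_injective (hT : T ⊆ S) (k : ℕ) : Function.Injective (tensIncl hT k) := by
  have : LinearIndependent ℂ fun w : Fin k → T => tensIncl hT k (tensBasis T k w) := by
    simp only [tensIncl_basis]
    refine (tensBasis S k).linearIndependent.comp
      (fun (w : Fin k → T) b => Set.inclusion hT (w b)) fun w w' h => ?_
    funext b
    exact Set.inclusion_injective hT (congrFun h b)
  refine LinearMap.injective_of_linearIndependent (f := tensIncl hT k)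
    (v := tensBasis T k) (tensBasis T k).span_eq this

end PartialWeights

/-! ### Invariants of polynomial modules -/

section Inv

variable {V V' : Type*} [AddCommGroup V] [Module ℂ V] [AddCommGroup V'] [Module ℂ V']
  {S T : Set ℕ} {e : Ops V} {e' : Ops V'}

/-- `ι` identifies `V'` with the vectors of weight zero outside `T`. -/
structure IsInv (T S : Set ℕ) (e' : Ops V') (e : Ops V) (ι : V' →ₗ[ℂ] V) : Prop where
  commutes : Commutes T e' e ι
  injective : Function.Injective ι
  range_eq : LinearMap.range ι = wt (S \ T) e 0

theorem tensIncl_commutes (hT : T ⊆ S) (k : ℕ) :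
    Commutes T (tensPow T k).e (tensPow S k).e (tensIncl hT k) := by
  intro i hi j hj v
  suffices h : tensIncl hT k ∘ₗ (tensPow T k).e i j = (tensPow S k).e i j ∘ₗ tensIncl hT k from
    LinearMap.congr_fun h v
  refine (tensBasis T k).ext fun w => ?_
  rw [LinearMap.comp_apply, LinearMap.comp_apply, tensIncl_basis, tensPow_e_basis hi hj,
    tensPow_e_basis (hT hi) (hT hj), map_sum]
  refine Finset.sum_congr rfl fun b _ => ?_
  rw [apply_ite (tensIncl hT k), map_zero, tensIncl_basis]
  refine if_congr Iff.rfl ?_ rfl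
  congr 1
  funext c
  by_cases h : c = b
  · subst h; simp
  · simp [Function.update_of_ne h]

theorem tensIncl_mem_wt (hT : T ⊆ S) (k : ℕ) (x : (tensPow T k).V) :
    tensIncl hT k x ∈ wt (S \ T) (tensPow S k).e 0 := by
  suffices h : LinearMap.range (tensIncl hT k) ≤ wt (S \ T) (tensPow S k).e 0 from h ⟨x, rfl⟩
  rw [LinearMap.range_eq_map, ← (tensBasis T k).span_eq, Submodule.map_span_le]
  rintro _ ⟨w, rfl⟩
  rw [tensIncl_basis, mem_wt_zero]
  intro i hi
  rw [wt_apply (tensBasis_mem_wt _) hi.1, wordWt_apply, Finset.sum_eq_zero, Nat.cast_zero,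
    zero_smul]
  intro b _
  rw [if_neg]
  rintro rfl
  exact hi.2 (w b).2

/-- A word with a letter outside `T` has non-zero weight there and is projected to zero; the other
words are words in `T`. -/
theorem pr_tensBasis_zero (hT : T ⊆ S) (k : ℕ) (w : Fin k → S) :
    pr (S \ T) (tensPow S k).e {0} (tensBasis S k w) ∈ LinearMap.range (tensIncl hT k) := by
  have hw := (isWeight_tensPow S k).mono (C := S \ T) Set.sdiff_subset
  by_cases h : ∀ b, (w b : ℕ) ∈ T
  · have h1 : tensBasis S k w = tensIncl hT k (tensBasis T k fun b => ⟨w b, h b⟩) := by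
      rw [tensIncl_basis]
    rw [h1, pr_of_mem hw (Set.mem_singleton 0) (tensIncl_mem_wt hT k _)]
    exact ⟨_, rfl⟩
  · push Not at h
    obtain ⟨b, hb⟩ := h
    classical
    have hne : (wordWt w).filter (· ∈ S \ T) ∉ ({0} : Set (ℕ →₀ ℕ)) := by
      intro h0
      have h1 := DFunLike.congr_fun (Set.mem_singleton_iff.mp h0) (w b : ℕ)
      rw [Finsupp.filter_apply_pos _ _ ⟨(w b).2, hb⟩, wordWt_apply, Finsupp.zero_apply,
        Finset.sum_eq_zero_iff] at h1
      simpa using h1 b (Finset.mem_univ b)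
    have hm := wt_le_of_subset (C := S \ T) Set.sdiff_subset _ (tensBasis_mem_wt w)
    rw [pr_of_notMem hw hne (by convert hm)]
    exact Submodule.zero_mem _

theorem IsInv.exists_restrict (hT : T ⊆ S) {ι : V' →ₗ[ℂ] V} (hι : IsInv T S e' e ι) {k : ℕ}
    {f : (tensPow S k).V →ₗ[ℂ] V} (hf : Commutes S (tensPow S k).e e f) :
    ∃ f' : (tensPow T k).V →ₗ[ℂ] V', Commutes T (tensPow T k).e e' f' ∧
      ι ∘ₗ f' = f ∘ₗ tensIncl hT k := by
  have hr : ∀ x, (f ∘ₗ tensIncl hT k) x ∈ LinearMap.range ι := fun x => by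
    rw [hι.range_eq]
    exact (hf.mono Set.sdiff_subset).map_wt (tensIncl_mem_wt hT k x)
  let q := LinearEquiv.ofInjective ι hι.injective
  have hq : ∀ x, ι (q.symm ⟨_, hr x⟩) = f (tensIncl hT k x) := fun x =>
    congrArg Subtype.val (q.apply_symm_apply ⟨_, hr x⟩)
  refine ⟨q.symm.toLinearMap ∘ₗ (f ∘ₗ tensIncl hT k).codRestrict _ hr, ?_,
    LinearMap.ext fun x => hq x⟩
  intro i hi j hj x
  apply hι.injective
  rw [hι.commutes i hi j hj]
  refine (hq _).trans ?_
  rw [tensIncl_commutes hT k i hi j hj, hf i (hT hi) j (hT hj)]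
  exact congrArg (e i j) (hq x).symm

/-- The projection to weight zero commutes with `f` and sends words to words in `T` or to zero. So
the invariants of the image of a tensor power are the image of the smaller tensor power, and `IndP`
and `FinP` pass to invariants. -/
theorem pr_zero_mem_map (hT : T ⊆ S) {ι : V' →ₗ[ℂ] V} (h : IsWeight (S \ T) e) {W : Submodule ℂ V'} {k : ℕ} {f : (tensPow S k).V →ₗ[ℂ] V}
    (hf : Commutes S (tensPow S k).e e f) {f' : (tensPow T k).V →ₗ[ℂ] V'}
    (hf' : ι ∘ₗ f' = f ∘ₗ tensIncl hT k) (hW : LinearMap.range f' ≤ W) (x : (tensPow S k).V) :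
    pr (S \ T) e {0} (f x) ∈ W.map ι := by
  have hw := (isWeight_tensPow S k).mono (C := S \ T) Set.sdiff_subset
  suffices h' : ⊤ ≤ (W.map ι).comap (pr (S \ T) e {0} ∘ₗ f) from h' (x := x) trivial
  rw [← (tensBasis S k).span_eq, Submodule.span_le]
  rintro _ ⟨w, rfl⟩
  change pr (S \ T) e {0} (f (tensBasis S k w)) ∈ W.map ι
  rw [← (hf.mono Set.sdiff_subset).pr hw h]
  obtain ⟨y, hy⟩ := pr_tensBasis_zero hT k w
  rw [← hy]
  exact ⟨f' y, hW ⟨y, rfl⟩, LinearMap.congr_fun hf' y⟩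

theorem IsInv.pr_apply {ι : V' →ₗ[ℂ] V} (hι : IsInv T S e' e ι) (h : IsWeight (S \ T) e) (v : V') :
    pr (S \ T) e {0} (ι v) = ι v :=
  pr_of_mem h (Set.mem_singleton 0) (hι.range_eq ▸ ⟨v, rfl⟩)

theorem IndP.inv (hT : T ⊆ S) {ι : V' →ₗ[ℂ] V} (hι : IsInv T S e' e ι) (h : IndP S e) :
    IndP T e' := by
  have hw := h.isWeight.mono (C := S \ T) Set.sdiff_subset
  have key : ⊤ ≤ ((Submodule.span ℂ (polyVecs T e')).map ι).comap (pr (S \ T) e {0}) := by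
    rw [← h, Submodule.span_le]
    rintro _ ⟨k, f, x, hf, rfl⟩
    obtain ⟨f', hf', hff'⟩ := hι.exists_restrict hT hf
    refine pr_zero_mem_map hT hw hf hff' ?_ x
    rintro _ ⟨y, rfl⟩
    exact Submodule.subset_span ⟨k, f', y, hf', rfl⟩
  unfold IndP
  rw [eq_top_iff]
  rintro v -
  obtain ⟨v', hv', hvv⟩ := key (x := ι v) trivial
  rw [hι.pr_apply hw] at hvv
  exact hι.injective hvv ▸ hv'

theorem FinP.inv (hT : T ⊆ S) {ι : V' →ₗ[ℂ] V} (hι : IsInv T S e' e ι) (h : FinP S e) :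
    FinP T e' := by
  have hw := h.indP.isWeight.mono (C := S \ T) Set.sdiff_subset
  obtain ⟨r, d, f, hf, htop⟩ := h
  choose f' hf' hff' using fun j => hι.exists_restrict hT (hf j)
  refine ⟨r, d, f', hf', ?_⟩
  have key : ⊤ ≤ ((⨆ j, LinearMap.range (f' j)).map ι).comap (pr (S \ T) e {0}) := by
    rw [← htop]
    refine iSup_le fun j => ?_
    rintro _ ⟨x, rfl⟩
    exact pr_zero_mem_map hT hw (hf j) (hff' j) (le_iSup (fun j => LinearMap.range (f' j)) j) x
  rw [eq_top_iff]
  rintro v -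
  obtain ⟨v', hv', hvv⟩ := key (x := ι v) trivial
  rw [hι.pr_apply hw] at hvv
  exact hι.injective hvv ▸ hv'

/-- A weight vector in a sum of images of tensor powers is a combination of images of words of the
same weight. -/
theorem IndP.mem_span_words (h : IndP S e) {α : ℕ →₀ ℕ} {v : V} (hv : v ∈ wt S e α) :
    v ∈ Submodule.span ℂ {v | ∃ (f : (tensPow S (deg α)).V →ₗ[ℂ] V) (w : Fin (deg α) → S),
      Commutes S (tensPow S (deg α)).e e f ∧ wordWt w = α ∧ f (tensBasis S (deg α) w) = v} := by
  let I := Σ k : ℕ, {f : (tensPow S k).V →ₗ[ℂ] V // Commutes S (tensPow S k).e e f} × (Fin k → S)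
  let g : I → V := fun i => i.2.1.1 (tensBasis S i.1 i.2.2)
  have hg : ∀ i, g i ∈ wt S e (wordWt i.2.2) := fun i => i.2.1.2.map_wt (tensBasis_mem_wt _)
  have hspan : Submodule.span ℂ (Set.range g) = ⊤ := by
    rw [eq_top_iff, ← h, Submodule.span_le]
    rintro _ ⟨k, f, x, hf, rfl⟩
    suffices h' : ⊤ ≤ (Submodule.span ℂ (Set.range g)).comap f from h' (x := x) trivial
    rw [← (tensBasis S k).span_eq, Submodule.span_le]
    rintro _ ⟨w, rfl⟩
    exact Submodule.subset_span ⟨⟨k, ⟨f, hf⟩, w⟩, rfl⟩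
  have h1 := mem_span_wt h.isWeight hg DiagStable.bot hv
    (by rw [hspan, sup_top_eq]; trivial)
  rw [bot_sup_eq] at h1
  refine Submodule.span_mono ?_ h1
  rintro _ ⟨⟨k, f, w⟩, hi, rfl⟩
  have hi : wordWt w = α := hi
  obtain rfl : deg α = k := by rw [← hi, deg_wordWt]
  exact ⟨f.1, w, f.2, hi, rfl⟩

end Inv

/-! ### The category `O` in terms of matrix units -/

section IsO

variable {V V' : Type*} [AddCommGroup V] [Module ℂ V] [AddCommGroup V'] [Module ℂ V']
  {ν : ℂ} {N n : ℕ∞} {e : Ops V} {e' : Ops V'}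

theorem idxU_subset (N : ℕ∞) : idxU N ⊆ idx N := fun _ h => h.2

theorem zero_notMem_idxU (N : ℕ∞) : 0 ∉ idxU N := fun h => lt_irrefl 0 h.1

theorem mem_idxU {i : ℕ} (hi : i ∈ idx N) (h0 : i ≠ 0) : i ∈ idxU N := ⟨Nat.pos_of_ne_zero h0, hi⟩

theorem ne_zero_of_mem_idxU {i : ℕ} (hi : i ∈ idxU N) : i ≠ 0 := fun h =>
  zero_notMem_idxU N (h ▸ hi)

theorem zero_mem_idx_diff (h0 : 0 ∈ idx N) : 0 ∈ idx N \ idxU N := ⟨h0, zero_notMem_idxU N⟩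

/-- Integrability for `𝔤𝔩(U_N)` and homogeneity of degree `ν`. -/
structure IsGraded (ν : ℂ) (N : ℕ∞) (e : Ops V) : Prop where
  sys : IsSys (idx N) e
  ind : IndP (idxU N) e
  degr : ∀ α, ∀ v ∈ wt (idxU N) e α, e 0 0 v = (ν - deg α) • v

/-- The conditions defining the category `O`, for a system of matrix units: weights and degrees
replace the direct sum decomposition, and finite generation is over the `e i 0`. -/
structure IsO (ν : ℂ) (N : ℕ∞) (e : Ops V) : Prop extends IsGraded ν N e where
  gen : ∃ K : ℕ, ∀ W : Submodule ℂ V, (∀ i ∈ idxU N, ∀ v ∈ W, e i 0 v ∈ W) →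
    (∀ α, deg α ≤ K → wt (idxU N) e α ≤ W) → W = ⊤
  fin : ∀ α, FiniteDimensional ℂ (wt (idxU N) e α)

theorem IsGraded.isWeight (h : IsGraded ν N e) : IsWeight (idxU N) e := h.ind.isWeight

theorem IsGraded.sysU (h : IsGraded ν N e) : IsSys (idxU N) e := h.sys.mono (idxU_subset N)

/-- The operators `e 0 j` lower the degree. -/
theorem IsGraded.map_zero_left (h : IsGraded ν N e) (h0 : 0 ∈ idx N) {j : ℕ} (hj : j ∈ idxU N)
    {α : ℕ →₀ ℕ} {v : V} (hv : v ∈ wt (idxU N) e α) :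
    e 0 j v = 0 ∨ ∃ β, β + Finsupp.single j 1 = α ∧ e 0 j v ∈ wt (idxU N) e β := by
  by_cases hα : α j = 0
  · left
    refine map_eq_zero_of_diag h.sys h.isWeight h0 hj.2 hj (ne_zero_of_mem_idxU hj).symm ?_
    rw [wt_apply hv hj, hα, Nat.cast_zero, zero_smul]
  · right
    have hβ : (α - Finsupp.single j 1) + Finsupp.single j 1 = α :=
      tsub_add_cancel_of_le (Finsupp.single_le_iff.mpr (Nat.one_le_iff_ne_zero.mpr hα))
    exact ⟨_, hβ, map_wt_lower h.sys (idxU_subset N) (zero_mem_idx_diff h0) hj (hβ.symm ▸ hv)⟩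

theorem exists_map_wt_deg {S : Set ℕ} (hs : IsSys S e) (h : IsWeight S e) {i j : ℕ} (hi : i ∈ S)
    (hj : j ∈ S) {α : ℕ →₀ ℕ} {v : V} (hv : v ∈ wt S e α) :
    ∃ β, deg β = deg α ∧ e i j v ∈ wt S e β := by
  by_cases hij : i = j
  · subst hij
    exact ⟨α, rfl, wt_apply hv hi ▸ Submodule.smul_mem _ _ hv⟩
  by_cases hα : α j = 0
  · refine ⟨α, rfl, ?_⟩
    rw [map_eq_zero_of_diag hs h hi hj hj hij]
    · exact Submodule.zero_mem _
    · rw [wt_apply hv hj, hα, Nat.cast_zero, zero_smul]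
  · have hβ : (α - Finsupp.single j 1) + Finsupp.single j 1 = α :=
      tsub_add_cancel_of_le (Finsupp.single_le_iff.mpr (Nat.one_le_iff_ne_zero.mpr hα))
    refine ⟨α - Finsupp.single j 1 + Finsupp.single i 1, ?_, map_wt hs hi hj ?_ hv⟩
    · conv_rhs => rw [← hβ]
      rw [deg_add, deg_add, deg_single, deg_single]
    · conv_lhs => rw [← hβ]
      rw [add_right_comm]

/-- The operators other than the `e i 0` do not raise the degree. -/
theorem IsGraded.exists_map_wt (h : IsGraded ν N e) (h0 : 0 ∈ idx N) {i j : ℕ} (hi : i ∈ idx N)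
    (hj : j ∈ idx N) (hij : j ≠ 0 ∨ i = 0) {α : ℕ →₀ ℕ} {v : V} (hv : v ∈ wt (idxU N) e α) :
    ∃ β, deg β ≤ deg α ∧ e i j v ∈ wt (idxU N) e β := by
  by_cases hj0 : j = 0
  · subst hj0
    obtain rfl : i = 0 := hij.resolve_left (fun h => h rfl)
    exact ⟨α, le_rfl, h.degr α v hv ▸ Submodule.smul_mem _ _ hv⟩
  have hj' := mem_idxU hj hj0
  by_cases hi0 : i = 0
  · subst hi0
    rcases h.map_zero_left h0 hj' hv with h1 | ⟨β, hβ, h1⟩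
    · exact ⟨α, le_rfl, h1 ▸ Submodule.zero_mem _⟩
    · exact ⟨β, by rw [← hβ, deg_add]; exact Nat.le_add_right _ _, h1⟩
  obtain ⟨β, hβ, hm⟩ := exists_map_wt_deg h.sysU h.isWeight (mem_idxU hi hi0) hj' hv
  exact ⟨β, hβ.le, hm⟩

theorem idx_diff (hn : 0 ∈ idx n) : idx N \ idx n = idxU N \ idxU n := by
  ext i
  constructor
  · rintro ⟨h1, h2⟩
    have : i ≠ 0 := fun h => h2 (h ▸ hn)
    exact ⟨mem_idxU h1 this, fun h => h2 h.2⟩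
  · rintro ⟨h1, h2⟩
    exact ⟨h1.2, fun h => h2 (mem_idxU h (ne_zero_of_mem_idxU h1))⟩

theorem idx_mono (h : n ≤ N) : idx n ⊆ idx N := fun _ hi => lt_of_lt_of_le hi h

theorem idxU_mono (h : n ≤ N) : idxU n ⊆ idxU N := fun _ hi => ⟨hi.1, lt_of_lt_of_le hi.2 h⟩

theorem IsInv.toU (hn : 0 ∈ idx n) {ι : V' →ₗ[ℂ] V} (hι : IsInv (idx n) (idx N) e' e ι) :
    IsInv (idxU n) (idxU N) e' e ι :=
  ⟨hι.commutes.mono (idxU_subset n), hι.injective, idx_diff (N := N) hn ▸ hι.range_eq⟩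

/-- The invariants of a module in the category `O`. -/
theorem IsO.inv (h : IsO ν N e) (hn : 0 ∈ idx n) (hnN : n ≤ N) {ι : V' →ₗ[ℂ] V}
    (hι : IsInv (idx n) (idx N) e' e ι) : IsO ν n e' := by
  have hU := hι.toU hn
  have hT := idxU_mono hnN
  have hwt : ∀ {α : ℕ →₀ ℕ} {v : V'}, v ∈ wt (idxU n) e' α → ι v ∈ wt (idxU N) e α :=
    fun hv => map_wt_inv hT hU.commutes hU.range_eq.le hv
  have hw := h.isWeight.mono (C := idxU N \ idxU n) Set.sdiff_subset
  have hC : idxU N \ idxU n ⊆ idx N := Set.sdiff_subset.trans (idxU_subset N)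
  have hmem : ∀ {i : ℕ}, i ∈ idx n → i ∈ idx N \ (idxU N \ idxU n) := fun {i} hi =>
    ⟨idx_mono hnN hi, fun h => h.2 (mem_idxU hi (ne_zero_of_mem_idxU h.1))⟩
  refine ⟨⟨fun i hi j hj k hk l hl v => hι.injective ?_, h.ind.inv hT hU, fun α v hv => ?_⟩, ?_,
    fun α => ?_⟩
  · have hc := hι.commutes
    rw [hc i hi j hj, hc k hk l hl, map_sub, map_add, hc k hk l hl, hc i hi j hj,
      apply_ite ι, apply_ite ι, map_zero, hc i hi l hl, hc k hk j hj]
    exact h.sys i (idx_mono hnN hi) j (idx_mono hnN hj) k (idx_mono hnN hk) l (idx_mono hnN hl) _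
  · apply hι.injective
    rw [hι.commutes 0 hn 0 hn, h.degr α _ (hwt hv), map_smul]
  · obtain ⟨K, hK⟩ := h.gen
    refine ⟨K, fun W hW hWK => ?_⟩
    -- Generation is transported along the weight projection: it commutes with `e i 0` for indices
    -- `i` of the smaller algebra and kills the image of `e i 0` for the others.
    have h1 := hK ((W.map ι).comap (pr (idxU N \ idxU n) e {0})) ?_ ?_
    · rw [eq_top_iff]
      rintro v -
      have h2 : ι v ∈ (W.map ι).comap (pr (idxU N \ idxU n) e {0}) := by rw [h1]; trivial
      obtain ⟨v', hv', hvv⟩ := h2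
      rw [hU.pr_apply hw] at hvv
      exact hι.injective hvv ▸ hv'
    · intro i hi v hv
      change pr _ e {0} (e i 0 v) ∈ W.map ι
      by_cases hin : i ∈ idxU n
      · rw [pr_map_same h.sys hw hC (hmem hin.2) (hmem hn)]
        obtain ⟨v', hv', hvv⟩ := hv
        exact ⟨e' i 0 v', hW i hin v' hv', by rw [hι.commutes i hin.2 0 hn, hvv]⟩
      · rw [pr_zero_map h.sys hw hC ⟨hi, hin⟩ (idx_mono hnN hn) (ne_zero_of_mem_idxU hi)]
        exact Submodule.zero_mem _
    · intro α hα v hv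
      change pr _ e {0} v ∈ W.map ι
      have h2 : pr (idxU N \ idxU n) e {0} v ∈ LinearMap.range ι := by
        rw [hU.range_eq]; exact pr_zero_mem hw v
      obtain ⟨v', hv'⟩ := h2
      refine ⟨v', hWK α hα (mem_wt_of_inv hT hU.commutes hU.injective hU.range_eq.le ?_), hv'⟩
      rw [hv', mem_wt]
      refine ⟨fun i hi => ?_, fun i hi h => ?_⟩
      · have hc : pr (idxU N \ idxU n) e {0} (e i i v) = e i i (pr (idxU N \ idxU n) e {0} v) := by
          by_cases hin : i ∈ idxU n
          · exact pr_map_same h.sys hw hC (hmem hin.2) (hmem hin.2) _ _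
          · exact pr_diag hw _ ⟨hi, hin⟩ _
        rw [← hc, wt_apply hv hi, map_smul]
      · rw [wt_eq_zero hv hi h, map_zero]
  · have := h.fin α
    exact Module.Finite.of_injective
      ((ι.comp (wt (idxU n) e' α).subtype).codRestrict (wt (idxU N) e α) fun v => hwt v.2)
      fun a b hab => Subtype.ext (hι.injective (congrArg Subtype.val hab))

/-- Quotients of modules in the category `O`. -/
theorem IsO.of_surjective (h : IsO ν N e) {q : V →ₗ[ℂ] V'} (hq : Commutes (idx N) e e' q)
    (hsurj : Function.Surjective q) (h0 : 0 ∈ idx N) : IsO ν N e' := by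
  have hqU := hq.mono (idxU_subset N)
  have ind' : IndP (idxU N) e' := h.ind.of_surjective hqU hsurj
  refine ⟨⟨fun i hi j hj k hk l hl v => ?_, ind', fun α v hv => ?_⟩, ?_, fun α => ?_⟩
  · obtain ⟨v, rfl⟩ := hsurj v
    rw [← hq k hk l hl, ← hq i hi j hj, ← hq i hi j hj, ← hq k hk l hl, ← hq i hi l hl,
      ← hq k hk j hj, h.sys i hi j hj k hk l hl, map_sub, map_add, apply_ite q, apply_ite q,
      map_zero]
  · obtain ⟨w, hw, rfl⟩ := exists_wt_lift h.isWeight ind'.isWeight hqU hsurj hv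
    rw [← hq 0 h0 0 h0, h.degr α w hw, map_smul]
  · obtain ⟨K, hK⟩ := h.gen
    refine ⟨K, fun W hW hWK => ?_⟩
    have h1 := hK (W.comap q) (fun i hi v hv => ?_) (fun α hα v hv => hWK α hα (hqU.map_wt hv))
    · rw [eq_top_iff]
      rintro v -
      obtain ⟨v, rfl⟩ := hsurj v
      have : v ∈ W.comap q := by rw [h1]; trivial
      exact this
    · change q (e i 0 v) ∈ W
      rw [hq i hi.2 0 h0]
      exact hW i hi _ hv
  · have := h.fin α
    refine Module.Finite.of_surjective
      ((q.comp (wt (idxU N) e α).subtype).codRestrict (wt (idxU N) e' α) fun v => hqU.map_wt v.2)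
      fun v => ?_
    obtain ⟨w, hw, hwv⟩ := exists_wt_lift h.isWeight ind'.isWeight hqU hsurj v.2
    exact ⟨⟨w, hw⟩, Subtype.ext hwv⟩

end IsO

/-! ### A finiteness property of submodules -/

section Linear

variable {V : Type*} [AddCommGroup V] [Module ℂ V]

/-- If `T` acts modulo `Z` by a multiple of the identity minus a sum of few permutations, then it is
injective modulo `Z`. -/
theorem mem_of_sub_sum_perm {I K : Type*} [Fintype I] [Fintype K] {Z : Submodule ℂ V}
    {T : Module.End ℂ V} (hT : ∀ z ∈ Z, T z ∈ Z) {g : I → V} {c : ℂ}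
    (hc : (Fintype.card K : ℝ) < ‖c‖) (σ : K → Equiv.Perm I)
    (hg : ∀ x, T (g x) - (c • g x - ∑ k, g (σ k x)) ∈ Z) {v : V}
    (hv : v ∈ Z ⊔ Submodule.span ℂ (Set.range g)) (hTv : T v ∈ Z) : v ∈ Z := by
  let Φ : (I → ℂ) →ₗ[ℂ] V := Fintype.linearCombination ℂ g
  have hΦ : ∀ ξ, Φ ξ = ∑ x, ξ x • g x := fun ξ => Fintype.linearCombination_apply ℂ g ξ
  -- The matrix that describes `T` modulo `Z` on the spanning family `g`, which need not be linearly
  -- independent.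
  let A : (I → ℂ) →ₗ[ℂ] (I → ℂ) := c • LinearMap.id - ∑ k, LinearMap.funLeft ℂ ℂ (σ k).symm
  have hA : ∀ ξ x, A ξ x = c * ξ x - ∑ k, ξ ((σ k).symm x) := fun ξ x => by
    simp [A, LinearMap.funLeft_apply, Finset.sum_apply]
  have hinj : Function.Injective A := by
    rw [← LinearMap.ker_eq_bot, LinearMap.ker_eq_bot']
    intro ξ hξ
    by_contra hne
    have : Nonempty I := by
      by_contra h
      rw [not_nonempty_iff] at h
      exact hne (Subsingleton.elim _ _)
    -- Diagonal dominance: at a coordinate of largest norm, `c * ξ x₀` is a sum of `card K`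
    -- coordinates, which is impossible for `ξ ≠ 0` when `‖c‖` exceeds `card K`.
    obtain ⟨x₀, hx₀⟩ := Finite.exists_max fun x => ‖ξ x‖
    have h1 : c * ξ x₀ = ∑ k, ξ ((σ k).symm x₀) := by
      have := congrFun hξ x₀
      rw [hA, Pi.zero_apply, sub_eq_zero] at this
      exact this
    have h2 : ‖c‖ * ‖ξ x₀‖ ≤ Fintype.card K * ‖ξ x₀‖ := by
      rw [← norm_mul, h1]
      refine (norm_sum_le _ _).trans ((Finset.sum_le_sum fun k _ => hx₀ _).trans ?_)
      rw [Finset.sum_const, Finset.card_univ, nsmul_eq_mul]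
    have h3 : ‖ξ x₀‖ ≤ 0 := by nlinarith [norm_nonneg (ξ x₀)]
    exact hne (funext fun x => norm_le_zero_iff.mp ((hx₀ x).trans h3))
  have hTΦ : ∀ ξ, T (Φ ξ) - Φ (A ξ) ∈ Z := by
    intro ξ
    have : T (Φ ξ) - Φ (A ξ) = ∑ x, ξ x • (T (g x) - (c • g x - ∑ k, g (σ k x))) := by
      have h1 : ∑ x, ∑ k, ξ ((σ k).symm x) • g x = ∑ x, ∑ k, ξ x • g (σ k x) := by
        rw [Finset.sum_comm, Finset.sum_comm (s := Finset.univ) (t := Finset.univ)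
          (f := fun x k => ξ x • g (σ k x))]
        refine Finset.sum_congr rfl fun k _ => ?_
        rw [← Equiv.sum_comp (σ k)]
        simp
      simp only [hΦ, hA, map_sum, map_smul, smul_sub, Finset.sum_sub_distrib, sub_smul,
        Finset.sum_smul, Finset.smul_sum, h1, mul_smul]
      simp only [smul_comm c]
    rw [this]
    exact Submodule.sum_mem _ fun x _ => Z.smul_mem _ (hg x)
  obtain ⟨z, hz, y, hy, rfl⟩ := Submodule.mem_sup.mp hv
  obtain ⟨ξ, rfl⟩ : ∃ ξ, Φ ξ = y := by
    rw [← Fintype.range_linearCombination ℂ] at hy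
    exact hy
  -- The relations modulo `Z`. The injective map `A` preserves this finite-dimensional space, hence
  -- is onto it, so `A ξ ∈ R` implies `ξ ∈ R`.
  let R := Z.comap Φ
  have hAR : ∀ ξ ∈ R, A ξ ∈ R := fun η hη => by
    have h := Z.sub_mem (hT _ hη) (hTΦ η)
    rwa [sub_sub_cancel] at h
  have hAξ : A ξ ∈ R := by
    have h1 : T (Φ ξ) ∈ Z := by
      have := Z.sub_mem hTv (hT z hz)
      rwa [map_add, add_sub_cancel_left] at this
    have h := Z.sub_mem h1 (hTΦ ξ)
    rwa [sub_sub_cancel] at h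
  have hs : Function.Surjective (A.restrict hAR) :=
    LinearMap.injective_iff_surjective.mp fun a b hab =>
      Subtype.ext (hinj (congrArg Subtype.val hab))
  obtain ⟨η, hη⟩ := hs ⟨A ξ, hAξ⟩
  have : (η : I → ℂ) = ξ := hinj (congrArg Subtype.val hη)
  exact Z.add_mem hz (this ▸ η.2)

/-- An endomorphism of a finite-dimensional space that is injective modulo a stable subspace is
surjective modulo this subspace. -/
theorem le_map_sup_of_injective {X Z : Submodule ℂ V} [FiniteDimensional ℂ X] {T : Module.End ℂ V}
    (hX : ∀ x ∈ X, T x ∈ X) (hZ : ∀ x ∈ Z, T x ∈ Z) (h : ∀ x ∈ X, T x ∈ Z → x ∈ Z) :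
    X ≤ X.map T ⊔ X ⊓ Z := by
  let Z' := Z.comap X.subtype
  let T' : X →ₗ[ℂ] X := T.restrict hX
  let Q : (X ⧸ Z') →ₗ[ℂ] (X ⧸ Z') := Z'.mapQ Z' T' fun x hx => hZ x hx
  have hQ : ∀ x, Q (Submodule.Quotient.mk x) = Submodule.Quotient.mk (T' x) := fun _ => rfl
  have hinj : Function.Injective Q := by
    rw [← LinearMap.ker_eq_bot, LinearMap.ker_eq_bot']
    intro q hq
    obtain ⟨x, rfl⟩ := Submodule.mkQ_surjective _ q
    rw [Submodule.mkQ_apply] at hq ⊢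
    rw [hQ, Submodule.Quotient.mk_eq_zero] at hq
    rw [Submodule.Quotient.mk_eq_zero]
    exact h x x.2 hq
  have hsurj := LinearMap.injective_iff_surjective.mp hinj
  intro x hx
  obtain ⟨q, hq⟩ := hsurj (Z'.mkQ ⟨x, hx⟩)
  obtain ⟨y, rfl⟩ := Submodule.mkQ_surjective _ q
  rw [Submodule.mkQ_apply, Submodule.mkQ_apply, hQ, Submodule.Quotient.eq] at hq
  have h1 : T y - x ∈ X ⊓ Z := ⟨X.sub_mem (hX _ y.2) hx, hq⟩
  rw [← sub_sub_self (T y) x]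
  exact Submodule.sub_mem _ (Submodule.mem_sup_left ⟨y, y.2, rfl⟩) (Submodule.mem_sup_right h1)

end Linear

/-! ### Submodules generated over the operators `e i 0` -/

section Lower

variable {V : Type*} [AddCommGroup V] [Module ℂ V] {ν : ℂ} {N : ℕ∞} {e : Ops V}

/-- The smallest subspace containing `Y` and stable under the operators `e i 0` with `i ∈ U`. -/
def lowerGen (U : Set ℕ) (e : Ops V) (Y : Submodule ℂ V) : Submodule ℂ V :=
  sInf {W | Y ≤ W ∧ ∀ i ∈ U, ∀ v ∈ W, e i 0 v ∈ W}

theorem le_lowerGen (U : Set ℕ) (e : Ops V) (Y : Submodule ℂ V) : Y ≤ lowerGen U e Y :=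
  le_sInf fun _ h => h.1

theorem lowerGen_map {U : Set ℕ} {Y : Submodule ℂ V} {i : ℕ} (hi : i ∈ U) {v : V}
    (hv : v ∈ lowerGen U e Y) : e i 0 v ∈ lowerGen U e Y := by
  rw [lowerGen, Submodule.mem_sInf] at hv ⊢
  exact fun W hW => hW.2 i hi v (hv W hW)

theorem lowerGen_le {U : Set ℕ} {Y W : Submodule ℂ V} (h : Y ≤ W)
    (hW : ∀ i ∈ U, ∀ v ∈ W, e i 0 v ∈ W) : lowerGen U e Y ≤ W := sInf_le ⟨h, hW⟩

/-- The Poincaré–Birkhoff–Witt decomposition of 𝔤𝔩 into 𝔲⁻ and the parabolic subalgebra: the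
𝔲⁻-submodule generated by a space stable under the parabolic is stable under everything. All units
of the parabolic are treated at once, because their commutators with `e k 0` mix them. -/
theorem stable_lowerGen (hs : IsSys (idx N) e) (h0 : 0 ∈ idx N) {Y : Submodule ℂ V}
    (hY : ∀ i ∈ idx N, ∀ j ∈ idx N, (j ≠ 0 ∨ i = 0) → ∀ v ∈ Y, e i j v ∈ Y) :
    Stable (idx N) e (lowerGen (idxU N) e Y) := by
  let W : Submodule ℂ V :=
    { carrier := {v | v ∈ lowerGen (idxU N) e Y ∧ ∀ i ∈ idx N, ∀ j ∈ idx N, (j ≠ 0 ∨ i = 0) →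
        e i j v ∈ lowerGen (idxU N) e Y}
      add_mem' := fun ha hb => ⟨Submodule.add_mem _ ha.1 hb.1, fun i hi j hj h => by
        rw [map_add]; exact Submodule.add_mem _ (ha.2 i hi j hj h) (hb.2 i hi j hj h)⟩
      zero_mem' := ⟨Submodule.zero_mem _, fun i _ j _ _ => by
        rw [map_zero]; exact Submodule.zero_mem _⟩
      smul_mem' := fun c v hv => ⟨Submodule.smul_mem _ c hv.1, fun i hi j hj h => by
        rw [map_smul]; exact Submodule.smul_mem _ c (hv.2 i hi j hj h)⟩ }
  have hle : lowerGen (idxU N) e Y ≤ W := by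
    refine lowerGen_le (fun v hv => ⟨le_lowerGen _ _ _ hv, fun i hi j hj h =>
      le_lowerGen _ _ _ (hY i hi j hj h v hv)⟩) ?_
    rintro k hk v ⟨hv, hv'⟩
    refine ⟨lowerGen_map hk hv, fun i hi j hj h => ?_⟩
    rw [hs i hi j hj k hk.2 0 h0]
    refine Submodule.sub_mem _ (Submodule.add_mem _ (lowerGen_map hk (hv' i hi j hj h)) ?_) ?_
    · split_ifs with hjk
      · by_cases hi0 : i = 0
        · exact hv' i hi 0 h0 (Or.inr hi0)
        · exact lowerGen_map (mem_idxU hi hi0) hv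
      · exact Submodule.zero_mem _
    · split_ifs with hi0
      · by_cases hj0 : j = 0
        · subst hj0
          exact lowerGen_map hk hv
        · exact hv' k hk.2 j hj (Or.inl hj0)
      · exact Submodule.zero_mem _
  intro i hi j hj v hv
  by_cases h : j ≠ 0 ∨ i = 0
  · exact (hle hv).2 i hi j hj h
  · push Not at h
    rw [h.1]
    exact lowerGen_map (mem_idxU hi h.2) hv

/-- The part of `W` of degree less than `d`. -/
def lowPart (N : ℕ∞) (e : Ops V) (W : Submodule ℂ V) (d : ℕ) : Submodule ℂ V :=
  ⨆ (α : ℕ →₀ ℕ) (_ : deg α < d), W ⊓ wt (idxU N) e α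

theorem mem_lowPart {W : Submodule ℂ V} {d : ℕ} {α : ℕ →₀ ℕ} (hα : deg α < d) {v : V} (hv : v ∈ W)
    (hvα : v ∈ wt (idxU N) e α) : v ∈ lowPart N e W d :=
  Submodule.mem_iSup_of_mem α (Submodule.mem_iSup_of_mem hα ⟨hv, hvα⟩)

/-- Only the units `e i 0` with `i ≠ 0` raise the degree, so the low degree part of a stable
subspace is stable under the parabolic subalgebra. -/
theorem IsGraded.stable_lowerGen (h : IsGraded ν N e) (h0 : 0 ∈ idx N) {W : Submodule ℂ V}
    (hW : Stable (idx N) e W) (d : ℕ) :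
    Stable (idx N) e (lowerGen (idxU N) e (lowPart N e W d)) := by
  refine ParabolicO.stable_lowerGen h.sys h0 fun i hi j hj hij => ?_
  suffices hle : lowPart N e W d ≤ (lowPart N e W d).comap (e i j) from fun v hv => hle hv
  refine iSup₂_le fun α hα v hv => ?_
  obtain ⟨β, hβ, hm⟩ := h.exists_map_wt h0 hi hj hij hv.2
  exact mem_lowPart (hβ.trans_lt hα) (hW i hi j hj v hv.1) hm

end Lower

/-! ### Monomials in the lowering operators -/

section Monomials

variable {V : Type*} [AddCommGroup V] [Module ℂ V] {S U : Set ℕ} {e : Ops V} {d : ℕ}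

/-- The monomial `e (a 0) 0 ⋯ e (a (m-1)) 0` applied to `g w`. -/
def mon (e : Ops V) (g : (Fin d → ℕ) → V) : (m : ℕ) → (Fin m → ℕ) → (Fin d → ℕ) → V
  | 0, _, w => g w
  | m + 1, a, w => e (a 0) 0 (mon e g m (Fin.tail a) w)

theorem mon_succ (g : (Fin d → ℕ) → V) (m : ℕ) (a : Fin (m + 1) → ℕ) (w : Fin d → ℕ) :
    mon e g (m + 1) a w = e (a 0) 0 (mon e g m (Fin.tail a) w) := rfl

theorem lower_comm (hs : IsSys S e) (h0 : 0 ∈ S) {k l : ℕ} (hk : k ∈ S) (hl : l ∈ S) (hk0 : k ≠ 0)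
    (hl0 : l ≠ 0) (v : V) : e k 0 (e l 0 v) = e l 0 (e k 0 v) := by
  rw [hs k hk 0 h0 l hl 0 h0, if_neg (Ne.symm hl0), if_neg (Ne.symm hk0), add_zero, sub_zero]

/-- The operators `e i 0` commute with each other, so a letter inside a monomial can be exchanged
with one in front of it. -/
theorem mon_swap (hs : IsSys S e) (h0 : 0 ∈ S) {g : (Fin d → ℕ) → V} {w : Fin d → ℕ} {x : ℕ}
    (hx : x ∈ S) (hx0 : x ≠ 0) : ∀ (m : ℕ) (a : Fin m → ℕ), (∀ q, a q ∈ S ∧ a q ≠ 0) → ∀ q,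
      e (a q) 0 (mon e g m (Function.update a q x) w) = e x 0 (mon e g m a w) := by
  intro m
  induction m with
  | zero => exact fun a _ q => q.elim0
  | succ m ih =>
    intro a ha q
    induction q using Fin.cases with
    | zero =>
      rw [mon_succ, mon_succ, Function.update_self, Fin.tail_update_zero,
        lower_comm hs h0 (ha 0).1 hx (ha 0).2 hx0]
    | succ q =>
      rw [mon_succ, mon_succ, Fin.tail_update_succ, Function.update_of_ne (Fin.succ_ne_zero q).symm,
        lower_comm hs h0 (ha _).1 (ha 0).1 (ha _).2 (ha 0).2]
      have := ih (Fin.tail a) (fun q => ha q.succ) q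
      rw [Fin.tail] at this
      rw [this, lower_comm hs h0 hx (ha 0).1 hx0 (ha 0).2]

/-- The letters of a word transform like basis vectors of the tautological module. -/
def IsWordMap (U : Set ℕ) (e : Ops V) (g : (Fin d → ℕ) → V) : Prop :=
  ∀ i ∈ U, ∀ j ∈ U, ∀ w, (∀ b, w b ∈ U) →
    e i j (g w) = ∑ b, if w b = j then g (Function.update w b i) else 0

theorem update_mem {m : ℕ} {U : Set ℕ} {a : Fin m → ℕ} (ha : ∀ q, a q ∈ U) (q : Fin m) {i : ℕ}
    (hi : i ∈ U) : ∀ p, Function.update a q i p ∈ U := fun p => by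
  by_cases h : p = q
  · subst h; rwa [Function.update_self]
  · rw [Function.update_of_ne h]; exact ha p

/-- Under commutation with `e i j` the operators `e k 0` transform like basis vectors of U, so the
Leibniz rule treats the letters of `a` and of `w` alike. -/
theorem e_mon (hs : IsSys S e) (h0 : 0 ∈ S) (hU : ∀ i ∈ U, i ∈ S ∧ i ≠ 0) {g : (Fin d → ℕ) → V}
    (hg : IsWordMap U e g) {i j : ℕ} (hi : i ∈ U) (hj : j ∈ U) {w : Fin d → ℕ}
    (hw : ∀ b, w b ∈ U) : ∀ (m : ℕ) (a : Fin m → ℕ), (∀ q, a q ∈ U) →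
      e i j (mon e g m a w) =
        (∑ q, if a q = j then mon e g m (Function.update a q i) w else 0) +
          ∑ b, if w b = j then mon e g m a (Function.update w b i) else 0 := by
  intro m
  induction m with
  | zero =>
    intro a _
    rw [Finset.univ_eq_empty, Finset.sum_empty, zero_add]
    exact hg i hi j hj w hw
  | succ m ih =>
    intro a ha
    rw [mon_succ, hs i (hU i hi).1 j (hU j hj).1 _ (hU _ (ha 0)).1 0 h0,
      if_neg (Ne.symm (hU i hi).2), sub_zero, ih (Fin.tail a) fun q => ha q.succ, map_add, map_sum, map_sum,
      Fin.sum_univ_succ, add_right_comm, mon_succ, Function.update_self, Fin.tail_update_zero]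
    congr 1
    · rw [add_comm]
      congr 1
      · simp only [eq_comm]
      · refine Finset.sum_congr rfl fun q _ => ?_
        rw [mon_succ, Fin.tail_update_succ, Function.update_of_ne (Fin.succ_ne_zero q).symm,
          apply_ite (e (a 0) 0), map_zero]
        rfl
    · refine Finset.sum_congr rfl fun b _ => ?_
      rw [apply_ite (e (a 0) 0), map_zero, mon_succ]

theorem e_zero_mon (hs : IsSys S e) (h0 : 0 ∈ S) (hU : ∀ i ∈ U, i ∈ S ∧ i ≠ 0)
    {g : (Fin d → ℕ) → V} {μ : ℂ} (hg : ∀ w, e 0 0 (g w) = μ • g w) (w : Fin d → ℕ) :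
    ∀ (m : ℕ) (a : Fin m → ℕ), (∀ q, a q ∈ U) →
      e 0 0 (mon e g m a w) = (μ - m) • mon e g m a w := by
  intro m
  induction m with
  | zero => intro a _; rw [Nat.cast_zero, sub_zero]; exact hg w
  | succ m ih =>
    intro a ha
    rw [mon_succ, hs 0 h0 0 h0 _ (hU _ (ha 0)).1 0 h0, if_neg (Ne.symm (hU _ (ha 0)).2),
      if_pos rfl, ih (Fin.tail a) fun q => ha q.succ, add_zero, map_smul, Nat.cast_succ]
    module

/-- The Casimir-like operator `∑ e i 0 e 0 i` on monomials. -/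
theorem casimir_mon (hs : IsSys S e) (h0 : 0 ∈ S) {F : Finset ℕ}
    (hF : ∀ i ∈ (F : Set ℕ), i ∈ S ∧ i ≠ 0) {g : (Fin d → ℕ) → V} (hg : IsWordMap F e g) {μ : ℂ}
    (hg0 : ∀ w, e 0 0 (g w) = μ • g w) {Z : Submodule ℂ V} (hZ : ∀ i ∈ F, ∀ v ∈ Z, e i 0 v ∈ Z)
    (hgZ : ∀ i ∈ F, ∀ w, e 0 i (g w) ∈ Z) {w : Fin d → ℕ} (hw : ∀ b, w b ∈ F) :
    ∀ (m : ℕ) (a : Fin m → ℕ), (∀ q, a q ∈ F) →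
      (∑ i ∈ F, e i 0 (e 0 i (mon e g m a w))) - ((m * (μ - m + 1)) • mon e g m a w -
        ∑ p, ∑ b, mon e g m (Function.update a p (w b)) (Function.update w b (a p))) ∈ Z := by
  intro m
  induction m with
  | zero =>
    intro a _
    rw [Nat.cast_zero, zero_mul, zero_smul, Finset.univ_eq_empty, Finset.sum_empty, sub_zero,
      sub_zero]
    exact Submodule.sum_mem _ fun i hi => hZ i hi _ (hgZ i hi w)
  | succ m ih =>
    intro a ha
    have ha' : ∀ q, Fin.tail a q ∈ F := fun q => ha q.succ
    have h := hZ _ (ha 0) _ (ih (Fin.tail a) ha')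
    set y := mon e g m (Fin.tail a) w with hy
    -- Commuting `e 0 i` past `e (a 0) 0` leaves `e 0 0`, when `i = a 0`, minus `e (a 0) i`. The
    -- first gives the scalar `μ - m`. The second replaces a letter equal to `i` by `a 0`: for each
    -- of the `m` letters of the tail this returns the same monomial by `mon_swap`, and for the
    -- letters of `w` it gives the exchange with `a 0`. The scalars add up: m(μ - m + 1) + (μ - m) -
    -- m = (m + 1)(μ - m).
    have key : ∑ i ∈ F, e i 0 (e 0 i (e (a 0) 0 y)) =
        e (a 0) 0 (∑ i ∈ F, e i 0 (e 0 i y)) + (μ - m) • e (a 0) 0 y -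
          (m • e (a 0) 0 y + ∑ b, e (w b) 0 (mon e g m (Fin.tail a)
            (Function.update w b (a 0)))) := by
      have step : ∀ i ∈ F, e i 0 (e 0 i (e (a 0) 0 y)) = e (a 0) 0 (e i 0 (e 0 i y)) +
          (if i = a 0 then (μ - m) • e (a 0) 0 y else 0) -
          ((∑ q, if Fin.tail a q = i then
              e i 0 (mon e g m (Function.update (Fin.tail a) q (a 0)) w) else 0) +
            ∑ b, if w b = i then
              e i 0 (mon e g m (Fin.tail a) (Function.update w b (a 0))) else 0) := by
        intro i hi
        rw [hs 0 h0 i (hF i hi).1 _ (hF _ (ha 0)).1 0 h0, if_pos rfl, map_sub, map_add,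
          lower_comm hs h0 (hF i hi).1 (hF _ (ha 0)).1 (hF i hi).2 (hF _ (ha 0)).2]
        congr 1
        · congr 1
          split_ifs with hia
          · rw [e_zero_mon hs h0 hF hg0 w m _ ha', map_smul, hia]
          · rw [map_zero]
        · rw [hy, e_mon hs h0 hF hg (ha 0) hi hw m _ ha', map_add, map_sum, map_sum]
          simp only [apply_ite (e i 0), map_zero]
      rw [Finset.sum_congr rfl step, Finset.sum_sub_distrib, Finset.sum_add_distrib,
        Finset.sum_add_distrib, map_sum, Finset.sum_ite_eq' F (a 0), if_pos (ha 0)]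
      congr 2
      · rw [Finset.sum_comm]
        have : ∀ q : Fin m, (∑ i ∈ F, if Fin.tail a q = i then
            e i 0 (mon e g m (Function.update (Fin.tail a) q (a 0)) w) else 0) =
            e (a 0) 0 y := by
          intro q
          rw [Finset.sum_ite_eq F, if_pos (ha' q)]
          exact mon_swap hs h0 (hF _ (ha 0)).1 (hF _ (ha 0)).2 m _ (fun q => hF _ (ha' q)) q
        rw [Finset.sum_congr rfl fun q _ => this q, Finset.sum_const, Finset.card_univ,
          Fintype.card_fin]
      · rw [Finset.sum_comm]
        refine Finset.sum_congr rfl fun b _ => ?_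
        rw [Finset.sum_ite_eq F, if_pos (hw b)]
    rw [mon_succ, ← hy, key, Fin.sum_univ_succ]
    have e1 : ∑ b, mon e g (m + 1) (Function.update a 0 (w b)) (Function.update w b (a 0)) =
        ∑ b, e (w b) 0 (mon e g m (Fin.tail a) (Function.update w b (a 0))) := by
      refine Finset.sum_congr rfl fun b _ => ?_
      rw [mon_succ, Function.update_self, Fin.tail_update_zero]
    have e2 : ∑ p : Fin m, ∑ b, mon e g (m + 1) (Function.update a p.succ (w b))
        (Function.update w b (a p.succ)) = e (a 0) 0 (∑ p : Fin m, ∑ b,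
          mon e g m (Function.update (Fin.tail a) p (w b))
            (Function.update w b (Fin.tail a p))) := by
      simp only [map_sum]
      refine Finset.sum_congr rfl fun p _ => Finset.sum_congr rfl fun b _ => ?_
      rw [mon_succ, Fin.tail_update_succ, Function.update_of_ne (Fin.succ_ne_zero p).symm]
      rfl
    rw [e1, e2]
    rw [map_sub, map_sub, map_smul] at h
    convert h using 1
    rw [← Nat.cast_smul_eq_nsmul ℂ, Nat.cast_succ]
    module

end Monomials

/-! ### Submodules are determined in bounded degree -/

section Bounded

variable {V : Type*} [AddCommGroup V] [Module ℂ V] {ν : ℂ} {N : ℕ∞} {e : Ops V} {d : ℕ}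

open Classical in
/-- The images of words under an equivariant map from a tensor power. -/
def wordVec {U : Set ℕ} (f : (tensPow U d).V →ₗ[ℂ] V) (w : Fin d → ℕ) : V :=
  if h : ∀ b, w b ∈ U then f (tensBasis U d fun b => ⟨w b, h b⟩) else 0

theorem wordVec_eq {U : Set ℕ} (f : (tensPow U d).V →ₗ[ℂ] V) {w : Fin d → ℕ} (h : ∀ b, w b ∈ U) :
    wordVec f w = f (tensBasis U d fun b => ⟨w b, h b⟩) := dif_pos h

theorem isWordMap_wordVec {U F : Set ℕ} (hF : F ⊆ U) {f : (tensPow U d).V →ₗ[ℂ] V}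
    (hf : Commutes U (tensPow U d).e e f) : IsWordMap F e (wordVec f) := by
  intro i hi j hj w hw
  rw [wordVec_eq f fun b => hF (hw b), ← hf i (hF hi) j (hF hj), tensPow_e_basis (hF hi) (hF hj),
    map_sum]
  refine Finset.sum_congr rfl fun b _ => ?_
  rw [apply_ite f, map_zero, wordVec_eq f fun b => hF (update_mem hw _ hi b)]
  refine if_congr Iff.rfl ?_ rfl
  congr 2
  funext c
  by_cases h : c = b
  · subst h; simp
  · simp [Function.update_of_ne h]

/-- The weight of a word. -/
def letterWt {m : ℕ} (a : Fin m → ℕ) : ℕ →₀ ℕ := ∑ q, Finsupp.single (a q) 1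

theorem deg_letterWt {m : ℕ} (a : Fin m → ℕ) : deg (letterWt a) = m := by
  have h := deg_wordWt (S := Set.univ) fun q => ⟨a q, Set.mem_univ _⟩
  exact h

theorem mem_support_letterWt {m : ℕ} (a : Fin m → ℕ) (q : Fin m) : letterWt a (a q) ≠ 0 := by
  rw [letterWt, Finsupp.finsetSum_apply]
  intro h
  simpa using Finset.sum_eq_zero_iff.mp h q (Finset.mem_univ q)

theorem wordVec_mem_wt {U : Set ℕ} {f : (tensPow U d).V →ₗ[ℂ] V}
    (hf : Commutes U (tensPow U d).e e f) (w : Fin d → ℕ) :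
    wordVec f w ∈ wt U e (letterWt w) := by
  by_cases h : ∀ b, w b ∈ U
  · rw [wordVec_eq f h]
    have h1 := hf.map_wt (tensBasis_mem_wt fun b => (⟨w b, h b⟩ : U))
    exact h1
  · rw [wordVec, dif_neg h]
    exact Submodule.zero_mem _

theorem mon_mem_wt (hs : IsSys (idx N) e) (h0 : 0 ∈ idx N) {g : (Fin d → ℕ) → V} {w : Fin d → ℕ}
    (hg : g w ∈ wt (idxU N) e (letterWt w)) : ∀ (m : ℕ) (a : Fin m → ℕ),
      (∀ q, a q ∈ idxU N) → mon e g m a w ∈ wt (idxU N) e (letterWt w + letterWt a) := by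
  intro m
  induction m with
  | zero =>
    intro a _
    rw [letterWt, letterWt, Finset.univ_eq_empty (α := Fin 0), Finset.sum_empty, add_zero]
    exact hg
  | succ m ih =>
    intro a ha
    have h1 := map_wt_raise hs (idxU_subset N) (ha 0) (zero_mem_idx_diff h0)
      (ih (Fin.tail a) fun q => ha q.succ)
    have h2 : letterWt a = letterWt (Fin.tail a) + Finsupp.single (a 0) 1 := by
      rw [letterWt, Fin.sum_univ_succ, add_comm]
      rfl
    rw [h2, ← add_assoc]
    exact h1

/-- The submodule generated by the part of degree less than `d`. -/
def filt (N : ℕ∞) (e : Ops V) (d : ℕ) : Submodule ℂ V := lowerGen (idxU N) e (lowPart N e ⊤ d)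

theorem IsO.stable_filt (h : IsO ν N e) (h0 : 0 ∈ idx N) (d : ℕ) :
    Stable (idx N) e (filt N e d) := h.stable_lowerGen h0 (Stable.top _ _) d

theorem filt_zero (N : ℕ∞) (e : Ops V) : filt N e 0 = ⊥ := by
  rw [eq_bot_iff]
  refine lowerGen_le ?_ fun i _ v hv => ?_
  · exact iSup₂_le fun α hα => absurd hα (Nat.not_lt_zero _)
  · rw [(Submodule.mem_bot ℂ).mp hv, map_zero]
    exact Submodule.zero_mem _

theorem mem_filt {d : ℕ} {α : ℕ →₀ ℕ} (hα : deg α < d) {v : V} (hv : v ∈ wt (idxU N) e α) :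
    v ∈ filt N e d := le_lowerGen _ _ _ (mem_lowPart hα trivial hv)

/-- The monomials in the lowering operators applied to words of length `d`. -/
structure MonIdx (N : ℕ∞) (e : Ops V) (d : ℕ) where
  f : (tensPow (idxU N) d).V →ₗ[ℂ] V
  comm : Commutes (idxU N) (tensPow (idxU N) d).e e f
  m : ℕ
  a : Fin m → ℕ
  mem_a : ∀ q, a q ∈ idxU N
  w : Fin d → ℕ
  mem_w : ∀ b, w b ∈ idxU N

/-- The vector attached to an index of a monomial. -/
def MonIdx.vec (x : MonIdx N e d) : V := mon e (wordVec x.f) x.m x.a x.w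

/-- The weight of a monomial. -/
def MonIdx.weight (x : MonIdx N e d) : ℕ →₀ ℕ := letterWt x.w + letterWt x.a

theorem MonIdx.vec_mem_wt (hs : IsSys (idx N) e) (h0 : 0 ∈ idx N) (x : MonIdx N e d) :
    x.vec ∈ wt (idxU N) e x.weight :=
  mon_mem_wt hs h0 (wordVec_mem_wt x.comm x.w) _ _ x.mem_a

/-- A monomial with a further lowering operator. -/
def MonIdx.cons (x : MonIdx N e d) {i : ℕ} (hi : i ∈ idxU N) : MonIdx N e d :=
  ⟨x.f, x.comm, x.m + 1, Fin.cons i x.a, fun q => by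
    refine Fin.cases ?_ (fun q => ?_) q
    · exact hi
    · exact x.mem_a q, x.w, x.mem_w⟩

theorem MonIdx.vec_cons (x : MonIdx N e d) {i : ℕ} (hi : i ∈ idxU N) :
    (x.cons hi).vec = e i 0 x.vec := by
  change mon e _ (x.m + 1) (Fin.cons i x.a) x.w = e i 0 x.vec
  rw [mon_succ, Fin.cons_zero, Fin.tail_cons]
  rfl

/-- Vectors of degree exactly `d` are combinations of images of words of length `d`, so the new part
of the filtration is spanned by monomials in the `e i 0` applied to such words. -/
theorem IsO.filt_succ_le (h : IsO ν N e) (d : ℕ) : filt N e (d + 1) ≤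
    filt N e d ⊔ Submodule.span ℂ (Set.range (MonIdx.vec (N := N) (e := e) (d := d))) := by
  refine lowerGen_le (iSup₂_le fun α hα v hv => ?_) fun i hi v hv => ?_
  · rcases Nat.lt_succ_iff_lt_or_eq.mp hα with hlt | rfl
    · exact Submodule.mem_sup_left (mem_filt hlt hv.2)
    · refine Submodule.mem_sup_right (Submodule.span_mono ?_ (h.ind.mem_span_words hv.2))
      rintro _ ⟨f, w, hf, -, rfl⟩
      refine ⟨⟨f, hf, 0, Fin.elim0, fun q => q.elim0, fun b => w b, fun b => (w b).2⟩, ?_⟩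
      exact wordVec_eq f fun b => (w b).2
  · suffices hle : filt N e d ⊔ Submodule.span ℂ (Set.range MonIdx.vec) ≤
        (filt N e d ⊔ Submodule.span ℂ (Set.range
          (MonIdx.vec (N := N) (e := e) (d := d)))).comap (e i 0) from hle hv
    refine sup_le (fun v hv => Submodule.mem_sup_left (lowerGen_map hi hv)) ?_
    rw [Submodule.span_le]
    rintro _ ⟨x, rfl⟩
    exact Submodule.mem_sup_right (Submodule.subset_span ⟨x.cons hi, x.vec_cons hi⟩)

/-- The swap of a letter of one word with a letter of another word. -/
def swapPerm {F : Type*} {m d : ℕ} (p : Fin m) (b : Fin d) :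
    Equiv.Perm ((Fin m → F) × (Fin d → F)) where
  toFun x := (Function.update x.1 p (x.2 b), Function.update x.2 b (x.1 p))
  invFun x := (Function.update x.1 p (x.2 b), Function.update x.2 b (x.1 p))
  left_inv x := by simp
  right_inv x := by simp

theorem exists_finset_mem_sup_span {ι : Type*} {g : ι → V} {A : Set ι} {W : Submodule ℂ V} {v : V}
    (hv : v ∈ W ⊔ Submodule.span ℂ (g '' A)) :
    ∃ t : Finset ι, (∀ x ∈ t, x ∈ A) ∧ v ∈ W ⊔ Submodule.span ℂ (g '' t) := by
  obtain ⟨y, hy, z, hz, rfl⟩ := Submodule.mem_sup.mp hv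
  rw [Finsupp.mem_span_image_iff_linearCombination] at hz
  obtain ⟨l, hl, rfl⟩ := hz
  refine ⟨l.support, fun x hx => hl hx, Submodule.add_mem_sup hy ?_⟩
  rw [Finsupp.mem_span_image_iff_linearCombination]
  exact ⟨l, Finsupp.mem_supported_support ℂ l, rfl⟩

/-- The operator `∑ e i 0 e 0 i` is injective on the graded pieces of the filtration, in large
degree. -/
theorem IsO.mem_filt_of_casimir (h : IsO ν N e) (h0 : 0 ∈ idx N) {d : ℕ} {α : ℕ →₀ ℕ}
    {F : Finset ℕ} (hFU : ∀ i ∈ F, i ∈ idxU N) (hF : ∀ i ∈ idxU N, α i ≠ 0 → i ∈ F)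
    (hα : ‖ν‖ + 2 * d + 1 < deg α - d) {v : V} (hv : v ∈ wt (idxU N) e α)
    (hvd : v ∈ filt N e (d + 1))
    (hT : (∑ i ∈ F, e i 0 (e 0 i v)) ∈ filt N e d) : v ∈ filt N e d := by
  have hst := h.stable_filt h0 d
  have hv1 := mem_span_wt h.isWeight (MonIdx.vec_mem_wt h.sys h0) (hst.mono (idxU_subset N)).diag hv
    (h.filt_succ_le d hvd)
  obtain ⟨t, ht, hv2⟩ := exists_finset_mem_sup_span hv1
  -- Each operator `e i 0` contributes one to the degree, so all monomials of weight `α` over words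
  -- of length `d` have exactly `m = deg α - d` factors.
  obtain ⟨m, hm⟩ : ∃ m, m + d = deg α := by
    refine ⟨deg α - d, Nat.sub_add_cancel ?_⟩
    have h1 : (0 : ℝ) ≤ ‖ν‖ := norm_nonneg ν
    have h2 : (0 : ℝ) ≤ d := Nat.cast_nonneg d
    have h3 : (d : ℝ) ≤ deg α := by linarith
    exact_mod_cast h3
  have hxm : ∀ x ∈ t, x.m = m := fun x hx => by
    have h1 : x.weight = α := ht x hx
    rw [← h1, MonIdx.weight, deg_add, deg_letterWt, deg_letterWt] at hm
    omega
  -- The family is enlarged to all words in the finite alphabet `F`, so that it is closed under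
  -- exchanging letters.
  let g : t × ((Fin m → F) × (Fin d → F)) → V := fun x =>
    mon e (wordVec x.1.1.f) m (fun q => (x.2.1 q : ℕ)) (fun b => (x.2.2 b : ℕ))
  have hle : Submodule.span ℂ (MonIdx.vec '' (t : Set (MonIdx N e d))) ≤
      Submodule.span ℂ (Set.range g) := by
    rw [Submodule.span_le]
    rintro _ ⟨x, hx, rfl⟩
    have hxα : x.weight = α := ht x hx
    have e1 := hxm x hx
    have hsup : ∀ i, letterWt x.w i ≠ 0 ∨ letterWt x.a i ≠ 0 → α i ≠ 0 := fun i hi => by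
      rw [← hxα, MonIdx.weight, Finsupp.add_apply]
      omega
    have ha : ∀ q, x.a q ∈ F := fun q =>
      hF _ (x.mem_a q) (hsup _ (Or.inr (mem_support_letterWt x.a q)))
    have hw : ∀ b, x.w b ∈ F := fun b =>
      hF _ (x.mem_w b) (hsup _ (Or.inl (mem_support_letterWt x.w b)))
    subst e1
    exact Submodule.subset_span ⟨(⟨x, hx⟩, fun q => ⟨x.a q, ha q⟩, fun b => ⟨x.w b, hw b⟩), rfl⟩
  have hv3 : v ∈ filt N e d ⊔ Submodule.span ℂ (Set.range g) := sup_le_sup_left hle _ hv2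
  let T : Module.End ℂ V := ∑ i ∈ F, e i 0 ∘ₗ e 0 i
  have hTa : ∀ x, T x = ∑ i ∈ F, e i 0 (e 0 i x) := fun x => by simp [T]
  -- On words of length `d` the unit `e 0 0` acts by `ν - d`, which gives the scalar `c` of
  -- `casimir_mon`. There are `m * d` exchanges, so the required bound is `d < ‖ν - d - m + 1‖`.
  refine mem_of_sub_sum_perm (T := T) (c := m * ((ν - d) - m + 1)) (K := Fin m × Fin d) ?_ ?_
    (fun k => (Equiv.refl _).prodCongr (swapPerm k.1 k.2)) ?_ hv3 (by rw [hTa]; exact hT)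
  · intro z hz
    rw [hTa]
    exact Submodule.sum_mem _ fun i hi => hst i (hFU i hi).2 0 h0 _
      (hst 0 h0 i (hFU i hi).2 z hz)
  · have h1 : (m : ℝ) + d = deg α := by exact_mod_cast hm
    have h2 : ‖ν‖ + 2 * d + 1 < m := by linarith
    have h3 : (0 : ℝ) ≤ ‖ν‖ := norm_nonneg ν
    have h4 : (0 : ℝ) ≤ d := Nat.cast_nonneg d
    have h5 : (d : ℝ) < ‖ν - d - m + 1‖ := by
      have h6 : ‖((m : ℂ) + d - 1)‖ ≤ ‖ν‖ + ‖ν - d - m + 1‖ := by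
        have : (m : ℂ) + d - 1 = ν - (ν - d - m + 1) := by ring
        rw [this]
        exact norm_sub_le _ _
      have h7 : ‖((m : ℂ) + d - 1)‖ = m + d - 1 := by
        have : (m : ℂ) + d - 1 = ((m + d - 1 : ℝ) : ℂ) := by push_cast; ring
        rw [this, Complex.norm_real, Real.norm_of_nonneg (by linarith)]
      linarith
    rw [Fintype.card_prod, Fintype.card_fin, Fintype.card_fin, norm_mul, Complex.norm_natCast]
    push_cast
    exact mul_lt_mul_of_pos_left h5 (by linarith)
  · rintro ⟨x, a, w⟩
    have hgZ : ∀ w, wordVec x.1.f w ∈ wt (idxU N) e (letterWt w) := wordVec_mem_wt x.1.comm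
    have key := casimir_mon (F := F) h.sys h0 (fun i hi => ⟨(hFU i hi).2,
      ne_zero_of_mem_idxU (hFU i hi)⟩) (isWordMap_wordVec hFU x.1.comm) (μ := ν - d)
      (fun w => by rw [h.degr _ _ (hgZ w), deg_letterWt]) (Z := filt N e d)
      (fun i hi v hv => lowerGen_map (hFU i hi) hv)
      (fun i hi w => by
        rcases h.map_zero_left h0 (hFU i hi) (hgZ w) with h1 | ⟨β, hβ, h1⟩
        · rw [h1]; exact Submodule.zero_mem _
        · refine mem_filt ?_ h1
          have h2 := congrArg deg hβ
          rw [deg_add, deg_single, deg_letterWt] at h2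
          omega)
      (w := fun b => (w b : ℕ)) (fun b => (w b).2) m (fun q => (a q : ℕ)) (fun q => (a q).2)
    rw [hTa]
    convert key using 3
    rw [Fintype.sum_prod_type]
    refine Finset.sum_congr rfl fun p _ => Finset.sum_congr rfl fun b _ => ?_
    change mon e _ m _ _ = _
    congr 1
    · funext q
      change ((Function.update a p (w b) q : F) : ℕ) = _
      by_cases hq : q = p
      · subst hq; simp
      · simp [Function.update_of_ne hq]
    · funext q
      change ((Function.update w b (a p) q : F) : ℕ) = _
      by_cases hq : q = b
      · subst hq; simp
      · simp [Function.update_of_ne hq]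

/-- A submodule of a module in the category `O` is determined by its part of bounded degree. -/
theorem IsO.exists_bound (h : IsO ν N e) (h0 : 0 ∈ idx N) : ∃ K : ℕ, ∀ W W' : Submodule ℂ V,
    Stable (idx N) e W → Stable (idx N) e W' →
    (∀ α, deg α ≤ K → ∀ v ∈ wt (idxU N) e α, v ∈ W' → v ∈ W) → W' ≤ W := by
  classical
  obtain ⟨K, hK⟩ := h.gen
  have htop : filt N e (K + 1) = ⊤ := hK _ (fun i hi v hv => lowerGen_map hi hv)
    fun α hα v hv => mem_filt (Nat.lt_succ_of_le hα) hv
  -- For `d ≤ K`, any degree above this constant satisfies the inequality required by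
  -- `IsO.mem_filt_of_casimir`.
  refine ⟨3 * K + 2 + ⌈‖ν‖⌉₊, fun W W' hW hW' hlow => ?_⟩
  -- Induction on the filtration step, and inside it strong induction on the degree.
  have key : ∀ d ≤ K + 1, W' ⊓ filt N e d ≤ W := by
    intro d
    induction d with
    | zero => intro _; rw [filt_zero, inf_bot_eq]; exact bot_le
    | succ d ihd =>
      intro hd
      have ihd := ihd (by omega)
      have hst := h.stable_filt h0 (d + 1)
      have hst' := h.stable_filt h0 d
      have hU := idxU_subset N
      suffices hα : ∀ (D : ℕ) (α : ℕ →₀ ℕ), deg α = D → ∀ v ∈ wt (idxU N) e α,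
          v ∈ W' ⊓ filt N e (d + 1) → v ∈ W from
        le_of_wt h.isWeight ((hW'.inf hst).mono hU).diag fun α => hα _ α rfl
      intro D
      induction D using Nat.strong_induction_on with
      | _ D ihD =>
        intro α hαD v hv hvW
        by_cases hsmall : deg α ≤ 3 * K + 2 + ⌈‖ν‖⌉₊
        · exact hlow α hsmall v hv hvW.1
        have hbig : ‖ν‖ + 2 * d + 1 < deg α - d := by
          have h1 : 3 * K + 2 + ⌈‖ν‖⌉₊ + 1 ≤ deg α := by omega
          have h2 : (3 * K + 2 + ⌈‖ν‖⌉₊ + 1 : ℝ) ≤ deg α := by exact_mod_cast h1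
          have h3 := Nat.le_ceil ‖ν‖
          have h4 : (d : ℝ) ≤ K := by exact_mod_cast (by omega : d ≤ K)
          linarith
        let T : Module.End ℂ V := ∑ i ∈ α.support with i ∈ idxU N, e i 0 ∘ₗ e 0 i
        have hTa : ∀ x, T x = ∑ i ∈ α.support with i ∈ idxU N, e i 0 (e 0 i x) := fun x => by
          simp [T]
        have hFU : ∀ {i}, i ∈ α.support.filter (· ∈ idxU N) → i ∈ idxU N := fun hi =>
          (Finset.mem_filter.mp hi).2
        have hstab : ∀ Z, Stable (idx N) e Z → ∀ x ∈ Z, T x ∈ Z := fun Z hZ x hx => by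
          rw [hTa]
          exact Submodule.sum_mem _ fun i hi => hZ i (hFU hi).2 0 h0 _
            (hZ 0 h0 i (hFU hi).2 x hx)
        let X := W' ⊓ filt N e (d + 1) ⊓ wt (idxU N) e α
        -- The factor `e 0 i` lowers the degree, so by induction its values are already in `W`;
        -- applying `e i 0` returns to weight `α` inside `W`.
        have hTX : ∀ x ∈ X, T x ∈ X ∧ T x ∈ W := by
          intro x hx
          rw [hTa]
          have : ∀ i ∈ α.support.filter (· ∈ idxU N), e i 0 (e 0 i x) ∈ X ⊓ W := by
            intro i hi
            have hiU := hFU hi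
            have hWx := (hW'.inf hst) 0 h0 i hiU.2 x hx.1
            rcases h.map_zero_left h0 hiU hx.2 with h1 | ⟨β, hβ, h1⟩
            · rw [h1, map_zero]; exact Submodule.zero_mem _
            · have hdeg : deg β < D := by
                rw [← hαD, ← hβ, deg_add, deg_single]; omega
              refine ⟨⟨(hW'.inf hst) i hiU.2 0 h0 _ hWx, ?_⟩,
                hW i hiU.2 0 h0 _ (ihD _ hdeg β rfl _ h1 hWx)⟩
              rw [← hβ]
              exact map_wt_raise h.sys hU hiU (zero_mem_idx_diff h0) h1
          exact Submodule.mem_inf.mp (Submodule.sum_mem (X ⊓ W) this)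
        have := h.fin α
        have : FiniteDimensional ℂ X := Submodule.finiteDimensional_of_le inf_le_right
        -- The space `X` is finite-dimensional and `T` is injective on it modulo the previous
        -- filtration step. So `X` is covered by the image of `T`, which is in `W`, and by the part
        -- in the previous step, which is in `W` by induction.
        have h1 := le_map_sup_of_injective (X := X) (Z := filt N e d) (T := T)
          (fun x hx => (hTX x hx).1) (hstab _ hst') (fun x hx hTx =>
            h.mem_filt_of_casimir h0 (fun _ hi => hFU hi) (fun i hi hα => Finset.mem_filter.mpr
              ⟨Finsupp.mem_support_iff.mpr hα, hi⟩) hbig hx.2 hx.1.2 (by rw [← hTa]; exact hTx))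
        have h2 : X.map T ⊔ X ⊓ filt N e d ≤ W := by
          refine sup_le ?_ ?_
          · rintro _ ⟨x, hx, rfl⟩
            exact (hTX x hx).2
          · exact fun x hx => ihd ⟨hx.1.1.1, hx.2⟩
        exact h2 (h1 ⟨hvW, hv⟩)
  intro v hv
  exact key (K + 1) le_rfl ⟨hv, by rw [htop]; trivial⟩

end Bounded

/-! ### Finiteness -/

section Finiteness

variable {V V' : Type*} [AddCommGroup V] [Module ℂ V] [AddCommGroup V'] [Module ℂ V'] {ν : ℂ}
  {N n : ℕ∞} {S T : Set ℕ} {e : Ops V} {e' : Ops V'}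

/-- The sum of the weight spaces of degree at most `K` with weights supported in `T`. -/
def boxPart (S : Set ℕ) (e : Ops V) (T : Finset ℕ) (K : ℕ) : Submodule ℂ V :=
  ⨆ α ∈ T.finsupp fun _ => Finset.range (K + 1), wt S e α

theorem finiteDimensional_boxPart (h : ∀ α, FiniteDimensional ℂ (wt S e α)) (T : Finset ℕ) (K : ℕ) :
    FiniteDimensional ℂ (boxPart S e T K) := by
  have := h
  rw [boxPart, ← Finset.sup_eq_iSup]
  exact Submodule.finiteDimensional_finset_sup _ _

theorem le_deg (α : ℕ →₀ ℕ) (i : ℕ) : α i ≤ deg α := by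
  by_cases h : α i = 0
  · rw [h]; exact Nat.zero_le _
  · exact Finset.single_le_sum (f := fun i => α i) (fun _ _ => Nat.zero_le _)
      (Finsupp.mem_support_iff.mpr h)

theorem mem_boxPart (hfin : T.Finite) {K : ℕ} {α : ℕ →₀ ℕ} (hα : deg α ≤ K)
    {v : V} (hv : v ∈ wt S e α) (hv0 : v ∈ wt (S \ T) e 0) :
    v ∈ boxPart S e hfin.toFinset K := by
  by_cases h0 : v = 0
  · rw [h0]; exact Submodule.zero_mem _
  have hα' : α ∈ hfin.toFinset.finsupp fun _ => Finset.range (K + 1) := by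
    refine Finset.mem_finsupp_iff.mpr ⟨fun i hi => ?_, fun i _ => ?_⟩
    · rw [Set.Finite.mem_toFinset]
      by_contra hiT
      have hi0 := Finsupp.mem_support_iff.mp hi
      by_cases hiS : i ∈ S
      · have h1 := wt_apply hv hiS
        rw [mem_wt_zero.mp hv0 i ⟨hiS, hiT⟩, eq_comm, smul_eq_zero] at h1
        exact h1.elim (fun h => hi0 (by exact_mod_cast h)) h0
      · exact h0 (wt_eq_zero hv hiS hi0)
    · exact Finset.mem_range.mpr (Nat.lt_succ_of_le ((le_deg α i).trans hα))
  exact Submodule.mem_iSup_of_mem α (Submodule.mem_iSup_of_mem hα' hv)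

theorem exists_subset_large (S : Set ℕ) (K : ℕ) :
    ∃ T ⊆ S, T.Finite ∧ ((K : ℕ∞) ≤ T.encard ∨ T = S) := by
  rcases le_total (K : ℕ∞) S.encard with h | h
  · obtain ⟨T, hT, hK⟩ := Set.exists_subset_encard_eq h
    exact ⟨T, hT, Set.finite_of_encard_eq_coe hK, Or.inl hK.ge⟩
  · exact ⟨S, subset_rfl, Set.finite_of_encard_le_coe h, Or.inr rfl⟩

/-- In bounded degree, a stable subspace is determined by the vectors of weight zero outside a
large set. -/
theorem mem_of_large (hs : IsSys S e) (h : IsWeight S e) (hT : T ⊆ S) {K : ℕ}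
    (hK : (K : ℕ∞) ≤ T.encard ∨ T = S) {W X : Submodule ℂ V} (hW : Stable S e W)
    (hX : Stable S e X) {α : ℕ →₀ ℕ} (hα : deg α ≤ K)
    (hWX : ∀ β, deg β = deg α → ∀ v ∈ wt S e β, v ∈ W → v ∈ wt (S \ T) e 0 → v ∈ X)
    {v : V} (hv : v ∈ wt S e α) (hvW : v ∈ W) : v ∈ X := by
  rcases hK with hK | rfl
  · exact mem_of_deg_le_encard hs h hT hW hX ((Nat.cast_le.mpr hα).trans hK) hWX hv hvW
  · refine hWX α rfl v hv hvW ?_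
    rw [mem_wt_zero]
    exact fun i hi => absurd hi.1 hi.2

/-- In bounded degree everything is generated by weight vectors supported on finitely many indices.
These form a finite-dimensional space, which finitely many maps from tensor powers suffice to cover.
-/
theorem finP_of_bounded (hs : IsSys S e) (h : IndP S e)
    (hfin : ∀ α, FiniteDimensional ℂ (wt S e α)) {K : ℕ}
    (hK : ∀ α, ∀ v ∈ wt S e α, v ≠ 0 → deg α ≤ K) : FinP S e := by
  obtain ⟨T, hTS, hTfin, hTK⟩ := exists_subset_large S K
  have := finiteDimensional_boxPart hfin hTfin.toFinset K
  obtain ⟨s, hs'⟩ := (boxPart S e hTfin.toFinset K).fg_iff_finiteDimensional.mpr this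
  obtain ⟨t, ht, hst⟩ : ∃ t : Finset V, (t : Set V) ⊆ polyVecs S e ∧
      (s : Set V) ⊆ Submodule.span ℂ (t : Set V) := by
    have : (s : Set V) ⊆ Submodule.span ℂ (polyVecs S e) := fun v _ => by
      rw [show Submodule.span ℂ (polyVecs S e) = ⊤ from h]; trivial
    clear hs'
    classical
    induction s using Finset.induction_on with
    | empty => exact ⟨∅, by simp, by simp⟩
    | insert a s _ ih =>
      obtain ⟨t, ht, hst⟩ := ih fun v hv => this (Finset.mem_insert_of_mem hv)
      obtain ⟨t', ht', ha⟩ := Submodule.mem_span_finite_of_mem_span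
        (this (Finset.mem_insert_self a s))
      refine ⟨t ∪ t', by simp [ht, ht'], ?_⟩
      intro v hv
      rcases Finset.mem_insert.mp hv with rfl | hv
      · exact Submodule.span_mono (by simp) ha
      · exact Submodule.span_mono (by simp) (hst hv)
  choose k f x hf hfx using fun v : t => ht v.2
  let ε := t.equivFin
  refine ⟨t.card, fun j => k (ε.symm j), fun j => f (ε.symm j), fun j => hf _, ?_⟩
  set X := ⨆ j, LinearMap.range (f (ε.symm j)) with hX
  have hXst : Stable S e X := by
    rw [hX, iSup]
    refine stable_sSup ?_
    rintro _ ⟨j, rfl⟩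
    exact (hf _).stable_range
  have hbox : boxPart S e hTfin.toFinset K ≤ X := by
    rw [← hs', Submodule.span_le]
    refine hst.trans ?_
    change Submodule.span ℂ (t : Set V) ≤ X
    rw [Submodule.span_le]
    intro v hv
    refine Submodule.mem_iSup_of_mem (ε ⟨v, hv⟩) ?_
    rw [Equiv.symm_apply_apply]
    exact ⟨x ⟨v, hv⟩, hfx ⟨v, hv⟩⟩
  rw [eq_top_iff]
  refine le_of_wt h.isWeight (Stable.top S e).diag fun α v hv _ => ?_
  by_cases hv0 : v = 0
  · rw [hv0]; exact Submodule.zero_mem _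
  exact mem_of_large hs h.isWeight hTS hTK (Stable.top S e) hXst (hK α v hv hv0)
    (fun β hβ w hw _ hw0 => hbox (mem_boxPart hTfin (hβ ▸ hK α v hv hv0) hw hw0)) hv trivial

/-- Submodules of a module in the category `O` are determined by a finite-dimensional subspace. -/
theorem IsO.exists_finite_detect (h : IsO ν N e) (h0 : 0 ∈ idx N) :
    ∃ P : Submodule ℂ V, FiniteDimensional ℂ P ∧ ∀ W W' : Submodule ℂ V,
      Stable (idx N) e W → Stable (idx N) e W' → W' ⊓ P ≤ W → W' ≤ W := by
  obtain ⟨K, hK⟩ := h.exists_bound h0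
  obtain ⟨T, hTS, hTfin, hTK⟩ := exists_subset_large (idxU N) K
  refine ⟨_, finiteDimensional_boxPart h.fin hTfin.toFinset K, fun W W' hW hW' hWW => ?_⟩
  have hWU := hW.mono (idxU_subset N)
  have hW'U := hW'.mono (idxU_subset N)
  refine hK W W' hW hW' fun α hα v hv hvW => ?_
  exact mem_of_large h.sysU h.isWeight hTS hTK hW'U hWU hα
    (fun β hβ w hw hwW hw0 => hWW ⟨hwW, mem_boxPart hTfin (hβ ▸ hα) hw hw0⟩) hv hvW

theorem le_encard_idxU {K : ℕ} (h : (K : ℕ∞) + 1 ≤ n) : (K : ℕ∞) ≤ (idxU n).encard := by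
  have h1 : ((Finset.Icc 1 K : Finset ℕ) : Set ℕ) ⊆ idxU n := by
    intro i hi
    rw [Finset.coe_Icc, Set.mem_Icc] at hi
    refine ⟨hi.1, lt_of_lt_of_le ?_ h⟩
    exact_mod_cast Nat.lt_succ_of_le hi.2
  have h2 := Set.encard_le_encard h1
  rwa [Set.encard_coe_eq_coe_finsetCard, Nat.card_Icc, Nat.add_sub_cancel] at h2

/-- Submodules of a module in the category `O` are determined by the vectors of weight zero outside
`T`. -/
def Detects (N n : ℕ∞) (e : Ops V) : Prop :=
  ∀ W W' : Submodule ℂ V, Stable (idx N) e W → Stable (idx N) e W' →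
    W' ⊓ wt (idx N \ idx n) e 0 ≤ W → W' ≤ W

/-- Submodules of a module in the category `O` are determined by their invariants for large `n`. -/
theorem IsO.exists_detects (h : IsO ν N e) (h0 : 0 ∈ idx N) :
    ∃ K : ℕ, ∀ n : ℕ∞, (K : ℕ∞) ≤ n → n ≤ N → Detects N n e := by
  obtain ⟨K, hK⟩ := h.exists_bound h0
  refine ⟨K + 1, fun n hn hnN W W' hW hW' hWW => ?_⟩
  have hn' : (K : ℕ∞) + 1 ≤ n := by exact_mod_cast hn
  have h0n : 0 ∈ idx n := lt_of_lt_of_le (by simp) (le_add_self.trans hn')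
  rw [idx_diff h0n] at hWW
  refine hK W W' hW hW' fun α hα v hv hvW => ?_
  exact mem_of_large h.sysU h.isWeight (idxU_mono hnN) (Or.inl (le_encard_idxU hn'))
    (hW'.mono (idxU_subset N)) (hW.mono (idxU_subset N)) hα
    (fun β _ w _ hwW hw0 => hWW ⟨hwW, hw0⟩) hv hvW

/-- Submodules of modules in the category `O`. -/
theorem IsO.of_injective (h : IsO ν N e) (h0 : 0 ∈ idx N) {i : V' →ₗ[ℂ] V}
    (hi : Commutes (idx N) e' e i) (hinj : Function.Injective i) : IsO ν N e' := by
  have hiU := hi.mono (idxU_subset N)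
  refine ⟨⟨fun a ha b hb k hk l hl v => hinj ?_, h.ind.of_injective hiU hinj,
    fun α v hv => hinj ?_⟩, ?_, fun α => ?_⟩
  · rw [hi a ha b hb, hi k hk l hl, map_sub, map_add, hi k hk l hl, hi a ha b hb,
      apply_ite i, apply_ite i, map_zero, hi a ha l hl, hi k hk b hb]
    exact h.sys a ha b hb k hk l hl _
  · rw [hi 0 h0 0 h0, map_smul, h.degr α _ (hiU.map_wt hv)]
  · obtain ⟨K, hK⟩ := h.exists_bound h0
    refine ⟨K, fun W hW hWK => ?_⟩
    -- The Noetherian property: the submodule and the 𝔲⁻-submodule generated by its part of degree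
    -- at most `K` are both stable and agree in degree at most `K`, so they are equal.
    have h1 := hK _ _ (h.stable_lowerGen h0 hi.stable_range (K + 1)) hi.stable_range
      fun α hα v hv hvR => le_lowerGen _ _ _ (mem_lowPart (Nat.lt_succ_of_le hα) hvR hv)
    have h2 : lowerGen (idxU N) e (lowPart N e (LinearMap.range i) (K + 1)) ≤ W.map i := by
      refine lowerGen_le (iSup₂_le fun α hα => ?_) ?_
      · rintro _ ⟨⟨v, rfl⟩, hv⟩
        exact ⟨v, hWK α (Nat.le_of_lt_succ hα) (hiU.mem_wt_of_injective hinj hv), rfl⟩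
      · rintro k hk _ ⟨v, hv, rfl⟩
        exact ⟨e' k 0 v, hW k hk v hv, hi k hk.2 0 h0 v⟩
    rw [eq_top_iff]
    rintro v -
    obtain ⟨w, hw, hwv⟩ := h2 (h1 ⟨v, rfl⟩)
    exact hinj hwv ▸ hw
  · have := h.fin α
    exact Module.Finite.of_injective
      ((i.comp (wt (idxU N) e' α).subtype).codRestrict (wt (idxU N) e α) fun v => hiU.map_wt v.2)
      fun a b hab => Subtype.ext (hinj (congrArg Subtype.val hab))

end Finiteness

/-! ### The category `O` and matrix units -/

section ParO

variable {N : ℕ∞} {ν : ℂ}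

theorem resU_e (M : LieRep.{u} (gl N)) {i j : ℕ} (hi : i ∈ idxU N) (hj : j ∈ idxU N)
    (m : (resU M).V) : M.resEquiv _ ((resU M).e i j m) = M.e i j (M.resEquiv _ m) :=
  LieRep.res_e (idxU_subset N) i j hi hj m

theorem resU_commutes (M : LieRep.{u} (gl N)) :
    Commutes (idxU N) (resU M).e M.e (M.resEquiv (LieSubalgebra.inclusion (glU_le N))).toLinearMap :=
  fun _ hi _ hj m => resU_e M hi hj m

theorem resU_commutes_symm (M : LieRep.{u} (gl N)) : Commutes (idxU N) M.e (resU M).e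
    (M.resEquiv (LieSubalgebra.inclusion (glU_le N))).symm.toLinearMap := fun i hi j hj m => by
  apply (M.resEquiv (LieSubalgebra.inclusion (glU_le N))).injective
  change M.resEquiv _ ((M.resEquiv _).symm (M.e i j m)) =
    M.resEquiv _ ((resU M).e i j ((M.resEquiv _).symm m))
  rw [resU_e M hi hj, LinearEquiv.apply_symm_apply, LinearEquiv.apply_symm_apply]

theorem isIndPoly_resU_iff (M : LieRep.{u} (gl N)) : IsIndPoly (resU M) ↔ IndP (idxU N) M.e := by
  rw [isIndPoly_iff]
  exact ⟨fun h => h.of_surjective (resU_commutes M) (LinearEquiv.surjective _),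
    fun h => h.of_surjective (resU_commutes_symm M) (LinearEquiv.surjective _)⟩

theorem HasDegree.degr {M : LieRep.{u} (gl N)} (h : HasDegree ν M) (h0 : 0 ∈ idx N)
    (hM : IndP (idxU N) M.e) (α : ℕ →₀ ℕ) (v : M.V) (hv : v ∈ wt (idxU N) M.e α) :
    M.e 0 0 v = (ν - deg α) • v := by
  suffices hle : Submodule.span ℂ {v | ∃ (f : (tensPow (idxU N) (deg α)).V →ₗ[ℂ] M.V)
      (w : Fin (deg α) → idxU N), Commutes (idxU N) (tensPow (idxU N) (deg α)).e M.e f ∧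
        wordWt w = α ∧ f (tensBasis (idxU N) (deg α) w) = v} ≤
      LinearMap.ker (M.e 0 0 - (ν - deg α) • LinearMap.id) by
    have := hle (hM.mem_span_words hv)
    rwa [LinearMap.mem_ker, LinearMap.sub_apply, LinearMap.smul_apply, LinearMap.id_apply,
      sub_eq_zero] at this
  rw [Submodule.span_le]
  rintro _ ⟨f, w, hf, -, rfl⟩
  rw [SetLike.mem_coe, LinearMap.mem_ker, LinearMap.sub_apply, LinearMap.smul_apply,
    LinearMap.id_apply, sub_eq_zero]
  rw [M.e_eq h0 h0]
  exact h (deg α) (LieRep.homOfCommutes _ ((resU_commutes_symm M).comp hf))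
    (tensBasis (idxU N) (deg α) w) ⟨matUnit 0 0, matUnit_mem h0 h0⟩ rfl

theorem IsO.hasDegree {M : LieRep.{u} (gl N)} (h : IsO ν N M.e) (h0 : 0 ∈ idx N) :
    HasDegree ν M := by
  intro k f t x hx
  rw [M.lie_eq h0 h0 x hx]
  have hf := (resU_commutes M).comp (LieRep.commutes f)
  suffices hle : ⊤ ≤ LinearMap.ker ((M.e 0 0 - (ν - k) • LinearMap.id) ∘ₗ
      ((M.resEquiv (LieSubalgebra.inclusion (glU_le N))).toLinearMap ∘ₗ
        (f : (tensPow (idxU N) k).V →ₗ[ℂ] (resU M).V))) from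
    sub_eq_zero.mp (hle (x := t) trivial)
  rw [← (tensBasis (idxU N) k).span_eq, Submodule.span_le]
  rintro _ ⟨w, rfl⟩
  rw [SetLike.mem_coe, LinearMap.mem_ker, LinearMap.comp_apply, LinearMap.sub_apply,
    h.degr _ _ (hf.map_wt (tensBasis_mem_wt w)), deg_wordWt, LinearMap.smul_apply,
    LinearMap.id_apply, sub_self]

theorem uMinus_lie_mem {M : LieRep.{u} (gl N)} {W : Submodule ℂ M.V} (h0 : 0 ∈ idx N)
    (hW : ∀ i ∈ idxU N, ∀ v ∈ W, M.e i 0 v ∈ W) (x : uMinus N) :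
    ∀ v ∈ W, ⁅LieSubalgebra.inclusion (uMinus_le N) x, v⁆ ∈ W := by
  obtain ⟨x, hx⟩ := x
  intro v hv
  have hx' : x ∈ Submodule.span ℂ {A | ∃ i j, (i ∈ idxU N ∧ j = 0) ∧ A = matUnit i j} := hx
  have key : ∀ y (hy : y ∈ Submodule.span ℂ {A | ∃ i j, (i ∈ idxU N ∧ j = 0) ∧ A = matUnit i j})
      (hy' : y ∈ gl N), ⁅(⟨y, hy'⟩ : gl N), v⁆ ∈ W := by
    intro y hy
    induction hy using Submodule.span_induction with
    | zero =>
      intro hy'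
      have : (⟨0, hy'⟩ : gl N) = 0 := rfl
      rw [this, zero_lie]
      exact W.zero_mem
    | add a b ha hb iha ihb =>
      intro hy'
      have ha' : a ∈ gl N := uMinus_le N ha
      have hb' : b ∈ gl N := uMinus_le N hb
      have : (⟨a + b, hy'⟩ : gl N) = ⟨a, ha'⟩ + ⟨b, hb'⟩ := rfl
      rw [this, add_lie]
      exact W.add_mem (iha _) (ihb _)
    | smul c a ha iha =>
      intro hy'
      have ha' : a ∈ gl N := uMinus_le N ha
      have : (⟨c • a, hy'⟩ : gl N) = c • ⟨a, ha'⟩ := rfl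
      rw [this, smul_lie]
      exact W.smul_mem c (iha _)
    | mem a ha =>
      obtain ⟨i, j, ⟨hi, rfl⟩, rfl⟩ := ha
      intro hy'
      rw [M.lie_eq hi.2 h0 ⟨_, hy'⟩ rfl]
      exact hW i hi v hv
  exact key x hx' _

theorem IsFG.exists_generators {M : LieRep.{u} (gl N)} (h : IsFG M) (h0 : 0 ∈ idx N) :
    ∃ (r : ℕ) (d : Fin r → ℕ) (f : ∀ j, (tensPow (idxU N) (d j)).V →ₗ[ℂ] M.V),
      (∀ j, Commutes (idxU N) (tensPow (idxU N) (d j)).e M.e (f j)) ∧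
      ∀ W : Submodule ℂ M.V, (∀ i ∈ idxU N, ∀ v ∈ W, M.e i 0 v ∈ W) →
        (∀ j, LinearMap.range (f j) ≤ W) → W = ⊤ := by
  obtain ⟨E, φ, hE, htop⟩ := h
  obtain ⟨r, d, f, hf, hfE⟩ := (isPoly_iff E).mp hE
  let ψ : E.V →ₗ[ℂ] M.V := (M.resEquiv (LieSubalgebra.inclusion (glU_le N))).toLinearMap ∘ₗ
    (φ : E.V →ₗ[ℂ] (resU M).V)
  refine ⟨r, d, fun j => ψ ∘ₗ f j,
    fun j => ((resU_commutes M).comp (LieRep.commutes φ)).comp (hf j), fun W hW hfW => ?_⟩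
  let L : LieSubmodule ℂ (uMinus N) (M.res (LieSubalgebra.inclusion (uMinus_le N))).V :=
    { toSubmodule := W.comap (M.resEquiv (LieSubalgebra.inclusion (uMinus_le N))).toLinearMap
      lie_mem := fun {x m} hm => uMinus_lie_mem h0 hW x _ hm }
  have hψ : ∀ e, ψ e ∈ W := by
    suffices hle : ⊤ ≤ W.comap ψ from fun e => hle (x := e) trivial
    rw [← hfE]
    refine iSup_le fun j => ?_
    rintro _ ⟨x, rfl⟩
    exact hfW j ⟨x, rfl⟩
  have hL : (⊤ : LieSubmodule ℂ (uMinus N) _) ≤ L := by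
    rw [← htop, LieSubmodule.lieSpan_le]
    rintro _ ⟨e, rfl⟩
    exact hψ e
  rw [eq_top_iff]
  intro v _
  exact hL (x := (M.resEquiv (LieSubalgebra.inclusion (uMinus_le N))).symm v) trivial

/-- Monomials in the `e i 0` applied to words in the generators span. Those of weight `α` have
letters in the support of `α` and at most `deg α` factors, so they are finite in number. -/
theorem FiniteDimensional.of_generators {V : Type*} [AddCommGroup V] [Module ℂ V] {e : Ops V}
    (hs : IsSys (idx N) e) (h0 : 0 ∈ idx N) (hw : IsWeight (idxU N) e) {r : ℕ} {d : Fin r → ℕ}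
    {f : ∀ j, (tensPow (idxU N) (d j)).V →ₗ[ℂ] V}
    (hf : ∀ j, Commutes (idxU N) (tensPow (idxU N) (d j)).e e (f j))
    (hgen : ∀ W : Submodule ℂ V, (∀ i ∈ idxU N, ∀ v ∈ W, e i 0 v ∈ W) →
        (∀ j, LinearMap.range (f j) ≤ W) → W = ⊤) (α : ℕ →₀ ℕ) :
    FiniteDimensional ℂ (wt (idxU N) e α) := by
  let I := Σ j, {x : MonIdx N e (d j) // x.f = f j}
  let g : I → V := fun i => i.2.1.vec
  have htop : Submodule.span ℂ (Set.range g) = ⊤ := by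
    refine hgen _ (fun i hi v hv => ?_) fun j => ?_
    · suffices hle : Submodule.span ℂ (Set.range g) ≤
          (Submodule.span ℂ (Set.range g)).comap (e i 0) from hle hv
      rw [Submodule.span_le]
      rintro _ ⟨⟨j, x, hx⟩, rfl⟩
      exact Submodule.subset_span ⟨⟨j, x.cons hi, hx⟩, x.vec_cons hi⟩
    · rw [LinearMap.range_eq_map, ← (tensBasis (idxU N) (d j)).span_eq, Submodule.map_span_le]
      rintro _ ⟨w, rfl⟩
      refine Submodule.subset_span ⟨⟨j, ⟨f j, hf j, 0, Fin.elim0, fun q => q.elim0, fun b => w b,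
        fun b => (w b).2⟩, rfl⟩, ?_⟩
      exact wordVec_eq (f j) fun b => (w b).2
  have hle : wt (idxU N) e α ≤ Submodule.span ℂ (g '' {i | i.2.1.weight = α}) := by
    intro v hv
    have := mem_span_wt hw (fun i : I => i.2.1.vec_mem_wt hs h0) DiagStable.bot hv
      (by change v ∈ ⊥ ⊔ Submodule.span ℂ (Set.range g); rw [htop, sup_top_eq]; trivial)
    rwa [bot_sup_eq] at this
  have hfin : (g '' {i | i.2.1.weight = α}).Finite := by
    refine Set.Finite.subset (Set.finite_iUnion fun j : Fin r => Set.finite_iUnion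
      fun m : Fin (deg α + 1) => Set.finite_range
        fun x : (Fin m → α.support) × (Fin (d j) → α.support) =>
          mon e (wordVec (f j)) m (fun q => (x.1 q : ℕ)) (fun b => (x.2 b : ℕ))) ?_
    rintro _ ⟨⟨j, x, hx⟩, hxα, rfl⟩
    have hxα : x.weight = α := hxα
    have ha : ∀ q, x.a q ∈ α.support := fun q => by
      have := mem_support_letterWt x.a q
      rw [Finsupp.mem_support_iff, ← hxα, MonIdx.weight, Finsupp.add_apply]
      omega
    have hw : ∀ b, x.w b ∈ α.support := fun b => by
      have := mem_support_letterWt x.w b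
      rw [Finsupp.mem_support_iff, ← hxα, MonIdx.weight, Finsupp.add_apply]
      omega
    have hm : x.m < deg α + 1 := by
      rw [← hxα, MonIdx.weight, deg_add, deg_letterWt, deg_letterWt]
      omega
    refine Set.mem_iUnion.mpr ⟨j, Set.mem_iUnion.mpr ⟨⟨x.m, hm⟩,
      (fun q => ⟨x.a q, ha q⟩, fun b => ⟨x.w b, hw b⟩), ?_⟩⟩
    change mon e (wordVec (f j)) x.m x.a x.w = mon e (wordVec x.f) x.m x.a x.w
    rw [hx]
  have := FiniteDimensional.span_of_finite ℂ hfin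
  exact Submodule.finiteDimensional_of_le hle

theorem deg_le_of_mem_lowPart {V : Type*} [AddCommGroup V] [Module ℂ V] {e : Ops V}
    (hw : IsWeight (idxU N) e) {W : Submodule ℂ V} {D : ℕ} {α : ℕ →₀ ℕ} {v : V}
    (hv : v ∈ wt (idxU N) e α) (hvD : v ∈ lowPart N e W D) (h0 : v ≠ 0) : deg α < D := by
  by_contra hα
  have h1 : pr (idxU N) e {β | deg β < D} v = 0 := pr_of_notMem hw hα hv
  have h2 : lowPart N e W D ≤
      LinearMap.ker (pr (idxU N) e {β | deg β < D} - LinearMap.id) := by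
    refine iSup₂_le fun β hβ v hv => ?_
    rw [LinearMap.mem_ker, LinearMap.sub_apply, pr_of_mem hw hβ hv.2, LinearMap.id_apply, sub_self]
  have h3 := h2 hvD
  rw [LinearMap.mem_ker, LinearMap.sub_apply, h1, LinearMap.id_apply, zero_sub, neg_eq_zero] at h3
  exact h0 h3

/-- The part of degree at most `K` serves as the generating module; it is polynomial by
`finP_of_bounded`. -/
theorem IsO.isFG {M : LieRep.{u} (gl N)} (h : IsO ν N M.e) (h0 : 0 ∈ idx N) : IsFG M := by
  obtain ⟨K, hK⟩ := h.gen
  let a := M.resEquiv (LieSubalgebra.inclusion (glU_le N))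
  let Y := lowPart N M.e ⊤ (K + 1)
  have hY : Stable (idxU N) M.e Y := by
    intro i hi j hj
    suffices hle : Y ≤ Y.comap (M.e i j) from fun v hv => hle hv
    refine iSup₂_le fun α hα v hv => ?_
    obtain ⟨β, hβ, hm⟩ := h.exists_map_wt h0 hi.2 hj.2 (Or.inl (ne_zero_of_mem_idxU hj)) hv.2
    exact mem_lowPart (hβ.trans_lt hα) trivial hm
  let L := LieRep.subOfStable (M := resU M) (Y.comap a.toLinearMap)
    ((resU_commutes M).stable_comap hY)
  let i : L →ₗ[ℂ] M.V := a.toLinearMap ∘ₗ L.toSubmodule.subtype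
  have hi : Commutes (idxU N) ((resU M).ofSub L).e M.e i :=
    (resU_commutes M).comp (ofSub_commutes L)
  have hinj : Function.Injective i := a.injective.comp Subtype.val_injective
  refine ⟨(resU M).ofSub L, L.incl, (isPoly_iff _).mpr (finP_of_bounded (K := K)
    (LieRep.isSys _) (h.ind.of_injective hi hinj) (fun α => ?_) fun α v hv hv0 => ?_), ?_⟩
  · have := h.fin α
    exact Module.Finite.of_injective
      ((i.comp (wt (idxU N) ((resU M).ofSub L).e α).subtype).codRestrict (wt (idxU N) M.e α)
        fun v => hi.map_wt v.2)
      fun a b hab => Subtype.ext (hinj (by have := congrArg Subtype.val hab; exact this))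
  · refine Nat.le_of_lt_succ (deg_le_of_mem_lowPart h.isWeight (hi.map_wt hv) (W := ⊤) ?_ ?_)
    · exact v.2
    · exact fun h => hv0 (hinj (h.trans (map_zero i).symm))
  · set X := LieSubmodule.lieSpan ℂ (uMinus N) (Set.range fun e : L =>
      (M.resEquiv (LieSubalgebra.inclusion (uMinus_le N))).symm (M.resEquiv _ (L.incl e))) with hX
    have h1 := hK (X.toSubmodule.comap
      (M.resEquiv (LieSubalgebra.inclusion (uMinus_le N))).symm.toLinearMap) ?_ ?_
    · rw [eq_top_iff]
      intro v _
      have : M.resEquiv (LieSubalgebra.inclusion (uMinus_le N)) v ∈ X.toSubmodule.comap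
        (M.resEquiv (LieSubalgebra.inclusion (uMinus_le N))).symm.toLinearMap := by
        rw [h1]; trivial
      exact this
    · intro i hi v hv
      have hmem : matUnit i 0 ∈ uMinus N := Submodule.subset_span ⟨i, 0, ⟨hi, rfl⟩, rfl⟩
      have hl : ∀ m : (M.res (LieSubalgebra.inclusion (uMinus_le N))).V, m ∈ X →
          ⁅(⟨matUnit i 0, hmem⟩ : uMinus N), m⁆ ∈ X := fun m hm => X.lie_mem hm
      rw [Submodule.mem_comap, M.e_eq hi.2 h0]
      exact hl _ hv
    · intro α hα v hv
      change (M.resEquiv (LieSubalgebra.inclusion (uMinus_le N))).symm v ∈ X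
      refine LieSubmodule.subset_lieSpan ?_
      exact ⟨⟨a.symm v, mem_lowPart (Nat.lt_succ_of_le hα) trivial hv⟩, rfl⟩

/-- Each element of 𝔲⁺ lowers the degree by one, and degrees are natural numbers. -/
theorem IsO.isLocNilp {M : LieRep.{u} (gl N)} (h : IsO ν N M.e) (h0 : 0 ∈ idx N) :
    IsLocNilp M := by
  have step : ∀ (k : ℕ) (x : uPlus N), ∀ v ∈ lowPart N M.e ⊤ (k + 1),
      ⁅LieSubalgebra.inclusion (uPlus_le N) x, v⁆ ∈ lowPart N M.e ⊤ k := by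
    rintro k ⟨x, hx⟩ v hv
    have hx' : x ∈ Submodule.span ℂ {A | ∃ i j, (i = 0 ∧ j ∈ idxU N) ∧ A = matUnit i j} := hx
    have key : ∀ y (hy : y ∈ Submodule.span ℂ {A | ∃ i j, (i = 0 ∧ j ∈ idxU N) ∧ A = matUnit i j})
        (hy' : y ∈ gl N), ⁅(⟨y, hy'⟩ : gl N), v⁆ ∈ lowPart N M.e ⊤ k := by
      intro y hy
      induction hy using Submodule.span_induction with
      | zero =>
        intro hy'
        have : (⟨0, hy'⟩ : gl N) = 0 := rfl
        rw [this, zero_lie]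
        exact Submodule.zero_mem _
      | add a b ha hb iha ihb =>
        intro hy'
        have ha' : a ∈ gl N := uPlus_le N ha
        have hb' : b ∈ gl N := uPlus_le N hb
        have : (⟨a + b, hy'⟩ : gl N) = ⟨a, ha'⟩ + ⟨b, hb'⟩ := rfl
        rw [this, add_lie]
        exact Submodule.add_mem _ (iha _) (ihb _)
      | smul c a ha iha =>
        intro hy'
        have ha' : a ∈ gl N := uPlus_le N ha
        have : (⟨c • a, hy'⟩ : gl N) = c • ⟨a, ha'⟩ := rfl
        rw [this, smul_lie]
        exact Submodule.smul_mem _ c (iha _)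
      | mem a ha =>
        obtain ⟨i, j, ⟨rfl, hj⟩, rfl⟩ := ha
        intro hy'
        rw [M.lie_eq h0 hj.2 ⟨_, hy'⟩ rfl]
        suffices hle : lowPart N M.e ⊤ (k + 1) ≤ (lowPart N M.e ⊤ k).comap (M.e 0 j) from hle hv
        refine iSup₂_le fun α hα v hv => ?_
        rcases h.map_zero_left h0 hj hv.2 with h1 | ⟨β, hβ, h1⟩
        · rw [Submodule.mem_comap, h1]; exact Submodule.zero_mem _
        · refine mem_lowPart ?_ trivial h1
          rw [← hβ, deg_add, deg_single] at hα
          omega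
    exact key x hx' _
  have fold : ∀ (l : List (uPlus N)) (k : ℕ) (v : M.V), v ∈ lowPart N M.e ⊤ (k + l.length) →
      l.foldr (fun x t => ⁅LieSubalgebra.inclusion (uPlus_le N) x, t⁆) v ∈ lowPart N M.e ⊤ k := by
    intro l
    induction l with
    | nil => exact fun k v hv => hv
    | cons a l ih =>
      intro k v hv
      rw [List.foldr_cons]
      refine step k a _ (ih (k + 1) v ?_)
      rwa [List.length_cons, ← add_assoc, add_right_comm] at hv
  intro v
  obtain ⟨s, x, hx, rfl⟩ := exists_sum_wt h.isWeight v
  refine ⟨s.sup deg + 1, fun l hl => ?_⟩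
  have h1 := fold l 0 (∑ α ∈ s, x α) (Submodule.sum_mem _ fun α hα => mem_lowPart
    (by rw [hl, zero_add]; exact Nat.lt_succ_of_le (Finset.le_sup hα)) trivial (hx α))
  have h2 : lowPart N M.e ⊤ 0 = ⊥ := by
    rw [eq_bot_iff]
    exact iSup₂_le fun α hα => absurd hα (Nat.not_lt_zero _)
  rw [h2] at h1
  exact h1

/-- The category `O` in terms of matrix units. -/
theorem parO_iff (h0 : 0 ∈ idx N) (M : LieRep.{u} (gl N)) : parO ν N M ↔ IsO ν N M.e := by
  constructor
  · rintro ⟨h1, h2, h3, -⟩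
    have hind := (isIndPoly_resU_iff M).mp h1
    obtain ⟨r, d, f, hf, hgen⟩ := h3.exists_generators h0
    refine ⟨⟨M.isSys, hind, h2.degr h0 hind⟩, ⟨Finset.univ.sup d, fun W hW hWK => ?_⟩,
      FiniteDimensional.of_generators M.isSys h0 hind.isWeight hf hgen⟩
    refine hgen W hW fun j => ?_
    rw [LinearMap.range_eq_map, ← (tensBasis (idxU N) (d j)).span_eq, Submodule.map_span_le]
    rintro _ ⟨w, rfl⟩
    exact hWK _ (by rw [deg_wordWt]; exact Finset.le_sup (Finset.mem_univ j))
      ((hf j).map_wt (tensBasis_mem_wt w))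
  · intro h
    exact ⟨(isIndPoly_resU_iff M).mpr h.ind, h.hasDegree h0, h.isFG h0, h.isLocNilp h0⟩

end ParO

/-! ### Invariants as modules -/

section Modules

variable {S : Set ℕ} {M M' M'' : LieRep.{u} (glOn S)}

@[ext]
theorem LieRep.hom_ext {f g : M ⟶ M'} (h : ∀ m, LieRep.toLie f m = LieRep.toLie g m) : f = g :=
  LieModuleHom.ext h

theorem LieRep.isIso_of_bijective (f : M ⟶ M') (hf : Function.Bijective (LieRep.toLie f)) :
    IsIso f := by
  let q := LinearEquiv.ofBijective (LieRep.toLie f : M.V →ₗ[ℂ] M'.V) hf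
  have hq : ∀ m, LieRep.toLie f (q.symm m) = m := fun m => q.apply_symm_apply m
  let g : M' ⟶ M := LieRep.homOfCommutes q.symm.toLinearMap fun i hi j hj m => hf.1 (by
    have h1 := LieRep.commutes (LieRep.toLie f) i hi j hj (q.symm m)
    exact (hq _).trans (h1.trans (congrArg (M'.e i j) (hq m))).symm)
  exact ⟨g, LieModuleHom.ext fun m => hf.1 (hq _), LieModuleHom.ext fun m => hq m⟩

/-- Finite iterated extensions of polynomial modules. -/
inductive PF {S : Set ℕ} : LieRep.{u} (glOn S) → Prop
  | of_isPoly (M : LieRep.{u} (glOn S)) : IsPoly M → PF M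
  | of_ext (M : LieRep.{u} (glOn S)) (K : LieSubmodule ℂ (glOn S) M.V) :
      PF (M.ofSub K) → PF (M.ofQuot K) → PF M

theorem isPoly_of_injective (h : IsPoly M) (f : M'.V →ₗ⁅ℂ, glOn S⁆ M.V)
    (hf : Function.Injective f) : IsPoly M' :=
  (isPoly_iff M').mpr (((isPoly_iff M).mp h).of_injective (LieRep.commutes f) hf)

theorem isPoly_of_surjective (h : IsPoly M) (f : M.V →ₗ⁅ℂ, glOn S⁆ M'.V)
    (hf : Function.Surjective f) : IsPoly M' :=
  (isPoly_iff M').mpr (((isPoly_iff M).mp h).of_surjective (LieRep.commutes f) hf)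

/-- The homomorphism induced on a quotient. -/
def quotDesc (K : LieSubmodule ℂ (glOn S) M.V) (f : M.V →ₗ⁅ℂ, glOn S⁆ M'.V)
    (h : ∀ m ∈ K, f m = 0) : (M.V ⧸ K) →ₗ⁅ℂ, glOn S⁆ M'.V :=
  LieRep.homOfCommutes (M := M.ofQuot K) (M' := M')
    (K.toSubmodule.liftQ (f : M.V →ₗ[ℂ] M'.V) h) fun i hi j hj m => by
      obtain ⟨m, rfl⟩ := LieSubmodule.Quotient.surjective_mk' K m
      have h1 := LieRep.ofQuot_e K i j m
      exact (congrArg _ h1).trans (LieRep.commutes f i hi j hj m)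

theorem quotDesc_mk (K : LieSubmodule ℂ (glOn S) M.V) (f : M.V →ₗ⁅ℂ, glOn S⁆ M'.V)
    (h : ∀ m ∈ K, f m = 0) (m : M.V) : quotDesc K f h (LieSubmodule.Quotient.mk' K m) = f m := rfl

theorem quotDesc_injective (K : LieSubmodule ℂ (glOn S) M.V) (f : M.V →ₗ⁅ℂ, glOn S⁆ M'.V)
    (h : ∀ m ∈ K, f m = 0) (h' : ∀ m, f m = 0 → m ∈ K) :
    Function.Injective (quotDesc K f h) := by
  rw [injective_iff_map_eq_zero]
  intro m hm
  obtain ⟨m, rfl⟩ := LieSubmodule.Quotient.surjective_mk' K m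
  rw [quotDesc_mk] at hm
  exact (LieSubmodule.Quotient.mk_eq_zero _).mpr (h' m hm)

/-- The restriction of a homomorphism to submodules. -/
def subMap {K : LieSubmodule ℂ (glOn S) M.V} {K' : LieSubmodule ℂ (glOn S) M'.V}
    (f : M.V →ₗ⁅ℂ, glOn S⁆ M'.V) (h : ∀ m ∈ K, f m ∈ K') : K →ₗ⁅ℂ, glOn S⁆ K' where
  toLinearMap := (f : M.V →ₗ[ℂ] M'.V).restrict (p := K.toSubmodule) (q := K'.toSubmodule) h
  map_lie' := fun {x m} => Subtype.ext (f.map_lie x m)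

/-- Induction along the extension: the submodule `K` is pulled back, and its preimage and the
corresponding quotient embed in the two pieces. -/
theorem PF.of_injective (h : PF M) : ∀ {M' : LieRep.{u} (glOn S)} (f : M'.V →ₗ⁅ℂ, glOn S⁆ M.V),
    Function.Injective f → PF M' := by
  induction h with
  | of_isPoly M h => exact fun f hf => .of_isPoly _ (isPoly_of_injective h f hf)
  | of_ext M K _ _ ih1 ih2 =>
    intro M' f hf
    refine .of_ext M' (K.comap f) (ih1 (subMap f fun m hm => hm) fun a b hab => ?_)
      (ih2 (quotDesc (M' := M.ofQuot K) (K.comap f) ((LieSubmodule.Quotient.mk' K).comp f)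
        fun m hm => (LieSubmodule.Quotient.mk_eq_zero _).mpr hm)
        (quotDesc_injective (M' := M.ofQuot K) _ _ _
          fun m hm => (LieSubmodule.Quotient.mk_eq_zero K (m := f m)).mp hm))
    exact Subtype.ext (hf (congrArg Subtype.val hab))

theorem PF.of_surjective (h : PF M) : ∀ {M' : LieRep.{u} (glOn S)} (f : M.V →ₗ⁅ℂ, glOn S⁆ M'.V),
    Function.Surjective f → PF M' := by
  induction h with
  | of_isPoly M h => exact fun f hf => .of_isPoly _ (isPoly_of_surjective h f hf)
  | of_ext M K _ _ ih1 ih2 =>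
    intro M' f hf
    refine .of_ext M' (K.map f) (ih1 (subMap f fun m hm => LieSubmodule.mem_map_of_mem hm) ?_)
      (ih2 (quotDesc (M' := M'.ofQuot (K.map f)) K ((LieSubmodule.Quotient.mk' (K.map f)).comp f)
        fun m hm => (LieSubmodule.Quotient.mk_eq_zero _).mpr (LieSubmodule.mem_map_of_mem hm)) ?_)
    · rintro ⟨m', hm'⟩
      obtain ⟨m, hm, rfl⟩ := (LieSubmodule.mem_map _).mp hm'
      exact ⟨⟨m, hm⟩, rfl⟩
    · intro m'
      obtain ⟨m', rfl⟩ := LieSubmodule.Quotient.surjective_mk' _ m'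
      obtain ⟨m, rfl⟩ := hf m'
      exact ⟨LieSubmodule.Quotient.mk' K m, rfl⟩

/-- Extensions. -/
theorem PF.of_exact (h : PF M) (h'' : PF M'') (f : M.V →ₗ⁅ℂ, glOn S⁆ M'.V)
    (g : M'.V →ₗ⁅ℂ, glOn S⁆ M''.V) (hfg : ∀ m, g m = 0 → ∃ a, f a = m) : PF M' := by
  have h1 : PF (M'.ofQuot g.ker) := h''.of_injective
    (quotDesc g.ker g fun m hm => LieModuleHom.mem_ker.mp hm)
    (quotDesc_injective _ _ _ fun m hm => LieModuleHom.mem_ker.mpr hm)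
  refine .of_ext M' f.range (h.of_surjective
    (LieRep.homOfCommutes (M := M) (M' := M'.ofSub f.range)
      ((f : M.V →ₗ[ℂ] M'.V).codRestrict f.range.toSubmodule fun m => ⟨m, rfl⟩)
      fun i hi j hj m => Subtype.ext ((LieRep.commutes f i hi j hj m).trans
        (LieRep.ofSub_e (M := M') f.range i j ⟨f m, m, rfl⟩).symm)) ?_)
    (h1.of_surjective (M' := M'.ofQuot f.range) (quotDesc (M' := M'.ofQuot f.range) g.ker
      (LieSubmodule.Quotient.mk' f.range) fun m hm => ?_) ?_)
  · rintro ⟨_, m, rfl⟩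
    exact ⟨m, rfl⟩
  · obtain ⟨a, ha⟩ := hfg m (LieModuleHom.mem_ker.mp hm)
    exact (LieSubmodule.Quotient.mk_eq_zero _).mpr ⟨a, ha⟩
  · intro m
    obtain ⟨m, rfl⟩ := LieSubmodule.Quotient.surjective_mk' _ m
    exact ⟨LieSubmodule.Quotient.mk' g.ker m, rfl⟩

theorem isPoly_of_subsingleton [Subsingleton M.V] : IsPoly M :=
  ⟨0, Fin.elim0, 0, 0, fun _ => Subsingleton.elim _ _⟩

end Modules

/-! ### Invariants of modules over matrices as vectors of weight zero -/

section Invariants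

variable {n n' N : ℕ∞} {ν : ℂ}

theorem idxPerp_eq (n N : ℕ∞) : idxPerp n N = idx N \ idx n := by
  ext i
  exact ⟨fun h => ⟨h.2, fun h' => absurd h.1 (not_le.mpr h')⟩, fun h => ⟨not_lt.mp h.2, h.1⟩⟩

/-- The inclusion of the invariants. -/
def invMap (h : n ≤ N) (M : LieRep.{u} (gl N)) : ((glInv h).obj M).V →ₗ[ℂ] M.V :=
  (M.resEquiv (LieSubalgebra.inclusion (gl_le h))).toLinearMap ∘ₗ
    (M.invSub _ _ (gl_comm_glPerp h)).toSubmodule.subtype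

theorem invMap_injective (h : n ≤ N) (M : LieRep.{u} (gl N)) : Function.Injective (invMap h M) :=
  fun _ _ hab => Subtype.ext ((M.resEquiv (LieSubalgebra.inclusion (gl_le h))).injective hab)

theorem invMap_commutes (h : n ≤ N) (M : LieRep.{u} (gl N)) :
    Commutes (idx n) ((glInv h).obj M).e M.e (invMap h M) := by
  intro i hi j hj m
  have h1 := ofSub_commutes (M.invSub _ _ (gl_comm_glPerp h)) i hi j hj m
  exact (congrArg (M.resEquiv (LieSubalgebra.inclusion (gl_le h))) h1).trans
    (LieRep.res_e (idx_mono h) i j hi hj _)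

theorem invMap_naturality (h : n ≤ N) {M M' : LieRep.{u} (gl N)} (f : M ⟶ M')
    (m : ((glInv h).obj M).V) :
    invMap h M' (LieRep.toLie ((glInv h).map f) m) = LieRep.toLie f (invMap h M m) := rfl

/-- Invariants are killed by the diagonal units of 𝔤𝔩_n^⊥; conversely `map_zero_wt` shows that
weight zero implies invariance. -/
theorem range_invMap (h : n ≤ N) (M : LieRep.{u} (gl N))
    (hw : IsWeight (idx N \ idx n) M.e) :
    LinearMap.range (invMap h M) = wt (idx N \ idx n) M.e 0 := by
  have hperp : ∀ {i}, i ∈ idx N \ idx n → i ∈ idxPerp n N := fun hi => idxPerp_eq n N ▸ hi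
  apply le_antisymm
  · rintro _ ⟨m, rfl⟩
    rw [mem_wt_zero]
    intro i hi
    rw [M.e_eq hi.1 hi.1]
    exact m.2 ⟨matUnit i i, matUnit_mem (hperp hi) (hperp hi)⟩
  · intro v hv
    refine ⟨⟨(M.resEquiv (LieSubalgebra.inclusion (gl_le h))).symm v, fun y => ?_⟩,
      (M.resEquiv (LieSubalgebra.inclusion (gl_le h))).apply_symm_apply v⟩
    rw [LinearEquiv.apply_symm_apply]
    refine glOn_induction (p := fun y => ⁅LieSubalgebra.inclusion (glPerp_le n N) y, v⁆ = 0)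
      ?_ ?_ ?_ ?_ y
    · intro i hi j hj
      have hj' : j ∈ idx N \ idx n := idxPerp_eq n N ▸ hj
      have h1 := map_zero_wt M.isSys hw Set.sdiff_subset hi.2 hj' hv
      rw [M.e_eq hi.2 hj.2] at h1
      exact h1
    · rw [_root_.map_zero, zero_lie]
    · intro x y hx hy
      rw [_root_.map_add, add_lie, hx, hy, add_zero]
    · intro c x hx
      rw [_root_.map_smul, smul_lie, hx, smul_zero]

theorem invMap_isInv (h : n ≤ N) (M : LieRep.{u} (gl N))
    (hw : IsWeight (idx N \ idx n) M.e) :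
    IsInv (idx n) (idx N) ((glInv h).obj M).e M.e (invMap h M) :=
  ⟨invMap_commutes h M, invMap_injective h M, range_invMap h M hw⟩

theorem IsO.isWeight_diff {V : Type*} [AddCommGroup V] [Module ℂ V] {e : Ops V} (h : IsO ν N e)
    (hn : 0 ∈ idx n) : IsWeight (idx N \ idx n) e := by
  rw [idx_diff hn]
  exact h.isWeight.mono Set.sdiff_subset

theorem isO_glInv (h : n ≤ N) (hn : 0 ∈ idx n) {M : LieRep.{u} (gl N)} (hM : IsO ν N M.e) :
    IsO ν n ((glInv h).obj M).e :=
  hM.inv hn h (invMap_isInv h M (hM.isWeight_diff hn))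

theorem invMapsO (h : n ≤ N) (hn : 0 ∈ idx n) : InvMapsO.{u} ν h := fun M hM =>
  (parO_iff hn _).mpr (isO_glInv h hn ((parO_iff (idx_mono h hn) M).mp hM))

theorem isPoly_glInv (h : n ≤ N) {M : LieRep.{u} (gl N)} (hM : IsPoly M) :
    IsPoly ((glInv h).obj M) := by
  rw [isPoly_iff] at hM ⊢
  exact hM.inv (idx_mono h) (invMap_isInv h M (hM.indP.isWeight.mono Set.sdiff_subset))

theorem zero_mem_idx_nn (i : ℕ) : 0 ∈ idx (nn i) := by
  change ((0 : ℕ) : ℕ∞) < ((i + 1 : ℕ) : ℕ∞)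
  exact_mod_cast Nat.succ_pos i

/-- The composition of two functors of invariants. -/
theorem invMap_comp_range (h : n ≤ n') (h' : n' ≤ N) (hn : 0 ∈ idx n) {M : LieRep.{u} (gl N)}
    (hM : IsO ν N M.e) (x : ((glInv h).obj ((glInv h').obj M)).V) :
    invMap h' M (invMap h _ x) ∈ LinearMap.range (invMap (h.trans h') M) := by
  have hn' := idx_mono h hn
  have hM' := isO_glInv h' hn' hM
  rw [range_invMap _ _ (hM.isWeight_diff hn), mem_wt_zero]
  have h1 : invMap h _ x ∈ wt (idx n' \ idx n) ((glInv h').obj M).e 0 := by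
    rw [← range_invMap h _ (hM'.isWeight_diff hn)]; exact ⟨x, rfl⟩
  have h2 : invMap h' M (invMap h _ x) ∈ wt (idx N \ idx n') M.e 0 := by
    rw [← range_invMap h' _ (hM.isWeight_diff hn')]; exact ⟨_, rfl⟩
  rw [mem_wt_zero] at h1 h2
  intro i hi
  by_cases hin : i ∈ idx n'
  · rw [← invMap_commutes h' M i hin i hin, h1 i ⟨hin, hi.2⟩, map_zero]
  · exact h2 i ⟨hi.1, hin⟩

theorem invMap_invIncl (h : n ≤ n') (h' : n' ≤ N) (M : LieRep.{u} (gl N))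
    (x : ((glInv (h.trans h')).obj M).V) :
    invMap h' M (invMap h _ (LieRep.toLie ((invIncl h h').app M) x)) =
      invMap (h.trans h') M x := rfl

/-- Weight zero outside `n` is weight zero outside `n'` together with weight zero at the indices
between `n` and `n'`. -/
theorem isIso_invIncl (h : n ≤ n') (h' : n' ≤ N) (hn : 0 ∈ idx n) {M : LieRep.{u} (gl N)}
    (hM : IsO ν N M.e) : IsIso ((invIncl h h').app M) := by
  refine LieRep.isIso_of_bijective _ ⟨fun a b hab => ?_, fun x => ?_⟩
  · apply invMap_injective (h.trans h') M
    rw [← invMap_invIncl h h' M a, ← invMap_invIncl h h' M b, hab]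
  · obtain ⟨y, hy⟩ := invMap_comp_range h h' hn hM x
    refine ⟨y, invMap_injective h _ (invMap_injective h' M ?_)⟩
    rw [invMap_invIncl, hy]

theorem invCompatible (i : ℕ) : InvCompatible.{u} ν i := fun M hM =>
  isIso_invIncl _ _ (zero_mem_idx_nn i) ((parO_iff (by simp [idx]) M).mp hM)

end Invariants

/-! ### Subquotients modulo polynomial modules -/

section Subquotients

variable {S : Set ℕ} {M M' : LieRep.{u} (glOn S)}

/-- The subquotient `B / (A ∩ B)` is an iterated extension of polynomial modules. -/
def PFq (A B : LieSubmodule ℂ (glOn S) M.V) : Prop :=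
  ∃ (P : LieRep.{u} (glOn S)) (g : B →ₗ⁅ℂ, glOn S⁆ P.V), PF P ∧ ∀ b, g b = 0 → (b : M.V) ∈ A

variable {A A' B B' C Y : LieSubmodule ℂ (glOn S) M.V}

theorem PFq.mono (h : PFq A B) (hA : A ≤ A') (hB : B' ≤ B) : PFq A' B' := by
  obtain ⟨P, g, hP, hg⟩ := h
  exact ⟨P, g.comp (LieSubmodule.inclusion hB), hP, fun b hb => hA (hg _ hb)⟩

theorem PFq.of_le (h : B ≤ A) : PFq A B :=
  ⟨M.ofSub ⊥, 0, .of_isPoly _ isPoly_of_subsingleton, fun b _ => h b.2⟩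

/-- The subquotient `B / (A ∩ B)`. -/
abbrev subq (A B : LieSubmodule ℂ (glOn S) M.V) : LieRep.{u} (glOn S) :=
  (M.ofSub B).ofQuot (A.comap B.incl)

theorem PFq.pf_subq (h : PFq A B) : PF (subq A B) := by
  obtain ⟨P, g, hP, hg⟩ := h
  have h1 : PF ((M.ofSub B).ofQuot g.ker) := hP.of_injective
    (quotDesc (M := M.ofSub B) g.ker g fun m hm => LieModuleHom.mem_ker.mp hm)
    (quotDesc_injective (M := M.ofSub B) _ _ _ fun m hm => LieModuleHom.mem_ker.mpr hm)
  refine h1.of_surjective (M' := subq A B) (quotDesc (M := M.ofSub B) (M' := subq A B) g.ker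
    (LieSubmodule.Quotient.mk' _) fun m hm => ?_) fun m => ?_
  · exact (LieSubmodule.Quotient.mk_eq_zero (A.comap B.incl)).mpr (hg m (LieModuleHom.mem_ker.mp hm))
  · obtain ⟨m, rfl⟩ := LieSubmodule.Quotient.surjective_mk' _ m
    exact ⟨LieSubmodule.Quotient.mk' g.ker m, rfl⟩

theorem PFq.of_subq {P : LieRep.{u} (glOn S)} (hP : PF P) (g : P.V →ₗ⁅ℂ, glOn S⁆ (subq A B).V)
    (hg : Function.Surjective g) : PFq A B :=
  ⟨subq A B, LieSubmodule.Quotient.mk' _, hP.of_surjective g hg,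
    fun _ hb => (LieSubmodule.Quotient.mk_eq_zero (A.comap B.incl)).mp hb⟩

theorem PFq.of_hom {A' B' : LieSubmodule ℂ (glOn S) M'.V} (h : PFq A B)
    (φ : B →ₗ⁅ℂ, glOn S⁆ B') (hA : ∀ b : B, (b : M.V) ∈ A → (φ b : M'.V) ∈ A')
    (hs : ∀ b' : B', ∃ b : B, ((φ b - b' : B') : M'.V) ∈ A') : PFq A' B' := by
  let q : B' →ₗ⁅ℂ, glOn S⁆ (subq A' B').V := LieSubmodule.Quotient.mk' (A'.comap B'.incl)
  have hq : ∀ b', q b' = 0 ↔ (b' : M'.V) ∈ A' := fun b' =>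
    LieSubmodule.Quotient.mk_eq_zero (A'.comap B'.incl)
  have hqs : Function.Surjective q := LieSubmodule.Quotient.surjective_mk' _
  let g : (subq A B).V →ₗ⁅ℂ, glOn S⁆ (subq A' B').V :=
    quotDesc (M := M.ofSub B) (M' := subq A' B') (A.comap B.incl) (q.comp φ)
      fun m hm => (hq _).mpr (hA m hm)
  refine PFq.of_subq h.pf_subq g fun m => ?_
  obtain ⟨b', rfl⟩ := hqs m
  obtain ⟨b, hb⟩ := hs b'
  have h1 := (hq _).mpr hb
  rw [map_sub, sub_eq_zero] at h1
  exact ⟨LieSubmodule.Quotient.mk' (A.comap B.incl) b, h1⟩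

theorem PFq.map (h : PFq A B) (f : M.V →ₗ⁅ℂ, glOn S⁆ M'.V) :
    PFq (M := M') (A.map f) (B.map f) := by
  refine h.of_hom (M' := M') (subMap f fun m hm => LieSubmodule.mem_map_of_mem hm)
    (fun b hb => LieSubmodule.mem_map_of_mem hb) ?_
  rintro ⟨m, hm⟩
  obtain ⟨b, hb, rfl⟩ := (LieSubmodule.mem_map _).mp hm
  refine ⟨⟨b, hb⟩, ?_⟩
  change f b - f b ∈ _
  rw [sub_self]
  exact zero_mem _

theorem PFq.comap {A B : LieSubmodule ℂ (glOn S) M'.V} (h : PFq A B)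
    (f : M.V →ₗ⁅ℂ, glOn S⁆ M'.V) : PFq (M := M) (A.comap f) (B.comap f) := by
  obtain ⟨P, g, hP, hg⟩ := h
  exact ⟨P, g.comp (subMap f fun m hm => hm), hP, fun b hb => hg _ hb⟩

theorem PFq.inf (h : PFq A B) (Y : LieSubmodule ℂ (glOn S) M.V) : PFq (A ⊓ Y) (B ⊓ Y) := by
  obtain ⟨P, g, hP, hg⟩ := h
  exact ⟨P, g.comp (LieSubmodule.inclusion inf_le_left), hP, fun b hb => ⟨hg _ hb, b.2.2⟩⟩

theorem PFq.sup (h : PFq A B) (Y : LieSubmodule ℂ (glOn S) M.V) : PFq (A ⊔ Y) (B ⊔ Y) := by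
  refine h.of_hom (LieSubmodule.inclusion le_sup_left)
    (fun b hb => (le_sup_left : A ≤ A ⊔ Y) hb) ?_
  rintro ⟨m, hm⟩
  obtain ⟨b, hb, y, hy, rfl⟩ := (LieSubmodule.mem_sup B Y m).mp hm
  refine ⟨⟨b, hb⟩, ?_⟩
  change b - (b + y) ∈ A ⊔ Y
  rw [sub_add_cancel_left]
  exact neg_mem ((le_sup_right : Y ≤ A ⊔ Y) hy)

/-- Uses the exact sequence formed by the subquotients of `B ⊓ C` by `A`, of `C` by `A`, and of `C`
by `B`. -/
theorem PFq.trans (h : PFq A B) (h' : PFq B C) (hAB : A ≤ B) : PFq A C := by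
  have h1 := (h.mono le_rfl (inf_le_left : B ⊓ C ≤ B)).pf_subq
  have h2 := h'.pf_subq
  have hPF : PF (subq A C) := by
    refine PF.of_exact (M' := subq A C) h1 h2
      (quotDesc (M := M.ofSub (B ⊓ C)) (M' := subq A C) _
        ((LieSubmodule.Quotient.mk' _).comp (LieSubmodule.inclusion inf_le_right)) fun m hm => ?_)
      (quotDesc (M := M.ofSub C) (M' := subq B C) _ (LieSubmodule.Quotient.mk' _) fun m hm => ?_)
      fun m hm => ?_
    · exact (LieSubmodule.Quotient.mk_eq_zero (A.comap C.incl)).mpr hm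
    · exact (LieSubmodule.Quotient.mk_eq_zero (B.comap C.incl)).mpr (hAB hm)
    · obtain ⟨m, rfl⟩ := LieSubmodule.Quotient.surjective_mk' _ m
      exact ⟨LieSubmodule.Quotient.mk' _
        ⟨m.1, (LieSubmodule.Quotient.mk_eq_zero (B.comap C.incl)).mp hm, m.2⟩, rfl⟩
  exact .of_subq hPF LieModuleHom.id Function.surjective_id

theorem PFq.sup_bot (h : PFq ⊥ A) (h' : PFq ⊥ B) : PFq ⊥ (A ⊔ B) :=
  h'.trans ((h.sup B).mono (by rw [bot_sup_eq]) le_rfl) bot_le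

theorem pFq_bot_iff : PFq ⊥ A ↔ PF (M.ofSub A) := by
  constructor
  · rintro ⟨P, g, hP, hg⟩
    refine hP.of_injective (M' := M.ofSub A) g ((injective_iff_map_eq_zero g).mpr fun b hb => ?_)
    exact Subtype.ext ((LieSubmodule.mem_bot _).mp (hg b hb))
  · exact fun h => ⟨_, LieModuleHom.id, h, fun b hb => (LieSubmodule.mem_bot _).mpr (by
      have : b = 0 := hb
      rw [this]; rfl)⟩

theorem pFq_top_iff : PFq A ⊤ ↔ PF (M.ofQuot A) := by
  constructor
  · intro h
    refine h.pf_subq.of_surjective (M' := M.ofQuot A) (quotDesc (M := M.ofSub ⊤) (M' := M.ofQuot A) _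
      ((LieSubmodule.Quotient.mk' A).comp (⊤ : LieSubmodule ℂ (glOn S) M.V).incl) fun m hm =>
        (LieSubmodule.Quotient.mk_eq_zero A (m := m.1)).mpr hm) fun m => ?_
    obtain ⟨m, rfl⟩ := LieSubmodule.Quotient.surjective_mk' _ m
    exact ⟨LieSubmodule.Quotient.mk' _ ⟨m, trivial⟩, rfl⟩
  · exact fun h => ⟨_, (LieSubmodule.Quotient.mk' A).comp (⊤ : LieSubmodule ℂ (glOn S) M.V).incl, h,
      fun b hb => (LieSubmodule.Quotient.mk_eq_zero A (m := b.1)).mp hb⟩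

/-- No non-zero quotient and no non-zero submodule is an iterated extension of polynomial modules. -/
def IsLocal (M : LieRep.{u} (glOn S)) : Prop :=
  (∀ A : LieSubmodule ℂ (glOn S) M.V, PFq A ⊤ → A = ⊤) ∧
    ∀ A : LieSubmodule ℂ (glOn S) M.V, PFq ⊥ A → A = ⊥

theorem IsLocal.top (h : IsLocal M) (hA : PFq A ⊤) : A = ⊤ := h.1 A hA

theorem IsLocal.bot (h : IsLocal M) (hA : PFq ⊥ A) : A = ⊥ := h.2 A hA

/-- The lattice of submodules has finite length. -/
def FinLen (M : LieRep.{u} (glOn S)) : Prop :=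
  ∃ (k : ℕ) (φ : LieSubmodule ℂ (glOn S) M.V → Fin (k + 1)), StrictMono φ

/-- The submodules with quotient in the class are closed under intersection, because the class is
closed under submodules and extensions; so a minimal one is the least. -/
theorem FinLen.exists_core (h : FinLen M) (B : LieSubmodule ℂ (glOn S) M.V) :
    ∃ A ≤ B, PFq A B ∧ ∀ A', PFq A' B → A ≤ A' := by
  obtain ⟨k, φ, hφ⟩ := h
  have : WellFoundedLT (LieSubmodule ℂ (glOn S) M.V) := hφ.wellFoundedLT
  obtain ⟨A, hA, hmin⟩ := wellFounded_lt.has_min {A | A ≤ B ∧ PFq A B} ⟨B, le_rfl, .of_le le_rfl⟩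
  refine ⟨A, hA.1, hA.2, fun A' hA' => ?_⟩
  have h1 : PFq (A ⊓ A') B :=
    ((hA'.inf A).mono (inf_comm A' A).le le_rfl).trans (hA.2.mono (le_inf hA.1 le_rfl) le_rfl)
      (inf_le_left.trans (le_inf hA.1 le_rfl))
  by_contra hle
  exact hmin _ ⟨inf_le_left.trans hA.1, h1⟩ (inf_le_left.lt_of_ne fun h => hle (inf_eq_left.mp h))

theorem FinLen.exists_torsion (h : FinLen M) :
    ∃ A : LieSubmodule ℂ (glOn S) M.V, PFq ⊥ A ∧ ∀ A', PFq ⊥ A' → A' ≤ A := by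
  obtain ⟨k, φ, hφ⟩ := h
  have : WellFoundedGT (LieSubmodule ℂ (glOn S) M.V) := hφ.wellFoundedGT
  obtain ⟨A, hA, hmax⟩ := wellFounded_gt.has_min {A : LieSubmodule ℂ (glOn S) M.V | PFq ⊥ A}
    ⟨⊥, .of_le le_rfl⟩
  refine ⟨A, hA, fun A' hA' => ?_⟩
  by_contra hle
  exact hmax (A ⊔ A') (hA.sup_bot hA') (le_sup_left.lt_of_ne fun h => hle (sup_eq_left.mp h.symm))

/-- The least submodule of `B` with quotient an iterated extension of polynomial modules. -/
def core (h : FinLen M) (B : LieSubmodule ℂ (glOn S) M.V) : LieSubmodule ℂ (glOn S) M.V :=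
  (h.exists_core B).choose

theorem core_le (h : FinLen M) (B : LieSubmodule ℂ (glOn S) M.V) : core h B ≤ B :=
  (h.exists_core B).choose_spec.1

theorem pFq_core (h : FinLen M) (B : LieSubmodule ℂ (glOn S) M.V) : PFq (core h B) B :=
  (h.exists_core B).choose_spec.2.1

theorem core_le_of_pFq (h : FinLen M) (hA : PFq A B) : core h B ≤ A :=
  (h.exists_core B).choose_spec.2.2 A hA

theorem core_mono (h : FinLen M) (hAB : A ≤ B) : core h A ≤ core h B :=
  core_le_of_pFq h ((pFq_core h B).mono le_rfl hAB)

theorem core_core (h : FinLen M) (B : LieSubmodule ℂ (glOn S) M.V) :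
    core h (core h B) = core h B :=
  le_antisymm (core_le h _) (core_le_of_pFq h
    ((pFq_core h _).trans (pFq_core h B) (core_le h _)))

/-- The largest submodule that is an iterated extension of polynomial modules. -/
def torsion (h : FinLen M) : LieSubmodule ℂ (glOn S) M.V := h.exists_torsion.choose

theorem pFq_torsion (h : FinLen M) : PFq ⊥ (torsion h) := h.exists_torsion.choose_spec.1

theorem le_torsion (h : FinLen M) (hA : PFq ⊥ A) : A ≤ torsion h :=
  h.exists_torsion.choose_spec.2 A hA

/-- Passing to `B = core h B` removes the quotients, and a further quotient of `B` cannot create new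
ones. Dividing by the largest submodule in the class then removes the submodules, by closure under
extensions. -/
theorem IsLocal.of_core (h : FinLen M) (hB : core h B = B)
    (h' : FinLen (M.ofSub B)) : IsLocal ((M.ofSub B).ofQuot (torsion h')) := by
  refine ⟨fun A hA => ?_, fun A hA => ?_⟩
  · have h1 := ((hA.comap (M := M.ofSub B) (LieSubmodule.Quotient.mk' (torsion h'))).map
      (M' := M) B.incl)
    have h0 : (⊤ : LieSubmodule ℂ (glOn S) _).comap (LieSubmodule.Quotient.mk' (torsion h')) = ⊤ :=
      eq_top_iff.mpr fun _ _ => trivial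
    rw [h0, LieModuleHom.map_top, LieSubmodule.range_incl] at h1
    have h2 := hB ▸ core_le_of_pFq h h1
    rw [eq_top_iff]
    intro m _
    obtain ⟨m, rfl⟩ := LieSubmodule.Quotient.surjective_mk' _ m
    obtain ⟨b, hb, hbm⟩ := (LieSubmodule.mem_map _).mp (h2 m.2)
    have : b = m := Subtype.ext hbm
    exact this ▸ hb
  · have h1 := hA.comap (M := M.ofSub B) (LieSubmodule.Quotient.mk' (torsion h'))
    have h2 : (⊥ : LieSubmodule ℂ (glOn S) _).comap (LieSubmodule.Quotient.mk' (torsion h')) =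
        torsion h' := LieSubmodule.Quotient.mk'_ker (torsion h')
    rw [h2] at h1
    have h3 := le_torsion h' ((pFq_torsion h').trans h1 bot_le)
    rw [eq_bot_iff]
    intro m hm
    obtain ⟨m, rfl⟩ := LieSubmodule.Quotient.surjective_mk' _ m
    exact (LieSubmodule.mem_bot _).mpr ((LieSubmodule.Quotient.mk_eq_zero _).mpr (h3 hm))

theorem IsLocal.core_top (hM : IsLocal M) (h : FinLen M) : core h ⊤ = ⊤ :=
  hM.top (pFq_core h ⊤)

/-- Submodules without quotients that are extensions of polynomial modules are local. -/
theorem IsLocal.ofSub (hM : IsLocal M) (h : FinLen M) (hB : core h B = B) :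
    IsLocal (M.ofSub B) := by
  refine ⟨fun A hA => ?_, fun A hA => ?_⟩
  · have h1 := hA.map (M' := M) B.incl
    rw [LieModuleHom.map_top, LieSubmodule.range_incl] at h1
    have h2 := hB ▸ core_le_of_pFq h h1
    rw [eq_top_iff]
    intro m _
    obtain ⟨b, hb, hbm⟩ := (LieSubmodule.mem_map _).mp (h2 m.2)
    exact (Subtype.ext hbm : b = m) ▸ hb
  · have h1 := hA.map (M' := M) B.incl
    rw [LieSubmodule.map_bot] at h1
    have h2 := hM.bot h1
    rw [eq_bot_iff]
    intro m hm
    have h3 : (m : M.V) ∈ A.map B.incl := LieSubmodule.mem_map_of_mem hm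
    rw [h2] at h3
    exact (LieSubmodule.mem_bot _).mpr (Subtype.ext ((LieSubmodule.mem_bot _).mp h3))

/-- There is a chain of submodules with `p` steps that are not iterated extensions of polynomial
modules. -/
def HasChain (M : LieRep.{u} (glOn S)) (p : ℕ) : Prop :=
  ∃ A : ℕ → LieSubmodule ℂ (glOn S) M.V, Monotone A ∧ ∀ i < p, ¬ PFq (A i) (A (i + 1))

theorem HasChain.of_injective {p : ℕ} (h : HasChain M p) (f : M.V →ₗ⁅ℂ, glOn S⁆ M'.V)
    (hf : Function.Injective f) : HasChain M' p := by
  obtain ⟨A, hA, hp⟩ := h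
  refine ⟨fun i => (A i).map f, fun i j hij => LieSubmodule.map_mono (hA hij), fun i hi hq => ?_⟩
  refine hp i hi ((hq.comap f).mono ?_ (LieSubmodule.le_comap_map _ _))
  intro m hm
  obtain ⟨a, ha, ham⟩ := (LieSubmodule.mem_map _).mp hm
  exact hf ham ▸ ha

theorem HasChain.of_surjective {p : ℕ} (h : HasChain M' p) (f : M.V →ₗ⁅ℂ, glOn S⁆ M'.V)
    (hf : Function.Surjective f) : HasChain M p := by
  obtain ⟨A, hA, hp⟩ := h
  refine ⟨fun i => (A i).comap f, fun i j hij m hm => hA hij hm, fun i hi hq => ?_⟩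
  refine hp i hi ((hq.map f).mono ?_ ?_)
  · intro m hm
    obtain ⟨a, ha, rfl⟩ := (LieSubmodule.mem_map _).mp hm
    exact ha
  · intro m hm
    obtain ⟨a, rfl⟩ := hf m
    exact LieSubmodule.mem_map_of_mem hm

end Subquotients

/-! ### The Serre quotient as the category of local modules -/

section SerreQuotient

variable {ν : ℂ} {N : ℕ∞}

theorem parO_of_injective (h0 : 0 ∈ idx N) {M M' : LieRep.{u} (gl N)} (hM : parO ν N M)
    (f : M'.V →ₗ⁅ℂ, gl N⁆ M.V) (hf : Function.Injective f) : parO ν N M' :=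
  (parO_iff h0 M').mpr (((parO_iff h0 M).mp hM).of_injective h0 (LieRep.commutes f) hf)

theorem parO_of_surjective (h0 : 0 ∈ idx N) {M M' : LieRep.{u} (gl N)} (hM : parO ν N M)
    (f : M.V →ₗ⁅ℂ, gl N⁆ M'.V) (hf : Function.Surjective f) : parO ν N M' :=
  (parO_iff h0 M').mpr (((parO_iff h0 M).mp hM).of_surjective (LieRep.commutes f) hf h0)

theorem parO_ofSub (h0 : 0 ∈ idx N) {M : LieRep.{u} (gl N)} (hM : parO ν N M)
    (K : LieSubmodule ℂ (gl N) M.V) : parO ν N (M.ofSub K) :=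
  parO_of_injective h0 (M' := M.ofSub K) hM K.incl Subtype.val_injective

theorem parO_ofQuot (h0 : 0 ∈ idx N) {M : LieRep.{u} (gl N)} (hM : parO ν N M)
    (K : LieSubmodule ℂ (gl N) M.V) : parO ν N (M.ofQuot K) :=
  parO_of_surjective h0 (M' := M.ofQuot K) hM (LieSubmodule.Quotient.mk' K)
    (LieSubmodule.Quotient.surjective_mk' K)

/-- Submodules are determined by their intersection with a fixed finite-dimensional space, so the
dimension of this intersection is strictly increasing. -/
theorem finLen_of_parO (h0 : 0 ∈ idx N) {M : LieRep.{u} (gl N)} (hM : parO ν N M) : FinLen M := by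
  obtain ⟨P, hP, h⟩ := ((parO_iff h0 M).mp hM).exists_finite_detect h0
  refine ⟨Module.finrank ℂ P, fun W => ⟨Module.finrank ℂ ↥(W.toSubmodule ⊓ P),
    Nat.lt_succ_of_le (Submodule.finrank_mono inf_le_right)⟩, fun W W' hWW => ?_⟩
  have : FiniteDimensional ℂ ↥(W'.toSubmodule ⊓ P) := Submodule.finiteDimensional_inf_right _ _
  refine Submodule.finrank_lt_finrank_of_lt (lt_of_le_of_ne (inf_le_inf_right P hWW.le) fun heq => ?_)
  exact hWW.not_ge (h W.toSubmodule W'.toSubmodule (LieRep.stable W) (LieRep.stable W')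
    (heq ▸ inf_le_left))

/-- The localization inverts inclusions whose cokernel is an iterated extension of polynomial
modules. -/
theorem isIso_piHat_of_injective (h0 : 0 ∈ idx N) {P : LieRep.{u} (gl N)} (hP : PF P) :
    ∀ {A M : OCat.{u} ν N} (f : A ⟶ M) (g : M.obj.V →ₗ⁅ℂ, gl N⁆ P.V),
      Function.Injective (LieRep.toLie f.hom) →
      (∀ m, g m = 0 ↔ ∃ a, LieRep.toLie f.hom a = m) → IsIso ((piHat ν N).map f) := by
  induction hP with
  | of_isPoly P hP =>
    intro A M f g hf hg
    refine MorphismProperty.Q_inverts _ f ⟨?_, ?_⟩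
    · have : Subsingleton (LieRep.toLie f.hom).ker := ⟨fun a b => Subtype.ext (hf
        ((LieModuleHom.mem_ker.mp a.2).trans (LieModuleHom.mem_ker.mp b.2).symm))⟩
      exact isPoly_of_subsingleton
    · refine isPoly_of_injective (M' := M.obj.ofQuot _) hP (quotDesc _ g fun m hm => ?_)
        (quotDesc_injective _ _ _ fun m hm => ?_)
      · obtain ⟨a, ha⟩ := (LieModuleHom.mem_range _ _).mp hm
        exact (hg m).mpr ⟨a, ha⟩
      · exact (LieModuleHom.mem_range _ _).mpr ((hg m).mp hm)
  | of_ext P K _ _ ih1 ih2 =>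
    intro A M f g hf hg
    -- The inclusion factors through the preimage of `K`, and the cokernels of the two factors embed
    -- in `K` and in the quotient by `K`.
    let B : OCat.{u} ν N := ⟨M.obj.ofSub (K.comap g), parO_ofSub h0 M.property _⟩
    have hfB : ∀ a, LieRep.toLie f.hom a ∈ K.comap g := fun a => by
      have : g (LieRep.toLie f.hom a) = 0 := (hg _).mpr ⟨a, rfl⟩
      change g (LieRep.toLie f.hom a) ∈ K
      rw [this]; exact zero_mem K
    let i : B ⟶ M := ObjectProperty.homMk (K.comap g).incl
    let f' : A ⟶ B := ObjectProperty.homMk (LieRep.homOfCommutes (M := A.obj) (M' := B.obj)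
      ((LieRep.toLie f.hom : A.obj.V →ₗ[ℂ] M.obj.V).codRestrict (K.comap g).toSubmodule hfB)
      fun i hi j hj m => Subtype.ext ((LieRep.commutes (LieRep.toLie f.hom) i hi j hj m).trans
        (LieRep.ofSub_e (M := M.obj) (K.comap g) i j ⟨_, hfB m⟩).symm))
    have hfi : f' ≫ i = f := rfl
    have h1 : IsIso ((piHat ν N).map f') := ih1 f'
      (subMap (M := M.obj) (M' := P) (K := K.comap g) g fun m hm => hm)
      (fun a b hab => hf (congrArg Subtype.val hab)) fun m =>
        ⟨fun hm => by
          obtain ⟨a, ha⟩ := (hg m.1).mp (congrArg Subtype.val hm)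
          exact ⟨a, Subtype.ext ha⟩, fun ⟨a, ha⟩ => Subtype.ext ((hg m.1).mpr
            ⟨a, congrArg Subtype.val ha⟩)⟩
    have h2 : IsIso ((piHat ν N).map i) := ih2 i ((LieSubmodule.Quotient.mk' K).comp g)
      Subtype.val_injective fun m => ⟨fun hm => ⟨⟨m,
        (LieSubmodule.Quotient.mk_eq_zero K (m := g m)).mp hm⟩, rfl⟩, fun ⟨a, ha⟩ =>
        (LieSubmodule.Quotient.mk_eq_zero K (m := g m)).mpr (ha ▸ a.2)⟩
    rw [← hfi, Functor.map_comp]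
    infer_instance

/-- The localization inverts projections whose kernel is an iterated extension of polynomial
modules. -/
theorem isIso_piHat_of_surjective (h0 : 0 ∈ idx N) {P : LieRep.{u} (gl N)} (hP : PF P) :
    ∀ {M C : OCat.{u} ν N} (f : M ⟶ C) (g : P.V →ₗ⁅ℂ, gl N⁆ M.obj.V),
      Function.Surjective (LieRep.toLie f.hom) →
      (∀ m, LieRep.toLie f.hom m = 0 ↔ ∃ a, g a = m) → IsIso ((piHat ν N).map f) := by
  induction hP with
  | of_isPoly P hP =>
    intro M C f g hf hg
    refine MorphismProperty.Q_inverts _ f ⟨?_, ?_⟩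
    · have hgk : ∀ a, g a ∈ (LieRep.toLie f.hom).ker := fun a =>
        LieModuleHom.mem_ker.mpr ((hg _).mpr ⟨a, rfl⟩)
      refine isPoly_of_surjective (M' := M.obj.ofSub _) hP
        (LieRep.homOfCommutes (M := P) (M' := M.obj.ofSub _)
          ((g : P.V →ₗ[ℂ] M.obj.V).codRestrict (LieRep.toLie f.hom).ker.toSubmodule hgk)
          fun i hi j hj m => Subtype.ext ((LieRep.commutes g i hi j hj m).trans
            (LieRep.ofSub_e (M := M.obj) (LieRep.toLie f.hom).ker i j ⟨_, hgk m⟩).symm)) ?_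
      rintro ⟨m, hm⟩
      obtain ⟨a, ha⟩ := (hg m).mp (LieModuleHom.mem_ker.mp hm)
      exact ⟨a, Subtype.ext ha⟩
    · have : Subsingleton (C.obj.V ⧸ (LieRep.toLie f.hom).range) := by
        refine subsingleton_of_forall_eq 0 fun m => ?_
        obtain ⟨m, rfl⟩ := LieSubmodule.Quotient.surjective_mk' _ m
        obtain ⟨a, rfl⟩ := hf m
        exact (LieSubmodule.Quotient.mk_eq_zero _).mpr ⟨a, rfl⟩
      exact isPoly_of_subsingleton
  | of_ext P K _ _ ih1 ih2 =>
    intro M C f g hf hg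
    -- The projection factors through the quotient by the image of `K`; the kernels of the two
    -- factors are images of `K` and of the quotient by `K`.
    let B : OCat.{u} ν N := ⟨M.obj.ofQuot (K.map g), parO_ofQuot h0 M.property _⟩
    have hfB : ∀ m ∈ K.map g, LieRep.toLie f.hom m = 0 := fun m hm => by
      obtain ⟨a, -, rfl⟩ := (LieSubmodule.mem_map _).mp hm
      exact (hg _).mpr ⟨a, rfl⟩
    let q : M ⟶ B := ObjectProperty.homMk (LieSubmodule.Quotient.mk' (K.map g))
    let f' : B ⟶ C := ObjectProperty.homMk (quotDesc (K.map g) (LieRep.toLie f.hom) hfB)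
    have hfi : q ≫ f' = f := rfl
    have h1 : IsIso ((piHat ν N).map q) := by
      refine ih1 q (g.comp K.incl) (LieSubmodule.Quotient.surjective_mk' (K.map g)) fun m =>
        (LieSubmodule.Quotient.mk_eq_zero (K.map g) (m := m)).trans ⟨fun hm => ?_, ?_⟩
      · obtain ⟨a, ha, ham⟩ := (LieSubmodule.mem_map _).mp hm
        exact ⟨⟨a, ha⟩, ham⟩
      · rintro ⟨a, rfl⟩
        exact LieSubmodule.mem_map_of_mem a.2
    have h2 : IsIso ((piHat ν N).map f') := by
      refine ih2 f' (quotDesc (M' := B.obj) K ((LieSubmodule.Quotient.mk' (K.map g)).comp g)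
        fun a ha => (LieSubmodule.Quotient.mk_eq_zero _).mpr (LieSubmodule.mem_map_of_mem ha))
        (fun c => ?_) fun m => ?_
      · obtain ⟨m, rfl⟩ := hf c
        exact ⟨LieSubmodule.Quotient.mk' (K.map g) m, rfl⟩
      · obtain ⟨m, rfl⟩ := LieSubmodule.Quotient.surjective_mk' (K.map g) m
        refine (hg m).trans ⟨?_, ?_⟩
        · rintro ⟨a, rfl⟩
          exact ⟨LieSubmodule.Quotient.mk' K a, rfl⟩
        · rintro ⟨a, ha⟩
          obtain ⟨a, rfl⟩ := LieSubmodule.Quotient.surjective_mk' K a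
          refine (hg m).mp ?_
          exact congrArg (LieRep.toLie f'.hom) ha |>.symm.trans ((hg _).mpr ⟨a, rfl⟩)
    rw [← hfi, Functor.map_comp]
    infer_instance

/-- Modules of the category `O` without polynomial submodules or quotients. -/
def locO (ν : ℂ) (N : ℕ∞) : ObjectProperty (LieRep.{u} (gl N)) := fun M => parO ν N M ∧ IsLocal M

/-- The category of modules of `O` without polynomial submodules or quotients. -/
abbrev LCat (ν : ℂ) (N : ℕ∞) := (locO.{u} ν N).FullSubcategory

/-- The inclusion functor. -/
abbrev locIncl (ν : ℂ) (N : ℕ∞) : LCat.{u} ν N ⥤ OCat.{u} ν N :=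
  ObjectProperty.ιOfLE fun _ h => h.1

variable (h0 : 0 ∈ idx N)

/-- The least submodule whose quotient is an iterated extension of polynomial modules. -/
def topCore (M : OCat.{u} ν N) : LieSubmodule ℂ (gl N) M.obj.V :=
  core (finLen_of_parO h0 M.property) ⊤

/-- The submodule `topCore`, as an object. -/
def coreObj (M : OCat.{u} ν N) : OCat.{u} ν N :=
  ⟨M.obj.ofSub (topCore h0 M), parO_ofSub h0 M.property _⟩

/-- The largest submodule of `topCore` that is an iterated extension of polynomial modules. -/
def coreTors (M : OCat.{u} ν N) : LieSubmodule ℂ (gl N) (coreObj h0 M).obj.V :=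
  torsion (finLen_of_parO h0 (coreObj h0 M).property)

/-- The local module attached to a module. -/
def locObj (M : OCat.{u} ν N) : LCat.{u} ν N :=
  ⟨(coreObj h0 M).obj.ofQuot (coreTors h0 M), parO_ofQuot h0 (coreObj h0 M).property _,
    IsLocal.of_core (finLen_of_parO h0 M.property) (core_core _ _) _⟩

theorem map_topCore {M M' : OCat.{u} ν N} (f : M ⟶ M') (m : M.obj.V) (hm : m ∈ topCore h0 M) :
    LieRep.toLie f.hom m ∈ topCore h0 M' :=
  core_le_of_pFq _ ((pFq_core (finLen_of_parO h0 M'.property) ⊤).comap (LieRep.toLie f.hom)) hm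

/-- The functor `coreObj`. -/
def coreFunctor : OCat.{u} ν N ⥤ OCat.{u} ν N where
  obj := coreObj h0
  map f := ObjectProperty.homMk (subMap (LieRep.toLie f.hom) (map_topCore h0 f))
  map_id _ := rfl
  map_comp _ _ := rfl

theorem map_coreTors {M M' : OCat.{u} ν N} (f : coreObj h0 M ⟶ coreObj h0 M')
    (m : (coreObj h0 M).obj.V) (hm : m ∈ coreTors h0 M) :
    LieRep.toLie f.hom m ∈ coreTors h0 M' := by
  refine le_torsion _ ?_ (LieSubmodule.mem_map_of_mem (f := LieRep.toLie f.hom) hm)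
  exact ((pFq_torsion (finLen_of_parO h0 (coreObj h0 M).property)).map
    (LieRep.toLie f.hom)).mono LieSubmodule.map_bot.le le_rfl

/-- The functor that attaches a local module to a module. -/
def locFunctor : OCat.{u} ν N ⥤ LCat.{u} ν N where
  obj := locObj h0
  map {M M'} f := ObjectProperty.homMk (quotDesc (M := (coreObj h0 M).obj)
    (M' := (locObj h0 M').obj) (coreTors h0 M)
    ((LieSubmodule.Quotient.mk' (coreTors h0 M')).comp
      (LieRep.toLie ((coreFunctor h0).map f).hom)) fun m hm =>
        (LieSubmodule.Quotient.mk_eq_zero _).mpr (map_coreTors h0 ((coreFunctor h0).map f) m hm))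
  map_id M := by
    apply ObjectProperty.hom_ext
    apply LieRep.hom_ext
    intro m
    obtain ⟨m, rfl⟩ := LieSubmodule.Quotient.surjective_mk' (coreTors h0 M) m
    rfl
  map_comp {M _ _} f g := by
    apply ObjectProperty.hom_ext
    apply LieRep.hom_ext
    intro m
    obtain ⟨m, rfl⟩ := LieSubmodule.Quotient.surjective_mk' (coreTors h0 M) m
    rfl

/-- The inclusion of `topCore`. -/
def coreIncl : coreFunctor.{u} (ν := ν) h0 ⟶ 𝟭 _ where
  app M := ObjectProperty.homMk (topCore h0 M).incl
  naturality _ _ _ := rfl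

/-- The projection from `topCore`. -/
def coreProj : coreFunctor.{u} (ν := ν) h0 ⟶ locFunctor h0 ⋙ locIncl ν N where
  app M := ObjectProperty.homMk (LieSubmodule.Quotient.mk' (coreTors h0 M))
  naturality _ _ _ := rfl

end SerreQuotient

/-! ### Equivalence of the Serre quotient with local modules -/

section SerreEquivalence

theorem PFq.bot_map {S : Set ℕ} {M M' : LieRep.{u} (glOn S)} {A : LieSubmodule ℂ (glOn S) M.V}
    (h : PFq ⊥ A) (f : M.V →ₗ⁅ℂ, glOn S⁆ M'.V) : PFq (M := M') ⊥ (A.map f) :=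
  (h.map f).mono LieSubmodule.map_bot.le le_rfl

variable {ν : ℂ} {N : ℕ∞} (h0 : 0 ∈ idx N)

/-- The image of the core has its quotient in the class: first inside the range of `f`, then, as the
cokernel is polynomial, inside the whole target. -/
theorem topCore_le_map {M M' : OCat.{u} ν N} (f : M ⟶ M') (hf : isoModPoly ν N f) :
    topCore h0 M' ≤ (topCore h0 M).map (LieRep.toLie f.hom) := by
  refine core_le_of_pFq _ ?_
  have h1 := (pFq_core (finLen_of_parO h0 M.property) ⊤).map (LieRep.toLie f.hom)
  rw [LieModuleHom.map_top] at h1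
  exact h1.trans (pFq_top_iff.mpr (.of_isPoly _ hf.2)) (by
    rw [← LieModuleHom.map_top]; exact LieSubmodule.map_mono le_top)

/-- Injectivity: the preimage of the torsion is an extension of a module in the class by part of the
polynomial kernel, hence is torsion. Surjectivity is `topCore_le_map`. -/
theorem locFunctor_inverts : (isoModPoly.{u} ν N).IsInvertedBy (locFunctor h0) := by
  intro M M' f hf
  let φ : (coreObj h0 M).obj ⟶ (coreObj h0 M').obj := ((coreFunctor h0).map f).hom
  refine (ObjectProperty.isIso_hom_iff _).mp (LieRep.isIso_of_bijective _ ⟨(injective_iff_map_eq_zero _).mpr fun m hm => ?_, fun m => ?_⟩)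
  · obtain ⟨m, rfl⟩ := LieSubmodule.Quotient.surjective_mk' (coreTors h0 M) m
    have hm' : LieRep.toLie φ m ∈ coreTors h0 M' :=
      (LieSubmodule.Quotient.mk_eq_zero (coreTors h0 M')).mp hm
    refine (LieSubmodule.Quotient.mk_eq_zero (coreTors h0 M)).mpr (le_torsion _ (A := (coreTors h0 M').comap
      (LieRep.toLie φ)) ?_ hm')
    have h1 := (pFq_torsion (finLen_of_parO h0 (coreObj h0 M').property)).comap
      (LieRep.toLie φ)
    refine PFq.trans ?_ h1 bot_le
    refine ((pFq_bot_iff.mpr (.of_isPoly _ hf.1)).comap (M := (coreObj h0 M).obj)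
      (topCore h0 M).incl).mono ?_ ?_
    · intro x hx
      have hx' : (topCore h0 M).incl x ∈ (⊥ : LieSubmodule ℂ (gl N) M.obj.V) := hx
      exact (LieSubmodule.mem_bot _).mpr (Subtype.ext ((LieSubmodule.mem_bot _).mp hx'))
    · intro x hx
      have hx' : LieRep.toLie φ x = 0 := hx
      exact LieModuleHom.mem_ker.mpr (congrArg Subtype.val hx')
  · obtain ⟨m, rfl⟩ := LieSubmodule.Quotient.surjective_mk' (coreTors h0 M') m
    obtain ⟨a, ha, ham⟩ := (LieSubmodule.mem_map _).mp (topCore_le_map h0 f hf m.2)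
    exact ⟨LieSubmodule.Quotient.mk' (coreTors h0 M) ⟨a, ha⟩,
      congrArg (LieSubmodule.Quotient.mk' (coreTors h0 M')) (Subtype.ext ham)⟩

/-- A module is related to its local module by an inclusion of its core and a projection from the
core. Both become invertible in the Serre quotient and both are invertible on local modules; these
two facts give the counit and the unit of the equivalence. -/
instance isIso_piHat_coreIncl : IsIso (Functor.whiskerRight (coreIncl h0) (piHat.{u} ν N)) := by
  rw [NatTrans.isIso_iff_isIso_app]
  intro M
  refine isIso_piHat_of_injective h0 (pFq_top_iff.mp (pFq_core (finLen_of_parO h0 M.property) ⊤))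
    ((coreIncl h0).app M) (LieSubmodule.Quotient.mk' _) Subtype.val_injective fun m =>
      (LieSubmodule.Quotient.mk_eq_zero _ (m := m)).trans ⟨fun hm => ⟨⟨m, hm⟩, rfl⟩, ?_⟩
  rintro ⟨a, rfl⟩
  exact a.2

instance isIso_piHat_coreProj : IsIso (Functor.whiskerRight (coreProj h0) (piHat.{u} ν N)) := by
  rw [NatTrans.isIso_iff_isIso_app]
  intro M
  refine isIso_piHat_of_surjective h0 (pFq_bot_iff.mp (pFq_torsion
    (finLen_of_parO h0 (coreObj h0 M).property)))
    ((coreProj h0).app M) (coreTors h0 M).incl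
    (LieSubmodule.Quotient.surjective_mk' (coreTors h0 M)) fun m =>
      (LieSubmodule.Quotient.mk_eq_zero (coreTors h0 M)).trans ⟨fun hm => ⟨⟨m, hm⟩, rfl⟩, ?_⟩
  rintro ⟨a, rfl⟩
  exact a.2

instance isIso_locIncl_coreIncl :
    IsIso (Functor.whiskerLeft (locIncl.{u} ν N) (coreIncl h0)) := by
  rw [NatTrans.isIso_iff_isIso_app]
  intro M
  have htop : topCore h0 ((locIncl ν N).obj M) = ⊤ := M.property.2.core_top _
  refine (ObjectProperty.isIso_hom_iff _).mp (LieRep.isIso_of_bijective _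
    ⟨Subtype.val_injective, fun m => ⟨⟨m, ?_⟩, rfl⟩⟩)
  rw [htop]
  trivial

instance isIso_locIncl_coreProj :
    IsIso (Functor.whiskerLeft (locIncl.{u} ν N) (coreProj h0)) := by
  rw [NatTrans.isIso_iff_isIso_app]
  intro M
  have key : ∀ m ∈ coreTors h0 ((locIncl ν N).obj M), m = 0 := fun m hm => by
    have h2 := (pFq_torsion (finLen_of_parO h0 (coreObj h0 ((locIncl ν N).obj M)).property)).bot_map
      (M' := M.obj) (topCore h0 ((locIncl ν N).obj M)).incl
    have h3 := (M.property.2.bot h2).le (LieSubmodule.mem_map_of_mem hm)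
    exact Subtype.ext ((LieSubmodule.mem_bot _).mp h3)
  refine (ObjectProperty.isIso_hom_iff _).mp (LieRep.isIso_of_bijective _ ⟨?_,
    LieSubmodule.Quotient.surjective_mk' (coreTors h0 ((locIncl ν N).obj M))⟩)
  refine (injective_iff_map_eq_zero (LieSubmodule.Quotient.mk'
    (coreTors h0 ((locIncl ν N).obj M)))).mpr fun m hm => ?_
  exact key m ((LieSubmodule.Quotient.mk_eq_zero (coreTors h0 ((locIncl ν N).obj M))).mp hm)

include h0 in
/-- The Serre quotient is equivalent to the category of local modules. -/
theorem isEquivalence_locIncl_piHat : (locIncl.{u} ν N ⋙ piHat ν N).IsEquivalence := by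
  let Φ : OHat.{u} ν N ⥤ LCat.{u} ν N :=
    Localization.Construction.lift _ (locFunctor_inverts h0)
  have hΦ : piHat ν N ⋙ Φ = locFunctor h0 := Localization.Construction.fac _ _
  let η : 𝟭 (LCat.{u} ν N) ≅ locIncl ν N ⋙ locFunctor h0 :=
    Functor.fullyFaithfulCancelRight (locIncl ν N)
      ((asIso (Functor.whiskerLeft (locIncl.{u} ν N) (coreIncl h0))).symm ≪≫
        asIso (Functor.whiskerLeft (locIncl.{u} ν N) (coreProj h0)))
  let _ : Localization.Lifting (piHat.{u} ν N) (isoModPoly ν N)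
      ((locFunctor h0 ⋙ locIncl ν N) ⋙ piHat ν N) (Φ ⋙ locIncl ν N ⋙ piHat ν N) :=
    ⟨eqToIso (congrArg (· ⋙ locIncl ν N ⋙ piHat ν N) hΦ)⟩
  let ε : Φ ⋙ locIncl ν N ⋙ piHat ν N ≅ 𝟭 _ :=
    Localization.liftNatIso (piHat ν N) (isoModPoly ν N)
      ((locFunctor h0 ⋙ locIncl ν N) ⋙ piHat ν N) (piHat ν N) _ _
      ((asIso (Functor.whiskerRight (coreProj h0) (piHat.{u} ν N))).symm ≪≫
        asIso (Functor.whiskerRight (coreIncl h0) (piHat.{u} ν N)))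
  exact Functor.IsEquivalence.mk' Φ
    (η ≪≫ Functor.isoWhiskerLeft (locIncl ν N) (eqToIso hΦ.symm)) ε

/-- A module and the associated local module become isomorphic in the Serre quotient. -/
def piHatIsoLoc (M : OCat.{u} ν N) :
    (piHat ν N).obj M ≅ (piHat ν N).obj ((locIncl ν N).obj (locObj h0 M)) :=
  ((asIso (Functor.whiskerRight (coreIncl h0) (piHat.{u} ν N))).symm ≪≫
    asIso (Functor.whiskerRight (coreProj h0) (piHat.{u} ν N))).app M

end SerreEquivalence

/-! ### Lengths -/

section Lengths

universe u' v'

theorem objLength_of_iso {C : Type u} [Category.{v} C] {X Y : C} (i : X ≅ Y) :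
    objLength X = objLength Y := by
  unfold objLength
  rw [← Order.height_orderIso (Subobject.mapIsoToOrderIso i), OrderIso.map_top]

theorem objLength_equivalence {C : Type u} [Category.{v} C] {D : Type u'} [Category.{v'} D]
    (F : C ⥤ D) [F.IsEquivalence] (X : C) : objLength (F.obj X) = objLength X := by
  unfold objLength
  rw [← Order.height_orderIso
    (Subobject.lowerEquivalence (MonoOver.congr X F.asEquivalence)).toOrderIso, OrderIso.map_top]
  rfl

variable {ν : ℂ} {N : ℕ∞} (h0 : 0 ∈ idx N)

theorem LieRep.exists_lift {S : Set ℕ} {M M' M'' : LieRep.{u} (glOn S)} (f : M ⟶ M'') (g : M' ⟶ M'')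
    (hg : Function.Injective (LieRep.toLie g))
    (h : ∀ m, ∃ m', LieRep.toLie g m' = LieRep.toLie f m) : ∃ k : M ⟶ M', k ≫ g = f := by
  let k := (LinearEquiv.ofInjective (LieRep.toLie g : M'.V →ₗ[ℂ] M''.V) hg).symm.toLinearMap ∘ₗ
    (LieRep.toLie f : M.V →ₗ[ℂ] M''.V).codRestrict _ h
  have hk : ∀ m, LieRep.toLie g (k m) = LieRep.toLie f m := fun m =>
    congrArg Subtype.val ((LinearEquiv.ofInjective (LieRep.toLie g : M'.V →ₗ[ℂ] M''.V) hg).apply_symm_apply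
      ((LieRep.toLie f : M.V →ₗ[ℂ] M''.V).codRestrict _ h m))
  exact ⟨LieRep.homOfCommutes k fun i hi j hj m => hg ((hk _).trans
    ((LieRep.commutes (LieRep.toLie f) i hi j hj m).trans ((congrArg (M''.e i j) (hk m).symm).trans
      (LieRep.commutes (LieRep.toLie g) i hi j hj _).symm))), LieModuleHom.ext hk⟩

include h0 in
-- The kernel need not be local, so the monomorphism is tested on the local module attached to the
-- kernel, which still maps to `A` because `A` has no torsion. This test map must vanish, so the
-- core of the kernel is zero, the kernel lies in the class, and it is zero by locality of `A`.
theorem injective_of_mono {A M : LCat.{u} ν N} (f : A ⟶ M) [Mono f] :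
    Function.Injective (LieRep.toLie f.hom) := by
  let K : OCat.{u} ν N := ⟨A.obj.ofSub (LieRep.toLie f.hom).ker, parO_ofSub h0 A.property.1 _⟩
  have htors : ∀ m ∈ coreTors h0 K,
      (LieRep.toLie f.hom).ker.incl ((topCore h0 K).incl m) = 0 := by
    intro m hm
    have h1 := ((pFq_torsion (finLen_of_parO h0 (coreObj h0 K).property)).bot_map (M' := K.obj)
      (topCore h0 K).incl).bot_map (M' := A.obj) (LieRep.toLie f.hom).ker.incl
    exact (LieSubmodule.mem_bot _).mp ((A.property.2.bot h1).le (LieSubmodule.mem_map_of_mem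
      (LieSubmodule.mem_map_of_mem hm)))
  let g : locObj h0 K ⟶ A := ObjectProperty.homMk (quotDesc (M := (coreObj h0 K).obj)
    (M' := A.obj) (coreTors h0 K) ((LieRep.toLie f.hom).ker.incl.comp (topCore h0 K).incl) htors)
  have hg : g ≫ f = (ObjectProperty.homMk (0 : (locObj h0 K).obj.V →ₗ⁅ℂ, gl N⁆ A.obj.V)) ≫ f := by
    apply ObjectProperty.hom_ext
    apply LieRep.hom_ext
    intro m
    obtain ⟨m, rfl⟩ := LieSubmodule.Quotient.surjective_mk' (coreTors h0 K) m
    exact (LieModuleHom.mem_ker.mp m.1.2).trans (LieRep.toLie f.hom).map_zero.symm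
  have hg0 := (cancel_mono f).mp hg
  have hcore : topCore h0 K = ⊥ := by
    rw [eq_bot_iff]
    intro m hm
    refine (LieSubmodule.mem_bot _).mpr (Subtype.ext ?_)
    exact DFunLike.congr_fun (F := (locObj h0 K).obj.V →ₗ⁅ℂ, gl N⁆ A.obj.V)
      (congrArg (fun q : locObj h0 K ⟶ A => LieRep.toLie q.hom) hg0)
      (LieSubmodule.Quotient.mk' (coreTors h0 K) ⟨m, hm⟩)
  have h1 : PFq (M := K.obj) ⊥ ⊤ := hcore ▸ pFq_core (finLen_of_parO h0 K.property) ⊤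
  have h2 := h1.bot_map (M' := A.obj) (LieRep.toLie f.hom).ker.incl
  rw [LieModuleHom.map_top, LieSubmodule.range_incl] at h2
  exact LieModuleHom.ker_eq_bot _ |>.mp (A.property.2.bot h2)

theorem mono_of_injective {A M : LCat.{u} ν N} (f : A ⟶ M)
    (hf : Function.Injective (LieRep.toLie f.hom)) : Mono f := by
  refine ⟨fun a b hab => ObjectProperty.hom_ext _ (LieRep.hom_ext fun m => hf ?_)⟩
  exact DFunLike.congr_fun (F := _ →ₗ⁅ℂ, gl N⁆ M.obj.V)
    (congrArg (fun q => LieRep.toLie q.hom) hab) m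

include h0 in
-- A strict inclusion of local submodules is never a step in the class, by locality of the larger
-- one. Conversely, a chain of arbitrary submodules is turned into subobjects by taking cores, and
-- steps outside the class stay strict.
theorem le_objLength_iff (M : LCat.{u} ν N) (p : ℕ) : (p : ℕ∞) ≤ objLength M ↔ HasChain M.obj p := by
  constructor
  · intro h
    obtain ⟨s, -, rfl⟩ := Order.exists_series_of_le_height _ h
    -- The series is continued by its last term to get a sequence indexed by all natural numbers.
    let x : ℕ → Subobject M := fun i => s ⟨min i s.length, by lia⟩
    have hx : Monotone x := fun i j hij => s.monotone (by
      rw [Fin.le_def]; exact min_le_min_right _ hij)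
    refine ⟨fun i => (LieRep.toLie (x i).arrow.hom).range, fun i j hij => ?_, fun i hi hq => ?_⟩
    · rintro _ ⟨m, rfl⟩
      rw [← Subobject.ofLE_arrow (hx hij)]
      exact ⟨_, rfl⟩
    · have h1 := hq.comap (LieRep.toLie (x (i + 1)).arrow.hom)
      have h2 : (LieRep.toLie (x (i + 1)).arrow.hom).range.comap
          (LieRep.toLie (x (i + 1)).arrow.hom) = ⊤ := eq_top_iff.mpr fun m _ => ⟨m, rfl⟩
      rw [h2] at h1
      have h3 := ((x (i + 1) : LCat ν N)).property.2.top h1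
      obtain ⟨k, hk⟩ := LieRep.exists_lift (x (i + 1)).arrow.hom (x i).arrow.hom
        (injective_of_mono h0 _) fun m => by
          have : m ∈ (LieRep.toLie (x i).arrow.hom).range.comap
            (LieRep.toLie (x (i + 1)).arrow.hom) := h3 ▸ trivial
          exact this
      have hle : x (i + 1) ≤ x i :=
        Subobject.le_of_comm (ObjectProperty.homMk k) (ObjectProperty.hom_ext _ hk)
      have hlt : x i < x (i + 1) := s.strictMono (by rw [Fin.lt_def]; simp only; lia)
      exact hlt.not_ge hle
  · rintro ⟨A, hA, hp⟩
    have hfin := finLen_of_parO h0 M.property.1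
    let B : ℕ → LCat.{u} ν N := fun i => ⟨M.obj.ofSub (core hfin (A i)),
      parO_ofSub h0 M.property.1 _, M.property.2.ofSub hfin (core_core hfin _)⟩
    let f : ∀ i, B i ⟶ M := fun i => ObjectProperty.homMk (core hfin (A i)).incl
    have hf : ∀ i, Mono (f i) := fun i => mono_of_injective _ Subtype.val_injective
    refine Order.length_le_height (p := LTSeries.mk p (fun i => Subobject.mk (f i))
      (Fin.strictMono_iff_lt_succ.mpr fun i => ?_)) le_top
    refine lt_of_le_not_ge (Subobject.mk_le_mk_of_comm (ObjectProperty.homMk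
      (LieSubmodule.inclusion (core_mono hfin (hA (Nat.le_succ i))))) rfl) fun hle => ?_
    refine hp i i.2 ((pFq_core hfin (A (i + 1))).mono (fun m hm => ?_) le_rfl)
    have h1 := Subobject.ofMkLEMk_comp hle
    have h2 := DFunLike.congr_fun (F := (B (i + 1)).obj.V →ₗ⁅ℂ, gl N⁆ M.obj.V)
      (congrArg (fun q => LieRep.toLie q.hom) h1) ⟨m, hm⟩
    change _ = m at h2
    rw [← h2]
    exact core_le hfin _ (Subtype.property (LieRep.toLie (Subobject.ofMkLEMk _ _ hle).hom _))

theorem FinLen.hasChain_le {S : Set ℕ} {M : LieRep.{u} (glOn S)} (h : FinLen M) :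
    ∃ k, ∀ p, HasChain M p → p ≤ k := by
  obtain ⟨k, φ, hφ⟩ := h
  refine ⟨k, fun p ⟨A, hA, hp⟩ => ?_⟩
  have h1 : StrictMono fun i : Fin (p + 1) => φ (A i) := Fin.strictMono_iff_lt_succ.mpr fun i =>
    hφ ((hA (Nat.le_succ i)).lt_of_ne fun heq => hp i i.2 (.of_le (le_of_eq heq.symm)))
  have := Fintype.card_le_of_injective _ h1.injective
  simpa using this

include h0 in
theorem le_objLength_piHat_iff (M : LCat.{u} ν N) (p : ℕ) :
    (p : ℕ∞) ≤ objLength ((piHat ν N).obj ((locIncl ν N).obj M)) ↔ HasChain M.obj p := by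
  have := isEquivalence_locIncl_piHat (ν := ν) h0
  rw [← le_objLength_iff h0 M p]
  exact Iff.of_eq (congrArg _ (objLength_equivalence (locIncl ν N ⋙ piHat ν N) M))

include h0 in
theorem hasChain_of_le_objLength (M : OCat.{u} ν N) {p : ℕ}
    (h : (p : ℕ∞) ≤ objLength ((piHat ν N).obj M)) : HasChain M.obj p := by
  rw [objLength_of_iso (piHatIsoLoc h0 M), le_objLength_piHat_iff h0] at h
  exact (h.of_surjective (M := (coreObj h0 M).obj) (LieSubmodule.Quotient.mk' (coreTors h0 M))
    (LieSubmodule.Quotient.surjective_mk' _)).of_injective (topCore h0 M).incl Subtype.val_injective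

end Lengths

/-! ### Extension from invariants -/

section Extension

variable {V V' W W' : Type*} [AddCommGroup V] [Module ℂ V] [AddCommGroup V'] [Module ℂ V']
  [AddCommGroup W] [Module ℂ W] [AddCommGroup W'] [Module ℂ W']
  {S T : Set ℕ} {e : Ops V} {e' : Ops V'} {a : Ops W} {a' : Ops W'}

/-- Equivariant maps between invariants extend. -/
theorem IsInv.exists_extension (hs : IsSys S e) (hs' : IsSys S a)
    (h : IsWeight (S \ T) e) (h' : IsWeight (S \ T) a)
    (hgen : ∀ X, Stable S e X → wt (S \ T) e 0 ≤ X → X = ⊤)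
    {ι : V' →ₗ[ℂ] V} (hι : IsInv T S e' e ι) {κ : W' →ₗ[ℂ] W} (hκ : IsInv T S a' a κ)
    {g : V' →ₗ[ℂ] W'} (hg : Commutes T e' a' g)
    (hcog : ∀ X, Stable S a X → X ≤ gen S a (Set.range (κ ∘ₗ g)) → X ⊓ wt (S \ T) a 0 = ⊥ → X = ⊥) :
    ∃ f : V →ₗ[ℂ] W, Commutes S e a f ∧ ∀ v, f (ι v) = κ (g v) := by
  let q : V' ≃ₗ[ℂ] wt (S \ T) e 0 :=
    (LinearEquiv.ofInjective ι hι.injective).trans (LinearEquiv.ofEq _ _ hι.range_eq)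
  have hq : ∀ v, ι (q.symm v) = v := fun v => congrArg Subtype.val (q.apply_symm_apply v)
  have hST : ∀ {i}, i ∈ S \ (S \ T) → i ∈ T := fun hi => by_contra fun h => hi.2 ⟨hi.1, h⟩
  obtain ⟨f, hf, hfg⟩ := ParabolicO.exists_extension hs hs' h h' Set.sdiff_subset hgen
    (κ ∘ₗ g ∘ₗ q.symm.toLinearMap) (fun X hX hXg => hcog X hX (hXg.trans (gen_le (gen_stable _ _ _)
      (by rintro _ ⟨v, rfl⟩; exact subset_gen _ _ _ ⟨q.symm v, rfl⟩)))) (fun v => hκ.range_eq ▸ ⟨_, rfl⟩)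
    (fun i hi j hj v w hvw => by
      have h1 : q.symm w = e' i j (q.symm v) := hι.injective (by
        rw [hq, hvw, hι.commutes i (hST hi) j (hST hj), hq])
      have h2 := hκ.commutes i (hST hi) j (hST hj) (g (q.symm v))
      rw [← hg i (hST hi) j (hST hj), ← h1] at h2
      exact h2)
  refine ⟨f, hf, fun v => ?_⟩
  have := hfg (q v)
  rw [show ((q v : wt (S \ T) e 0) : V) = ι v from rfl] at this
  rw [this]
  exact congrArg (fun x => κ (g x)) (q.symm_apply_apply v)

theorem isInv_tensIncl (hT : T ⊆ S) (k : ℕ) :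
    IsInv T S (tensPow T k).e (tensPow S k).e (tensIncl hT k) := by
  refine ⟨tensIncl_commutes hT k, tensIncl_injective hT k, le_antisymm ?_ fun v hv => ?_⟩
  · rintro _ ⟨x, rfl⟩
    exact tensIncl_mem_wt hT k x
  · have hw := (isWeight_tensPow S k).mono (C := S \ T) Set.sdiff_subset
    have := pr_zero_mem_map hT (ι := tensIncl hT k) hw (Commutes.id _) (f' := LinearMap.id) rfl
      le_top v
    rw [LinearMap.id_apply, pr_of_mem hw (Set.mem_singleton 0) hv] at this
    exact LinearMap.map_le_range this

/-- With at least `k` letters in `T`, every word of length `k` is generated by words with letters in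
`T`, by moving letters into unused indices of `T`. -/
theorem tensPow_generated (hT : T ⊆ S) {k : ℕ} (hk : (k : ℕ∞) ≤ T.encard)
    (X : Submodule ℂ (tensPow S k).V) (hX : Stable S (tensPow S k).e X)
    (hX0 : wt (S \ T) (tensPow S k).e 0 ≤ X) : X = ⊤ := by
  rw [eq_top_iff, ← (tensBasis S k).span_eq, Submodule.span_le]
  rintro _ ⟨w, rfl⟩
  exact mem_of_deg_le_encard (tensPow S k).isSys (isWeight_tensPow S k) hT (Stable.top _ _) hX
    (by rw [deg_wordWt]; exact hk) (fun _ _ v _ _ hv => hX0 hv) (tensBasis_mem_wt w) trivial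

/-- A module whose submodules are detected by invariants is polynomial if its invariants are. -/
theorem FinP.of_inv (hT : T ⊆ S) (hs : IsSys S e) (h : IsWeight (S \ T) e)
    {ι : V' →ₗ[ℂ] V} (hι : IsInv T S e' e ι)
    (hdet : ∀ X X', Stable S e X → Stable S e X' → X' ⊓ wt (S \ T) e 0 ≤ X → X' ≤ X)
    (hdeg : ∀ k (f : (tensPow T k).V →ₗ[ℂ] V'), Commutes T (tensPow T k).e e' f → f ≠ 0 →
      (k : ℕ∞) ≤ T.encard)
    (hp : FinP T e') : FinP S e := by
  obtain ⟨r, d, f, hf, htop⟩ := hp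
  -- Each non-zero map from a smaller tensor power extends to the larger one: the size condition
  -- makes the source generated by its invariants, and detection controls the target. A zero map
  -- extends by zero without any condition.
  have hF : ∀ j, ∃ F : (tensPow S (d j)).V →ₗ[ℂ] V, Commutes S (tensPow S (d j)).e e F ∧
      ∀ x, F (tensIncl hT (d j) x) = ι (f j x) := by
    intro j
    by_cases h0 : f j = 0
    · refine ⟨0, fun i _ k _ v => (map_zero _).symm, fun x => ?_⟩
      rw [h0, LinearMap.zero_apply, LinearMap.zero_apply, map_zero]
    · refine IsInv.exists_extension (tensPow S (d j)).isSys hs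
        ((isWeight_tensPow S _).mono Set.sdiff_subset) h
        (tensPow_generated hT (hdeg _ _ (hf j) h0)) (isInv_tensIncl hT _) hι (hf j)
        fun X hX _ hX0 => ?_
      exact le_bot_iff.mp (hdet ⊥ X (Stable.bot _ _) hX hX0.le)
  choose F hF hFf using hF
  -- The extended images contain all invariants, so they exhaust the module by detection.
  refine ⟨r, d, F, hF, eq_top_iff.mpr (hdet _ ⊤ ?_ (Stable.top _ _) ?_)⟩
  · rw [iSup]
    refine stable_sSup ?_
    rintro _ ⟨j, rfl⟩
    exact (hF j).stable_range
  · rw [top_inf_eq, ← hι.range_eq, LinearMap.range_eq_map, ← htop, Submodule.map_iSup]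
    refine iSup_mono fun j => ?_
    rintro _ ⟨_, ⟨x, rfl⟩, rfl⟩
    exact ⟨_, hFf j x⟩

end Extension

/-! ### The degree of polynomial objects, and stability of detection -/

section Degree

variable {V V' : Type*} [AddCommGroup V] [Module ℂ V] [AddCommGroup V'] [Module ℂ V']
  {ν : ℂ} {n N : ℕ∞} {e : Ops V} {e' : Ops V'}

open Classical in
theorem deg_eq_of_idx {α : ℕ →₀ ℕ} (h : ∀ i ∉ idx n, α i = 0) :
    deg α = α 0 + deg (α.filter (· ∈ idxU n)) := by
  have h1 : α = Finsupp.single 0 (α 0) + α.filter (· ∈ idxU n) := by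
    ext i
    rw [Finsupp.add_apply]
    by_cases hi : i ∈ idxU n
    · rw [Finsupp.filter_apply_pos _ _ hi,
        Finsupp.single_eq_of_ne (ne_zero_of_mem_idxU hi), zero_add]
    · rw [Finsupp.filter_apply_neg _ _ hi, add_zero]
      by_cases h0 : i = 0
      · rw [h0, Finsupp.single_eq_same]
      · rw [Finsupp.single_eq_of_ne h0, h i fun h' => hi (mem_idxU h' h0)]
  conv_lhs => rw [h1]
  rw [deg_add, deg_single]

/-- In the category `O` of degree `ν`, polynomial submodules have degree `ν`. -/
theorem IsO.degree_eq (h : IsO ν n e) (h0 : 0 ∈ idx n) {k : ℕ} {f : (tensPow (idx n) k).V →ₗ[ℂ] V}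
    (hf : Commutes (idx n) (tensPow (idx n) k).e e f) (hne : f ≠ 0) : (k : ℂ) = ν := by
  obtain ⟨w, hw⟩ : ∃ w, f (tensBasis (idx n) k w) ≠ 0 := by
    by_contra hcon
    push Not at hcon
    exact hne ((tensBasis (idx n) k).ext hcon)
  have hv := hf.map_wt (tensBasis_mem_wt w)
  have h1 := h.degr _ _ (wt_le_of_subset (idxU_subset n) _ hv)
  rw [wt_apply hv h0] at h1
  have h2 := smul_left_injective ℂ hw h1
  have h3 := deg_eq_of_idx (n := n) (α := wordWt w) fun i hi => by
    by_contra hne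
    exact hw (wt_eq_zero hv hi hne)
  rw [deg_wordWt] at h3
  rw [h3]
  push_cast
  rw [h2, sub_add_cancel]

/-- `n` is large compared with the degree of the polynomial objects of the category `O`. -/
def LargeFor (ν : ℂ) (n : ℕ∞) : Prop := ∀ k : ℕ, (k : ℂ) = ν → (k : ℕ∞) ≤ (idx n).encard

theorem exists_largeFor (ν : ℂ) : ∃ K : ℕ, ∀ n : ℕ∞, (K : ℕ∞) ≤ n → LargeFor ν n := by
  by_cases h : ∃ k : ℕ, (k : ℂ) = ν
  · obtain ⟨k, hk⟩ := h
    refine ⟨k + 1, fun n hn k' hk' => ?_⟩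
    obtain rfl : k' = k := by exact_mod_cast hk'.trans hk.symm
    exact (le_encard_idxU (by exact_mod_cast hn)).trans (Set.encard_le_encard (idxU_subset n))
  · exact ⟨0, fun n _ k hk => (h ⟨k, hk⟩).elim⟩

theorem Detects.of_injective (h : Detects N n e) {f : V' →ₗ[ℂ] V} (hf : Commutes (idx N) e' e f)
    (hi : Function.Injective f) : Detects N n e' := by
  intro X X' hX hX' hle v hv
  obtain ⟨w, hw, hwv⟩ := h (X.map f) (X'.map f) (hf.stable_map hX) (hf.stable_map hX') (by
    rintro _ ⟨⟨w, hw, rfl⟩, h0⟩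
    exact ⟨w, hle ⟨hw, (hf.mono Set.sdiff_subset).mem_wt_of_injective hi h0⟩, rfl⟩) ⟨v, hv, rfl⟩
  exact hi hwv ▸ hw

theorem Detects.of_surjective (h : Detects N n e) {f : V →ₗ[ℂ] V'} (hf : Commutes (idx N) e e' f)
    (hs : Function.Surjective f) : Detects N n e' := by
  intro X X' hX hX' hle v hv
  obtain ⟨v, rfl⟩ := hs v
  exact h (X.comap f) (X'.comap f) (hf.stable_comap hX) (hf.stable_comap hX')
    (fun w hw => hle ⟨hw.1, (hf.mono Set.sdiff_subset).map_wt hw.2⟩) hv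

end Degree

/-! ### Invariants of submodules -/

section InvariantSubmodules

variable {ν : ℂ} {n N : ℕ∞} (h : n ≤ N)

/-- Invariants are exact. -/
theorem exists_inv_lift {M M' : LieRep.{u} (gl N)} (f : M ⟶ M')
    (hM : IsWeight (idx N \ idx n) M.e) (hM' : IsWeight (idx N \ idx n) M'.e)
    (x : ((glInv h).obj M').V) {m : M.V} (hm : LieRep.toLie f m = invMap h M' x) :
    ∃ y, LieRep.toLie ((glInv h).map f) y = x := by
  -- An arbitrary lift is projected to weight zero; the projection commutes with `f` and fixes the
  -- invariant `x`.
  have h1 := pr_zero_mem hM m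
  rw [← range_invMap h M hM] at h1
  obtain ⟨y, hy⟩ := h1
  refine ⟨y, invMap_injective h M' ?_⟩
  have h2 := ((LieRep.commutes (LieRep.toLie f)).mono Set.sdiff_subset).pr hM hM' {0} m
  have h3 : LieRep.toLie f (pr (idx N \ idx n) M.e {0} m) =
    pr (idx N \ idx n) M'.e {0} (LieRep.toLie f m) := h2
  rw [invMap_naturality, hy, h3, hm]
  exact (invMap_isInv h M' hM').pr_apply hM' x

theorem glInv_map_injective {M M' : LieRep.{u} (gl N)} (f : M ⟶ M')
    (hf : Function.Injective (LieRep.toLie f)) :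
    Function.Injective (LieRep.toLie ((glInv h).map f)) := fun x y hxy =>
  invMap_injective h M (hf (by rw [← invMap_naturality, hxy, invMap_naturality]))

theorem glInv_map_surjective {M M' : LieRep.{u} (gl N)} (f : M ⟶ M')
    (hM : IsWeight (idx N \ idx n) M.e) (hM' : IsWeight (idx N \ idx n) M'.e)
    (hf : Function.Surjective (LieRep.toLie f)) :
    Function.Surjective (LieRep.toLie ((glInv h).map f)) := fun x => by
  obtain ⟨m, hm⟩ := hf (invMap h M' x)
  exact exists_inv_lift h f hM hM' x hm

/-- The inclusion of a submodule, as a morphism. -/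
def subIncl {S : Set ℕ} {M : LieRep.{u} (glOn S)} (K : LieSubmodule ℂ (glOn S) M.V) :
    M.ofSub K ⟶ M := K.incl

/-- The projection to a quotient, as a morphism. -/
def quotProj {S : Set ℕ} {M : LieRep.{u} (glOn S)} (K : LieSubmodule ℂ (glOn S) M.V) :
    M ⟶ M.ofQuot K := LieSubmodule.Quotient.mk' K

theorem quotProj_eq_zero {S : Set ℕ} {M : LieRep.{u} (glOn S)}
    {K : LieSubmodule ℂ (glOn S) M.V} {m : M.V} : LieRep.toLie (quotProj K) m = 0 ↔ m ∈ K :=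
  LieSubmodule.Quotient.mk_eq_zero K

theorem quotProj_surjective {S : Set ℕ} {M : LieRep.{u} (glOn S)}
    (K : LieSubmodule ℂ (glOn S) M.V) : Function.Surjective (LieRep.toLie (quotProj K)) :=
  LieSubmodule.Quotient.surjective_mk' K

variable {M : LieRep.{u} (gl N)}

theorem isWeight_ofSub {C S : Set ℕ} (hC : C ⊆ S) {M : LieRep.{u} (glOn S)} (hM : IsWeight C M.e)
    (K : LieSubmodule ℂ (glOn S) M.V) : IsWeight C (M.ofSub K).e :=
  hM.of_injective ((ofSub_commutes K).mono hC) Subtype.val_injective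

theorem isWeight_ofQuot {C S : Set ℕ} (hC : C ⊆ S) {M : LieRep.{u} (glOn S)} (hM : IsWeight C M.e)
    (K : LieSubmodule ℂ (glOn S) M.V) : IsWeight C (M.ofQuot K).e :=
  hM.of_surjective ((ofQuot_commutes K).mono hC) (LieSubmodule.Quotient.surjective_mk' K)

theorem PF.inv {P : LieRep.{u} (gl N)} (hP : PF P) (hw : IsWeight (idx N \ idx n) P.e) :
    PF ((glInv h).obj P) := by
  induction hP with
  | of_isPoly P hP => exact .of_isPoly _ (isPoly_glInv h hP)
  | of_ext P K _ _ ih1 ih2 =>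
    have hw1 := isWeight_ofSub Set.sdiff_subset hw K
    have hw2 := isWeight_ofQuot Set.sdiff_subset hw K
    refine PF.of_exact (ih1 hw1) (ih2 hw2) (LieRep.toLie ((glInv h).map (subIncl K)))
      (LieRep.toLie ((glInv h).map (quotProj K))) fun x hx => ?_
    have h1 := congrArg (invMap h _) hx
    rw [invMap_naturality, map_zero] at h1
    exact exists_inv_lift h (subIncl K) hw1 hw x (m := ⟨_, quotProj_eq_zero.mp h1⟩) rfl

/-- The invariants of a submodule. -/
def invSub (X : LieSubmodule ℂ (gl N) M.V) : LieSubmodule ℂ (gl n) ((glInv h).obj M).V :=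
  LieRep.subOfStable (X.toSubmodule.comap (invMap h M))
    ((invMap_commutes h M).stable_comap ((LieRep.stable X).mono (idx_mono h)))

theorem mem_invSub {X : LieSubmodule ℂ (gl N) M.V} {x : ((glInv h).obj M).V} :
    x ∈ invSub h X ↔ invMap h M x ∈ X := Iff.rfl

theorem invSub_mono {X X' : LieSubmodule ℂ (gl N) M.V} (hX : X ≤ X') :
    invSub h X ≤ invSub h X' := fun _ hx => hX hx

/-- The submodule generated by a module of invariants. -/
def genSub (Y : LieSubmodule ℂ (gl n) ((glInv h).obj M).V) : LieSubmodule ℂ (gl N) M.V :=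
  LieRep.subOfStable (gen (idx N) M.e (Y.toSubmodule.map (invMap h M))) (gen_stable _ _ _)

theorem genSub_mono {Y Y' : LieSubmodule ℂ (gl n) ((glInv h).obj M).V} (hY : Y ≤ Y') :
    genSub h Y ≤ genSub h Y' :=
  gen_le (gen_stable _ _ _) ((Submodule.map_mono hY).trans (subset_gen _ _ _))

theorem genSub_le {Y : LieSubmodule ℂ (gl n) ((glInv h).obj M).V} {X : LieSubmodule ℂ (gl N) M.V}
    (hY : Y ≤ invSub h X) : genSub h Y ≤ X :=
  gen_le (LieRep.stable X) (Submodule.map_le_iff_le_comap.mpr hY)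

theorem stable_map_invMap (Y : LieSubmodule ℂ (gl n) ((glInv h).obj M).V) :
    Stable (idx n) M.e (Y.toSubmodule.map (invMap h M)) :=
  (invMap_commutes h M).stable_map (LieRep.stable Y)

theorem map_invMap_le (hw : IsWeight (idx N \ idx n) M.e)
    (Y : LieSubmodule ℂ (gl n) ((glInv h).obj M).V) :
    Y.toSubmodule.map (invMap h M) ≤ wt (idx N \ idx n) M.e 0 :=
  LinearMap.map_le_range.trans (range_invMap h M hw).le

theorem diff_diff_idx (h : n ≤ N) : idx N \ (idx N \ idx n) = idx n :=
  Set.sdiff_sdiff_cancel_left (idx_mono h)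

/-- By `pr_zero_gen`, generating a submodule creates no new invariants. So the lattice of submodules
of the invariants embeds in that of `M`, for every `n` and without any detection hypothesis. -/
theorem invSub_genSub (hw : IsWeight (idx N \ idx n) M.e)
    (Y : LieSubmodule ℂ (gl n) ((glInv h).obj M).V) : invSub h (genSub h Y) = Y := by
  apply le_antisymm
  · intro x hx
    have h1 := pr_zero_gen M.isSys hw Set.sdiff_subset
      (by rw [diff_diff_idx h]; exact stable_map_invMap h Y) (map_invMap_le h hw Y) hx
    rw [(invMap_isInv h M hw).pr_apply hw x] at h1
    obtain ⟨y, hy, hyx⟩ := h1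
    exact invMap_injective h M hyx ▸ hy
  · exact fun x hx => subset_gen _ _ _ ⟨x, hx, rfl⟩

theorem invSub_bot : invSub h (⊥ : LieSubmodule ℂ (gl N) M.V) = ⊥ := by
  rw [eq_bot_iff]
  intro x hx
  exact (LieSubmodule.mem_bot _).mpr (invMap_injective h M
    (((LieSubmodule.mem_bot _).mp ((mem_invSub h).mp hx)).trans (map_zero _).symm))

theorem invSub_top : invSub h (⊤ : LieSubmodule ℂ (gl N) M.V) = ⊤ := rfl

theorem PFq.invSub (hw : IsWeight (idx N \ idx n) M.e) {A B : LieSubmodule ℂ (gl N) M.V}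
    (hAB : PFq A B) : PFq (M := (glInv h).obj M) (invSub h A) (invSub h B) := by
  have hwB := isWeight_ofSub Set.sdiff_subset hw B
  have hP := hAB.pf_subq.inv h (isWeight_ofQuot Set.sdiff_subset hwB (A.comap B.incl))
  let g := LieRep.toLie ((glInv h).map (quotProj (M := M.ofSub B) (A.comap B.incl)))
  have h1 : PFq (M := (glInv h).obj (M.ofSub B)) g.ker ⊤ :=
    ⟨_, g.comp (⊤ : LieSubmodule ℂ (gl n) _).incl, hP, fun b hb => LieModuleHom.mem_ker.mpr hb⟩
  refine (h1.map (M' := (glInv h).obj M) (LieRep.toLie ((glInv h).map (subIncl B)))).mono ?_ ?_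
  · intro x hx
    obtain ⟨y, hy, rfl⟩ := (LieSubmodule.mem_map _).mp hx
    have h2 := congrArg (invMap h _) (LieModuleHom.mem_ker.mp hy)
    rw [invMap_naturality, map_zero] at h2
    have h3 : invMap h _ y ∈ A.comap B.incl := (quotProj_eq_zero (M := M.ofSub B)).mp h2
    exact h3
  · intro x hx
    obtain ⟨y, hy⟩ := exists_inv_lift h (subIncl B) hwB hw x (m := ⟨_, hx⟩) rfl
    exact (LieSubmodule.mem_map _).mpr ⟨y, trivial, hy⟩

/-- A detected module is an extension of polynomial modules if its invariants are. -/
theorem PF.of_inv (h0 : 0 ∈ idx n) (hν : LargeFor ν n) {P : LieRep.{u} (gl n)} (hP : PF P) :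
    ∀ {X : LieRep.{u} (gl N)} (g : P ⟶ (glInv h).obj X), IsO ν N X.e → Detects N n X.e →
      Function.Surjective (LieRep.toLie g) → PF X := by
  induction hP with
  | of_isPoly P hP =>
    intro X g hX hd hg
    have hw := hX.isWeight_diff h0
    refine .of_isPoly _ ((isPoly_iff X).mpr (FinP.of_inv (idx_mono h) X.isSys hw
      (invMap_isInv h X hw) hd (fun k f hf hne => ?_)
      ((isPoly_iff _).mp (isPoly_of_surjective hP (LieRep.toLie g) hg))))
    -- Polynomial objects of O have degree `ν`, so `LargeFor` supplies enough letters for every map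
    -- that has to be extended.
    exact hν k ((isO_glInv h h0 hX).degree_eq h0 hf hne)
  | of_ext P K _ _ ih1 ih2 =>
    intro X g hX hd hg
    have hw := hX.isWeight_diff h0
    have h0N := idx_mono h h0
    -- The induction is set up for surjections from `P`, since the pieces of an extension only map
    -- onto the pieces of the invariants. The submodule `A` generated by the image `Y` of `K` has
    -- exactly `Y` as invariants, so it cuts `X` compatibly with the extension.
    let Y := K.map (LieRep.toLie g)
    let A := genSub h Y
    have hYA : ∀ x, invMap h X x ∈ A ↔ x ∈ Y := fun x => by
      rw [← mem_invSub, invSub_genSub h hw]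
    have hwA := isWeight_ofSub Set.sdiff_subset hw A
    have hwQ := isWeight_ofQuot Set.sdiff_subset hw A
    obtain ⟨k, hk⟩ := LieRep.exists_lift (subIncl K ≫ g) ((glInv h).map (subIncl A))
      (glInv_map_injective h _ Subtype.val_injective) fun m =>
        exists_inv_lift h (subIncl A) hwA hw (LieRep.toLie g m)
          (m := ⟨_, (hYA _).mpr (LieSubmodule.mem_map_of_mem m.2)⟩) rfl
    have hk' : ∀ m, LieRep.toLie ((glInv h).map (subIncl A)) (LieRep.toLie k m) =
      LieRep.toLie g m := fun m => DFunLike.congr_fun (F := _ →ₗ⁅ℂ, gl n⁆ _) hk m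
    refine .of_ext X A (ih1 k (hX.of_injective h0N (ofSub_commutes A) Subtype.val_injective)
      (hd.of_injective (ofSub_commutes A) Subtype.val_injective) fun y => ?_)
      (ih2 (quotDesc (M' := (glInv h).obj (X.ofQuot A)) K
        (LieRep.toLie (g ≫ (glInv h).map (quotProj A))) fun m hm => ?_)
        (hX.of_surjective (ofQuot_commutes A) (LieSubmodule.Quotient.surjective_mk' A) h0N)
        (hd.of_surjective (ofQuot_commutes A) (LieSubmodule.Quotient.surjective_mk' A)) fun y => ?_)
    · have h1 : LieRep.toLie ((glInv h).map (subIncl A)) y ∈ Y := (hYA _).mp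
        ((invMap_naturality h (subIncl A) y).symm ▸ (invMap h _ y).2)
      obtain ⟨m, hm, hmy⟩ := (LieSubmodule.mem_map _).mp h1
      exact ⟨⟨m, hm⟩, glInv_map_injective h (subIncl A) Subtype.val_injective
        ((hk' ⟨m, hm⟩).trans hmy)⟩
    · refine invMap_injective h _ ?_
      rw [map_zero]
      exact quotProj_eq_zero.mpr ((hYA _).mpr (LieSubmodule.mem_map_of_mem hm))
    · obtain ⟨x, rfl⟩ := glInv_map_surjective h (quotProj A) hw hwQ (quotProj_surjective A) y
      obtain ⟨m, rfl⟩ := hg x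
      exact ⟨LieSubmodule.Quotient.mk' K m, rfl⟩

/-- By exactness, the invariants of the subquotient are a subquotient of the invariants, and
`PF.of_inv` lifts the conclusion to the detected subquotient itself. -/
theorem PFq.of_invSub (h0 : 0 ∈ idx n) (hν : LargeFor ν n) (hM : IsO ν N M.e)
    (hd : Detects N n M.e) {A B : LieSubmodule ℂ (gl N) M.V}
    (hAB : PFq (M := (glInv h).obj M) (ParabolicO.invSub h A) (ParabolicO.invSub h B)) :
    PFq A B := by
  have hw := hM.isWeight_diff h0
  have h0N := idx_mono h h0
  have hwB := isWeight_ofSub Set.sdiff_subset hw B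
  have h1 := (hAB.comap (M := (glInv h).obj (M.ofSub B))
    (LieRep.toLie ((glInv h).map (subIncl B)))).map (M' := (glInv h).obj (subq A B))
      (LieRep.toLie ((glInv h).map (quotProj (M := M.ofSub B) (A.comap B.incl))))
  have h2 : PFq (M := (glInv h).obj (subq A B)) ⊥ ⊤ := by
    refine h1.mono (fun x hx => ?_) fun x _ => ?_
    · obtain ⟨y, hy, rfl⟩ := (LieSubmodule.mem_map _).mp hx
      refine (LieSubmodule.mem_bot _).mpr (invMap_injective h _ ?_)
      rw [map_zero]
      exact quotProj_eq_zero.mpr hy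
    · obtain ⟨y, rfl⟩ := glInv_map_surjective h (quotProj (M := M.ofSub B) (A.comap B.incl)) hwB
        (isWeight_ofQuot Set.sdiff_subset hwB _) (quotProj_surjective _) x
      exact LieSubmodule.mem_map_of_mem (invMap h _ y).2
  refine .of_subq (PF.of_inv h h0 hν (pFq_bot_iff.mp h2) (X := subq A B) (subIncl ⊤) ?_ ?_ fun x =>
    ⟨⟨x, trivial⟩, rfl⟩) LieModuleHom.id Function.surjective_id
  · exact (hM.of_injective h0N (ofSub_commutes B) Subtype.val_injective).of_surjective
      (ofQuot_commutes (M := M.ofSub B) _) (LieSubmodule.Quotient.surjective_mk' _) h0N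
  · exact (hd.of_injective (ofSub_commutes B) Subtype.val_injective).of_surjective
      (ofQuot_commutes (M := M.ofSub B) _) (LieSubmodule.Quotient.surjective_mk' _)

/-- A submodule of the invariants with torsion quotient, or that is torsion, generates a submodule
of `M` of the same kind; locality of `M` then applies. -/
theorem IsLocal.inv (hM : IsLocal M) (h0 : 0 ∈ idx n) (hν : LargeFor ν n) (hO : IsO ν N M.e)
    (hd : Detects N n M.e) : IsLocal ((glInv h).obj M) := by
  have hw := hO.isWeight_diff h0
  refine ⟨fun Y hY => ?_, fun Y hY => ?_⟩
  · rw [← invSub_genSub h hw Y] at hY ⊢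
    rw [hM.top (PFq.of_invSub h h0 hν hO hd (B := ⊤) hY), invSub_top]
  · have h1 := hM.bot (A := genSub h Y) (PFq.of_invSub h h0 hν hO hd (by
      rw [invSub_bot, invSub_genSub h hw]; exact hY))
    rw [← invSub_genSub h hw Y, h1, invSub_bot]

/-- Chains go up by generation and down by invariants. Only the way down needs detection and large
`n`. -/
theorem hasChain_glInv_iff (h0 : 0 ∈ idx n) (hν : LargeFor ν n) (hO : IsO ν N M.e)
    (hd : Detects N n M.e) (p : ℕ) : HasChain ((glInv h).obj M) p ↔ HasChain M p := by
  have hw := hO.isWeight_diff h0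
  constructor
  · rintro ⟨Y, hY, hp⟩
    refine ⟨fun i => genSub h (Y i), fun i j hij => genSub_mono h (hY hij), fun i hi hq => ?_⟩
    have h1 := hq.invSub h hw
    rw [invSub_genSub h hw, invSub_genSub h hw] at h1
    exact hp i hi h1
  · rintro ⟨A, hA, hp⟩
    exact ⟨fun i => invSub h (A i), fun i j hij => invSub_mono h (hA hij), fun i hi hq =>
      hp i hi (PFq.of_invSub h h0 hν hO hd hq)⟩

/-- Homomorphisms between the invariants of detected modules extend uniquely. -/
theorem glInv_map_bijective (h0 : 0 ∈ idx n) {M' : LieRep.{u} (gl N)} (hO : IsO ν N M.e)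
    (hO' : IsO ν N M'.e) (hd : Detects N n M.e) (hd' : Detects N n M'.e) :
    Function.Bijective fun f : M ⟶ M' => (glInv h).map f := by
  have hw := hO.isWeight_diff h0
  have hw' := hO'.isWeight_diff h0
  refine ⟨fun f g hfg => LieRep.hom_ext fun m => ?_, fun g => ?_⟩
  · let d : M.V →ₗ[ℂ] M'.V := (LieRep.toLie f : M.V →ₗ[ℂ] M'.V) - (LieRep.toLie g : M.V →ₗ[ℂ] M'.V)
    have hdc : Commutes (idx N) M.e M'.e d := fun i hi j hj v => by
      rw [LinearMap.sub_apply, LinearMap.sub_apply, map_sub, LieRep.commutes _ i hi j hj,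
        LieRep.commutes _ i hi j hj]
    have h1 := hd (LinearMap.ker d) ⊤ hdc.stable_ker (Stable.top _ _) (by
      rw [top_inf_eq, ← range_invMap h M hw]
      rintro _ ⟨x, rfl⟩
      have h2 := congrArg (fun q => invMap h M' (LieRep.toLie q x)) hfg
      exact LinearMap.mem_ker.mpr (sub_eq_zero.mpr h2))
    exact sub_eq_zero.mp (LinearMap.mem_ker.mp (h1 (x := m) trivial))
  · obtain ⟨f, hf, hfg⟩ := IsInv.exists_extension M.isSys M'.isSys hw hw'
      (fun X hX hX0 => eq_top_iff.mpr (hd X ⊤ hX (Stable.top _ _) (top_inf_eq _ |>.trans_le hX0)))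
      (invMap_isInv h M hw) (invMap_isInv h M' hw') (LieRep.commutes (LieRep.toLie g))
      fun X hX _ hX0 => le_bot_iff.mp (hd' ⊥ X (Stable.bot _ _) hX hX0.le)
    refine ⟨LieRep.homOfCommutes f hf, LieRep.hom_ext fun x => invMap_injective h M' ?_⟩
    exact hfg x

end InvariantSubmodules

/-! ### The functors on the Serre quotients -/

section Descent

variable {ν : ℂ} {n N : ℕ∞} (h : n ≤ N)

/-- By exactness the kernel and the cokernel on invariants embed in the invariants of the kernel and
the cokernel, which are polynomial. -/
theorem isoModPoly_invO (h0 : 0 ∈ idx n) {M M' : OCat.{u} ν N} (f : M ⟶ M')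
    (hf : isoModPoly ν N f) : isoModPoly ν n ((invO h (invMapsO h h0)).map f) := by
  have h0N := idx_mono h h0
  have hw := ((parO_iff h0N _).mp M.property).isWeight_diff h0
  have hw' := ((parO_iff h0N _).mp M'.property).isWeight_diff h0
  let g : (glInv h).obj M.obj ⟶ (glInv h).obj M'.obj := (glInv h).map f.hom
  have hker : IsPoly (((glInv h).obj M.obj).ofSub (LieRep.toLie g).ker) := by
    obtain ⟨k, hk⟩ := LieRep.exists_lift (subIncl (LieRep.toLie g).ker)
      ((glInv h).map (subIncl (LieRep.toLie f.hom).ker))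
      (glInv_map_injective h _ Subtype.val_injective) fun m =>
        exists_inv_lift h (subIncl _) (isWeight_ofSub Set.sdiff_subset hw _) hw _
          (m := ⟨invMap h M.obj m.1, LieModuleHom.mem_ker.mpr (by
            rw [← invMap_naturality, show LieRep.toLie ((glInv h).map f.hom) m.1 = 0 from
              LieModuleHom.mem_ker.mp m.2, map_zero])⟩) rfl
    refine isPoly_of_injective (isPoly_glInv h hf.1) (LieRep.toLie k) fun a b hab => Subtype.ext ?_
    have h1 := DFunLike.congr_fun (F := _ →ₗ⁅ℂ, gl n⁆ ((glInv h).obj M.obj).V) hk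
    exact (h1 a).symm.trans ((congrArg
      (LieRep.toLie ((glInv h).map (subIncl (LieRep.toLie f.hom).ker))) hab).trans (h1 b))
  have hcoker : IsPoly (((glInv h).obj M'.obj).ofQuot (LieRep.toLie g).range) := by
    let q := (glInv h).map (quotProj (LieRep.toLie f.hom).range)
    refine isPoly_of_injective (isPoly_glInv h hf.2) (quotDesc _ (LieRep.toLie q) ?_)
      (quotDesc_injective _ _ _ fun x hx => ?_)
    · rintro _ ⟨x, rfl⟩
      refine invMap_injective h _ ?_
      rw [map_zero]
      exact quotProj_eq_zero.mpr ⟨invMap h M.obj x, rfl⟩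
    · have h1 := congrArg (invMap h _) hx
      rw [map_zero] at h1
      obtain ⟨m, hm⟩ := (LieModuleHom.mem_range _ _).mp (quotProj_eq_zero.mp h1)
      exact exists_inv_lift h f.hom hw hw' x hm
  exact ⟨hker, hcoker⟩

theorem invDescends (h0 : 0 ∈ idx n) : InvDescends.{u} (ν := ν) h (invMapsO h h0) :=
  fun _ _ f hf => MorphismProperty.Q_inverts _ _ (isoModPoly_invO h h0 f hf)

variable (hO : InvMapsO.{u} ν h) (hW : InvDescends h hO)

theorem invHat_map (M M' : OCat.{u} ν N) (f : M ⟶ M') :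
    (invHat h hO hW).map ((piHat ν N).map f) = (piHat ν n).map ((invO h hO).map f) := by
  refine (Functor.congr_hom (piHat_comp_invHat h hO hW) f).trans ?_
  exact (Category.id_comp _).trans (Category.comp_id _)

/-- Homomorphisms between local modules and in the Serre quotient agree. -/
theorem piHat_map_bijective (h0 : 0 ∈ idx N) (M M' : LCat.{u} ν N) :
    Function.Bijective fun f : M.obj ⟶ M'.obj =>
      (piHat ν N).map (X := (locIncl ν N).obj M) (Y := (locIncl ν N).obj M')
        (ObjectProperty.homMk f) := by
  have := isEquivalence_locIncl_piHat.{u} (ν := ν) h0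
  have h1 : Function.Bijective ((locIncl ν N ⋙ piHat ν N).map (X := M) (Y := M')) :=
    ⟨Functor.map_injective _, Functor.map_surjective _⟩
  exact h1.comp ⟨fun f g hfg => congrArg (fun q : M ⟶ M' => q.hom) hfg, fun q => ⟨q.hom, rfl⟩⟩

theorem exists_local_iso (h0 : 0 ∈ idx N) (X : OHat.{u} ν N) :
    ∃ M : LCat.{u} ν N, Nonempty ((piHat ν N).obj ((locIncl ν N).obj M) ≅ X) := by
  have := isEquivalence_locIncl_piHat.{u} (ν := ν) h0
  exact ⟨_, ⟨(locIncl ν N ⋙ piHat ν N).objObjPreimageIso X⟩⟩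

/-- The invariants are still local, so on both sides the morphisms of the Serre quotient are
homomorphisms of modules; these correspond by unique extension. -/
theorem invHat_map_bijective (h0 : 0 ∈ idx n) (hν : LargeFor ν n) (M M' : LCat.{u} ν N)
    (hd : Detects N n M.obj.e) (hd' : Detects N n M'.obj.e) :
    Function.Bijective ((invHat h hO hW).map (X := (piHat ν N).obj ((locIncl ν N).obj M))
      (Y := (piHat ν N).obj ((locIncl ν N).obj M'))) := by
  have h0N := idx_mono h h0
  have hM := (parO_iff h0N _).mp M.property.1
  have hM' := (parO_iff h0N _).mp M'.property.1
  let Γ : ∀ (L : LCat.{u} ν N), Detects N n L.obj.e → LCat.{u} ν n := fun L hL =>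
    ⟨(glInv h).obj L.obj, hO _ L.property.1,
      L.property.2.inv h h0 hν ((parO_iff h0N _).mp L.property.1) hL⟩
  have h1 := piHat_map_bijective h0N M M'
  have h2 := (piHat_map_bijective h0 (Γ M hd) (Γ M' hd')).comp
    (glInv_map_bijective h h0 hM hM' hd hd')
  exact (Function.Bijective.of_comp_iff _ h1).mp ((congrArg Function.Bijective
    (funext fun f => invHat_map h hO hW _ _ _)).mpr h2)

theorem objLength_invHat (h0 : 0 ∈ idx n) (hν : LargeFor ν n) (M : LCat.{u} ν N)
    (hd : Detects N n M.obj.e) :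
    objLength ((invHat h hO hW).obj ((piHat ν N).obj ((locIncl ν N).obj M))) =
      objLength ((piHat ν N).obj ((locIncl ν N).obj M)) := by
  have h0N := idx_mono h h0
  have hM := (parO_iff h0N _).mp M.property.1
  let L : LCat.{u} ν n := ⟨(glInv h).obj M.obj, hO _ M.property.1, M.property.2.inv h h0 hν hM hd⟩
  refine ENat.eq_of_forall_natCast_le_iff fun p => ?_
  rw [le_objLength_piHat_iff h0N, ← hasChain_glInv_iff h h0 hν hM hd]
  exact le_objLength_piHat_iff h0 L p

theorem exists_objLength_eq (h0 : 0 ∈ idx N) (X : OHat.{u} ν N) : ∃ l : ℕ, objLength X = l := by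
  obtain ⟨M, ⟨i⟩⟩ := exists_local_iso h0 X
  obtain ⟨k, hk⟩ := (finLen_of_parO h0 M.property.1).hasChain_le
  rw [← objLength_of_iso i]
  refine ENat.ne_top_iff_exists.mp (fun htop => ?_) |>.imp fun _ => Eq.symm
  have := hk (k + 1) ((le_objLength_piHat_iff h0 M _).mp (htop ▸ le_top))
  lia

theorem map_bijective_of_iso {C D : Type*} [Category C] [Category D] (F : C ⥤ D) {X Y X' Y' : C}
    (i : X ≅ X') (j : Y ≅ Y') (hF : Function.Bijective (F.map (X := X) (Y := Y))) :
    Function.Bijective (F.map (X := X') (Y := Y')) := by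
  refine ⟨fun f g hfg => ?_, fun g => ?_⟩
  · have : F.map (i.hom ≫ f ≫ j.inv) = F.map (i.hom ≫ g ≫ j.inv) := by
      simp only [Functor.map_comp, hfg]
    simpa using hF.1 this
  · obtain ⟨f, hf⟩ := hF.2 (F.map i.hom ≫ g ≫ F.map j.inv)
    refine ⟨i.inv ≫ f ≫ j.hom, ?_⟩
    rw [Functor.map_comp, Functor.map_comp, hf]
    simp

theorem exists_detects_all (M : LCat.{u} ν ⊤) : ∃ m : ℕ, ∀ i, m ≤ i →
    LargeFor ν (nn i) ∧ Detects ⊤ (nn i) M.obj.e := by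
  obtain ⟨K, hK⟩ := exists_largeFor ν
  obtain ⟨K', hK'⟩ := ((parO_iff (by simp [idx]) M.obj).mp M.property.1).exists_detects
    (by simp [idx])
  refine ⟨max K K', fun i hi => ⟨hK _ ?_, hK' _ ?_ le_top⟩⟩
  · exact_mod_cast (le_max_left K K').trans (hi.trans (Nat.le_succ i))
  · exact_mod_cast (le_max_right K K').trans (hi.trans (Nat.le_succ i))

end Descent

/-! ### Inverse limits -/

namespace InvLim

variable {C : ℕ → Type u} [∀ i, Category.{v} (C i)] {F : ∀ i, C (i + 1) ⥤ C i}
  {D : Type*} [Category D] (G : ∀ i, D ⥤ C i) (α : ∀ i, G (i + 1) ⋙ F i ≅ G i)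

theorem map_eq_of_succ {X Y : D} (t : (lift G α).obj X ⟶ (lift G α).obj Y) {f : X ⟶ Y} {i : ℕ}
    (h : (G (i + 1)).map f = t.app (i + 1)) : (G i).map f = t.app i := by
  have h1 := (α i).hom.naturality f
  have h2 := t.comm i
  change (F i).map ((G (i + 1)).map f) ≫ _ = _ at h1
  rw [h] at h1
  exact (cancel_epi ((α i).hom.app X)).mp (h1.symm.trans h2)

/-- Components at small indices are determined by those at larger ones, so bijectivity at all large
indices is enough. -/
theorem lift_map_bijective (X Y : D) (m : ℕ)
    (hG : ∀ i, m ≤ i → Function.Bijective ((G i).map (X := X) (Y := Y))) :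
    Function.Bijective ((lift G α).map (X := X) (Y := Y)) := by
  refine ⟨fun f g hfg => (hG m le_rfl).1 (congrArg (fun t => Hom.app t m) hfg), fun t => ?_⟩
  obtain ⟨f, hf⟩ := (hG m le_rfl).2 (t.app m)
  have h1 : ∀ k, (G (m + k)).map f = t.app (m + k) := by
    intro k
    induction k with
    | zero => exact hf
    | succ k ih =>
      -- A lift of the next component also lifts the present one, so by injectivity it is the
      -- morphism already found.
      obtain ⟨f', hf'⟩ := (hG (m + k + 1) (by lia)).2 (t.app (m + k + 1))
      obtain rfl : f' = f := (hG (m + k) (by lia)).1 ((map_eq_of_succ G α t hf').trans ih.symm)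
      exact hf'
  have h2 : ∀ k i, (G (i + k)).map f = t.app (i + k) → (G i).map f = t.app i := by
    intro k
    induction k with
    | zero => exact fun i => id
    | succ k ih => exact fun i hi => ih i (map_eq_of_succ G α t hi)
  refine ⟨f, Hom.ext (funext fun i => h2 m i ?_)⟩
  rw [add_comm]
  exact h1 i

/-- An isomorphism of the tails extends one index downwards, by transport along the structure
isomorphisms of both objects. -/
theorem nonempty_iso (X : D) (Y : InvLim F) : ∀ (m : ℕ) (θ : ∀ i, m ≤ i → ((G i).obj X ≅ Y.obj i))
    (_ : ∀ i (hi : m ≤ i), (F i).map (θ (i + 1) (by lia)).hom ≫ (Y.iso i).hom =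
      (α i).hom.app X ≫ (θ i hi).hom), Nonempty ((lift G α).obj X ≅ Y) := by
  intro m
  induction m with
  | zero =>
    intro θ hθ
    refine ⟨⟨⟨fun i => (θ i i.zero_le).hom, fun i => hθ i i.zero_le⟩,
      ⟨fun i => (θ i i.zero_le).inv, fun i => ?_⟩, Hom.ext (funext fun i => Iso.hom_inv_id _),
      Hom.ext (funext fun i => Iso.inv_hom_id _)⟩⟩
    exact (Iso.inv_comp_eq ((F i).mapIso (θ (i + 1) (i + 1).zero_le))).mpr
      (((Iso.eq_comp_inv (θ i i.zero_le)).mpr (hθ i i.zero_le).symm).trans (Category.assoc _ _ _))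
  | succ m ih =>
    intro θ hθ
    let θ' : ∀ i, m ≤ i → ((G i).obj X ≅ Y.obj i) := fun i hi =>
      if h : m + 1 ≤ i then θ i h
      else ((α i).app X).symm ≪≫ (F i).mapIso (θ (i + 1) (by lia)) ≪≫ Y.iso i
    refine ih θ' fun i hi => ?_
    have h1 : θ' (i + 1) (by lia) = θ (i + 1) (by lia) := dif_pos _
    rw [h1]
    by_cases h : m + 1 ≤ i
    · rw [show θ' i hi = θ i h from dif_pos h]
      exact hθ i h
    · rw [show θ' i hi = ((α i).app X).symm ≪≫ (F i).mapIso (θ (i + 1) (by lia)) ≪≫ Y.iso i from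
        dif_neg h]
      simp

end InvLim

/-! ### Modules whose invariants have the same length -/

section Tight

variable {ν : ℂ} {n N : ℕ∞} (h : n ≤ N) {M : LieRep.{u} (gl N)}

/-- If a local module and its invariants have the same length, then the invariants are local and
generate the module. -/
theorem IsLocal.inv_of_length (hM : IsLocal M) (hw : IsWeight (idx N \ idx n) M.e) {l : ℕ}
    (hl : ∀ p, HasChain M p → p ≤ l) (hl' : HasChain ((glInv h).obj M) l) :
    IsLocal ((glInv h).obj M) ∧ genSub h (⊤ : LieSubmodule ℂ (gl n) ((glInv h).obj M).V) = ⊤ := by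
  obtain ⟨A, hA, hp⟩ := hl'
  have hinv : ∀ {Y Y' : LieSubmodule ℂ (gl n) ((glInv h).obj M).V},
      PFq (genSub h Y) (genSub h Y') → PFq Y Y' := fun {Y Y'} hY => by
    have := hY.invSub h hw
    rwa [invSub_genSub h hw, invSub_genSub h hw] at this
  -- If `Y` generated a proper submodule, the chain generated by the `A i ⊓ Y`, followed by `⊤`,
  -- would have `l + 1` steps outside the class: the last one by locality of `M`, the others because
  -- intersecting with `Y` changes the steps only within the class.
  have htop : ∀ Y : LieSubmodule ℂ (gl n) ((glInv h).obj M).V, PFq Y ⊤ → genSub h Y = ⊤ := by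
    intro Y hY
    by_contra hne
    refine (Nat.lt_succ_self l).not_ge (hl (l + 1) ⟨fun i => if i ≤ l then genSub h (A i ⊓ Y) else ⊤,
      fun i j hij => ?_, fun i hi hq => ?_⟩)
    · by_cases hj : j ≤ l
      · simp only [if_pos hj, if_pos (hij.trans hj)]
        exact genSub_mono h (inf_le_inf_right Y (hA hij))
      · simp only [if_neg hj]
        exact le_top
    · simp only [if_pos (Nat.lt_succ_iff.mp hi)] at hq
      by_cases hi' : i + 1 ≤ l
      · rw [if_pos hi'] at hq
        refine hp i hi' (((hinv hq).trans ((hY.inf (A (i + 1))).mono (inf_comm _ _).le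
          (by rw [top_inf_eq])) ?_).mono inf_le_left le_rfl)
        exact inf_le_inf_right Y (hA (Nat.le_succ i))
      · rw [if_neg hi'] at hq
        exact hne (hM.top (hq.mono (genSub_mono h inf_le_right) le_rfl))
  -- The dual argument, with `⊥` followed by the submodules generated by the `A i ⊔ Y`.
  have hbot : ∀ Y : LieSubmodule ℂ (gl n) ((glInv h).obj M).V, PFq ⊥ Y → genSub h Y = ⊥ := by
    intro Y hY
    by_contra hne
    refine (Nat.lt_succ_self l).not_ge (hl (l + 1) ⟨fun i => if i = 0 then ⊥ else
      genSub h (A (i - 1) ⊔ Y), fun i j hij => ?_, fun i hi hq => ?_⟩)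
    · by_cases hi : i = 0
      · simp only [if_pos hi]
        exact bot_le
      · simp only [if_neg hi, if_neg (show j ≠ 0 by lia)]
        exact genSub_mono h (sup_le_sup_right (hA (by lia)) Y)
    · simp only [if_neg (Nat.succ_ne_zero i), Nat.add_sub_cancel] at hq
      by_cases hi' : i = 0
      · rw [if_pos hi'] at hq
        exact hne (hM.bot (hq.mono le_rfl (genSub_mono h le_sup_right)))
      · rw [if_neg hi'] at hq
        obtain ⟨k, rfl⟩ := Nat.exists_eq_succ_of_ne_zero hi'
        refine hp k (by lia) ((PFq.trans ?_ (hinv hq) ?_).mono le_rfl le_sup_left)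
        · exact (hY.sup (A k)).mono (by rw [bot_sup_eq]) (sup_comm _ _).le
        · exact le_sup_left
  refine ⟨⟨fun Y hY => ?_, fun Y hY => ?_⟩, htop ⊤ (.of_le le_rfl)⟩
  · rw [← invSub_genSub h hw Y, htop Y hY, invSub_top]
  · rw [← invSub_genSub h hw Y, hbot Y hY, invSub_bot]

end Tight

/-! ### The module attached to a system of matrix units -/

section OfSys

variable {S : Set ℕ} {V : Type u} [AddCommGroup V] [Module ℂ V] {e : Ops V}

theorem linearIndependent_matUnit (S : Set ℕ) : LinearIndependent ℂ
    fun p : S × S => (⟨matUnit p.1 p.2, matUnit_mem p.1.2 p.2.2⟩ : glOn S) := by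
  rw [linearIndependent_iff]
  intro c hc
  ext ⟨k, l⟩
  let Φ : glOn S →ₗ[ℂ] ℂ := Finsupp.lapply (k : ℕ) ∘ₗ LinearMap.applyₗ (Finsupp.single (l : ℕ) 1) ∘ₗ
    (glOn S).toSubmodule.subtype
  have h1 : Φ ∘ₗ Finsupp.linearCombination ℂ
      (fun p : S × S => (⟨matUnit p.1 p.2, matUnit_mem p.1.2 p.2.2⟩ : glOn S)) =
      Finsupp.lapply (k, l) := by
    refine Finsupp.lhom_ext' fun p => LinearMap.ext_ring ?_
    change Φ (Finsupp.linearCombination ℂ _ (Finsupp.single p 1)) = Finsupp.single p 1 (k, l)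
    rw [Finsupp.linearCombination_single, one_smul]
    change Finsupp.single (p.1 : ℕ) (Finsupp.single (l : ℕ) (1 : ℂ) (p.2 : ℕ)) (k : ℕ) = _
    obtain ⟨p, q⟩ := p
    by_cases hp : p = k <;> by_cases hq : q = l <;>
      simp [Finsupp.single_apply, hp, hq, Subtype.ext_iff, eq_comm, ite_and]
  have h2 := LinearMap.congr_fun h1 c
  rw [LinearMap.comp_apply, hc, map_zero] at h2
  exact h2.symm

/-- The basis of matrix units. -/
def glBasis (S : Set ℕ) : Module.Basis (S × S) ℂ (glOn S) :=
  .mk (linearIndependent_matUnit S) fun x _ => by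
    refine glOn_induction (p := fun x => x ∈ Submodule.span ℂ (Set.range fun p : S × S =>
      (⟨matUnit p.1 p.2, matUnit_mem p.1.2 p.2.2⟩ : glOn S))) ?_ (Submodule.zero_mem _)
      (fun _ _ => Submodule.add_mem _) (fun c _ => Submodule.smul_mem _ c) x
    exact fun i hi j hj => Submodule.subset_span ⟨(⟨i, hi⟩, ⟨j, hj⟩), rfl⟩

/-- The action of a finitely supported matrix. -/
def sysLin (S : Set ℕ) (e : Ops V) : glOn S →ₗ[ℂ] Module.End ℂ V :=
  (glBasis S).constr ℂ fun p => e p.1 p.2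

theorem sysLin_matUnit {i j : ℕ} (hi : i ∈ S) (hj : j ∈ S) :
    sysLin S e ⟨matUnit i j, matUnit_mem hi hj⟩ = e i j := by
  have h1 : glBasis S (⟨i, hi⟩, ⟨j, hj⟩) = ⟨matUnit i j, matUnit_mem hi hj⟩ :=
    Module.Basis.mk_apply _ _ _
  rw [← h1, sysLin, Module.Basis.constr_basis]

/-- The action as a homomorphism of Lie algebras. -/
def sysHom (hs : IsSys S e) : glOn S →ₗ⁅ℂ⁆ Module.End ℂ V where
  toLinearMap := sysLin S e
  map_lie' := by
    intro x y
    change sysLin S e ⁅x, y⁆ = ⁅sysLin S e x, sysLin S e y⁆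
    induction x using glOn_induction with
    | zero => rw [zero_lie, map_zero, zero_lie]
    | add x x' hx hx' => rw [add_lie, map_add, hx, hx', map_add, add_lie]
    | smul c x hx => rw [smul_lie, map_smul, hx, map_smul, smul_lie]
    | unit i hi j hj =>
      induction y using glOn_induction with
      | zero => rw [lie_zero, map_zero, lie_zero]
      | add y y' hy hy' => rw [lie_add, map_add, hy, hy', map_add, lie_add]
      | smul c y hy => rw [lie_smul, map_smul, hy, map_smul, lie_smul]
      | unit k hk l hl =>
        have h1 : ⁅(⟨matUnit i j, matUnit_mem hi hj⟩ : glOn S),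
            (⟨matUnit k l, matUnit_mem hk hl⟩ : glOn S)⁆ =
            (if j = k then (⟨matUnit i l, matUnit_mem hi hl⟩ : glOn S) else 0) -
            (if l = i then (⟨matUnit k j, matUnit_mem hk hj⟩ : glOn S) else 0) := by
          apply Subtype.ext
          change matUnit i j * matUnit k l - matUnit k l * matUnit i j = _
          rw [matUnit_mul, matUnit_mul]
          split_ifs <;> rfl
        rw [h1, map_sub, apply_ite (sysLin S e), apply_ite (sysLin S e), map_zero,
          sysLin_matUnit hi hl, sysLin_matUnit hk hj, sysLin_matUnit hi hj, sysLin_matUnit hk hl]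
        ext v
        change _ = e i j (e k l v) - e k l (e i j v)
        rw [hs i hi j hj k hk l hl v, LinearMap.sub_apply]
        split_ifs <;> (try simp only [LinearMap.zero_apply]) <;> abel

/-- The module attached to a system of matrix units. -/
def LieRep.ofSys (hs : IsSys S e) : LieRep.{u} (glOn S) :=
  letI := LieRingModule.compLieHom V (sysHom hs)
  haveI := LieModule.compLieHom V (sysHom hs)
  { V := V }

/-- The identity map to `LieRep.ofSys`. -/
def ofSysEquiv (hs : IsSys S e) : V ≃ₗ[ℂ] (LieRep.ofSys hs).V := LinearEquiv.refl ℂ V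

theorem ofSysEquiv_commutes (hs : IsSys S e) :
    Commutes S e (LieRep.ofSys hs).e (ofSysEquiv hs).toLinearMap := by
  intro i hi j hj v
  rw [LieRep.e_eq _ hi hj]
  exact (LinearMap.congr_fun (sysLin_matUnit (e := e) hi hj) v).symm

end OfSys

/-! ### Unions of modules -/

section Union

theorem IsInv.comp {V V' V'' : Type*} [AddCommGroup V] [Module ℂ V] [AddCommGroup V'] [Module ℂ V']
    [AddCommGroup V''] [Module ℂ V''] {R T S : Set ℕ} (hRT : R ⊆ T) (hTS : T ⊆ S) {e'' : Ops V''}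
    {e' : Ops V'} {e : Ops V} {ι : V'' →ₗ[ℂ] V'} {κ : V' →ₗ[ℂ] V} (hκ : IsInv T S e' e κ)
    (hι : IsInv R T e'' e' ι) : IsInv R S e'' e (κ ∘ₗ ι) := by
  refine ⟨fun i hi j hj v => ?_, hκ.injective.comp hι.injective, le_antisymm ?_ fun v hv => ?_⟩
  · rw [LinearMap.comp_apply, LinearMap.comp_apply, hι.commutes i hi j hj,
      hκ.commutes i (hRT hi) j (hRT hj)]
  · rintro _ ⟨x, rfl⟩
    rw [mem_wt_zero]
    intro i hi
    by_cases hiT : i ∈ T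
    · have h1 : ι x ∈ wt (T \ R) e' 0 := hι.range_eq ▸ ⟨x, rfl⟩
      rw [LinearMap.comp_apply, ← hκ.commutes i hiT i hiT, mem_wt_zero.mp h1 i ⟨hiT, hi.2⟩, map_zero]
    · have h1 : κ (ι x) ∈ wt (S \ T) e 0 := hκ.range_eq ▸ ⟨ι x, rfl⟩
      exact mem_wt_zero.mp h1 i ⟨hi.1, hiT⟩
  · have h1 := mem_wt_zero.mp hv
    obtain ⟨y, rfl⟩ : v ∈ LinearMap.range κ := by
      rw [hκ.range_eq, mem_wt_zero]
      exact fun i hi => h1 i ⟨hi.1, fun h => hi.2 (hRT h)⟩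
    obtain ⟨x, rfl⟩ : y ∈ LinearMap.range ι := by
      rw [hι.range_eq, mem_wt_zero]
      intro i hi
      apply hκ.injective
      rw [hκ.commutes i hi.1 i hi.1, h1 i ⟨hTS hi.1, hi.2⟩, map_zero]
    exact ⟨x, rfl⟩

variable {V : ℕ → Type u} [∀ k, AddCommGroup (V k)] [∀ k, Module ℂ (V k)] {N : ℕ → ℕ∞}
  {e : ∀ k, Ops (V k)} {j : ∀ k, V k →ₗ[ℂ] V (k + 1)}
  {W : Type u} [AddCommGroup W] [Module ℂ W] {a : Ops W} {κ : ∀ k, V k →ₗ[ℂ] W}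

theorem mem_idx_of_le (hN : ∀ k : ℕ, (k : ℕ∞) < N k) {i k : ℕ} (h : i ≤ k) : i ∈ idx (N k) :=
  lt_of_le_of_lt (by exact_mod_cast h) (hN k)

theorem exists_le_map (hκj : ∀ k v, κ (k + 1) (j k v) = κ k v) (hsurj : ∀ w, ∃ k v, κ k v = w)
    (w : W) (m : ℕ) : ∃ k, m ≤ k ∧ ∃ v, κ k v = w := by
  obtain ⟨k, v, rfl⟩ := hsurj w
  suffices h : ∀ l, ∃ v', κ (k + l) v' = κ k v from ⟨k + m, by lia, h m⟩
  intro l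
  induction l with
  | zero => exact ⟨v, rfl⟩
  | succ l ih =>
    obtain ⟨v', hv'⟩ := ih
    exact ⟨j (k + l) v', (hκj _ _).trans hv'⟩

theorem isSys_of_union (hN : ∀ k : ℕ, (k : ℕ∞) < N k)
    (hκj : ∀ k v, κ (k + 1) (j k v) = κ k v) (hsurj : ∀ w, ∃ k v, κ k v = w)
    (hκ : ∀ k, IsInv (idx (N k)) (idx ⊤) (e k) a (κ k)) (hs : ∀ k, IsSys (idx (N k)) (e k)) :
    IsSys (idx ⊤) a := by
  intro p _ q _ r _ s _ w
  obtain ⟨k, hk, v, rfl⟩ := exists_le_map hκj hsurj w (p + q + r + s)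
  have hp := mem_idx_of_le hN (show p ≤ k by lia)
  have hq := mem_idx_of_le hN (show q ≤ k by lia)
  have hr := mem_idx_of_le hN (show r ≤ k by lia)
  have hs' := mem_idx_of_le hN (show s ≤ k by lia)
  have hc := (hκ k).commutes
  rw [← hc r hr s hs', ← hc p hp q hq, ← hc p hp q hq, ← hc r hr s hs', ← hc p hp s hs',
    ← hc r hr q hq, hs k p hp q hq r hr s hs', map_sub, map_add, apply_ite (κ k), apply_ite (κ k),
    map_zero]

variable {ν : ℂ}

/-- An increasing union of modules in the categories `O`, each of which consists of the invariants
of the next, satisfies all conditions except for finite generation. -/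
theorem isGraded_of_union (hN : ∀ k : ℕ, (k : ℕ∞) < N k)
    (hκj : ∀ k v, κ (k + 1) (j k v) = κ k v)
    (hsurj : ∀ w, ∃ k v, κ k v = w) (hκ : ∀ k, IsInv (idx (N k)) (idx ⊤) (e k) a (κ k))
    (h : ∀ k, IsGraded ν (N k) (e k)) : IsGraded ν ⊤ a := by
  have hs := isSys_of_union hN hκj hsurj hκ fun k => (h k).sys
  have hU := fun k => (hκ k).toU (mem_idx_of_le hN k.zero_le)
  have hT := fun k => idxU_mono (le_top (a := N k))
  have hwt : ∀ {k α} {x : V k}, x ∈ wt (idxU (N k)) (e k) α → κ k x ∈ wt (idxU ⊤) a α :=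
    fun hx => map_wt_inv (hT _) (hU _).commutes (hU _).range_eq.le hx
  have hw : IsWeight (idxU ⊤) a := by
    refine eq_top_iff.mpr fun v _ => ?_
    obtain ⟨k, x, rfl⟩ := hsurj v
    obtain ⟨s, y, hy, rfl⟩ := exists_sum_wt (h k).isWeight x
    rw [map_sum]
    exact Submodule.sum_mem _ fun α _ => Submodule.mem_iSup_of_mem α (hwt (hy α))
  have hsU := hs.mono (idxU_subset ⊤)
  refine ⟨hs, eq_top_iff.mpr fun v _ => ?_, fun α v hv => ?_⟩
  · have hv : v ∈ ⨆ α, wt (idxU ⊤) a α := (show _ = ⊤ from hw) ▸ trivial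
    refine Submodule.iSup_induction _ (motive := fun v => v ∈ Submodule.span ℂ
      (polyVecs (idxU ⊤) a)) hv (fun α v hv => ?_) (Submodule.zero_mem _)
      fun _ _ => Submodule.add_mem _
    -- The stage is chosen so late that it contains `v` and has at least `deg α` letters.
    obtain ⟨k, hk, x, rfl⟩ := exists_le_map hκj hsurj v (deg α)
    have hcard : (deg α : ℕ∞) ≤ (idxU (N k)).encard :=
      le_encard_idxU ((Order.add_one_le_of_lt (lt_of_le_of_lt (by exact_mod_cast hk) (hN k))))
    have hx : x ∈ wt (idxU (N k)) (e k) α :=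
      mem_wt_of_inv (hT k) (hU k).commutes (hU k).injective (hU k).range_eq.le hv
    have h1 := Submodule.mem_map_of_mem (f := κ k) ((h k).ind.mem_span_words hx)
    rw [Submodule.map_span] at h1
    refine Submodule.span_le.mpr ?_ h1
    rintro _ ⟨_, ⟨f, w, hf, -, rfl⟩, rfl⟩
    obtain ⟨F, hF, hFf⟩ := IsInv.exists_extension (tensPow (idxU ⊤) (deg α)).isSys hsU
      ((isWeight_tensPow (idxU ⊤) _).mono Set.sdiff_subset) (hw.mono Set.sdiff_subset)
      (tensPow_generated (hT k) hcard) (isInv_tensIncl (hT k) _) (hU k) hf fun X hX hXg hX0 => by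
        -- Detection is not available in the union, but the submodule generated by the image of `f`
        -- is concentrated in degree `deg α`, where `mem_of_deg_le_encard` replaces it.
        let Z : Submodule ℂ W := ⨆ (β : ℕ →₀ ℕ) (_ : deg β = deg α), wt (idxU ⊤) a β
        have hZ : Stable (idxU ⊤) a Z := by
          intro p hp q hq
          suffices hle : Z ≤ Z.comap (a p q) from fun v hv => hle hv
          refine iSup₂_le fun β hβ v hv => ?_
          obtain ⟨γ, hγ, hm⟩ := exists_map_wt_deg hsU hw hp hq hv
          exact Submodule.mem_iSup_of_mem γ (Submodule.mem_iSup_of_mem (hγ.trans hβ) hm)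
        have hXZ : X ≤ Z := hXg.trans (gen_le hZ (by
          rintro _ ⟨y, rfl⟩
          suffices hle : (⊤ : Submodule ℂ _) ≤ Z.comap (κ k ∘ₗ f) from hle (x := y) trivial
          rw [← (tensBasis (idxU (N k)) (deg α)).span_eq, Submodule.span_le]
          rintro _ ⟨w, rfl⟩
          exact Submodule.mem_iSup_of_mem (wordWt w) (Submodule.mem_iSup_of_mem (deg_wordWt w)
            (hwt (hf.map_wt (tensBasis_mem_wt w))))))
        have hpr : Z ≤ LinearMap.ker (pr (idxU ⊤) a {β | deg β ≠ deg α}) :=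
          iSup₂_le fun β hβ v hv => pr_of_notMem hw (not_not_intro hβ) hv
        refine le_bot_iff.mp (le_of_wt hw hX.diag fun β v hvβ hvX => ?_)
        by_cases hβ : deg β = deg α
        · exact mem_of_deg_le_encard hsU hw (hT k) hX (Stable.bot _ _) (hβ ▸ hcard)
            (fun γ _ v _ hvX hv0 => hX0 ▸ ⟨hvX, hv0⟩) hvβ hvX
        · have h2 := LinearMap.mem_ker.mp (hpr (hXZ hvX))
          rw [pr_of_mem hw (A := {β | deg β ≠ deg α}) hβ hvβ] at h2
          exact h2
    exact Submodule.subset_span ⟨_, F, _, hF, hFf _⟩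
  · obtain ⟨k, x, rfl⟩ := hsurj v
    have hx : x ∈ wt (idxU (N k)) (e k) α :=
      mem_wt_of_inv (hT k) (hU k).commutes (hU k).injective (hU k).range_eq.le hv
    have h0 := mem_idx_of_le hN k.zero_le
    rw [← (hκ k).commutes 0 h0 0 h0, (h k).degr α x hx, map_smul]

/-- If moreover each module generates the next one, the union is in the category `O`. -/
theorem isO_of_union (hN : ∀ k : ℕ, (k : ℕ∞) < N k)
    (hκj : ∀ k v, κ (k + 1) (j k v) = κ k v)
    (hsurj : ∀ w, ∃ k v, κ k v = w) (hκ : ∀ k, IsInv (idx (N k)) (idx ⊤) (e k) a (κ k))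
    (h : ∀ k, IsO ν (N k) (e k)) (htight : ∀ k X, Stable (idx (N (k + 1))) (e (k + 1)) X →
      LinearMap.range (j k) ≤ X → X = ⊤) : IsO ν ⊤ a := by
  have hG := isGraded_of_union hN hκj hsurj hκ fun k => (h k).toIsGraded
  have h0 : ∀ k, 0 ∈ idx (N k) := fun k => mem_idx_of_le hN k.zero_le
  have hT' := fun k => idx_mono (le_top (a := N k))
  have hU := fun k => (hκ k).toU (h0 k)
  have hT := fun k => idxU_mono (le_top (a := N k))
  have hwt : ∀ {k α} {x : V k}, x ∈ wt (idxU (N k)) (e k) α → κ k x ∈ wt (idxU ⊤) a α :=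
    fun hx => map_wt_inv (hT _) (hU _).commutes (hU _).range_eq.le hx
  obtain ⟨K, hK⟩ := (h 0).gen
  refine ⟨hG, ⟨K, fun X hX hXK => ?_⟩, fun α => ?_⟩
  · let G := lowerGen (idxU ⊤) a (lowPart ⊤ a ⊤ (K + 1))
    have hGX : G ≤ X := lowerGen_le (iSup₂_le fun α hα =>
      inf_le_right.trans (hXK α (Nat.le_of_lt_succ hα))) hX
    have hGs : Stable (idx ⊤) a G := hG.stable_lowerGen (hT' 0 (h0 0)) (Stable.top _ _) _
    have hGk : ∀ k, G.comap (κ k) = ⊤ := by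
      intro k
      induction k with
      | zero =>
        refine hK _ (fun i hi v hv => ?_) fun α hα v hv => ?_
        · rw [Submodule.mem_comap, (hκ 0).commutes i (idxU_subset _ hi) 0 (h0 0)]
          exact lowerGen_map (hT 0 hi) hv
        · exact le_lowerGen _ _ _ (mem_lowPart (Nat.lt_succ_of_le hα) trivial (hwt hv))
      | succ k ih =>
        refine htight k _ (((hκ _).commutes).stable_comap (hGs.mono (hT' _))) ?_
        rintro _ ⟨v, rfl⟩
        rw [Submodule.mem_comap, hκj]
        exact (show v ∈ G.comap (κ k) from ih ▸ trivial)
    refine eq_top_iff.mpr fun w _ => hGX ?_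
    obtain ⟨k, v, rfl⟩ := hsurj w
    exact (show v ∈ G.comap (κ k) from hGk k ▸ trivial)
  · let k := α.support.sup id
    have hk : ∀ i ∉ idxU (N k), i ∈ idxU ⊤ → α i = 0 := fun i hi hi' => by
      by_contra hne
      exact hi (mem_idxU (mem_idx_of_le hN (Finset.le_sup (f := id)
        (Finsupp.mem_support_iff.mpr hne))) (ne_zero_of_mem_idxU hi'))
    have := (h k).fin α
    refine Submodule.finiteDimensional_of_le (S₂ := (wt (idxU (N k)) (e k) α).map (κ k)) fun w hw => ?_
    obtain ⟨x, rfl⟩ : w ∈ LinearMap.range (κ k) := by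
      rw [(hU k).range_eq, mem_wt_zero]
      intro i hi
      rw [wt_apply hw hi.1, hk i hi.2 hi.1, Nat.cast_zero, zero_smul]
    exact ⟨x, mem_wt_of_inv (hT k) (hU k).commutes (hU k).injective (hU k).range_eq.le hw, rfl⟩

end Union

/-! ### The union of a sequence of modules -/

section Sequence

variable {V : ℕ → Type u} [∀ k, AddCommGroup (V k)] [∀ k, Module ℂ (V k)] {N : ℕ → ℕ∞}
  {e : ∀ k, Ops (V k)} (j : ∀ k, V k →ₗ[ℂ] V (k + 1))

/-- The composite `V k → V (k + 1) → ⋯ → V l`. -/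
def seqMap {k l : ℕ} (h : k ≤ l) : V k →ₗ[ℂ] V l :=
  Nat.leRec (motive := fun l _ => V k →ₗ[ℂ] V l) LinearMap.id (fun l _ f => j l ∘ₗ f) h

theorem seqMap_self (k : ℕ) : seqMap j (le_refl k) = LinearMap.id := Nat.leRec_self _ _

theorem seqMap_succ {k l : ℕ} (h : k ≤ l) (h' : k ≤ l + 1) :
    seqMap j h' = j l ∘ₗ seqMap j h := Nat.leRec_succ _ _ h

theorem seqMap_seqMap {k l m : ℕ} (h : k ≤ l) (h' : l ≤ m) (v : V k) :
    seqMap j h' (seqMap j h v) = seqMap j (h.trans h') v := by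
  induction m, h' using Nat.le_induction with
  | base => rw [seqMap_self, LinearMap.id_apply]
  | succ m h' ih =>
    rw [seqMap_succ j h', seqMap_succ j (h.trans h'), LinearMap.comp_apply, LinearMap.comp_apply, ih]

theorem IsInv.of_bijective {V V' : Type*} [AddCommGroup V] [Module ℂ V] [AddCommGroup V']
    [Module ℂ V'] {S : Set ℕ} {e' : Ops V'} {e : Ops V} {ι : V' →ₗ[ℂ] V} (hc : Commutes S e' e ι)
    (hι : Function.Bijective ι) : IsInv S S e' e ι :=
  ⟨hc, hι.1, (LinearMap.range_eq_top.mpr hι.2).trans (eq_top_iff.mpr fun _ _ =>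
    mem_wt_zero.mpr fun _ hi => absurd hi.1 hi.2).symm⟩

variable {j} (hmono : Monotone N)
  (hj : ∀ k, IsInv (idx (N k)) (idx (N (k + 1))) (e k) (e (k + 1)) (j k))

include hmono hj in
theorem isInv_seqMap {k l : ℕ} (h : k ≤ l) :
    IsInv (idx (N k)) (idx (N l)) (e k) (e l) (seqMap j h) := by
  induction l, h using Nat.le_induction with
  | base =>
    rw [seqMap_self]
    exact .of_bijective (Commutes.id _) Function.bijective_id
  | succ l h ih =>
    rw [seqMap_succ j h]
    exact (hj l).comp (idx_mono (hmono h)) (idx_mono (hmono l.le_succ)) ih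

include hmono hj in
/-- The union of an increasing sequence of modules. -/
theorem exists_union (hN : ∀ k : ℕ, (k : ℕ∞) < N k) :
    ∃ (W : Type u) (_ : AddCommGroup W) (_ : Module ℂ W) (a : Ops W) (κ : ∀ k, V k →ₗ[ℂ] W),
      (∀ k v, κ (k + 1) (j k v) = κ k v) ∧ (∀ w, ∃ k v, κ k v = w) ∧
      ∀ k, IsInv (idx (N k)) (idx ⊤) (e k) a (κ k) := by
  let f : ∀ k l, k ≤ l → V k →ₗ[ℂ] V l := fun k l h => seqMap j h
  have hsys : DirectedSystem V (f · · ·) :=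
    ⟨fun k v => LinearMap.congr_fun (seqMap_self j k) v,
      fun k l m h h' v => seqMap_seqMap j h h' v⟩
  let κ : ∀ k, V k →ₗ[ℂ] Module.DirectLimit V f := Module.DirectLimit.of ℂ ℕ V f
  have hκf : ∀ {k l} (h : k ≤ l) (v : V k), κ l (seqMap j h v) = κ k v := fun h v =>
    Module.DirectLimit.of_f (hij := h)
  have hinj : ∀ k, Function.Injective (κ k) := fun k =>
    (injective_iff_map_eq_zero _).mpr fun v hv => by
      obtain ⟨l, h, hl⟩ := Module.DirectLimit.of.zero_exact hv
      exact (isInv_seqMap hmono hj h).injective (hl.trans (map_zero _).symm)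
  have hmem : ∀ {i k : ℕ}, i ≤ k → i ∈ idx (N k) := mem_idx_of_le hN
  have key : ∀ {p q k l m : ℕ} (h : k ≤ l) (h' : k ≤ m) (_ : l ≤ m) (_ : p ∈ idx (N l))
      (_ : q ∈ idx (N l)) (v : V k),
      κ m (e m p q (seqMap j h' v)) = κ l (e l p q (seqMap j h v)) := by
    intro p q k l m h h' hlm hp hq v
    rw [← seqMap_seqMap j h hlm, ← (isInv_seqMap hmono hj hlm).commutes p hp q hq, hκf]
  -- The unit `e p q` acts meaningfully only at stages containing both indices, so a vector is first
  -- moved to stage `max k (p + q)`, which certainly does.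
  let a : Ops (Module.DirectLimit V f) := fun p q => Module.DirectLimit.lift ℂ ℕ V f
    (fun k => κ (max k (p + q)) ∘ₗ e _ p q ∘ₗ seqMap j (le_max_left k (p + q))) fun k l h v => by
      change κ _ (e _ p q (seqMap j _ (seqMap j h v))) = κ _ (e _ p q (seqMap j _ v))
      rw [seqMap_seqMap]
      exact key _ _ (max_le_max h le_rfl) (hmem (by lia)) (hmem (by lia)) v
  have ha : ∀ p q k v, a p q (κ k v) =
      κ (max k (p + q)) (e _ p q (seqMap j (le_max_left k (p + q)) v)) := fun p q k v =>
    Module.DirectLimit.lift_of _ _ _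
  have hcomm : ∀ k, Commutes (idx (N k)) (e k) a (κ k) := fun k p hp q hq v => by
    rw [ha, key le_rfl (le_max_left k (p + q)) (le_max_left _ _) hp hq, seqMap_self,
      LinearMap.id_apply]
  refine ⟨_, inferInstance, inferInstance, a, κ, fun k v => ?_, Module.DirectLimit.exists_of,
    fun k => ⟨hcomm k, hinj k, le_antisymm ?_ fun w hw => ?_⟩⟩
  · rw [← hκf k.le_succ, seqMap_succ j le_rfl, seqMap_self]
    rfl
  · rintro _ ⟨v, rfl⟩
    rw [mem_wt_zero]
    intro i hi
    have h1 := (isInv_seqMap hmono hj (le_max_left k i)).range_eq.le ⟨v, rfl⟩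
    have h2 := hmem (le_max_right k i)
    rw [← hκf (le_max_left k i), ← hcomm _ i h2 i h2, mem_wt_zero.mp h1 i ⟨h2, hi.2⟩, map_zero]
  · obtain ⟨l, v, rfl⟩ := Module.DirectLimit.exists_of w
    obtain ⟨x, hx⟩ : seqMap j (le_max_left l k) v ∈
        LinearMap.range (seqMap j (le_max_right l k)) := by
      rw [(isInv_seqMap hmono hj (le_max_right l k)).range_eq, mem_wt_zero]
      intro i hi
      refine hinj _ ?_
      rw [hcomm _ i hi.1 i hi.1, hκf, map_zero]
      exact mem_wt_zero.mp hw i ⟨ENat.natCast_lt_top i, hi.2⟩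
    exact ⟨x, by rw [← hκf (le_max_right l k), hx, hκf]⟩

end Sequence

/-! ### Realizing a compatible sequence by a module over infinite matrices -/

section Limit

theorem IsInv.exists_iso {n N : ℕ∞} (h : n ≤ N) {M : LieRep.{u} (gl N)} {L : LieRep.{u} (gl n)}
    (hw : IsWeight (idx N \ idx n) M.e) {ι : L.V →ₗ[ℂ] M.V}
    (hι : IsInv (idx n) (idx N) L.e M.e ι) :
    ∃ α : (glInv h).obj M ≅ L, ∀ m, ι (LieRep.toLie α.hom m) = invMap h M m := by
  have hm := invMap_isInv h M hw
  let q : L.V ≃ₗ[ℂ] LinearMap.range ι := LinearEquiv.ofInjective ι hι.injective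
  have hr : ∀ m, invMap h M m ∈ LinearMap.range ι := fun m =>
    (hι.range_eq.trans hm.range_eq.symm) ▸ ⟨m, rfl⟩
  let f : ((glInv h).obj M).V →ₗ[ℂ] L.V := q.symm.toLinearMap ∘ₗ (invMap h M).codRestrict _ hr
  have hf : ∀ m, ι (f m) = invMap h M m := fun m =>
    congrArg Subtype.val (q.apply_symm_apply ⟨_, hr m⟩)
  let g : (glInv h).obj M ⟶ L := LieRep.homOfCommutes f fun i hi j hj m => hι.injective (by
    rw [hf, hι.commutes i hi j hj, hf, hm.commutes i hi j hj])
  have : IsIso g := LieRep.isIso_of_bijective g ⟨fun a b hab => hm.injective (by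
    rw [← hf a, ← hf b]; exact congrArg ι hab), fun x => by
      obtain ⟨m, hm'⟩ : ι x ∈ LinearMap.range (invMap h M) :=
        (hm.range_eq.trans hι.range_eq.symm) ▸ ⟨x, rfl⟩
      exact ⟨m, hι.injective ((hf m).trans hm')⟩⟩
  exact ⟨asIso g, hf⟩

variable {ν : ℂ} {N : ℕ → ℕ∞}

/-- A sequence of modules in the categories `O`, each of which is generated by its predecessor and
has the latter as its invariants, comes from a module over the infinite matrices. -/
theorem exists_limit (hN : ∀ k : ℕ, (k : ℕ∞) < N k) (h : ∀ k, N k ≤ N (k + 1))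
    (L : ∀ k, LieRep.{u} (gl (N k))) (hL : ∀ k, IsO ν (N k) (L k).e)
    (ψ : ∀ k, (glInv (h k)).obj (L (k + 1)) ≅ L k)
    (htight : ∀ k, genSub (M := L (k + 1)) (h k) ⊤ = ⊤) :
    ∃ M : LieRep.{u} (gl ⊤), IsO ν ⊤ M.e ∧
      ∃ α : ∀ k, (glInv (le_top (a := N k))).obj M ≅ L k, ∀ k,
        (invIncl (h k) (le_top (a := N (k + 1)))).app M ≫
          (glInv (h k)).map (α (k + 1)).hom ≫ (ψ k).hom = (α k).hom := by
  have h0 : ∀ k, 0 ∈ idx (N k) := fun k => mem_idx_of_le hN k.zero_le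
  let j : ∀ k, (L k).V →ₗ[ℂ] (L (k + 1)).V := fun k =>
    invMap (h k) (L (k + 1)) ∘ₗ (LieRep.toLie (ψ k).inv : (L k).V →ₗ[ℂ] _)
  have hψ : ∀ k y, LieRep.toLie (ψ k).inv (LieRep.toLie (ψ k).hom y) = y := fun k y =>
    DFunLike.congr_fun (F := ((glInv (h k)).obj (L (k + 1))).V →ₗ⁅ℂ, gl (N k)⁆ _)
      (ψ k).hom_inv_id y
  have hψ' : ∀ k y, LieRep.toLie (ψ k).hom (LieRep.toLie (ψ k).inv y) = y := fun k y =>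
    DFunLike.congr_fun (F := (L k).V →ₗ⁅ℂ, gl (N k)⁆ (L k).V) (ψ k).inv_hom_id y
  have hjψ : ∀ k y, j k (LieRep.toLie (ψ k).hom y) = invMap (h k) (L (k + 1)) y := fun k y =>
    congrArg (invMap (h k) (L (k + 1))) (hψ k y)
  have hrange : ∀ k, LinearMap.range (j k) = LinearMap.range (invMap (h k) (L (k + 1))) :=
    fun k => le_antisymm (LinearMap.range_comp_le_range _ _) (by
      rintro _ ⟨y, rfl⟩
      exact ⟨_, hjψ k y⟩)
  have hj : ∀ k, IsInv (idx (N k)) (idx (N (k + 1))) (L k).e (L (k + 1)).e (j k) := fun k => by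
    have h1 := invMap_isInv (h k) (L (k + 1)) ((hL (k + 1)).isWeight_diff (h0 k))
    exact ⟨h1.commutes.comp (LieRep.commutes (LieRep.toLie (ψ k).inv)), h1.injective.comp
      (Function.LeftInverse.injective (hψ' k)), (hrange k).trans h1.range_eq⟩
  obtain ⟨W, _, _, a, κ, hκj, hsurj, hκ⟩ := exists_union (monotone_nat_of_le_succ h) hj hN
  have hs := isSys_of_union hN hκj hsurj hκ fun k => (hL k).sys
  have hO := isO_of_union hN hκj hsurj hκ hL fun k X hX hle => by
    have h2 : genSub (M := L (k + 1)) (h k) ⊤ ≤ LieRep.subOfStable X hX :=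
      genSub_le _ fun y _ => hle (hrange k ▸ ⟨y, rfl⟩)
    exact eq_top_iff.mpr fun v _ => h2 (htight k ▸ LieSubmodule.mem_top v)
  let q := ofSysEquiv hs
  have hM : IsO ν ⊤ (LieRep.ofSys hs).e := hO.of_surjective (ofSysEquiv_commutes hs) q.surjective
    (idx_mono le_top (h0 0))
  have hq : ∀ k, IsInv (idx (N k)) (idx ⊤) (L k).e (LieRep.ofSys hs).e (q.toLinearMap ∘ₗ κ k) :=
    fun k => (IsInv.of_bijective (ofSysEquiv_commutes hs) q.bijective).comp (idx_mono le_top)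
      subset_rfl (hκ k)
  choose α hα using fun k =>
    IsInv.exists_iso (le_top (a := N k)) (hM.isWeight_diff (h0 k)) (hq k)
  refine ⟨_, hM, α, fun k => LieModuleHom.ext fun m => (hq k).injective ?_⟩
  refine Eq.trans ?_ (hα k m).symm
  have h1 : ∀ x, q (κ k (LieRep.toLie (ψ k).hom x)) =
      q (κ (k + 1) (invMap (h k) (L (k + 1)) x)) := fun x => by rw [← hκj, hjψ]
  exact (h1 _).trans (hα (k + 1) (invMap (h k) _ (LieRep.toLie ((invIncl (h k) le_top).app _) m)))

end Limit

/-! ### The equivalence with the restricted inverse limit -/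

theorem InvLim.nonempty_iso_of_shift {C : ℕ → Type u} [∀ i, Category.{v} (C i)]
    {F : ∀ i, C (i + 1) ⥤ C i} {D : Type*} [Category D] (G : ∀ i, D ⥤ C i)
    (α : ∀ i, G (i + 1) ⋙ F i ≅ G i) (X : D) (Y : InvLim F) (m : ℕ)
    (θ : ∀ k, (G (m + k)).obj X ≅ Y.obj (m + k))
    (hθ : ∀ k, (F (m + k)).map (θ (k + 1)).hom ≫ (Y.iso (m + k)).hom =
      (α (m + k)).hom.app X ≫ (θ k).hom) : Nonempty ((lift G α).obj X ≅ Y) := by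
  let θ' : ∀ i, m ≤ i → ((G i).obj X ≅ Y.obj i) := fun i hi =>
    (Nat.add_sub_of_le hi) ▸ θ (i - m)
  have key : ∀ k k' (h : m + k' = m + k),
      (h ▸ θ k' : (G (m + k)).obj X ≅ Y.obj (m + k)) = θ k := by
    intro k k' h
    obtain rfl : k' = k := by lia
    rfl
  refine nonempty_iso G α X Y m θ' fun i hi => ?_
  obtain ⟨k, rfl⟩ := Nat.exists_eq_add_of_le hi
  rw [show θ' (m + k) hi = θ k from key _ _ _,
    show θ' (m + k + 1) (by lia) = θ (k + 1) from key (k + 1) _ _]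
  exact hθ k

section Equivalence

theorem zero_mem_idx_top : 0 ∈ idx ⊤ := by simp [idx]

variable {ν : ℂ}
  (hRes : ∀ i, InvMapsO.{u} ν (nn_le_succ i)) (hΓ : ∀ i, InvMapsO.{u} ν (nn_le_top i))
  (hResW : ∀ i, InvDescends (nn_le_succ i) (hRes i))
  (hΓW : ∀ i, InvDescends (nn_le_top i) (hΓ i))
  (hcomp : ∀ i, InvCompatible.{u} ν i)

/-- For a local representative, detected for large `n`, the length of the invariants is that of the
module. -/
theorem gammaHatLandsInRestr : GammaHatLandsInRestr hRes hΓ hResW hΓW hcomp := by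
  intro X
  obtain ⟨M, ⟨i⟩⟩ := exists_local_iso zero_mem_idx_top X
  obtain ⟨m, hm⟩ := exists_detects_all M
  obtain ⟨l, hl⟩ := exists_objLength_eq zero_mem_idx_top X
  refine ⟨l, m, fun k hk => ?_⟩
  have h1 := objLength_of_iso ((GammaHat hΓ hΓW k).mapIso i)
  have h2 := objLength_invHat (nn_le_top k) (hΓ k) (hΓW k) (zero_mem_idx_nn k) (hm k hk).1 M
    (hm k hk).2
  exact (h1.symm.trans h2).trans ((objLength_of_iso i).trans hl)

theorem gammaHatInvLim_map_bijective (X Y : OHat.{u} ν ⊤) :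
    Function.Bijective ((GammaHatInvLim hRes hΓ hResW hΓW hcomp).map (X := X) (Y := Y)) := by
  obtain ⟨M, ⟨i⟩⟩ := exists_local_iso zero_mem_idx_top X
  obtain ⟨M', ⟨i'⟩⟩ := exists_local_iso zero_mem_idx_top Y
  obtain ⟨m, hm⟩ := exists_detects_all M
  obtain ⟨m', hm'⟩ := exists_detects_all M'
  refine InvLim.lift_map_bijective _ _ X Y (max m m') fun k hk => ?_
  have h1 := hm k ((le_max_left _ _).trans hk)
  have h2 := hm' k ((le_max_right _ _).trans hk)
  exact map_bijective_of_iso _ i i' (invHat_map_bijective (nn_le_top k) (hΓ k) (hΓW k)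
    (zero_mem_idx_nn k) h1.1 M M' h1.2 h2.2)

/-- The lifting data come from equalities of functors whose components are identities, so on modules
the isomorphism of induced functors is the image of the isomorphism of invariants. -/
theorem resGammaHatIso_hom_app (i : ℕ) (M : OCat.{u} ν ⊤) :
    (resGammaHatIso hRes hΓ hResW hΓW hcomp i).hom.app ((piHat ν ⊤).obj M) =
      (piHat ν (nn i)).map ((resGammaIso hRes hΓ hcomp i).hom.app M) := by
  let _ : Localization.Lifting (piHat.{u} ν ⊤) (isoModPoly ν ⊤)
      ((invO (nn_le_top (i + 1)) (hΓ (i + 1)) ⋙ invO (nn_le_succ i) (hRes i)) ⋙ piHat ν (nn i))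
      (GammaHat hΓ hΓW (i + 1) ⋙ ResHat hRes hResW i) :=
    ⟨eqToIso (piHat_comp_GammaHat_comp_ResHat hRes hΓ hResW hΓW i)⟩
  let _ : Localization.Lifting (piHat.{u} ν ⊤) (isoModPoly ν ⊤)
      (invO (nn_le_top i) (hΓ i) ⋙ piHat ν (nn i)) (GammaHat hΓ hΓW i) :=
    ⟨eqToIso (piHat_comp_invHat (nn_le_top i) (hΓ i) (hΓW i))⟩
  refine (Localization.liftNatTrans_app _ _ _ _ _ _ _ M).trans ?_
  exact (Category.id_comp _).trans (Category.comp_id _)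

/-- Isomorphic objects of the Serre quotient come from isomorphic local modules. -/
theorem exists_iso_of_piHat_iso {N : ℕ∞} (h0 : 0 ∈ idx N) (M M' : LCat.{u} ν N)
    (i : (piHat ν N).obj ((locIncl ν N).obj M) ≅ (piHat ν N).obj ((locIncl ν N).obj M')) :
    ∃ j : (locIncl ν N).obj M ≅ (locIncl ν N).obj M', (piHat ν N).map j.hom = i.hom := by
  have := isEquivalence_locIncl_piHat.{u} (ν := ν) h0
  refine ⟨(locIncl ν N).mapIso ((locIncl ν N ⋙ piHat ν N).preimageIso i), ?_⟩
  exact (locIncl ν N ⋙ piHat ν N).map_preimage i.hom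

/-- If the lengths of a local module and of its image agree, and the image is isomorphic to a given
local module in the Serre quotient, then it is isomorphic to it as a module. -/
theorem exists_iso_of_length {n N : ℕ∞} (h : n ≤ N) (h0 : 0 ∈ idx n) (hO : InvMapsO.{u} ν h)
    (hW : InvDescends h hO) (M : LCat.{u} ν N) (L : LCat.{u} ν n) {l : ℕ}
    (hM : objLength ((piHat ν N).obj ((locIncl ν N).obj M)) = l)
    (hL : objLength ((piHat ν n).obj ((locIncl ν n).obj L)) = l)
    (i : (invHat h hO hW).obj ((piHat ν N).obj ((locIncl ν N).obj M)) ≅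
      (piHat ν n).obj ((locIncl ν n).obj L)) :
    genSub (M := M.obj) h ⊤ = ⊤ ∧
      ∃ j : (invO h hO).obj ((locIncl ν N).obj M) ≅ (locIncl ν n).obj L,
        (piHat ν n).map j.hom = i.hom := by
  have h0N := idx_mono h h0
  let R : OCat.{u} ν n := (invO h hO).obj ((locIncl ν N).obj M)
  let i' : (piHat ν n).obj R ≅ (piHat ν n).obj ((locIncl ν n).obj L) := i
  -- The invariants have the same length in the Serre quotient as `L`, hence as `M`; this is what
  -- `IsLocal.inv_of_length` requires.
  have h1 : HasChain R.obj l :=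
    hasChain_of_le_objLength h0 R ((hL.symm.trans (objLength_of_iso i').symm).le)
  have h2 := IsLocal.inv_of_length h M.property.2
    (((parO_iff h0N _).mp M.property.1).isWeight_diff h0)
    (fun p hp => by
      have := (le_objLength_piHat_iff h0N M p).mpr hp
      rw [hM] at this
      exact_mod_cast this) h1
  exact ⟨h2.2, exists_iso_of_piHat_iso h0 ⟨R.obj, R.property, h2.1⟩ L i'⟩

/-- From the index where the lengths stabilize, local representatives are linked by isomorphisms of
modules, each generated by its predecessor, and `exists_limit` glues them. What remains is the
comparison of the structure isomorphisms on the tail. -/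
theorem gammaHatInvLim_nonempty_iso (X : OHatInvLim hRes hResW)
    (hX : restrProp (C := fun i => OHat.{u} ν (nn i)) (ResHat hRes hResW) X) :
    ∃ Z, Nonempty ((GammaHatInvLim hRes hΓ hResW hΓW hcomp).obj Z ≅ X) := by
  obtain ⟨l, n₀, hl⟩ := hX
  choose L hL using fun i => exists_local_iso (zero_mem_idx_nn i) (X.obj i)
  let χ := fun i => (hL i).some
  have hlen : ∀ k, objLength ((piHat ν (nn (n₀ + k))).obj ((locIncl ν _).obj (L (n₀ + k)))) = l :=
    fun k => (objLength_of_iso (χ _)).trans (hl _ (Nat.le_add_right _ _))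
  choose htight ψ hψ using fun k => exists_iso_of_length (nn_le_succ (n₀ + k))
    (zero_mem_idx_nn (n₀ + k)) (hRes (n₀ + k)) (hResW (n₀ + k)) (L (n₀ + k + 1)) (L (n₀ + k))
    (hlen (k + 1)) (hlen k)
    ((ResHat hRes hResW (n₀ + k)).mapIso (χ (n₀ + k + 1)) ≪≫ X.iso (n₀ + k) ≪≫
      (χ (n₀ + k)).symm)
  obtain ⟨M, hM, α, hα⟩ := exists_limit (N := fun k => nn (n₀ + k)) (ν := ν)
    (fun k => by
      change (k : ℕ∞) < ((n₀ + k + 1 : ℕ) : ℕ∞)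
      exact_mod_cast (by lia : k < n₀ + k + 1))
    (fun k => nn_le_succ (n₀ + k)) (fun k => (L (n₀ + k)).obj)
    (fun k => (parO_iff (zero_mem_idx_nn _) _).mp (L (n₀ + k)).property.1)
    (fun k => (ObjectProperty.ι _).mapIso (ψ k)) htight
  let M' : OCat.{u} ν ⊤ := ⟨M, (parO_iff zero_mem_idx_top M).mpr hM⟩
  let β : ∀ k, (invO (nn_le_top (n₀ + k)) (hΓ (n₀ + k))).obj M' ≅
    (locIncl ν (nn (n₀ + k))).obj (L (n₀ + k)) := fun k => ObjectProperty.isoMk _ (α k)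
  refine ⟨(piHat ν ⊤).obj M', InvLim.nonempty_iso_of_shift _ _ _ X n₀
    (fun k => (piHat ν (nn (n₀ + k))).mapIso (β k) ≪≫ χ (n₀ + k)) fun k => ?_⟩
  have h1 : (ResHat hRes hResW (n₀ + k)).map (χ (n₀ + k + 1)).hom ≫ (X.iso (n₀ + k)).hom =
      (piHat ν _).map (ψ k).hom ≫ (χ (n₀ + k)).hom :=
    (Iso.comp_inv_eq (χ (n₀ + k))).mp ((Category.assoc _ _ _).trans (hψ k).symm)
  have h2 : (invO (nn_le_succ (n₀ + k)) (hRes (n₀ + k))).map (β (k + 1)).hom ≫ (ψ k).hom =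
      (resGammaIso hRes hΓ hcomp (n₀ + k)).hom.app M' ≫ (β k).hom :=
    (Iso.inv_comp_eq ((resGammaIso hRes hΓ hcomp (n₀ + k)).app M')).mp
      (congrArg (fun f => ObjectProperty.homMk f) (hα k))
  have h3 := invHat_map (nn_le_succ (n₀ + k)) (hRes (n₀ + k)) (hResW (n₀ + k)) _ _ (β (k + 1)).hom
  have h4 : (ResHat hRes hResW (n₀ + k)).map ((piHat ν (nn (n₀ + k + 1))).map (β (k + 1)).hom) ≫
      (piHat ν _).map (ψ k).hom = (piHat ν _).map
        ((resGammaIso hRes hΓ hcomp (n₀ + k)).hom.app M') ≫ (piHat ν _).map (β k).hom :=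
    (congrArg (· ≫ (piHat ν _).map (ψ k).hom) h3).trans
      (((piHat ν _).map_comp _ _).symm.trans ((congrArg _ h2).trans ((piHat ν _).map_comp _ _)))
  refine (congrArg (· ≫ (X.iso (n₀ + k)).hom) ((ResHat hRes hResW (n₀ + k)).map_comp _ _)).trans ?_
  refine (Category.assoc _ _ _).trans ((congrArg _ h1).trans ((Category.assoc _ _ _).symm.trans
    ((congrArg (· ≫ (χ (n₀ + k)).hom) h4).trans ((Category.assoc _ _ _).trans ?_))))
  exact (congrArg (· ≫ ((piHat ν _).mapIso (β k) ≪≫ χ (n₀ + k)).hom)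
    (resGammaHatIso_hom_app hRes hΓ hResW hΓW hcomp (n₀ + k) M')).symm

theorem isEquivalence_gammaHatLim (hlen : GammaHatLandsInRestr hRes hΓ hResW hΓW hcomp) :
    (GammaHatLim hRes hΓ hResW hΓW hcomp hlen).IsEquivalence := by
  have hb := gammaHatInvLim_map_bijective hRes hΓ hResW hΓW hcomp
  refine ⟨⟨fun {X Y} f g hfg => (hb X Y).1 (congrArg (fun t => t.hom) hfg)⟩,
    ⟨fun {X Y} t => ?_⟩, ⟨fun X => ?_⟩⟩
  · obtain ⟨f, hf⟩ := (hb X Y).2 t.hom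
    exact ⟨f, InducedCategory.Hom.ext hf⟩
  · obtain ⟨Z, ⟨i⟩⟩ := gammaHatInvLim_nonempty_iso hRes hΓ hResW hΓW hcomp X.obj X.property
    exact ⟨Z, ⟨ObjectProperty.isoMk _ i⟩⟩

end Equivalence

end ParabolicO

end

/-- The functors `Res_{n, n+1}` and `Γ_n` are well defined on the categories `O` (`hRes`, `hΓ`),
descend to the Serre quotients (`hResW`, `hΓW`), are compatible (`hcomp`), the resulting functor
lands in the restricted inverse limit (`hlen`), and it is an equivalence of categories. -/
theorem mainTheorem4 (ν : ℂ) :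
    ∃ (hRes : ∀ i, ParabolicO.InvMapsO.{u} ν (ParabolicO.nn_le_succ i))
      (hΓ : ∀ i, ParabolicO.InvMapsO.{u} ν (ParabolicO.nn_le_top i))
      (hResW : ∀ i, ParabolicO.InvDescends (ParabolicO.nn_le_succ i) (hRes i))
      (hΓW : ∀ i, ParabolicO.InvDescends (ParabolicO.nn_le_top i) (hΓ i))
      (hcomp : ∀ i, ParabolicO.InvCompatible.{u} ν i)
      (hlen : ParabolicO.GammaHatLandsInRestr hRes hΓ hResW hΓW hcomp),
      (ParabolicO.GammaHatLim hRes hΓ hResW hΓW hcomp hlen).IsEquivalence :=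
  ⟨fun i => ParabolicO.invMapsO _ (ParabolicO.zero_mem_idx_nn i),
    fun i => ParabolicO.invMapsO _ (ParabolicO.zero_mem_idx_nn i),
    fun i => ParabolicO.invDescends _ (ParabolicO.zero_mem_idx_nn i),
    fun i => ParabolicO.invDescends _ (ParabolicO.zero_mem_idx_nn i),
    ParabolicO.invCompatible, ParabolicO.gammaHatLandsInRestr _ _ _ _ _,
    ParabolicO.isEquivalence_gammaHatLim _ _ _ _ _ _⟩
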